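/- Let $N\ge 1$, $0<s<1$, let $E\subset\mathbb R^N$ be an open set with smooth boundary $\Sigma=\partial E$ (near each of its boundary points $E=\{\varphi<0\}$ with $\varphi$ smooth and $\nabla\varphi\neq 0$), let $\nu$ be the exterior unit normal of $\Sigma$, $H=\operatorname{div}\nu$ the classical mean curvature (the sum of the principal curvatures, positive for balls), and let $\Omega\subset\mathbb R^N$ be a bounded open set. Integrals over $\Sigma$ are with respect to the $(N-1)$-dimensional surface measure, and it is assumed that $\int_\Sigma (1+|x|)^{-(N+s)}\,dx<\infty$ (automatic when $\Sigma$ is compact), so that the integrals over $\Sigma$ below converge at infinity. Put $$Per_s(E,\Omega)=\int_{E\cap\Omega}\int_{\mathbb R^N\setminus E}\frac{dx\,dy}{|x-y|^{N+s}}+\int_{E\setminus\Omega}\int_{\Omega\setminus E}\frac{dx\,dy}{|x-y|^{N+s}},$$ and for $p\in\Sigma$ $$H^s_\Sigma(p)=\text{p.v.}\int_{\mathbb R^N}\frac{\chi_E(x)-\chi_{\mathbb R^N\setminus E}(x)}{|x-p|^{N+s}}\,dx,$$ $$\mathcal J^s_\Sigma[h](p)=\text{p.v.}\int_\Sigma\frac{h(x)-h(p)}{|p-x|^{N+s}}\,dx+h(p)\int_\Sigma\frac{\langle\nu(p)-\nu(x),\nu(p)\rangle}{|p-x|^{N+s}}\,dx,$$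 where the principal value is the limit as $\varepsilon\to0^+$ of the integrals over the complement of the ball $B_\varepsilon(p)$. Let $h\in C_0^\infty(\Omega\cap\Sigma)$, that is, $h$ is smooth on $\Sigma$ with compact support contained in $\Omega\cap\Sigma$, and for small $|t|$ let $E_{th}$ be the open set with smooth boundary $\partial E_{th}=\{x+th(x)\nu(x): x\in\Sigma\}$ whose exterior normal at $x+th(x)\nu(x)$ has positive inner product with $\nu(x)$. Then $H^s_\Sigma(p)$ and $\mathcal J^s_\Sigma[h](p)$ are well defined for all $p\in\Sigma$, the functions $\mathcal J^s_\Sigma[h]\,h$ and $h^2HH^s_\Sigma$ are integrable on $\Sigma$, such sets $E_{th}$ exist for all $t$ near $0$, and $t\mapsto Per_s(E_{th},\Omega)$ is finite and differentiable near $t=0$ and twice differentiable at $t=0$, with $$\frac{d^2}{dt^2}Per_s(E_{th},\Omega)\Big|_{t=0}=-2\int_\Sigma\mathcal J^s_\Sigma[h]\,h-\int_\Sigma h^2\,H\,H^s_\Sigma .$$ In particular, if $\Sigma$ is a nonlocal minimal surface in $\Omega$, i.e. $H^s_\Sigma(p)=0$ for all $p\in\Sigma\cap\Omega$, then $$\frac{d^2}{dt^2}Per_s(E_{th},\Omega)\Big|_{t=0}=-2\int_\Sigma\mathcal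 J^s_\Sigma[h]\,h .$$ -/

import Mathlib

open Set Filter Topology MeasureTheory
open scoped ContDiff ENNReal

noncomputable section

namespace NonlocalPerimeter

variable {N : ℕ}

/-- `φ` is a smooth defining function of the set `E` near the boundary point `p`: near `p` the
set `E` is `{φ < 0}`, and `∇φ(p) ≠ 0`. -/
structure IsDefiningFunction (E : Set (EuclideanSpace ℝ (Fin N))) (p : EuclideanSpace ℝ (Fin N))
    (φ : EuclideanSpace ℝ (Fin N) → ℝ) : Prop where
  contDiff : ContDiff ℝ ∞ φ
  apply_eq_zero : φ p = 0
  gradient_ne_zero : gradient φ p ≠ 0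
  mem_iff : ∀ᶠ x in 𝓝 p, (x ∈ E ↔ φ x < 0)

/-- The boundary of `E` is a smooth hypersurface, with `E` locally on one side of it. -/
def HasSmoothBoundary (E : Set (EuclideanSpace ℝ (Fin N))) : Prop :=
  ∀ p ∈ frontier E, ∃ φ, IsDefiningFunction E p φ

/-- The unit vector field `∇φ / |∇φ|`. -/
def unitGradient (φ : EuclideanSpace ℝ (Fin N) → ℝ) (x : EuclideanSpace ℝ (Fin N)) :
    EuclideanSpace ℝ (Fin N) :=
  ‖gradient φ x‖⁻¹ • gradient φ x

open Classical in
/-- The exterior unit normal `ν(p) = ∇φ(p) / |∇φ(p)|` of `∂E` at a smooth boundary point `p`; the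
value does not depend on the defining function `φ`. (Value `0` if there is none.) -/
def outerNormal (E : Set (EuclideanSpace ℝ (Fin N))) (p : EuclideanSpace ℝ (Fin N)) :
    EuclideanSpace ℝ (Fin N) :=
  if h : ∃ φ, IsDefiningFunction E p φ then unitGradient h.choose p else 0

open Classical in
/-- The classical mean curvature `H(p) = div ν (p)` (the sum of the principal curvatures with
respect to the exterior normal, positive for balls), with `ν` extended near `p` as the unit field
`∇φ / |∇φ|`; the value does not depend on the defining function `φ`. -/
def meanCurvature (E : Set (EuclideanSpace ℝ (Fin N))) (p : EuclideanSpace ℝ (Fin N)) : ℝ :=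
  if h : ∃ φ, IsDefiningFunction E p φ then
    LinearMap.trace ℝ (EuclideanSpace ℝ (Fin N))
      (fderiv ℝ (unitGradient h.choose) p : EuclideanSpace ℝ (Fin N) →ₗ[ℝ] EuclideanSpace ℝ (Fin N))
  else 0

/-- The surface measure of `∂E`: the `(N-1)`-dimensional Hausdorff measure, normalized to agree
with Lebesgue measure on hyperplanes, restricted to `∂E`. -/
def surfaceMeasure (E : Set (EuclideanSpace ℝ (Fin N))) : Measure (EuclideanSpace ℝ (Fin N)) :=
  (Measure.euclideanHausdorffMeasure (N - 1)).restrict (frontier E)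

/-- The localized `s`-perimeter
`Per_s(E, Ω) = ∫_{E ∩ Ω} ∫_{ℝᴺ \ E} |x - y|^{-(N+s)} + ∫_{E \ Ω} ∫_{Ω \ E} |x - y|^{-(N+s)}`. -/
def sPerimeter (s : ℝ) (E Ω : Set (EuclideanSpace ℝ (Fin N))) : ℝ≥0∞ :=
  (∫⁻ x in E ∩ Ω, ∫⁻ y in Eᶜ, ENNReal.ofReal (1 / ‖x - y‖ ^ ((N : ℝ) + s))) +
    ∫⁻ x in E \ Ω, ∫⁻ y in Ω \ E, ENNReal.ofReal (1 / ‖x - y‖ ^ ((N : ℝ) + s))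

/-- The principal value integral of `f` at `p`: the limit, as `ε → 0⁺`, of the integrals of `f`
over the complement of the ball of radius `ε` about `p`. -/
def pvIntegral (μ : Measure (EuclideanSpace ℝ (Fin N))) (f : EuclideanSpace ℝ (Fin N) → ℝ)
    (p : EuclideanSpace ℝ (Fin N)) : ℝ :=
  limUnder (𝓝[>] (0 : ℝ)) fun ε => ∫ x in (Metric.ball p ε)ᶜ, f x ∂μ

/-- The principal value integral of `f` at `p` is well defined. -/
def PVConverges (μ : Measure (EuclideanSpace ℝ (Fin N))) (f : EuclideanSpace ℝ (Fin N) → ℝ)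
    (p : EuclideanSpace ℝ (Fin N)) : Prop :=
  (∀ ε : ℝ, 0 < ε → IntegrableOn f (Metric.ball p ε)ᶜ μ) ∧
    ∃ v : ℝ, Tendsto (fun ε => ∫ x in (Metric.ball p ε)ᶜ, f x ∂μ) (𝓝[>] (0 : ℝ)) (𝓝 v)

/-- The integrand `(χ_E(x) - χ_{ℝᴺ \ E}(x)) / |x - p|^{N+s}` of the nonlocal mean curvature. -/
def curvatureIntegrand (s : ℝ) (E : Set (EuclideanSpace ℝ (Fin N)))
    (p x : EuclideanSpace ℝ (Fin N)) : ℝ :=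
  (E.indicator 1 x - Eᶜ.indicator 1 x) / ‖x - p‖ ^ ((N : ℝ) + s)

/-- The nonlocal mean curvature `H^s_Σ(p)`, where `Σ = ∂E`. -/
def nonlocalMeanCurvature (s : ℝ) (E : Set (EuclideanSpace ℝ (Fin N)))
    (p : EuclideanSpace ℝ (Fin N)) : ℝ :=
  pvIntegral volume (curvatureIntegrand s E p) p

/-- The integrand of the first (principal value) term of the nonlocal Jacobi operator. -/
def jacobiIntegrand (s : ℝ) (h : EuclideanSpace ℝ (Fin N) → ℝ)
    (p x : EuclideanSpace ℝ (Fin N)) : ℝ :=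
  (h x - h p) / ‖p - x‖ ^ ((N : ℝ) + s)

/-- The integrand of the second (zero order) term of the nonlocal Jacobi operator. -/
def jacobiPotentialIntegrand (s : ℝ) (E : Set (EuclideanSpace ℝ (Fin N)))
    (p x : EuclideanSpace ℝ (Fin N)) : ℝ :=
  inner ℝ (outerNormal E p - outerNormal E x) (outerNormal E p) / ‖p - x‖ ^ ((N : ℝ) + s)

/-- The nonlocal Jacobi operator `J^s_Σ[h](p)`, where `Σ = ∂E`. -/
def nonlocalJacobi (s : ℝ) (E : Set (EuclideanSpace ℝ (Fin N)))
    (h : EuclideanSpace ℝ (Fin N) → ℝ) (p : EuclideanSpace ℝ (Fin N)) : ℝ :=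
  pvIntegral (surfaceMeasure E) (jacobiIntegrand s h p) p +
    h p * ∫ x, jacobiPotentialIntegrand s E p x ∂(surfaceMeasure E)

/-- `∂E` is a nonlocal (`s`-)minimal surface in `Ω`. -/
def IsNonlocalMinimal (s : ℝ) (E Ω : Set (EuclideanSpace ℝ (Fin N))) : Prop :=
  ∀ p ∈ frontier E ∩ Ω, nonlocalMeanCurvature s E p = 0

/-- `h ∈ C_0^∞(Ω ∩ ∂E)`: the restriction of `h` to `∂E` is smooth (locally it extends to a smooth
function of the ambient space) and vanishes outside a compact subset of `Ω ∩ ∂E`. Values of `h`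
outside `∂E` are irrelevant. -/
structure IsTestFunction (E Ω : Set (EuclideanSpace ℝ (Fin N)))
    (h : EuclideanSpace ℝ (Fin N) → ℝ) : Prop where
  smooth : ∀ p ∈ frontier E, ∃ g : EuclideanSpace ℝ (Fin N) → ℝ,
    ContDiff ℝ ∞ g ∧ ∀ᶠ x in 𝓝[frontier E] p, h x = g x
  compact_support : ∃ K : Set (EuclideanSpace ℝ (Fin N)),
    IsCompact K ∧ K ⊆ Ω ∩ frontier E ∧ ∀ x ∈ frontier E, x ∉ K → h x = 0

/-- `F` is the normal perturbation `E_{th}` of `E`: the open set with smooth boundary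
`∂F = {x + t h(x) ν(x) : x ∈ ∂E}` whose exterior normal at `x + t h(x) ν(x)` points to the same
side as `ν(x)`. -/
structure IsNormalPerturbation (E : Set (EuclideanSpace ℝ (Fin N)))
    (h : EuclideanSpace ℝ (Fin N) → ℝ) (t : ℝ) (F : Set (EuclideanSpace ℝ (Fin N))) : Prop where
  isOpen : IsOpen F
  smooth : HasSmoothBoundary F
  frontier_eq : frontier F = (fun x => x + (t * h x) • outerNormal E x) '' frontier E
  normal_pos : ∀ x ∈ frontier E,
    0 < inner ℝ (outerNormal F (x + (t * h x) • outerNormal E x)) (outerNormal E x)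

end NonlocalPerimeter

end

noncomputable section

namespace NonlocalPerimeter

variable {N : ℕ}

local notation "𝔼" => EuclideanSpace ℝ (Fin N)

/-! ### Defining functions and the exterior normal -/

lemma normalize_eq_of_inner_neg_imp {a b : 𝔼} (ha : a ≠ 0) (hb : b ≠ 0)
    (H : ∀ v, inner ℝ a v < 0 → inner ℝ b v ≤ 0) : ‖a‖⁻¹ • a = ‖b‖⁻¹ • b := by
  by_contra hne
  have hna : 0 < ‖a‖ := norm_pos_iff.2 ha
  have hnb : 0 < ‖b‖ := norm_pos_iff.2 hb
  have h1 : ‖(‖a‖⁻¹ • a : 𝔼)‖ = 1 := by simp [norm_smul, hna.ne']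
  have h2 : ‖(‖b‖⁻¹ • b : 𝔼)‖ = 1 := by simp [norm_smul, hnb.ne']
  have hlt : inner ℝ (‖a‖⁻¹ • a) (‖b‖⁻¹ • b) < (1 : ℝ) :=
    (inner_lt_one_iff_real_of_norm_eq_one h1 h2).2 hne
  have e1 : inner ℝ a (‖b‖⁻¹ • b - ‖a‖⁻¹ • a) =
      ‖a‖ * (inner ℝ (‖a‖⁻¹ • a) (‖b‖⁻¹ • b) - 1) := by
    simp only [inner_sub_right, inner_smul_left, inner_smul_right, real_inner_self_eq_norm_sq]
    simp only [conj_trivial]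
    field_simp
  have e2 : inner ℝ b (‖b‖⁻¹ • b - ‖a‖⁻¹ • a) =
      ‖b‖ * (1 - inner ℝ (‖a‖⁻¹ • a) (‖b‖⁻¹ • b)) := by
    simp only [inner_sub_right, inner_smul_left, inner_smul_right, real_inner_self_eq_norm_sq,
      real_inner_comm a b]
    simp only [conj_trivial]
    field_simp
  have := H (‖b‖⁻¹ • b - ‖a‖⁻¹ • a) (by rw [e1]; nlinarith)
  rw [e2] at this
  nlinarith

lemma hasDerivAt_line {φ : 𝔼 → ℝ} {p : 𝔼} (hφ : DifferentiableAt ℝ φ p) (v : 𝔼) :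
    HasDerivAt (fun t : ℝ => φ (p + t • v)) (inner ℝ (gradient φ p) v) 0 := by
  have h1 : HasDerivAt (fun t : ℝ => p + t • v) v 0 := by
    simpa using ((hasDerivAt_id (0 : ℝ)).smul_const v).const_add p
  have h2 : HasFDerivAt φ (fderiv ℝ φ p) (p + (0 : ℝ) • v) := by simpa using hφ.hasFDerivAt
  have := h2.comp_hasDerivAt (0 : ℝ) h1
  simpa [gradient, InnerProductSpace.toDual_symm_apply, Function.comp_def] using! this

lemma eventually_neg_of_hasDerivAt_neg {f : ℝ → ℝ} {f' : ℝ} (hf : HasDerivAt f f' 0)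
    (h0 : f 0 = 0) (hf' : f' < 0) : ∀ᶠ t in 𝓝[>] (0 : ℝ), f t < 0 := by
  have h := hf.tendsto_slope_zero_right
  have h2 := h.eventually (gt_mem_nhds hf')
  filter_upwards [h2, self_mem_nhdsWithin] with t ht (ht0 : 0 < t)
  simp only [zero_add, h0, sub_zero, smul_eq_mul] at ht
  by_contra hcon
  push Not at hcon
  have : 0 ≤ t⁻¹ * f t := mul_nonneg (inv_nonneg.2 ht0.le) hcon
  linarith

lemma eventually_pos_of_hasDerivAt_pos {f : ℝ → ℝ} {f' : ℝ} (hf : HasDerivAt f f' 0)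
    (h0 : f 0 = 0) (hf' : 0 < f') : ∀ᶠ t in 𝓝[>] (0 : ℝ), 0 < f t := by
  filter_upwards [eventually_neg_of_hasDerivAt_neg hf.neg (by simp [h0]) (by linarith)] with t ht
  simpa using ht

lemma tendsto_line (p v : 𝔼) : Tendsto (fun t : ℝ => p + t • v) (𝓝[>] 0) (𝓝 p) := by
  have : Continuous fun t : ℝ => p + t • v := by fun_prop
  simpa using (this.tendsto 0).mono_left nhdsWithin_le_nhds

namespace IsDefiningFunction

variable {E : Set (EuclideanSpace ℝ (Fin N))} {p : EuclideanSpace ℝ (Fin N)}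
  {φ : EuclideanSpace ℝ (Fin N) → ℝ}

lemma differentiable (hφ : IsDefiningFunction E p φ) : Differentiable ℝ φ :=
  hφ.contDiff.differentiable (by simp)

lemma eventually_mem (hφ : IsDefiningFunction E p φ) {v : 𝔼} (hv : inner ℝ (gradient φ p) v < 0) :
    ∀ᶠ t in 𝓝[>] (0 : ℝ), p + t • v ∈ E := by
  have h1 := eventually_neg_of_hasDerivAt_neg (hasDerivAt_line (hφ.differentiable p) v)
    (by simpa using hφ.apply_eq_zero) hv
  filter_upwards [h1, (tendsto_line p v).eventually hφ.mem_iff] with t ht ht'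
  exact ht'.2 ht

lemma eventually_notMem (hφ : IsDefiningFunction E p φ) {v : 𝔼}
    (hv : 0 < inner ℝ (gradient φ p) v) :
    ∀ᶠ t in 𝓝[>] (0 : ℝ), p + t • v ∉ E := by
  have h1 := eventually_pos_of_hasDerivAt_pos (hasDerivAt_line (hφ.differentiable p) v)
    (by simpa using hφ.apply_eq_zero) hv
  filter_upwards [h1, (tendsto_line p v).eventually hφ.mem_iff] with t ht ht'
  exact fun h => absurd (ht'.1 h) (not_lt.2 ht.le)

lemma mem_frontier (hφ : IsDefiningFunction E p φ) : p ∈ frontier E := by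
  have hpos : 0 < ‖gradient φ p‖ := norm_pos_iff.2 hφ.gradient_ne_zero
  rw [frontier_eq_closure_inter_closure]
  constructor
  · refine mem_closure_of_tendsto (tendsto_line p (-gradient φ p)) (hφ.eventually_mem ?_)
    rw [inner_neg_right, real_inner_self_eq_norm_sq]
    exact neg_neg_of_pos (pow_pos hpos 2)
  · refine mem_closure_of_tendsto (tendsto_line p (gradient φ p)) (hφ.eventually_notMem ?_)
    rw [real_inner_self_eq_norm_sq]
    positivity

lemma unitGradient_eq (hφ : IsDefiningFunction E p φ) {ψ : 𝔼 → ℝ}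
    (hψ : IsDefiningFunction E p ψ) : unitGradient φ p = unitGradient ψ p := by
  refine normalize_eq_of_inner_neg_imp hφ.gradient_ne_zero hψ.gradient_ne_zero fun v hv => ?_
  by_contra hcon
  push Not at hcon
  obtain ⟨t, h1, h2⟩ := ((hφ.eventually_mem hv).and (hψ.eventually_notMem hcon)).exists
  exact h2 h1

lemma outerNormal_eq (hφ : IsDefiningFunction E p φ) : outerNormal E p = unitGradient φ p := by
  have h : ∃ φ, IsDefiningFunction E p φ := ⟨φ, hφ⟩
  rw [outerNormal, dif_pos h]
  exact h.choose_spec.unitGradient_eq hφ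

lemma continuous_gradient (hφ : IsDefiningFunction E p φ) : Continuous (gradient φ) :=
  (InnerProductSpace.toDual ℝ 𝔼).symm.continuous.comp (hφ.contDiff.continuous_fderiv (by simp))

lemma eventually_isDefiningFunction (hφ : IsDefiningFunction E p φ) :
    ∀ᶠ x in 𝓝 p, φ x = 0 → IsDefiningFunction E x φ := by
  have h1 : ∀ᶠ x in 𝓝 p, gradient φ x ≠ 0 :=
    hφ.continuous_gradient.continuousAt.eventually_ne hφ.gradient_ne_zero
  filter_upwards [h1, hφ.mem_iff.eventually_nhds] with x hx1 hx2 hx0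
  exact ⟨hφ.contDiff, hx0, hx1, hx2⟩

lemma eventually_frontier_iff (hφ : IsDefiningFunction E p φ) :
    ∀ᶠ x in 𝓝 p, (x ∈ frontier E ↔ φ x = 0) := by
  filter_upwards [hφ.eventually_isDefiningFunction, hφ.mem_iff.eventually_nhds] with x hx1 hx2
  refine ⟨fun hx => ?_, fun h0 => (hx1 h0).mem_frontier⟩
  have hc : Continuous φ := hφ.contDiff.continuous
  rcases lt_trichotomy (φ x) 0 with h | h | h
  · have : ∀ᶠ y in 𝓝 x, y ∈ E := by
      filter_upwards [hx2, hc.continuousAt.eventually (gt_mem_nhds h)] with y hy1 hy2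
      exact hy1.2 hy2
    exact absurd (mem_interior_iff_mem_nhds.2 this) hx.2
  · exact h
  · have : ∀ᶠ y in 𝓝 x, y ∈ Eᶜ := by
      filter_upwards [hx2, hc.continuousAt.eventually (lt_mem_nhds h)] with y hy1 hy2 hy3
      exact absurd (hy1.1 hy3) (not_lt.2 (le_of_lt hy2))
    have h3 : x ∈ interior Eᶜ := mem_interior_iff_mem_nhds.2 this
    rw [interior_compl] at h3
    exact absurd hx.1 h3

end IsDefiningFunction

lemma contDiff_gradient {φ : 𝔼 → ℝ} (hφ : ContDiff ℝ ∞ φ) : ContDiff ℝ ∞ (gradient φ) :=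
  (InnerProductSpace.toDual ℝ 𝔼).symm.contDiff.comp (hφ.fderiv_right (by simp))

lemma norm_unitGradient {φ : 𝔼 → ℝ} {x : 𝔼} (h : gradient φ x ≠ 0) : ‖unitGradient φ x‖ = 1 := by
  simp [unitGradient, norm_smul, norm_ne_zero_iff.2 h]

lemma contDiffAt_unitGradient {φ : 𝔼 → ℝ} (hφ : ContDiff ℝ ∞ φ) {x : 𝔼} (h : gradient φ x ≠ 0) :
    ContDiffAt ℝ ∞ (unitGradient φ) x := by
  have hg := (contDiff_gradient hφ).contDiffAt (x := x)
  exact ((hg.norm ℝ h).inv (norm_ne_zero_iff.2 h)).smul hg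

lemma exists_contDiff_forall_mem_convex {F : Type*} [NormedAddCommGroup F] [NormedSpace ℝ F]
    (t : 𝔼 → Set F) (ht : ∀ x, Convex ℝ (t x))
    (H : ∀ x, ∃ U ∈ 𝓝 x, ∃ g : 𝔼 → F, ContDiffOn ℝ ∞ g U ∧ ∀ y ∈ U, g y ∈ t y) :
    ∃ g : 𝔼 → F, ContDiff ℝ ∞ g ∧ ∀ x, g x ∈ t x := by
  obtain ⟨g, hg⟩ := exists_contMDiffMap_forall_mem_convex_of_local (n := ⊤)
    (modelWithCornersSelf ℝ 𝔼) ht (fun x => by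
      obtain ⟨U, hU, g, h1, h2⟩ := H x
      exact ⟨U, hU, g, contMDiffOn_iff_contDiffOn.2 h1, h2⟩)
  exact ⟨g, contMDiff_iff_contDiff.1 g.contMDiff, hg⟩

/-- The exterior normal extends smoothly to the whole space. -/
lemma exists_contDiff_eq_outerNormal {E : Set 𝔼} (hEs : HasSmoothBoundary E) :
    ∃ n : 𝔼 → 𝔼, ContDiff ℝ ∞ n ∧ ∀ x ∈ frontier E, n x = outerNormal E x := by
  obtain ⟨n, h1, h2⟩ := exists_contDiff_forall_mem_convex
    (fun x : 𝔼 => {v : 𝔼 | x ∈ frontier E → v = outerNormal E x}) (fun x => by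
      by_cases hx : x ∈ frontier E
      · simp only [hx, forall_const, ofPred_eq_eq_singleton]
        exact convex_singleton _
      · simp only [hx, false_imp_iff, ofPred_true]
        exact convex_univ) (fun p => by
      by_cases hp : p ∈ frontier E
      · obtain ⟨φ, hφ⟩ := hEs p hp
        have h1 : ∀ᶠ x in 𝓝 p, gradient φ x ≠ 0 :=
          hφ.continuous_gradient.continuousAt.eventually_ne hφ.gradient_ne_zero
        refine ⟨_, (h1.and (hφ.eventually_frontier_iff.and hφ.eventually_isDefiningFunction)),
          unitGradient φ, fun x hx => (contDiffAt_unitGradient hφ.contDiff hx.1).contDiffWithinAt,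
          fun x hx hxE => ?_⟩
        exact (hx.2.2 (hx.2.1.1 hxE)).outerNormal_eq.symm
      · refine ⟨_, isClosed_frontier.isOpen_compl.mem_nhds hp, fun _ => 0, contDiffOn_const,
          fun y hy hy' => absurd hy' hy⟩)
  exact ⟨n, h1, h2⟩

/-- A test function extends to a smooth function with compact support in `Ω`. -/
lemma IsTestFunction.exists_extension {E Ω : Set 𝔼} (hΩ : IsOpen Ω) {h : 𝔼 → ℝ}
    (hh : IsTestFunction E Ω h) :
    ∃ g : 𝔼 → ℝ, ContDiff ℝ ∞ g ∧ HasCompactSupport g ∧ tsupport g ⊆ Ω ∧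
      ∀ x ∈ frontier E, g x = h x := by
  obtain ⟨K, hK, hKs, hK0⟩ := hh.compact_support
  obtain ⟨L, hL, hKL, hLΩ⟩ := exists_compact_between hK hΩ (fun x hx => (hKs hx).1)
  obtain ⟨g, h1, h2⟩ := exists_contDiff_forall_mem_convex
    (fun x : 𝔼 => {v : ℝ | (x ∈ frontier E → v = h x) ∧ (x ∉ L → v = 0)}) (fun x => by
      intro a ha b hb r s hr hs hrs
      refine ⟨fun hx => ?_, fun hx => ?_⟩
      · rw [ha.1 hx, hb.1 hx, ← add_smul, hrs, one_smul]
      · rw [ha.2 hx, hb.2 hx]; simp) (fun p => by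
      by_cases hpK : p ∈ K
      · obtain ⟨g, hg, hgh⟩ := hh.smooth p (hKs hpK).2
        rw [eventually_nhdsWithin_iff] at hgh
        exact ⟨_, hgh.and (mem_interior_iff_mem_nhds.1 (hKL hpK)), g, hg.contDiffOn,
          fun y hy => ⟨fun hyE => (hy.1 hyE).symm, fun hyL => absurd hy.2 hyL⟩⟩
      · refine ⟨_, hK.isClosed.isOpen_compl.mem_nhds hpK, fun _ => 0, contDiffOn_const,
          fun y hy => ⟨fun hyE => (hK0 y hyE hy).symm, fun _ => rfl⟩⟩)
  have hts : tsupport g ⊆ L := closure_minimal (fun x hx => by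
    by_contra hxL; exact hx ((h2 x).2 hxL)) hL.isClosed
  exact ⟨g, h1, hL.of_isClosed_subset (isClosed_tsupport g) hts, hts.trans hLΩ,
    fun x hx => (h2 x).1 hx⟩

/-! ### A global defining function -/

lemma inner_gradient {φ : 𝔼 → ℝ} (x v : 𝔼) : inner ℝ (gradient φ x) v = fderiv ℝ φ x v := by
  simp [gradient, InnerProductSpace.toDual_symm_apply]

lemma exists_zero_near {φ : 𝔼 → ℝ} (hφ : Differentiable ℝ φ) {p u y : 𝔼} {a r : ℝ} (ha : 0 < a)
    (hu : ‖u‖ = 1) (hr : ∀ x ∈ Metric.ball p r, a ≤ inner ℝ (gradient φ x) u)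
    (hy : dist y p < r / 2) (hφy : |φ y| < a * (r / 2)) :
    ∃ x ∈ Metric.ball p r, φ x = 0 ∧ dist y x ≤ a⁻¹ * |φ y| := by
  set S := a⁻¹ * |φ y| with hS
  have hS0 : 0 ≤ S := by positivity
  have haS : a * S = |φ y| := by rw [hS]; field_simp
  have hSr : S < r / 2 := by nlinarith
  set f : ℝ → ℝ := fun t => φ (y + t • u)
  have hd : ∀ t, HasDerivAt f (inner ℝ (gradient φ (y + t • u)) u) t := fun t => by
    have h1 : HasDerivAt (fun t : ℝ => y + t • u) u t := by
      simpa using ((hasDerivAt_id t).smul_const u).const_add y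
    rw [inner_gradient]
    exact (hφ (y + t • u)).hasFDerivAt.comp_hasDerivAt t h1
  have hmem : ∀ t ∈ Icc (-S) S, y + t • u ∈ Metric.ball p r := fun t ht => by
    rw [Metric.mem_ball, dist_eq_norm]
    have : ‖t • u‖ ≤ S := by rw [norm_smul, hu, mul_one]; exact abs_le.2 ht
    calc ‖y + t • u - p‖ = ‖(y - p) + t • u‖ := by congr 1; abel
      _ ≤ ‖y - p‖ + ‖t • u‖ := norm_add_le _ _
      _ < r := by rw [dist_eq_norm] at hy; linarith
  have hmono : ∀ s ∈ Icc (-S) S, ∀ t ∈ Icc (-S) S, s ≤ t → a * (t - s) ≤ f t - f s := by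
    refine (convex_Icc (-S) S).mul_sub_le_image_sub_of_le_deriv
      (fun t _ => (hd t).continuousAt.continuousWithinAt)
      (fun t _ => (hd t).differentiableAt.differentiableWithinAt) (fun t ht => ?_)
    rw [(hd t).deriv]
    exact hr _ (hmem t (interior_subset ht))
  have h0 : (0 : ℝ) ∈ Icc (-S) S := ⟨by linarith, hS0⟩
  have f0 : f 0 = φ y := by simp [f]
  have h1 := hmono 0 h0 S ⟨by linarith, le_rfl⟩ hS0
  have h2 := hmono (-S) ⟨le_rfl, by linarith⟩ 0 h0 (by linarith)
  rw [f0] at h1 h2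
  have h3 : (0 : ℝ) ∈ Icc (f (-S)) (f S) := by
    constructor
    · linarith [neg_abs_le (φ y), le_abs_self (φ y)]
    · linarith [neg_abs_le (φ y), le_abs_self (φ y)]
  obtain ⟨t, ht, ht0⟩ := intermediate_value_Icc (by linarith : -S ≤ S)
    (fun t _ => (hd t).continuousAt.continuousWithinAt) h3
  refine ⟨y + t • u, hmem t ht, ht0, ?_⟩
  rw [dist_eq_norm]
  simpa [norm_smul, hu] using abs_le.2 ht

lemma IsDefiningFunction.exists_infDist_le {E : Set 𝔼} {p : 𝔼} {φ : 𝔼 → ℝ}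
    (hφ : IsDefiningFunction E p φ) :
    ∃ C, 0 < C ∧ ∀ᶠ y in 𝓝 p, Metric.infDist y (frontier E) ≤ C * |φ y| := by
  set G := gradient φ p
  have hG : 0 < ‖G‖ := norm_pos_iff.2 hφ.gradient_ne_zero
  set u := unitGradient φ p
  have hu : ‖u‖ = 1 := norm_unitGradient hφ.gradient_ne_zero
  have hGu : inner ℝ G u = ‖G‖ := by
    change inner ℝ G (‖G‖⁻¹ • G) = ‖G‖
    rw [inner_smul_right, real_inner_self_eq_norm_sq]
    field_simp
  have hc : Continuous fun x => inner ℝ (gradient φ x) u :=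
    hφ.continuous_gradient.inner continuous_const
  have h1 : ∀ᶠ x in 𝓝 p, ‖G‖ / 2 < inner ℝ (gradient φ x) u :=
    hc.continuousAt.eventually (lt_mem_nhds (by simp only; change _ < inner ℝ G u; rw [hGu]; linarith))
  obtain ⟨r, hr, hball⟩ := Metric.eventually_nhds_iff_ball.1 (h1.and hφ.eventually_frontier_iff)
  refine ⟨(‖G‖ / 2)⁻¹, by positivity, ?_⟩
  have h2 : ∀ᶠ y in 𝓝 p, |φ y| < ‖G‖ / 2 * (r / 2) := by
    have hc : Continuous fun y => |φ y| := hφ.contDiff.continuous.abs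
    exact hc.continuousAt.eventually (gt_mem_nhds (by
      simp only [hφ.apply_eq_zero, abs_zero]; positivity))
  filter_upwards [h2, Metric.ball_mem_nhds p (half_pos hr)] with y hy1 hy2
  obtain ⟨x, hx, hx0, hd⟩ := exists_zero_near hφ.differentiable (by positivity) hu
    (fun x hx => (hball x hx).1.le) hy2 hy1
  exact (Metric.infDist_le_dist_of_mem ((hball x hx).2.2 hx0)).trans hd

/-- A smooth function defining the set `E` and its boundary globally. -/
structure IsGlobalDefiningFunction (E : Set (EuclideanSpace ℝ (Fin N)))
    (ρ : EuclideanSpace ℝ (Fin N) → ℝ) : Prop where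
  contDiff : ContDiff ℝ ∞ ρ
  mem_iff : ∀ x, x ∈ E ↔ ρ x < 0
  frontier_iff : ∀ x, x ∈ frontier E ↔ ρ x = 0
  gradient_ne_zero : ∀ x ∈ frontier E, gradient ρ x ≠ 0

lemma IsGlobalDefiningFunction.isDefiningFunction {E : Set 𝔼} {ρ : 𝔼 → ℝ}
    (hρ : IsGlobalDefiningFunction E ρ) {p : 𝔼} (hp : p ∈ frontier E) :
    IsDefiningFunction E p ρ :=
  ⟨hρ.contDiff, (hρ.frontier_iff p).1 hp, hρ.gradient_ne_zero p hp, Eventually.of_forall hρ.mem_iff⟩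

lemma gradient_ne_zero_of_infDist_le {E : Set 𝔼} {p : 𝔼} {φ ρ : 𝔼 → ℝ}
    (hφ : IsDefiningFunction E p φ) (hρ : Differentiable ℝ ρ) (hρp : ρ p = 0)
    (h : ∀ y, y ∉ closure E → Metric.infDist y (frontier E) ≤ ρ y) : gradient ρ p ≠ 0 := by
  intro hzero
  set G := gradient φ p
  have hG : 0 < ‖G‖ := norm_pos_iff.2 hφ.gradient_ne_zero
  have hGG : 0 < inner ℝ G G := by rw [real_inner_self_eq_norm_sq]; positivity
  set a := inner ℝ G G
  obtain ⟨L, U, hU, hL⟩ := ((hφ.contDiff.of_le (by simp)).contDiffAt (x := p)).exists_lipschitzOnWith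
  obtain ⟨r, hr, hball⟩ := Metric.eventually_nhds_iff_ball.1
    (hφ.eventually_frontier_iff.and hU)
  -- along the normal line, `φ` grows linearly
  have h1 : ∀ᶠ t in 𝓝[>] (0 : ℝ), t * (a / 2) < φ (p + t • G) := by
    have hd := (hasDerivAt_line (hφ.differentiable p) G).sub
      ((hasDerivAt_id (0 : ℝ)).mul_const (a / 2))
    have := eventually_pos_of_hasDerivAt_pos hd (by simp [hφ.apply_eq_zero])
      (by simp only [one_mul]; change 0 < a - a / 2; linarith)
    filter_upwards [this] with t ht
    simpa using ht
  set ε := a / (4 * (L + 1)) with hε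
  have hL0 : (0 : ℝ) ≤ L := L.2
  have hε0 : 0 < ε := by positivity
  have h2 : ∀ᶠ t in 𝓝[>] (0 : ℝ), ρ (p + t • G) < t * ε := by
    have hd := (hasDerivAt_line (hρ p) G).sub ((hasDerivAt_id (0 : ℝ)).mul_const ε)
    rw [hzero] at hd
    have := eventually_neg_of_hasDerivAt_neg hd (by simp [hρp]) (by simpa using hε0)
    filter_upwards [this] with t ht
    simpa using ht
  have h3 : ∀ᶠ t in 𝓝[>] (0 : ℝ), t * (2 * ‖G‖) < r := by
    have hc : Continuous fun t : ℝ => t * (2 * ‖G‖) := by fun_prop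
    exact nhdsWithin_le_nhds (hc.continuousAt.eventually (gt_mem_nhds (by simpa using hr)))
  have h4 : ∀ᶠ t in 𝓝[>] (0 : ℝ), p + t • G ∉ E := hφ.eventually_notMem hGG
  obtain ⟨t, ht1, ht2, ht3, ht4, ht0⟩ :=
    (h1.and (h2.and (h3.and (h4.and self_mem_nhdsWithin)))).exists
  have ht0' : 0 < t := ht0
  set y := p + t • G
  have hyp : dist y p = t * ‖G‖ := by
    rw [dist_eq_norm]; simp [y, norm_smul, abs_of_pos ht0']
  have hyb : y ∈ Metric.ball p r := by
    rw [Metric.mem_ball, hyp]; nlinarith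
  have hycl : y ∉ closure E := by
    intro hy
    have : y ∈ frontier E := ⟨hy, fun h => ht4 (interior_subset h)⟩
    have := (hball y hyb).1.1 this
    have : 0 < t * (a / 2) := by positivity
    linarith
  obtain ⟨x, hx, hxd⟩ := isClosed_frontier.exists_infDist_eq_dist ⟨p, hφ.mem_frontier⟩ y
  have hxy : dist y x ≤ t * ‖G‖ := by
    rw [← hxd, ← hyp]; exact Metric.infDist_le_dist_of_mem hφ.mem_frontier
  have hxb : x ∈ Metric.ball p r := by
    rw [Metric.mem_ball]
    have := dist_triangle x y p
    rw [dist_comm x y] at this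
    linarith
  have hLip := hL.dist_le_mul y (hball y hyb).2 x (hball x hxb).2
  rw [(hball x hxb).1.1 hx, Real.dist_eq, sub_zero] at hLip
  have h5 := h y hycl
  rw [hxd] at h5
  have h6 : t * (a / 2) < L * (t * ε) :=
    (ht1.trans_le ((le_abs_self _).trans hLip)).trans_le
      (mul_le_mul_of_nonneg_left (h5.trans ht2.le) hL0)
  have h7 : L * ε ≤ a / 4 := by
    rw [hε, mul_div_assoc', div_le_div_iff₀ (by positivity) (by norm_num)]
    nlinarith
  nlinarith

lemma HasSmoothBoundary.exists_globalDefiningFunction {E : Set 𝔼} (hE : IsOpen E)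
    (hEs : HasSmoothBoundary E) : ∃ ρ, IsGlobalDefiningFunction E ρ := by
  set d : 𝔼 → ℝ := fun y => Metric.infDist y (frontier E)
  have hd0 : ∀ y, 0 ≤ d y := fun y => Metric.infDist_nonneg
  have hdc : Continuous d := Metric.continuous_infDist_pt _
  have hfr : ∀ y, y ∈ frontier E ↔ y ∈ closure E ∧ y ∉ E := fun y => by
    rw [hE.frontier_eq, Set.mem_sdiff]
  obtain ⟨ρ, h1, h2⟩ := exists_contDiff_forall_mem_convex
    (fun y : 𝔼 => {v : ℝ | (y ∈ E → v < 0) ∧ (y ∈ frontier E → v = 0) ∧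
      (y ∉ closure E → 0 < v ∧ d y ≤ v)}) (fun y => by
      by_cases hy : y ∈ E
      · have e : {v : ℝ | (y ∈ E → v < 0) ∧ (y ∈ frontier E → v = 0) ∧
            (y ∉ closure E → 0 < v ∧ d y ≤ v)} = Iio 0 := by
          ext v; simp [hy, hfr, subset_closure hy]
        rw [e]; exact convex_Iio 0
      by_cases hy' : y ∈ closure E
      · have e : {v : ℝ | (y ∈ E → v < 0) ∧ (y ∈ frontier E → v = 0) ∧
            (y ∉ closure E → 0 < v ∧ d y ≤ v)} = {0} := by
          ext v; simp [hy, hfr, hy']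
        rw [e]; exact convex_singleton 0
      · have e : {v : ℝ | (y ∈ E → v < 0) ∧ (y ∈ frontier E → v = 0) ∧
            (y ∉ closure E → 0 < v ∧ d y ≤ v)} = Ioi 0 ∩ Ici (d y) := by
          ext v; simp [hy, hfr, hy']
        rw [e]; exact (convex_Ioi 0).inter (convex_Ici _)) (fun p => by
      by_cases hp : p ∈ frontier E
      · obtain ⟨φ, hφ⟩ := hEs p hp
        obtain ⟨C, hC, hCd⟩ := hφ.exists_infDist_le
        refine ⟨_, hCd.and (hφ.eventually_frontier_iff.and hφ.mem_iff), fun y => C * φ y,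
          (contDiff_const.mul hφ.contDiff).contDiffOn, fun y hy => ⟨fun h => ?_, fun h => ?_,
          fun h => ?_⟩⟩
        · exact mul_neg_of_pos_of_neg hC (hy.2.2.1 h)
        · simp only [hy.2.1.1 h, mul_zero]
        · have hyE : y ∉ E := fun h' => h (subset_closure h')
          have h0 : φ y ≠ 0 := fun h0 => h (frontier_subset_closure (hy.2.1.2 h0))
          have h1 : 0 ≤ φ y := not_lt.1 fun h1 => hyE (hy.2.2.2 h1)
          have h2 : 0 < φ y := lt_of_le_of_ne h1 (Ne.symm h0)
          refine ⟨by positivity, ?_⟩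
          simpa [abs_of_pos h2] using hy.1
      · by_cases hpE : p ∈ E
        · exact ⟨E, hE.mem_nhds hpE, fun _ => -1, contDiffOn_const, fun y hy =>
            ⟨fun _ => by norm_num, fun h => absurd hy ((hfr y).1 h).2,
              fun h => absurd (subset_closure hy) h⟩⟩
        · have hpc : p ∉ closure E := fun h => hp ((hfr p).2 ⟨h, hpE⟩)
          refine ⟨_, (isClosed_closure.isOpen_compl.eventually_mem hpc).and
            (hdc.continuousAt.eventually (gt_mem_nhds (lt_add_one (d p)))), fun _ => d p + 1,
            contDiffOn_const, fun y hy => ⟨fun h => absurd (subset_closure h) hy.1,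
            fun h => absurd ((hfr y).1 h).1 hy.1, fun _ => ⟨?_, hy.2.le⟩⟩⟩
          linarith [hd0 p])
  have h0 : ∀ x, x ∈ frontier E → ρ x = 0 := fun x hx => (h2 x).2.1 hx
  have hcases : ∀ x, x ∈ E ∨ x ∈ frontier E ∨ x ∉ closure E := fun x => by
    rw [hfr]; tauto
  refine ⟨ρ, h1, fun x => ⟨(h2 x).1, fun hx => ?_⟩, fun x => ⟨h0 x, fun hx => ?_⟩, fun p hp => ?_⟩
  · rcases hcases x with h | h | h
    · exact h
    · rw [h0 x h] at hx; exact absurd hx (lt_irrefl _)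
    · exact absurd hx (not_lt.2 ((h2 x).2.2 h).1.le)
  · rcases hcases x with h | h | h
    · exact absurd hx ((h2 x).1 h).ne
    · exact h
    · exact absurd hx ((h2 x).2.2 h).1.ne'
  · obtain ⟨φ, hφ⟩ := hEs p hp
    exact gradient_ne_zero_of_infDist_le hφ (h1.differentiable (by simp)) (h0 p hp)
      fun y hy => ((h2 y).2.2 hy).2

/-! ### Uniqueness of normal perturbations -/

lemma outerNormal_eq_of_ball {F : Set 𝔼} {q x : 𝔼} {φ : 𝔼 → ℝ} (hφ : IsDefiningFunction F q φ)
    (hxq : x ≠ q) :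
    (Metric.ball x (dist x q) ⊆ F → outerNormal F q = -(‖x - q‖⁻¹ • (x - q))) ∧
    (Metric.ball x (dist x q) ⊆ Fᶜ → outerNormal F q = ‖x - q‖⁻¹ • (x - q)) := by
  have hne : x - q ≠ 0 := sub_ne_zero.2 hxq
  have key : ∀ v, 0 < inner ℝ (x - q) v →
      ∀ᶠ t in 𝓝[>] (0 : ℝ), q + t • v ∈ Metric.ball x (dist x q) := by
    intro v hv
    have h1 : ∀ᶠ t in 𝓝[>] (0 : ℝ), t * ‖v‖ ^ 2 < 2 * inner ℝ (x - q) v := by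
      have hc : Continuous fun t : ℝ => t * ‖v‖ ^ 2 := by fun_prop
      exact nhdsWithin_le_nhds (hc.continuousAt.eventually (gt_mem_nhds (by simpa using hv)))
    filter_upwards [h1, self_mem_nhdsWithin] with t ht (ht0 : 0 < t)
    rw [Metric.mem_ball, dist_comm, dist_eq_norm, dist_eq_norm]
    refine lt_of_pow_lt_pow_left₀ 2 (norm_nonneg _) ?_
    have e : x - (q + t • v) = (x - q) - t • v := by abel
    rw [e, norm_sub_sq_real, inner_smul_right, norm_smul, Real.norm_eq_abs, abs_of_pos ht0]
    nlinarith
  rw [hφ.outerNormal_eq]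
  constructor
  · intro hb
    have := normalize_eq_of_inner_neg_imp (a := -(x - q)) (b := gradient φ q)
      (neg_ne_zero.2 hne) hφ.gradient_ne_zero fun v hv => by
        rw [inner_neg_left, neg_lt_zero] at hv
        by_contra hcon
        push Not at hcon
        obtain ⟨t, h1, h2⟩ := ((key v hv).and (hφ.eventually_notMem hcon)).exists
        exact h2 (hb h1)
    rw [unitGradient, ← this, norm_neg, smul_neg]
  · intro hb
    have := normalize_eq_of_inner_neg_imp (a := (x - q)) (b := gradient φ q)
      hne hφ.gradient_ne_zero fun v hv => by
        by_contra hcon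
        push Not at hcon
        obtain ⟨t, h1, h2⟩ := ((key (-v) (by rw [inner_neg_right]; linarith)).and
          (hφ.eventually_mem (v := -v) (by rw [inner_neg_right]; linarith))).exists
        exact hb h1 h2
    rw [unitGradient, ← this]

lemma ball_subset_or_subset_compl {F : Set 𝔼} {x : 𝔼} {r : ℝ}
    (h : Disjoint (Metric.ball x r) (frontier F)) :
    Metric.ball x r ⊆ F ∨ Metric.ball x r ⊆ Fᶜ := by
  have hc : IsPreconnected (Metric.ball x r) := (convex_ball x r).isPreconnected
  by_contra hcon
  push Not at hcon
  obtain ⟨⟨a, ha, haF⟩, ⟨b, hb, hbF⟩⟩ := And.imp not_subset.1 not_subset.1 hcon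
  have hbF : b ∈ F := not_not.1 hbF
  have hcov : ∀ z ∈ Metric.ball x r, z ∈ interior F ∨ z ∈ interior Fᶜ := fun z hz => by
    have hzf := h.notMem_of_mem_left hz
    rw [interior_compl]
    by_contra hcon
    push Not at hcon
    exact hzf ⟨not_not.1 hcon.2, hcon.1⟩
  obtain ⟨z, -, hz1, hz2⟩ := hc _ _ isOpen_interior isOpen_interior hcov
    ⟨b, hb, (hcov b hb).resolve_right fun h => interior_subset h hbF⟩
    ⟨a, ha, (hcov a ha).resolve_left fun h => haF (interior_subset h)⟩
  exact interior_subset hz2 (interior_subset hz1)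

lemma IsNormalPerturbation.subset {E F F' : Set 𝔼} {h : 𝔼 → ℝ} {t : ℝ}
    (hF : IsNormalPerturbation E h t F) (hF' : IsNormalPerturbation E h t F')
    (hne : (frontier E).Nonempty) : F ⊆ F' := by
  intro x hx
  have hfr : frontier F = frontier F' := by rw [hF.frontier_eq, hF'.frontier_eq]
  have hxS : x ∉ frontier F := fun h => by
    rw [hF.isOpen.frontier_eq] at h; exact h.2 hx
  have hne' : (frontier F).Nonempty := by rw [hF.frontier_eq]; exact hne.image _
  obtain ⟨q, hq, hqd⟩ := isClosed_frontier.exists_infDist_eq_dist hne' x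
  have hxq : x ≠ q := fun h => hxS (h ▸ hq)
  have hdisj : Disjoint (Metric.ball x (dist x q)) (frontier F) := by
    rw [← hqd]; exact Metric.disjoint_ball_infDist
  have hxb : x ∈ Metric.ball x (dist x q) := Metric.mem_ball_self (dist_pos.2 hxq)
  obtain ⟨φ, hφ⟩ := hF.smooth q hq
  obtain ⟨ψ, hψ⟩ := hF'.smooth q (hfr ▸ hq)
  obtain ⟨y, hy, hyq⟩ : q ∈ (fun x => x + (t * h x) • outerNormal E x) '' frontier E := by
    rw [← hF.frontier_eq]; exact hq
  have p1 := hF.normal_pos y hy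
  have p2 := hF'.normal_pos y hy
  simp only at hyq
  rw [hyq] at p1 p2
  have c1 : Metric.ball x (dist x q) ⊆ F :=
    (ball_subset_or_subset_compl hdisj).resolve_right fun h => h hxb hx
  rcases ball_subset_or_subset_compl (hfr ▸ hdisj) with c2 | c2
  · exact c2 hxb
  · rw [(outerNormal_eq_of_ball hφ hxq).1 c1, inner_neg_left] at p1
    rw [(outerNormal_eq_of_ball hψ hxq).2 c2] at p2
    linarith

lemma sPerimeter_eq_zero_of_frontier_eq_empty (s : ℝ) {F : Set 𝔼} (Ω : Set 𝔼)
    (hF : frontier F = ∅) : sPerimeter s F Ω = 0 := by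
  rcases (isClopen_iff_frontier_eq_empty.2 hF) |> isClopen_iff.1 with h | h
  · simp [sPerimeter, h]
  · simp [sPerimeter, h]

/-- The perimeter of a normal perturbation does not depend on its choice. -/
lemma IsNormalPerturbation.sPerimeter_eq {E F F' : Set 𝔼} {h : 𝔼 → ℝ} {t : ℝ}
    (hF : IsNormalPerturbation E h t F) (hF' : IsNormalPerturbation E h t F') (s : ℝ)
    (Ω : Set 𝔼) : sPerimeter s F Ω = sPerimeter s F' Ω := by
  rcases (frontier E).eq_empty_or_nonempty with hE | hE
  · rw [sPerimeter_eq_zero_of_frontier_eq_empty, sPerimeter_eq_zero_of_frontier_eq_empty]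
    · rw [hF'.frontier_eq, hE, image_empty]
    · rw [hF.frontier_eq, hE, image_empty]
  · rw [(hF.subset hF' hE).antisymm (hF'.subset hF hE)]

/-! ### The diffeomorphisms `x ↦ x + t X(x)` and the existence of normal perturbations -/

lemma exists_norm_fderiv_le {F : Type*} [NormedAddCommGroup F] [NormedSpace ℝ F] {X : 𝔼 → F}
    (hX : ContDiff ℝ ∞ X) (hXc : HasCompactSupport X) :
    ∃ L : ℝ, 0 < L ∧ ∀ x, ‖fderiv ℝ X x‖ ≤ L := by
  obtain ⟨C, hC⟩ := (hXc.fderiv ℝ).exists_bound_of_continuous (hX.continuous_fderiv (by simp))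
  exact ⟨max C 1, by positivity, fun x => (hC x).trans (le_max_left _ _)⟩

lemma norm_sub_le_of_norm_fderiv_le {F : Type*} [NormedAddCommGroup F] [NormedSpace ℝ F]
    {X : 𝔼 → F} (hX : ContDiff ℝ ∞ X) {L : ℝ} (hL : ∀ x, ‖fderiv ℝ X x‖ ≤ L) (x y : 𝔼) :
    ‖X x - X y‖ ≤ L * ‖x - y‖ :=
  Convex.norm_image_sub_le_of_norm_fderiv_le (fun z _ => hX.differentiable (by simp) z)
    (fun z _ => hL z) convex_univ (mem_univ y) (mem_univ x)

lemma exists_equiv_one_add {A : 𝔼 →L[ℝ] 𝔼} (hA : ‖A‖ < 1) :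
    ∃ e : 𝔼 ≃L[ℝ] 𝔼, (e : 𝔼 →L[ℝ] 𝔼) = 1 + A := by
  refine ⟨ContinuousLinearEquiv.unitsEquiv ℝ 𝔼 (Units.oneSub (-A) (by rwa [norm_neg])), ?_⟩
  ext1 x
  simp

lemma hasFDerivAt_add_smul {X : 𝔼 → 𝔼} (hX : ContDiff ℝ ∞ X) (t : ℝ) (x : 𝔼) :
    HasFDerivAt (fun x => x + t • X x) (1 + t • fderiv ℝ X x) x :=
  (hasFDerivAt_id x).add ((hX.differentiable (by simp) x).hasFDerivAt.const_smul t)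

lemma exists_homeomorph_add_smul {X : 𝔼 → 𝔼} (hX : ContDiff ℝ ∞ X) {L : ℝ} (hL0 : 0 < L)
    (hL : ∀ x, ‖fderiv ℝ X x‖ ≤ L) {t : ℝ} (ht : |t| * L ≤ 1 / 4) :
    ∃ Φ : 𝔼 ≃ₜ 𝔼, (∀ x, Φ x = x + t • X x) ∧ ContDiff ℝ ∞ Φ.symm := by
  have h1 : ApproximatesLinearOn (fun x => x + t • X x)
      ((ContinuousLinearEquiv.refl ℝ 𝔼 : 𝔼 ≃L[ℝ] 𝔼) : 𝔼 →L[ℝ] 𝔼) univ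
      (|t| * L).toNNReal := fun x _ y _ => by
    have e : x + t • X x - (y + t • X y) -
        ((ContinuousLinearEquiv.refl ℝ 𝔼 : 𝔼 ≃L[ℝ] 𝔼) : 𝔼 →L[ℝ] 𝔼) (x - y) =
        t • (X x - X y) := by
      simp only [ContinuousLinearEquiv.coe_refl, ContinuousLinearMap.id_apply, smul_sub]
      abel
    rw [e, norm_smul, Real.norm_eq_abs]
    calc |t| * ‖X x - X y‖ ≤ |t| * (L * ‖x - y‖) := by
          gcongr; exact norm_sub_le_of_norm_fderiv_le hX hL x y
      _ = _ := by rw [Real.coe_toNNReal _ (by positivity), mul_assoc]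
  have h2 : Subsingleton 𝔼 ∨ (|t| * L).toNNReal <
      ‖((ContinuousLinearEquiv.refl ℝ 𝔼).symm : 𝔼 →L[ℝ] 𝔼)‖₊⁻¹ := by
    rcases subsingleton_or_nontrivial 𝔼 with h | h
    · exact Or.inl h
    · right
      rw [← NNReal.coe_lt_coe]
      simp only [ContinuousLinearEquiv.refl_symm, ContinuousLinearEquiv.coe_refl, NNReal.coe_inv,
        coe_nnnorm, ContinuousLinearMap.norm_id, inv_one]
      rw [Real.coe_toNNReal _ (by positivity)]
      linarith
  have h3 : ∀ x, (h1.toHomeomorph _ h2) x = x + t • X x := fun x => rfl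
  refine ⟨h1.toHomeomorph _ h2, h3, ?_⟩
  have h4 : ∀ x, ‖t • fderiv ℝ X x‖ < 1 := fun x => by
    rw [norm_smul, Real.norm_eq_abs]
    calc |t| * ‖fderiv ℝ X x‖ ≤ |t| * L := by gcongr; exact hL x
      _ < 1 := by linarith
  choose e he using fun x => exists_equiv_one_add (h4 x)
  refine (h1.toHomeomorph _ h2).contDiff_symm (f₀' := e) (fun x => ?_) ?_
  · rw [he]; exact hasFDerivAt_add_smul hX t x
  · exact contDiff_id.add (hX.const_smul t)

lemma isNormalPerturbation_image {E : Set 𝔼} (hE : IsOpen E) {ρ : 𝔼 → ℝ}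
    (hρ : IsGlobalDefiningFunction E ρ) {h : 𝔼 → ℝ} {X : 𝔼 → 𝔼} (hX : ContDiff ℝ ∞ X)
    (hXh : ∀ x ∈ frontier E, X x = h x • outerNormal E x) {L : ℝ}
    (hL : ∀ x, ‖fderiv ℝ X x‖ ≤ L) {t : ℝ} (ht : |t| * L ≤ 1 / 4) {Φ : 𝔼 ≃ₜ 𝔼}
    (hΦ : ∀ x, Φ x = x + t • X x) (hΦs : ContDiff ℝ ∞ Φ.symm) :
    IsNormalPerturbation E h t (Φ '' E) := by
  have hfr : frontier (Φ '' E) = Φ '' frontier E := (Φ.image_frontier E).symm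
  have himg : ∀ x ∈ frontier E, Φ x = x + (t * h x) • outerNormal E x := fun x hx => by
    rw [hΦ, hXh x hx, smul_smul]
  have hρd : Differentiable ℝ ρ := hρ.contDiff.differentiable (by simp)
  have hsd : Differentiable ℝ Φ.symm := hΦs.differentiable (by simp)
  have hD : ∀ x v, fderiv ℝ (ρ ∘ Φ.symm) (Φ x) v = fderiv ℝ ρ x (fderiv ℝ Φ.symm (Φ x) v) := by
    intro x v
    rw [fderiv_comp _ (hρd _) (hsd _)]
    simp
  have hinv : ∀ x v, fderiv ℝ Φ.symm (Φ x) v + t • fderiv ℝ X x (fderiv ℝ Φ.symm (Φ x) v) = v := by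
    intro x v
    have h1 : HasFDerivAt Φ (1 + t • fderiv ℝ X x) (Φ.symm (Φ x)) := by
      rw [Φ.symm_apply_apply]
      exact (hasFDerivAt_add_smul hX t x).congr_of_eventuallyEq (Eventually.of_forall hΦ)
    have h2 := h1.comp (Φ x) (hsd (Φ x)).hasFDerivAt
    have h3 : (Φ ∘ Φ.symm : 𝔼 → 𝔼) = id := by ext1 y; simp
    rw [h3] at h2
    have := congrArg (fun A : 𝔼 →L[ℝ] 𝔼 => A v) (h2.unique (hasFDerivAt_id _))
    simpa using this
  have hpos : ∀ x ∈ frontier E, 0 < fderiv ℝ (ρ ∘ Φ.symm) (Φ x) (outerNormal E x) := by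
    intro x hx
    have hdef := hρ.isDefiningFunction hx
    have hG : 0 < ‖gradient ρ x‖ := norm_pos_iff.2 hdef.gradient_ne_zero
    set ν := outerNormal E x
    have hν1 : ‖ν‖ = 1 := by
      change ‖outerNormal E x‖ = 1
      rw [hdef.outerNormal_eq]; exact norm_unitGradient hdef.gradient_ne_zero
    have hGν : gradient ρ x = ‖gradient ρ x‖ • ν := by
      change _ = _ • outerNormal E x
      rw [hdef.outerNormal_eq, unitGradient, smul_smul, mul_inv_cancel₀ hG.ne', one_smul]
    rw [hD]
    set w := fderiv ℝ Φ.symm (Φ x) ν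
    have hw : w + t • fderiv ℝ X x w = ν := hinv x ν
    have hw1 : ‖t • fderiv ℝ X x w‖ ≤ 1 / 4 * ‖w‖ := by
      rw [norm_smul, Real.norm_eq_abs]
      calc |t| * ‖fderiv ℝ X x w‖ ≤ |t| * (L * ‖w‖) := by
            gcongr; exact (fderiv ℝ X x).le_of_opNorm_le (hL x) w
        _ = |t| * L * ‖w‖ := by ring
        _ ≤ _ := by gcongr
    have hw2 : ‖w‖ ≤ 4 / 3 := by
      have : ‖w‖ ≤ ‖ν‖ + ‖t • fderiv ℝ X x w‖ := by
        rw [← hw]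
        calc ‖w‖ = ‖(w + t • fderiv ℝ X x w) - t • fderiv ℝ X x w‖ := by congr 1; abel
          _ ≤ _ := norm_sub_le _ _
      rw [hν1] at this
      linarith
    rw [← inner_gradient, hGν, inner_smul_left]
    refine mul_pos (by simpa using hG) ?_
    have e : w = ν - t • fderiv ℝ X x w := by rw [← hw]; abel
    rw [e, inner_sub_right, real_inner_self_eq_norm_sq, hν1]
    have := (abs_le.1 (abs_real_inner_le_norm ν (t • fderiv ℝ X x w))).2
    rw [hν1] at this
    linarith
  have hdef : ∀ x ∈ frontier E, IsDefiningFunction (Φ '' E) (Φ x) (ρ ∘ Φ.symm) := by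
    intro x hx
    refine ⟨hρ.contDiff.comp hΦs, ?_, fun h0 => ?_, Eventually.of_forall fun y => ?_⟩
    · simpa using (hρ.frontier_iff x).1 hx
    · have := hpos x hx
      rw [← inner_gradient, h0, inner_zero_left] at this
      exact lt_irrefl _ this
    · rw [Function.comp_apply, ← hρ.mem_iff]
      constructor
      · rintro ⟨z, hz, rfl⟩; simpa using hz
      · intro hy; exact ⟨_, hy, by simp⟩
  refine ⟨Φ.isOpenMap _ hE, fun p hp => ?_, ?_, fun x hx => ?_⟩
  · rw [hfr] at hp
    obtain ⟨x, hx, rfl⟩ := hp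
    exact ⟨_, hdef x hx⟩
  · rw [hfr]; exact image_congr himg
  · rw [← himg x hx, (hdef x hx).outerNormal_eq, unitGradient, inner_smul_left, inner_gradient]
    refine mul_pos ?_ (hpos x hx)
    simpa using (hdef x hx).gradient_ne_zero

/-! ### The divergence and integration by parts -/

/-- The trace of an endomorphism, as a continuous linear functional. -/
def traceL (N : ℕ) : (EuclideanSpace ℝ (Fin N) →L[ℝ] EuclideanSpace ℝ (Fin N)) →L[ℝ] ℝ :=
  LinearMap.toContinuousLinearMap
    ((LinearMap.trace ℝ (EuclideanSpace ℝ (Fin N))).comp (ContinuousLinearMap.coeLM ℝ))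

lemma traceL_apply (A : 𝔼 →L[ℝ] 𝔼) :
    traceL N A = LinearMap.trace ℝ 𝔼 (A : 𝔼 →ₗ[ℝ] 𝔼) := rfl

lemma traceL_smulRight (f : 𝔼 →L[ℝ] ℝ) (v : 𝔼) : traceL N (f.smulRight v) = f v := by
  rw [traceL_apply]
  exact LinearMap.trace_smulRight (f : 𝔼 →ₗ[ℝ] ℝ) v

lemma traceL_eq_sum (A : 𝔼 →L[ℝ] 𝔼) :
    traceL N A = ∑ i, inner ℝ (EuclideanSpace.basisFun (Fin N) ℝ i)
      (A (EuclideanSpace.basisFun (Fin N) ℝ i)) := by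
  rw [traceL_apply, LinearMap.trace_eq_sum_inner _ (EuclideanSpace.basisFun (Fin N) ℝ)]
  rfl

/-- The divergence of a vector field. -/
def divergence (Z : EuclideanSpace ℝ (Fin N) → EuclideanSpace ℝ (Fin N))
    (x : EuclideanSpace ℝ (Fin N)) : ℝ :=
  traceL N (fderiv ℝ Z x)

lemma contDiff_divergence {Z : 𝔼 → 𝔼} (hZ : ContDiff ℝ ∞ Z) : ContDiff ℝ ∞ (divergence Z) :=
  (traceL N).contDiff.comp (hZ.fderiv_right (by simp))

lemma HasCompactSupport.divergence {Z : 𝔼 → 𝔼} (hZ : HasCompactSupport Z) :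
    HasCompactSupport (divergence Z) :=
  (hZ.fderiv ℝ).comp_left (g := traceL N) (map_zero _)

lemma divergence_smul {f : 𝔼 → ℝ} {Z : 𝔼 → 𝔼} {x : 𝔼} (hf : DifferentiableAt ℝ f x)
    (hZ : DifferentiableAt ℝ Z x) :
    divergence (fun y => f y • Z y) x = fderiv ℝ f x (Z x) + f x * divergence Z x := by
  rw [divergence, fderiv_fun_smul hf hZ, map_add, map_smul, traceL_smulRight, add_comm]
  rfl

lemma divergence_smul_const {f : 𝔼 → ℝ} {x : 𝔼} (hf : DifferentiableAt ℝ f x) (v : 𝔼) :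
    divergence (fun y => f y • v) x = fderiv ℝ f x v := by
  rw [divergence_smul hf (differentiableAt_const v)]
  simp [divergence]

lemma divergence_add {Y Z : 𝔼 → 𝔼} {x : 𝔼} (hY : DifferentiableAt ℝ Y x)
    (hZ : DifferentiableAt ℝ Z x) :
    divergence (fun y => Y y + Z y) x = divergence Y x + divergence Z x := by
  rw [divergence, fderiv_fun_add hY hZ, map_add]
  rfl

lemma divergence_sub {Y Z : 𝔼 → 𝔼} {x : 𝔼} (hY : DifferentiableAt ℝ Y x)
    (hZ : DifferentiableAt ℝ Z x) :
    divergence (fun y => Y y - Z y) x = divergence Y x - divergence Z x := by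
  rw [divergence, fderiv_fun_sub hY hZ, map_sub]
  rfl

lemma integrable_divergence {Z : 𝔼 → 𝔼} (hZ : ContDiff ℝ ∞ Z) (hZc : HasCompactSupport Z) :
    Integrable (divergence Z) :=
  (contDiff_divergence hZ).continuous.integrable_of_hasCompactSupport
    (HasCompactSupport.divergence hZc)

lemma integral_fderiv_apply_eq_zero {f : 𝔼 → ℝ} (hf : ContDiff ℝ ∞ f) (hfc : HasCompactSupport f)
    (v : 𝔼) : ∫ x, fderiv ℝ f x v = 0 := by
  have hfd : Continuous fun x => fderiv ℝ f x v :=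
    (hf.continuous_fderiv (by simp)).clm_apply continuous_const
  have hfdc : HasCompactSupport fun x => fderiv ℝ f x v :=
    (hfc.fderiv ℝ).comp_left (g := fun A : 𝔼 →L[ℝ] ℝ => A v) (by simp)
  have := integral_mul_fderiv_eq_neg_fderiv_mul_of_integrable (μ := volume)
    (f := fun _ : 𝔼 => (1 : ℝ)) (g := f) (v := v) (by simp)
    (by simpa using hfd.integrable_of_hasCompactSupport hfdc)
    (by simpa using hf.continuous.integrable_of_hasCompactSupport hfc)
    (fun x _ => differentiableAt_const _) (fun x _ => hf.differentiable (by simp) x)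
  simpa using this

lemma integral_divergence_eq_zero {Z : 𝔼 → 𝔼} (hZ : ContDiff ℝ ∞ Z) (hZc : HasCompactSupport Z) :
    ∫ x, divergence Z x = 0 := by
  set b := EuclideanSpace.basisFun (Fin N) ℝ
  have h1 : ∀ i, ContDiff ℝ ∞ fun x => inner ℝ (b i) (Z x) := fun i => contDiff_const.inner ℝ hZ
  have h2 : ∀ i, HasCompactSupport fun x => inner ℝ (b i) (Z x) := fun i =>
    hZc.comp_left (g := fun z => inner ℝ (b i) z) (by simp)
  have h3 : ∀ x, divergence Z x = ∑ i, fderiv ℝ (fun x => inner ℝ (b i) (Z x)) x (b i) := by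
    intro x
    rw [divergence, traceL_eq_sum]
    refine Finset.sum_congr rfl fun i _ => ?_
    rw [fderiv_inner_apply ℝ (differentiableAt_const _) (hZ.differentiable (by simp) x)]
    simp [b]
  simp_rw [h3]
  rw [integral_finsetSum]
  · exact Finset.sum_eq_zero fun i _ => integral_fderiv_apply_eq_zero (h1 i) (h2 i) _
  · intro i _
    have hfd : Continuous fun x => fderiv ℝ (fun x => inner ℝ (b i) (Z x)) x (b i) :=
      ((h1 i).continuous_fderiv (by simp)).clm_apply continuous_const
    exact hfd.integrable_of_hasCompactSupport
      (((h2 i).fderiv ℝ).comp_left (g := fun A : 𝔼 →L[ℝ] ℝ => A (b i)) (by simp))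

lemma continuous_fderiv_apply {F : Type*} [NormedAddCommGroup F] [NormedSpace ℝ F] {u : 𝔼 → F}
    {Z : 𝔼 → 𝔼} (hu : ContDiff ℝ ∞ u) (hZ : Continuous Z) :
    Continuous fun x => fderiv ℝ u x (Z x) :=
  (hu.continuous_fderiv (by simp)).clm_apply hZ

lemma HasCompactSupport.fderiv_apply {F : Type*} [NormedAddCommGroup F] [NormedSpace ℝ F]
    {u : 𝔼 → F} {Z : 𝔼 → 𝔼} (hZ : HasCompactSupport Z) :
    HasCompactSupport fun x => fderiv ℝ u x (Z x) :=
  hZ.mono fun x hx => by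
    contrapose! hx
    simp only [Function.mem_support, not_not] at hx ⊢
    simp [hx]

lemma integral_mul_divergence {u : 𝔼 → ℝ} {Z : 𝔼 → 𝔼} (hu : ContDiff ℝ ∞ u)
    (hZ : ContDiff ℝ ∞ Z) (hZc : HasCompactSupport Z) :
    ∫ x, u x * divergence Z x = -∫ x, fderiv ℝ u x (Z x) := by
  have h := integral_divergence_eq_zero (hu.smul hZ)
    (hZc.smul_left (f := u))
  have h1 : ∀ x, divergence (fun y => u y • Z y) x =
      fderiv ℝ u x (Z x) + u x * divergence Z x := fun x =>
    divergence_smul (hu.differentiable (by simp) x) (hZ.differentiable (by simp) x)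
  have h' : ∫ x, (fderiv ℝ u x (Z x) + u x * divergence Z x) = 0 := by
    rw [← h]; exact integral_congr_ae (Eventually.of_forall fun x => (h1 x).symm)
  rw [integral_add] at h'
  · linarith
  · exact (continuous_fderiv_apply hu hZ.continuous).integrable_of_hasCompactSupport
      (HasCompactSupport.fderiv_apply hZc)
  · exact (hu.continuous.mul (contDiff_divergence hZ).continuous).integrable_of_hasCompactSupport
      (HasCompactSupport.divergence hZc).mul_left

/-! ### Thin layers around the boundary -/

lemma hasFDerivAt_arctan_div {ρ : 𝔼 → ℝ} (hρ : Differentiable ℝ ρ) {δ : ℝ} (hδ : 0 < δ) (x v : 𝔼) :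
    fderiv ℝ (fun y => Real.arctan (ρ y / δ)) x v = δ / (δ ^ 2 + ρ x ^ 2) * fderiv ℝ ρ x v := by
  have h1 : HasFDerivAt (fun y => ρ y / δ) (δ⁻¹ • fderiv ℝ ρ x) x := by
    simpa [div_eq_inv_mul] using (hρ x).hasFDerivAt.const_mul δ⁻¹
  rw [h1.arctan.fderiv]
  simp only [_root_.smul_apply, smul_eq_mul]
  field_simp

lemma exists_smooth_cutoff (R : ℝ) : ∃ η : 𝔼 → ℝ, ContDiff ℝ ∞ η ∧ HasCompactSupport η ∧
    (∀ x, 0 ≤ η x) ∧ (∀ x, η x ≤ 1) ∧ ∀ x ∈ Metric.closedBall (0 : 𝔼) R, η x = 1 := by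
  let f : ContDiffBump (0 : 𝔼) := ⟨max R 1, max R 1 + 1, by positivity, by linarith⟩
  refine ⟨f, f.contDiff, f.hasCompactSupport, fun x => f.nonneg, fun x => f.le_one, fun x hx => ?_⟩
  exact f.one_of_mem_closedBall (Metric.closedBall_subset_closedBall (le_max_left _ _) hx)

lemma poissonWeight_continuous {ρ : 𝔼 → ℝ} (hρ : Continuous ρ) {δ : ℝ} (hδ : 0 < δ) :
    Continuous fun x => δ / (δ ^ 2 + ρ x ^ 2) :=
  continuous_const.div (by fun_prop) fun x => by positivity

/-- The integrals of `δ / (δ² + ρ²)` over a ball are bounded uniformly in `δ`. -/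
lemma IsGlobalDefiningFunction.exists_integral_poisson_le {E : Set 𝔼} {ρ : 𝔼 → ℝ}
    (hρ : IsGlobalDefiningFunction E ρ) (R : ℝ) :
    ∃ C, 0 ≤ C ∧ ∀ δ, 0 < δ → δ ≤ 1 →
      ∫ x in Metric.closedBall (0 : 𝔼) R, δ / (δ ^ 2 + ρ x ^ 2) ≤ C := by
  set B := Metric.closedBall (0 : 𝔼) R
  have hB : IsCompact B := isCompact_closedBall _ _
  have hρc : Continuous ρ := hρ.contDiff.continuous
  have hρd : Differentiable ℝ ρ := hρ.contDiff.differentiable (by simp)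
  have hgc : Continuous (gradient ρ) := (contDiff_gradient hρ.contDiff).continuous
  obtain ⟨m, hm, hmB⟩ : ∃ m, 0 < m ∧ ∀ x ∈ B, m ≤ ‖gradient ρ x‖ ^ 2 + ρ x ^ 2 := by
    refine hB.exists_forall_le' (f := fun x => ‖gradient ρ x‖ ^ 2 + ρ x ^ 2) (by fun_prop)
      (a := 0) fun x _ => ?_
    by_cases h : ρ x = 0
    · have := norm_pos_iff.2 (hρ.gradient_ne_zero x ((hρ.frontier_iff x).2 h))
      positivity
    · positivity
  obtain ⟨η, hη, hηc, hη0, hη1, hηB⟩ := exists_smooth_cutoff (N := N) R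
  set Z : 𝔼 → 𝔼 := fun x => η x • gradient ρ x
  have hZ : ContDiff ℝ ∞ Z := hη.smul (contDiff_gradient hρ.contDiff)
  have hZc : HasCompactSupport Z := hηc.smul_right
  set D := ∫ x, |divergence Z x|
  have hD0 : 0 ≤ D := integral_nonneg fun x => abs_nonneg _
  refine ⟨m⁻¹ * (Real.pi / 2 * D + volume.real B), by positivity, fun δ hδ hδ1 => ?_⟩
  have hPc := poissonWeight_continuous hρc hδ
  have hP0 : ∀ x, 0 ≤ δ / (δ ^ 2 + ρ x ^ 2) := fun x => by positivity
  have hzz : ∀ x, fderiv ℝ ρ x (Z x) = η x * ‖gradient ρ x‖ ^ 2 := fun x => by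
    rw [← inner_gradient, inner_smul_right, real_inner_self_eq_norm_sq]
  have hcd : ContDiff ℝ ∞ fun y => Real.arctan (ρ y / δ) :=
    (hρ.contDiff.div_const δ).arctan
  have hI := integral_mul_divergence hcd hZ hZc
  simp_rw [hasFDerivAt_arctan_div hρd hδ, hzz] at hI
  have hcont : Continuous fun x => δ / (δ ^ 2 + ρ x ^ 2) * (η x * ‖gradient ρ x‖ ^ 2) :=
    hPc.mul (hη.continuous.mul (hgc.norm.pow 2))
  have hPint : Integrable fun x => δ / (δ ^ 2 + ρ x ^ 2) * (η x * ‖gradient ρ x‖ ^ 2) :=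
    hcont.integrable_of_hasCompactSupport (hηc.mul_right.mul_left)
  have hbound : ∫ x, δ / (δ ^ 2 + ρ x ^ 2) * (η x * ‖gradient ρ x‖ ^ 2) ≤ Real.pi / 2 * D := by
    rw [← neg_eq_iff_eq_neg] at hI
    rw [← hI, ← integral_const_mul, ← integral_neg]
    refine integral_mono ?_ ((integrable_divergence hZ hZc).abs.const_mul _) ?_
    · exact ((hcd.continuous.mul
        (contDiff_divergence hZ).continuous).integrable_of_hasCompactSupport
        (HasCompactSupport.divergence hZc).mul_left).neg
    · intro x
      simp only
      calc -(Real.arctan (ρ x / δ) * divergence Z x)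
          ≤ |Real.arctan (ρ x / δ) * divergence Z x| := neg_le_abs _
        _ = |Real.arctan (ρ x / δ)| * |divergence Z x| := abs_mul _ _
        _ ≤ _ := by
          gcongr
          exact abs_le.2 ⟨(Real.neg_pi_div_two_lt_arctan _).le, (Real.arctan_lt_pi_div_two _).le⟩
  have hset : ∫ x in B, δ / (δ ^ 2 + ρ x ^ 2) * (η x * ‖gradient ρ x‖ ^ 2) ≤ Real.pi / 2 * D :=
    (setIntegral_le_integral hPint (Eventually.of_forall fun x =>
      mul_nonneg (hP0 x) (mul_nonneg (hη0 x) (sq_nonneg _)))).trans hbound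
  calc ∫ x in B, δ / (δ ^ 2 + ρ x ^ 2)
      ≤ ∫ x in B, m⁻¹ * (δ / (δ ^ 2 + ρ x ^ 2) * (η x * ‖gradient ρ x‖ ^ 2) + 1) := by
        refine setIntegral_mono_on (hPc.continuousOn.integrableOn_compact hB) ?_ hB.measurableSet ?_
        · exact (continuous_const.mul
            (hcont.add continuous_const)).continuousOn.integrableOn_compact hB
        · intro x hx
          rw [hηB x hx, one_mul, ← div_eq_inv_mul, le_div_iff₀ hm]
          calc δ / (δ ^ 2 + ρ x ^ 2) * m
              ≤ δ / (δ ^ 2 + ρ x ^ 2) * (‖gradient ρ x‖ ^ 2 + ρ x ^ 2) :=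
                mul_le_mul_of_nonneg_left (hmB x hx) (hP0 x)
            _ = δ / (δ ^ 2 + ρ x ^ 2) * ‖gradient ρ x‖ ^ 2 +
                  δ * (ρ x ^ 2 / (δ ^ 2 + ρ x ^ 2)) := by ring
            _ ≤ δ / (δ ^ 2 + ρ x ^ 2) * ‖gradient ρ x‖ ^ 2 + 1 * 1 := by
                gcongr
                exact div_le_one_of_le₀ (by nlinarith) (by positivity)
            _ = _ := by ring
    _ = m⁻¹ * (∫ x in B, δ / (δ ^ 2 + ρ x ^ 2) * (η x * ‖gradient ρ x‖ ^ 2)) +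
          m⁻¹ * volume.real B := by
        rw [integral_const_mul, integral_add hPint.integrableOn
          (integrableOn_const hB.measure_lt_top.ne), mul_add]
        simp
    _ ≤ _ := by rw [mul_add]; gcongr

/-- The layer `{|ρ| ≤ δ}` has volume `O(δ)` in a ball. -/
lemma IsGlobalDefiningFunction.exists_volume_layer_le {E : Set 𝔼} {ρ : 𝔼 → ℝ}
    (hρ : IsGlobalDefiningFunction E ρ) (R : ℝ) :
    ∃ C, 0 ≤ C ∧ ∀ δ, 0 < δ → δ ≤ 1 →
      volume (Metric.closedBall (0 : 𝔼) R ∩ {x | |ρ x| ≤ δ}) ≤ ENNReal.ofReal (C * δ) := by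
  obtain ⟨C, hC0, hC⟩ := hρ.exists_integral_poisson_le R
  refine ⟨2 * C, by positivity, fun δ hδ hδ1 => ?_⟩
  set B := Metric.closedBall (0 : 𝔼) R
  have hB : IsCompact B := isCompact_closedBall _ _
  have hρc : Continuous ρ := hρ.contDiff.continuous
  have hPc := poissonWeight_continuous hρc hδ
  have hS : MeasurableSet (B ∩ {x | |ρ x| ≤ δ}) :=
    hB.measurableSet.inter (isClosed_le hρc.abs continuous_const).measurableSet
  have hlt : volume (B ∩ {x | |ρ x| ≤ δ}) ≠ ⊤ :=
    ((measure_mono inter_subset_left).trans_lt hB.measure_lt_top).ne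
  rw [← ENNReal.ofReal_toReal hlt]
  refine ENNReal.ofReal_le_ofReal ?_
  have hPint : IntegrableOn (fun x => δ / (δ ^ 2 + ρ x ^ 2)) B := hPc.continuousOn.integrableOn_compact hB
  have h1 : ∫ x in B ∩ {x | |ρ x| ≤ δ}, (2 * δ)⁻¹ ≤
      ∫ x in B ∩ {x | |ρ x| ≤ δ}, δ / (δ ^ 2 + ρ x ^ 2) := by
    refine setIntegral_mono_on ?_ (hPint.mono_set inter_subset_left) hS fun x hx => ?_
    · exact integrableOn_const hlt
    · have h2 : ρ x ^ 2 ≤ δ ^ 2 := sq_le_sq' (abs_le.1 hx.2).1 (abs_le.1 hx.2).2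
      rw [inv_eq_one_div, div_le_div_iff₀ (by positivity) (by positivity)]
      nlinarith
  have h2 : ∫ x in B ∩ {x | |ρ x| ≤ δ}, δ / (δ ^ 2 + ρ x ^ 2) ≤ C :=
    (setIntegral_mono_set hPint (Eventually.of_forall fun x => by
      simp only [Pi.zero_apply]; positivity)
      (LE.le.eventuallyLE inter_subset_left)).trans (hC δ hδ hδ1)
  have h3 := h1.trans h2
  simp only [integral_const, smul_eq_mul, MeasurableSet.univ, measureReal_restrict_apply,
    univ_inter] at h3
  rw [Measure.real] at h3
  have h4 : (2 * δ) * ((volume (B ∩ {x | |ρ x| ≤ δ})).toReal * (2 * δ)⁻¹) ≤ (2 * δ) * C :=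
    mul_le_mul_of_nonneg_left h3 (by positivity)
  calc (volume (B ∩ {x | |ρ x| ≤ δ})).toReal
      = (2 * δ) * ((volume (B ∩ {x | |ρ x| ≤ δ})).toReal * (2 * δ)⁻¹) := by field_simp
    _ ≤ _ := h4
    _ = 2 * C * δ := by ring

lemma IsGlobalDefiningFunction.volume_frontier {E : Set 𝔼} {ρ : 𝔼 → ℝ}
    (hρ : IsGlobalDefiningFunction E ρ) : volume (frontier E) = 0 := by
  have h1 : ∀ k : ℕ, volume (Metric.closedBall (0 : 𝔼) k ∩ frontier E) = 0 := by
    intro k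
    obtain ⟨C, hC0, hC⟩ := hρ.exists_volume_layer_le k
    have hle : ∀ δ : ℝ, 0 < δ → δ ≤ 1 →
        volume (Metric.closedBall (0 : 𝔼) k ∩ frontier E) ≤ ENNReal.ofReal (C * δ) := by
      intro δ hδ hδ1
      refine (measure_mono (inter_subset_inter_right _ fun x hx => ?_)).trans (hC δ hδ hδ1)
      simp [(hρ.frontier_iff x).1 hx, hδ.le]
    have hlim : Tendsto (fun δ : ℝ => ENNReal.ofReal (C * δ)) (𝓝[>] 0) (𝓝 0) := by
      have hc : Continuous fun δ : ℝ => ENNReal.ofReal (C * δ) :=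
        ENNReal.continuous_ofReal.comp (by fun_prop)
      simpa using (hc.tendsto 0).mono_left nhdsWithin_le_nhds
    refine le_antisymm (ge_of_tendsto hlim ?_) zero_le
    filter_upwards [Ioc_mem_nhdsGT (zero_lt_one (α := ℝ))] with δ hδ
    exact hle δ hδ.1 hδ.2
  have h2 : frontier E = ⋃ k : ℕ, Metric.closedBall (0 : 𝔼) k ∩ frontier E := by
    rw [← iUnion_inter, Metric.iUnion_closedBall_nat, univ_inter]
  rw [h2]
  exact measure_iUnion_null h1

/-- The divergence integral over `E` as a limit of integrals against Poisson weights. -/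
lemma IsGlobalDefiningFunction.tendsto_integral_poisson {E : Set 𝔼} {ρ : 𝔼 → ℝ} (hE : IsOpen E)
    (hρ : IsGlobalDefiningFunction E ρ) {Z : 𝔼 → 𝔼} (hZ : ContDiff ℝ ∞ Z)
    (hZc : HasCompactSupport Z) :
    Tendsto (fun δ : ℝ => Real.pi⁻¹ * ∫ x, δ / (δ ^ 2 + ρ x ^ 2) * fderiv ℝ ρ x (Z x)) (𝓝[>] 0)
      (𝓝 (∫ x in E, divergence Z x)) := by
  have hρd : Differentiable ℝ ρ := hρ.contDiff.differentiable (by simp)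
  set u : ℝ → 𝔼 → ℝ := fun δ x => 1 / 2 - Real.pi⁻¹ * Real.arctan (ρ x / δ) with hu
  have hus : ∀ δ, ContDiff ℝ ∞ (u δ) := fun δ =>
    contDiff_const.sub (contDiff_const.mul (hρ.contDiff.div_const δ).arctan)
  have hub : ∀ δ x, |u δ x| ≤ 1 := fun δ x => by
    have h1 := Real.neg_pi_div_two_lt_arctan (ρ x / δ)
    have h2 := Real.arctan_lt_pi_div_two (ρ x / δ)
    have hp := Real.pi_pos
    have e : u δ x = 1 / 2 - Real.arctan (ρ x / δ) / Real.pi := by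
      simp only [hu]; rw [div_eq_inv_mul (Real.arctan _)]
    have h3 : Real.arctan (ρ x / δ) / Real.pi ≤ 1 / 2 := by
      rw [div_le_iff₀ hp]; linarith
    have h4 : -(1 / 2) ≤ Real.arctan (ρ x / δ) / Real.pi := by
      rw [le_div_iff₀ hp]; linarith
    rw [e, abs_le]
    constructor <;> linarith
  have h1 : ∀ δ, 0 < δ → ∫ x, u δ x * divergence Z x =
      Real.pi⁻¹ * ∫ x, δ / (δ ^ 2 + ρ x ^ 2) * fderiv ℝ ρ x (Z x) := by
    intro δ hδ
    rw [integral_mul_divergence (hus δ) hZ hZc, ← integral_const_mul, ← integral_neg]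
    refine integral_congr_ae (Eventually.of_forall fun x => ?_)
    have hda : DifferentiableAt ℝ (fun y => Real.arctan (ρ y / δ)) x :=
      ((hρ.contDiff.div_const δ).arctan.differentiable (by simp)) x
    simp only [hu]
    rw [fderiv_const_sub, fderiv_const_mul hda]
    simp only [_root_.neg_apply, _root_.smul_apply, smul_eq_mul,
      hasFDerivAt_arctan_div hρd hδ, neg_neg]
  have hlim : Tendsto (fun δ => ∫ x, u δ x * divergence Z x) (𝓝[>] 0)
      (𝓝 (∫ x, E.indicator (divergence Z) x)) := by
    refine tendsto_integral_filter_of_dominated_convergence (fun x => |divergence Z x|)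
      (Eventually.of_forall fun δ => ((hus δ).continuous.mul
        (contDiff_divergence hZ).continuous).aestronglyMeasurable)
      (Eventually.of_forall fun δ => Eventually.of_forall fun x => ?_)
      (integrable_divergence hZ hZc).abs ?_
    · rw [norm_mul, Real.norm_eq_abs, Real.norm_eq_abs]
      exact mul_le_of_le_one_left (abs_nonneg _) (hub δ x)
    · have hnull : ∀ᵐ x : 𝔼, x ∉ frontier E := measure_eq_zero_iff_ae_notMem.1 hρ.volume_frontier
      filter_upwards [hnull] with x hx
      have hx0 : ρ x ≠ 0 := fun h => hx ((hρ.frontier_iff x).2 h)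
      have hp := Real.pi_pos
      rcases lt_or_gt_of_ne hx0 with h | h
      · have hxE : x ∈ E := (hρ.mem_iff x).2 h
        rw [indicator_of_mem hxE]
        have : Tendsto (fun δ : ℝ => ρ x / δ) (𝓝[>] 0) atBot := by
          simp_rw [div_eq_mul_inv]
          exact tendsto_inv_nhdsGT_zero.const_mul_atTop_of_neg h
        have h2 := ((Real.tendsto_arctan_atBot.mono_right nhdsWithin_le_nhds).comp this)
        have h3 : Tendsto (fun δ => u δ x) (𝓝[>] 0) (𝓝 (1 / 2 - Real.pi⁻¹ * -(Real.pi / 2))) :=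
          tendsto_const_nhds.sub (h2.const_mul _)
        have e : 1 / 2 - Real.pi⁻¹ * -(Real.pi / 2) = 1 := by field_simp; norm_num
        rw [e] at h3
        simpa using h3.mul_const (divergence Z x)
      · have hxE : x ∉ E := fun hxE => absurd ((hρ.mem_iff x).1 hxE) (not_lt.2 h.le)
        rw [indicator_of_notMem hxE]
        have : Tendsto (fun δ : ℝ => ρ x / δ) (𝓝[>] 0) atTop := by
          simp_rw [div_eq_mul_inv]
          exact tendsto_inv_nhdsGT_zero.const_mul_atTop h
        have h2 := ((Real.tendsto_arctan_atTop.mono_right nhdsWithin_le_nhds).comp this)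
        have h3 : Tendsto (fun δ => u δ x) (𝓝[>] 0) (𝓝 (1 / 2 - Real.pi⁻¹ * (Real.pi / 2))) :=
          tendsto_const_nhds.sub (h2.const_mul _)
        have e : 1 / 2 - Real.pi⁻¹ * (Real.pi / 2) = 0 := by field_simp; norm_num
        rw [e] at h3
        simpa using h3.mul_const (divergence Z x)
  rw [integral_indicator hE.measurableSet] at hlim
  refine hlim.congr' ?_
  filter_upwards [self_mem_nhdsWithin] with δ hδ
  exact h1 δ hδ

/-- A field pointing outwards along the boundary has nonnegative total divergence. -/
lemma IsGlobalDefiningFunction.setIntegral_divergence_nonneg {E : Set 𝔼} {ρ : 𝔼 → ℝ}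
    (hE : IsOpen E) (hρ : IsGlobalDefiningFunction E ρ) {Z : 𝔼 → 𝔼} (hZ : ContDiff ℝ ∞ Z)
    (hZc : HasCompactSupport Z) (h0 : ∀ x ∈ frontier E, 0 ≤ fderiv ℝ ρ x (Z x)) :
    0 ≤ ∫ x in E, divergence Z x := by
  have hlim := hρ.tendsto_integral_poisson hE hZ hZc
  set v : 𝔼 → ℝ := fun x => fderiv ℝ ρ x (Z x)
  have hvc : Continuous v := continuous_fderiv_apply hρ.contDiff hZ.continuous
  have hvs : HasCompactSupport v := HasCompactSupport.fderiv_apply hZc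
  have hρc : Continuous ρ := hρ.contDiff.continuous
  obtain ⟨R, hR⟩ := (hvs.isCompact.isBounded).subset_closedBall (0 : 𝔼)
  obtain ⟨C, hC0, hC⟩ := hρ.exists_integral_poisson_le R
  set B := Metric.closedBall (0 : 𝔼) R
  have hB : IsCompact B := isCompact_closedBall _ _
  have key : ∀ ε, 0 < ε → -(Real.pi⁻¹ * (ε * C)) ≤ ∫ x in E, divergence Z x := by
    intro ε hε
    obtain ⟨M, hM0, hM⟩ : ∃ M, 0 ≤ M ∧ ∀ x ∈ B, -ε - M * ρ x ^ 2 ≤ v x := by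
      have hT : IsCompact (B ∩ {x | v x ≤ -ε}) :=
        hB.inter_right (isClosed_le hvc continuous_const)
      obtain ⟨m, hm, hmT⟩ : ∃ m, 0 < m ∧ ∀ x ∈ B ∩ {x | v x ≤ -ε}, m ≤ ρ x ^ 2 := by
        refine hT.exists_forall_le' (f := fun x => ρ x ^ 2) (by fun_prop) (a := 0) fun x hx => ?_
        have : ρ x ≠ 0 := fun h => by
          have := h0 x ((hρ.frontier_iff x).2 h)
          have hx2 : v x ≤ -ε := hx.2
          change 0 ≤ v x at this
          linarith
        positivity
      obtain ⟨b, hb⟩ := hvs.exists_bound_of_continuous hvc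
      have hb0 : 0 ≤ b := (norm_nonneg _).trans (hb 0)
      refine ⟨b / m, by positivity, fun x hx => ?_⟩
      by_cases hxv : v x ≤ -ε
      · have h1 := hmT x ⟨hx, hxv⟩
        have h2 : b ≤ b / m * ρ x ^ 2 := by
          rw [div_mul_eq_mul_div, le_div_iff₀ hm]; gcongr
        have h3 := (abs_le.1 (hb x)).1
        linarith
      · push Not at hxv
        have : 0 ≤ b / m * ρ x ^ 2 := by positivity
        linarith
    have hbound : ∀ δ, 0 < δ → δ ≤ 1 →
        -(Real.pi⁻¹ * (ε * C + M * δ * volume.real B)) ≤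
          Real.pi⁻¹ * ∫ x, δ / (δ ^ 2 + ρ x ^ 2) * v x := by
      intro δ hδ hδ1
      have hPc := poissonWeight_continuous hρc hδ
      have hPi : IntegrableOn (fun x => δ / (δ ^ 2 + ρ x ^ 2)) B :=
        hPc.continuousOn.integrableOn_compact hB
      rw [← mul_neg]
      refine mul_le_mul_of_nonneg_left ?_ (inv_nonneg.2 Real.pi_pos.le)
      have e : ∫ x, δ / (δ ^ 2 + ρ x ^ 2) * v x = ∫ x in B, δ / (δ ^ 2 + ρ x ^ 2) * v x := by
        refine (setIntegral_eq_integral_of_forall_compl_eq_zero fun x hx => ?_).symm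
        rw [image_eq_zero_of_notMem_tsupport fun h => hx (hR h), mul_zero]
      rw [e]
      calc -(ε * C + M * δ * volume.real B)
          ≤ -(ε * (∫ x in B, δ / (δ ^ 2 + ρ x ^ 2)) + M * δ * volume.real B) := by
            gcongr; exact hC δ hδ hδ1
        _ = ∫ x in B, (-ε * (δ / (δ ^ 2 + ρ x ^ 2)) + -(M * δ)) := by
            rw [integral_add (hPi.const_mul _) (integrableOn_const hB.measure_lt_top.ne),
              integral_const_mul]
            simp; ring
        _ ≤ _ := by
            refine setIntegral_mono_on ((hPi.const_mul _).add
              (integrableOn_const hB.measure_lt_top.ne))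
              ((hPc.mul hvc).continuousOn.integrableOn_compact hB) hB.measurableSet fun x hx => ?_
            have h1 := hM x hx
            have hP0 : 0 ≤ δ / (δ ^ 2 + ρ x ^ 2) := by positivity
            have h2 : δ / (δ ^ 2 + ρ x ^ 2) * ρ x ^ 2 ≤ δ := by
              rw [div_mul_eq_mul_div, div_le_iff₀ (by positivity)]
              nlinarith [mul_nonneg hδ.le (sq_nonneg δ)]
            have h3 := mul_le_mul_of_nonneg_left h1 hP0
            have h4 := mul_le_mul_of_nonneg_left h2 hM0
            nlinarith
    have hleft : Tendsto (fun δ : ℝ => -(Real.pi⁻¹ * (ε * C + M * δ * volume.real B))) (𝓝[>] 0)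
        (𝓝 (-(Real.pi⁻¹ * (ε * C)))) := by
      have hc : Continuous fun δ : ℝ => -(Real.pi⁻¹ * (ε * C + M * δ * volume.real B)) := by
        fun_prop
      simpa using (hc.tendsto 0).mono_left nhdsWithin_le_nhds
    refine le_of_tendsto_of_tendsto hleft hlim ?_
    filter_upwards [Ioc_mem_nhdsGT (zero_lt_one (α := ℝ))] with δ hδ
    exact hbound δ hδ.1 hδ.2
  have hlim2 : Tendsto (fun ε : ℝ => -(Real.pi⁻¹ * (ε * C))) (𝓝[>] 0) (𝓝 0) := by
    have hc : Continuous fun ε : ℝ => -(Real.pi⁻¹ * (ε * C)) := by fun_prop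
    simpa using (hc.tendsto 0).mono_left nhdsWithin_le_nhds
  refine le_of_tendsto hlim2 ?_
  filter_upwards [self_mem_nhdsWithin] with ε hε
  exact key ε hε

/-- The total divergence over `E` is monotone in the normal component on the boundary. -/
lemma IsGlobalDefiningFunction.setIntegral_divergence_mono {E : Set 𝔼} {ρ : 𝔼 → ℝ}
    (hE : IsOpen E) (hρ : IsGlobalDefiningFunction E ρ) {Y Z : 𝔼 → 𝔼} (hY : ContDiff ℝ ∞ Y)
    (hYc : HasCompactSupport Y) (hZ : ContDiff ℝ ∞ Z) (hZc : HasCompactSupport Z)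
    (h0 : ∀ x ∈ frontier E, inner ℝ (Y x) (outerNormal E x) ≤ inner ℝ (Z x) (outerNormal E x)) :
    ∫ x in E, divergence Y x ≤ ∫ x in E, divergence Z x := by
  have h := hρ.setIntegral_divergence_nonneg hE (hZ.sub hY) (hZc.sub hYc) fun x hx => by
    have hd := hρ.isDefiningFunction hx
    have hG : 0 < ‖gradient ρ x‖ := norm_pos_iff.2 hd.gradient_ne_zero
    have h1 := h0 x hx
    rw [hd.outerNormal_eq, unitGradient, inner_smul_right, inner_smul_right,
      mul_le_mul_iff_right₀ (inv_pos.2 hG)] at h1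
    rw [← inner_gradient, inner_sub_right, real_inner_comm, real_inner_comm (Y x)]
    linarith
  have e : ∀ x, divergence (fun x => Z x - Y x) x = divergence Z x - divergence Y x := fun x =>
    divergence_sub (hZ.differentiable (by simp) x) (hY.differentiable (by simp) x)
  simp_rw [e] at h
  rw [integral_sub (integrable_divergence hZ hZc).integrableOn
    (integrable_divergence hY hYc).integrableOn] at h
  linarith

/-! ### Orthogonal coordinates and the boundary as a Lipschitz graph -/

lemma exists_orthogonal_coordinates {m : ℕ} {n : EuclideanSpace ℝ (Fin (m + 1))} (hn : ‖n‖ = 1) :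
    ∃ (ι : EuclideanSpace ℝ (Fin m) →ₗᵢ[ℝ] EuclideanSpace ℝ (Fin (m + 1)))
      (π : EuclideanSpace ℝ (Fin (m + 1)) →L[ℝ] EuclideanSpace ℝ (Fin m)),
      (∀ x, ι (π x) + (inner ℝ n x : ℝ) • n = x) ∧ (∀ y, ∀ t : ℝ, π (ι y + t • n) = y) ∧
      (∀ x, ‖x‖ ^ 2 = ‖π x‖ ^ 2 + (inner ℝ n x : ℝ) ^ 2) ∧
      MeasurePreserving (fun q : EuclideanSpace ℝ (Fin m) × ℝ => ι q.1 + q.2 • n) := by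
  have hn0 : n ≠ 0 := fun h => by simp [h] at hn
  haveI : Fact (Module.finrank ℝ (EuclideanSpace ℝ (Fin (m + 1))) = m + 1) := ⟨by simp⟩
  have hfr : Module.finrank ℝ (Submodule.span ℝ {n})ᗮ = m :=
    Submodule.finrank_orthogonal_span_singleton hn0
  let iso := ((stdOrthonormalBasis ℝ (Submodule.span ℝ {n})ᗮ).reindex (finCongr hfr)).repr
  let ι : EuclideanSpace ℝ (Fin m) →ₗᵢ[ℝ] EuclideanSpace ℝ (Fin (m + 1)) :=
    (Submodule.span ℝ {n})ᗮ.subtypeₗᵢ.comp iso.symm.toLinearIsometry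
  have hι : ∀ y, inner ℝ n (ι y) = (0 : ℝ) := fun y =>
    Submodule.mem_orthogonal_singleton_iff_inner_right.1 (iso.symm y).2
  let Ψ : WithLp 2 (EuclideanSpace ℝ (Fin m) × ℝ) →ₗᵢ[ℝ] EuclideanSpace ℝ (Fin (m + 1)) :=
    { toFun := fun q => ι q.fst + q.snd • n
      map_add' := fun q q' => by simp [add_smul]; abel
      map_smul' := fun c q => by simp [smul_smul]
      norm_map' := fun q => by
        have h1 : ‖ι q.fst + q.snd • n‖ ^ 2 = ‖q‖ ^ 2 := by
          rw [norm_add_sq_real, inner_smul_right, real_inner_comm, hι, WithLp.prod_norm_sq_eq_of_L2,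
            ι.norm_map, norm_smul, hn]
          simp
        exact (pow_left_inj₀ (norm_nonneg _) (norm_nonneg _) two_ne_zero).1 h1 }
  have hΨfr : Module.finrank ℝ (WithLp 2 (EuclideanSpace ℝ (Fin m) × ℝ)) =
      Module.finrank ℝ (EuclideanSpace ℝ (Fin (m + 1))) := by
    rw [LinearEquiv.finrank_eq (WithLp.linearEquiv 2 ℝ (EuclideanSpace ℝ (Fin m) × ℝ))]
    simp
  let e := Ψ.toLinearIsometryEquiv hΨfr
  have he : ∀ q, e q = ι q.fst + q.snd • n := fun q => rfl
  let π := ContinuousLinearMap.adjoint ι.toContinuousLinearMap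
  have hπ : ∀ y, ∀ t : ℝ, π (ι y + t • n) = y := fun y t => by
    refine ext_inner_right ℝ fun z => ?_
    rw [ContinuousLinearMap.adjoint_inner_left]
    simp only [LinearIsometry.coe_toContinuousLinearMap]
    rw [inner_add_left, inner_smul_left, hι, ι.inner_map_map]
    simp
  have hn2 : ∀ y, ∀ t : ℝ, inner ℝ n (ι y + t • n) = (t : ℝ) := fun y t => by
    rw [inner_add_right, hι, inner_smul_right, real_inner_self_eq_norm_sq, hn]; simp
  have hdec : ∀ x, ∃ y, ∃ t : ℝ, x = ι y + t • n := fun x =>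
    ⟨(e.symm x).fst, (e.symm x).snd, by rw [← he, e.apply_symm_apply]⟩
  refine ⟨ι, π, fun x => ?_, hπ, fun x => ?_, ?_⟩
  · obtain ⟨y, t, rfl⟩ := hdec x
    rw [hπ, hn2]
  · obtain ⟨y, t, rfl⟩ := hdec x
    rw [hπ, hn2, norm_add_sq_real, inner_smul_right, real_inner_comm, hι, ι.norm_map, norm_smul, hn]
    simp
  · exact e.measurePreserving.comp
      (WithLp.volume_preserving_toLp (EuclideanSpace ℝ (Fin m)) ℝ)

lemma euclideanHausdorffMeasure_image_le {X Y : Type*} [MetricSpace X] [MeasurableSpace X]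
    [BorelSpace X] [MetricSpace Y] [MeasurableSpace Y] [BorelSpace Y] {f : X → Y} {s : Set X}
    {K : NNReal} (hf : LipschitzOnWith K f s) (d : ℕ) :
    Measure.euclideanHausdorffMeasure d (f '' s) ≤
      (K : ℝ≥0∞) ^ d * Measure.euclideanHausdorffMeasure d s := by
  rw [Measure.euclideanHausdorffMeasure_def, Measure.euclideanHausdorffMeasure_def,
    Measure.smul_apply, Measure.smul_apply]
  have := hf.hausdorffMeasure_image_le (d := d) (by positivity)
  rw [ENNReal.rpow_natCast] at this
  simp only [ENNReal.smul_def, smul_eq_mul]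
  calc _ ≤ _ := mul_le_mul_right this _
    _ = _ := by ring

/-- The integral of a derivative over a sublevel set of a function that is increasing on the
support. -/
lemma integral_indicator_deriv {a b : ℝ → ℝ} (ha : ContDiff ℝ ∞ a) (hac : HasCompactSupport a)
    {I : Set ℝ} (hI : I.OrdConnected) (haI : tsupport a ⊆ I) (hbc : Continuous b)
    (hb : StrictMonoOn b I) :
    (∀ t₀ ∈ I, b t₀ = 0 → ∫ t, {t | b t < 0}.indicator (deriv a) t = a t₀) ∧
    ((∀ t ∈ I, b t ≠ 0) → ∫ t, {t | b t < 0}.indicator (deriv a) t = 0) := by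
  have hz : ∀ t, t ∉ I → deriv a t = 0 := fun t ht =>
    image_eq_zero_of_notMem_tsupport fun h => ht (haI (tsupport_deriv_subset h))
  have hderiv : ∫ t, deriv a t = 0 := by
    have hd : Continuous (deriv a) := ha.continuous_deriv (by simp)
    exact integral_eq_zero_of_hasDerivAt_of_integrable
      (fun t => (ha.differentiable (by simp) t).hasDerivAt)
      (hd.integrable_of_hasCompactSupport hac.deriv)
      (ha.continuous.integrable_of_hasCompactSupport hac)
  constructor
  · intro t₀ ht₀ hbt₀
    have e : {t | b t < 0}.indicator (deriv a) = (Iio t₀).indicator (deriv a) := by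
      ext t
      by_cases htI : t ∈ I
      · have : b t < 0 ↔ t < t₀ := by rw [← hbt₀]; exact hb.lt_iff_lt htI ht₀
        by_cases h : t < t₀
        · rw [indicator_of_mem (show t ∈ {t | b t < 0} from this.2 h),
            indicator_of_mem (show t ∈ Iio t₀ from h)]
        · rw [indicator_of_notMem (show t ∉ {t | b t < 0} from fun h' => h (this.1 h')),
            indicator_of_notMem (show t ∉ Iio t₀ from h)]
      · simp [indicator, hz t htI]
    rw [e, integral_indicator measurableSet_Iio, ← integral_Iic_eq_integral_Iio]
    exact hac.integral_Iic_deriv_eq (ha.of_le (by simp)) t₀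
  · intro hne
    by_cases hneg : ∃ t ∈ I, b t < 0
    · obtain ⟨t₁, ht₁, hbt₁⟩ := hneg
      have hall : ∀ t ∈ I, b t < 0 := by
        intro t ht
        by_contra hcon
        push Not at hcon
        obtain ⟨t', ht', hbt'⟩ := (hI.isPreconnected).intermediate_value ht₁ ht hbc.continuousOn
          ⟨hbt₁.le, hcon⟩
        exact hne t' ht' hbt'
      have e : {t | b t < 0}.indicator (deriv a) = deriv a := by
        ext t
        by_cases htI : t ∈ I
        · exact indicator_of_mem (show t ∈ {t | b t < 0} from hall t htI) _
        · simp [indicator, hz t htI]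
      rw [e, hderiv]
    · push Not at hneg
      have : {t | b t < 0}.indicator (deriv a) = 0 := by
        ext t
        by_cases htI : t ∈ I
        · exact indicator_of_notMem (show t ∉ {t | b t < 0} from not_lt.2 (hneg t htI)) _
        · simp [indicator, hz t htI]
      rw [this]; simp

/-- Near a boundary point, the gradient of the defining function is almost constant. -/
lemma IsGlobalDefiningFunction.exists_ball_gradient {E : Set 𝔼} {ρ : 𝔼 → ℝ}
    (hρ : IsGlobalDefiningFunction E ρ) {q : 𝔼} (hq : q ∈ frontier E) {ε : ℝ} (hε : 0 < ε) :
    ∃ r, 0 < r ∧ ∀ x ∈ Metric.ball q r,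
      ‖gradient ρ x - gradient ρ q‖ ≤ ε * ‖gradient ρ q‖ := by
  have hG : 0 < ‖gradient ρ q‖ := norm_pos_iff.2 (hρ.gradient_ne_zero q hq)
  have hgc : Continuous (gradient ρ) := (contDiff_gradient hρ.contDiff).continuous
  obtain ⟨r, hr, h⟩ := Metric.continuousAt_iff.1 (hgc.continuousAt (x := q)) (ε * ‖gradient ρ q‖)
    (by positivity)
  refine ⟨r, hr, fun x hx => ?_⟩
  have := h hx
  rw [dist_eq_norm] at this
  exact this.le

lemma gradient_eq_smul_outerNormal {E : Set 𝔼} {ρ : 𝔼 → ℝ} {q : 𝔼}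
    (hρ : IsDefiningFunction E q ρ) : gradient ρ q = ‖gradient ρ q‖ • outerNormal E q := by
  have hG : 0 < ‖gradient ρ q‖ := norm_pos_iff.2 hρ.gradient_ne_zero
  rw [hρ.outerNormal_eq, unitGradient, smul_smul, mul_inv_cancel₀ hG.ne', one_smul]

lemma IsDefiningFunction.norm_outerNormal {E : Set 𝔼} {ρ : 𝔼 → ℝ} {q : 𝔼}
    (hρ : IsDefiningFunction E q ρ) : ‖outerNormal E q‖ = 1 := by
  rw [hρ.outerNormal_eq]; exact norm_unitGradient hρ.gradient_ne_zero

lemma abs_sub_sub_inner_le {ρ : 𝔼 → ℝ} (hρ : Differentiable ℝ ρ) {q : 𝔼} {r c : ℝ} {G : 𝔼}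
    (h : ∀ x ∈ Metric.ball q r, ‖gradient ρ x - G‖ ≤ c) {x y : 𝔼}
    (hx : x ∈ Metric.ball q r) (hy : y ∈ Metric.ball q r) :
    |ρ x - ρ y - inner ℝ G (x - y)| ≤ c * ‖x - y‖ := by
  have := Convex.norm_image_sub_le_of_norm_hasFDerivWithin_le
    (f := fun x => ρ x - inner ℝ G x) (f' := fun x => fderiv ℝ ρ x - innerSL ℝ G) (C := c)
    (s := Metric.ball q r)
    (fun z _ => ((hρ z).hasFDerivAt.sub (innerSL ℝ G).hasFDerivAt).hasFDerivWithinAt)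
    (fun z hz => by
      refine ContinuousLinearMap.opNorm_le_bound _ ((norm_nonneg _).trans (h z hz)) fun v => ?_
      rw [_root_.sub_apply, ← inner_gradient, innerSL_apply_apply, ← inner_sub_left]
      exact (norm_inner_le_norm _ _).trans (by gcongr; exact h z hz))
    (convex_ball q r) hy hx
  rw [Real.norm_eq_abs] at this
  rw [inner_sub_right]
  convert this using 2
  ring

/-- Local comparison of the surface measure with the distributional normal derivative. -/
lemma IsGlobalDefiningFunction.exists_ball_comparison {m : ℕ}
    {E : Set (EuclideanSpace ℝ (Fin (m + 1)))} (hE : IsOpen E)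
    {ρ : EuclideanSpace ℝ (Fin (m + 1)) → ℝ} (hρ : IsGlobalDefiningFunction E ρ)
    {q : EuclideanSpace ℝ (Fin (m + 1))} (hq : q ∈ frontier E) {ε : ℝ} (hε : 0 < ε) (hε1 : ε < 1) :
    ∃ r, 0 < r ∧ (∀ x ∈ Metric.ball q r ∩ frontier E,
        1 - ε ≤ inner ℝ (outerNormal E q) (outerNormal E x)) ∧
      surfaceMeasure E (Metric.ball q r) < ⊤ ∧
      ∀ f : EuclideanSpace ℝ (Fin (m + 1)) → ℝ, ContDiff ℝ ∞ f → HasCompactSupport f →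
        tsupport f ⊆ Metric.ball q r → (∀ x, 0 ≤ f x) →
        ENNReal.ofReal (∫ x in E, fderiv ℝ f x (outerNormal E q)) ≤
          ∫⁻ x, ENNReal.ofReal (f x) ∂(surfaceMeasure E) ∧
        ∫⁻ x, ENNReal.ofReal (f x) ∂(surfaceMeasure E) ≤ ENNReal.ofReal ((1 + ε) ^ m) *
          ENNReal.ofReal (∫ x in E, fderiv ℝ f x (outerNormal E q)) := by
  have hdef := hρ.isDefiningFunction hq
  have hG : 0 < ‖gradient ρ q‖ := norm_pos_iff.2 hdef.gradient_ne_zero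
  have hρd : Differentiable ℝ ρ := hρ.contDiff.differentiable (by simp)
  have hρc : Continuous ρ := hρ.contDiff.continuous
  set n := outerNormal E q with hndef
  have hn : ‖n‖ = 1 := hdef.norm_outerNormal
  have hGn : gradient ρ q = ‖gradient ρ q‖ • n := gradient_eq_smul_outerNormal hdef
  set g := ‖gradient ρ q‖ with hgdef
  obtain ⟨r, hr, hball⟩ := hρ.exists_ball_gradient hq (half_pos hε)
  set B := Metric.ball q r with hBdef
  have hinc : ∀ x ∈ B, 0 < inner ℝ (gradient ρ x) n := fun x hx => by
    have h1 := hball x hx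
    have h2 : inner ℝ (gradient ρ x) n = g + inner ℝ (gradient ρ x - gradient ρ q) n := by
      rw [inner_sub_left, hGn, inner_smul_left, real_inner_self_eq_norm_sq, hn]; simp
    have h3 := (abs_le.1 (abs_real_inner_le_norm (gradient ρ x - gradient ρ q) n)).1
    rw [hn, mul_one] at h3
    rw [h2]
    nlinarith
  obtain ⟨ι, π, hdec, hπ, hnorm, hmp⟩ := exists_orthogonal_coordinates hn
  have hπn : ∀ x, ‖π x‖ ≤ ‖x‖ := fun x => by
    refine le_of_sq_le_sq ?_ (norm_nonneg _)
    rw [hnorm x]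
    nlinarith [sq_nonneg (inner ℝ n x : ℝ)]
  set S := B ∩ frontier E with hS
  have hSm : MeasurableSet S := Metric.isOpen_ball.measurableSet.inter isClosed_frontier.measurableSet
  -- the projection to the tangent plane is bi-Lipschitz on `S`
  have hlip : ∀ x ∈ S, ∀ y ∈ S, ‖x - y‖ ≤ (1 + ε) * ‖π x - π y‖ := fun x hx y hy => by
    have h1 := abs_sub_sub_inner_le hρd hball hx.1 hy.1
    have hi : inner ℝ (gradient ρ q) (x - y) = g * inner ℝ n (x - y) := by
      conv_lhs => rw [hGn]
      rw [inner_smul_left, conj_trivial]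
    rw [(hρ.frontier_iff x).1 hx.2, (hρ.frontier_iff y).1 hy.2, hi, sub_zero,
      zero_sub, abs_neg, abs_mul, abs_of_pos hG] at h1
    have h2 : |inner ℝ n (x - y)| ≤ ε / 2 * ‖x - y‖ := by
      refine le_of_mul_le_mul_left ?_ hG
      linarith
    have h3 := hnorm (x - y)
    rw [map_sub] at h3
    have h4 : (inner ℝ n (x - y) : ℝ) ^ 2 ≤ (ε / 2 * ‖x - y‖) ^ 2 := by
      rw [← sq_abs]; gcongr
    refine le_of_sq_le_sq ?_ (by positivity)
    set a := ‖x - y‖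
    set b := ‖π x - π y‖
    have h5 : a ^ 2 * (1 - ε ^ 2 / 4) ≤ b ^ 2 := by nlinarith
    have h6 : 1 ≤ (1 + ε) ^ 2 * (1 - ε ^ 2 / 4) := by
      have : 0 < ε ^ 2 := by positivity
      have h7 : ε ^ 3 ≤ ε := by nlinarith
      have h8 : ε ^ 4 ≤ ε := by nlinarith
      nlinarith
    calc a ^ 2 ≤ a ^ 2 * ((1 + ε) ^ 2 * (1 - ε ^ 2 / 4)) := le_mul_of_one_le_right (sq_nonneg _) h6
      _ = (1 + ε) ^ 2 * (a ^ 2 * (1 - ε ^ 2 / 4)) := by ring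
      _ ≤ (1 + ε) ^ 2 * b ^ 2 := by gcongr
      _ = _ := by ring
  have hinj : InjOn π S := fun x hx y hy hxy => by
    have := hlip x hx y hy
    rw [hxy, sub_self, norm_zero, mul_zero] at this
    exact sub_eq_zero.1 (norm_le_zero_iff.1 this)
  set A := π '' S with hA
  have hAm : MeasurableSet A := hSm.image_of_continuousOn_injOn π.continuous.continuousOn hinj
  set γ := Function.invFunOn π S
  have hγ : ∀ x ∈ S, γ (π x) = x := fun x hx =>
    hinj.leftInvOn_invFunOn hx
  have hγlip : LipschitzOnWith (1 + ε).toNNReal γ A := by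
    refine LipschitzOnWith.of_dist_le_mul ?_
    rintro _ ⟨x, hx, rfl⟩ _ ⟨y, hy, rfl⟩
    rw [hγ x hx, hγ y hy, dist_eq_norm, dist_eq_norm, Real.coe_toNNReal _ (by positivity)]
    exact hlip x hx y hy
  have hπlip : LipschitzWith 1 π := by
    refine LipschitzWith.of_dist_le_mul fun x y => ?_
    rw [dist_eq_norm, dist_eq_norm, ← map_sub, NNReal.coe_one, one_mul]
    exact hπn _
  -- the two measures on the tangent plane
  set ν₁ : Measure (EuclideanSpace ℝ (Fin m)) := volume.restrict A
  set ν₂ : Measure (EuclideanSpace ℝ (Fin m)) := ((surfaceMeasure E).restrict B).map π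
  have hσB : (surfaceMeasure E).restrict B = (Measure.euclideanHausdorffMeasure m).restrict S := by
    rw [surfaceMeasure, Measure.restrict_restrict Metric.isOpen_ball.measurableSet,
      Nat.add_sub_cancel]
  have hset : ∀ T, γ '' (T ∩ A) = S ∩ π ⁻¹' T := fun T => by
    ext x
    constructor
    · rintro ⟨_, ⟨hyT, ⟨y, hy, rfl⟩⟩, rfl⟩
      rw [hγ y hy]
      exact ⟨hy, hyT⟩
    · rintro ⟨hx, hxT⟩
      exact ⟨π x, ⟨hxT, ⟨x, hx, rfl⟩⟩, hγ x hx⟩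
  have hset' : ∀ T, π '' (S ∩ π ⁻¹' T) = T ∩ A := fun T => by
    rw [image_inter_preimage, inter_comm]
  have hν₁ : ∀ T, MeasurableSet T → ν₁ T = Measure.euclideanHausdorffMeasure m (T ∩ A) :=
    fun T hT => by
      rw [Measure.restrict_apply hT, EuclideanSpace.euclideanHausdorffMeasure_eq_volume]
  have hν₂ : ∀ T, MeasurableSet T →
      ν₂ T = Measure.euclideanHausdorffMeasure m (S ∩ π ⁻¹' T) := fun T hT => by
    rw [Measure.map_apply π.measurable hT, hσB, Measure.restrict_apply (π.measurable hT),
      inter_comm]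
  have hle₁ : ν₁ ≤ ν₂ := Measure.le_iff.2 fun T hT => by
    rw [hν₁ T hT, hν₂ T hT, ← hset']
    have := euclideanHausdorffMeasure_image_le (hπlip.lipschitzOnWith (s := S ∩ π ⁻¹' T)) m
    simpa using this
  have hle₂ : ν₂ ≤ ENNReal.ofReal ((1 + ε) ^ m) • ν₁ := Measure.le_iff.2 fun T hT => by
    rw [Measure.smul_apply, hν₁ T hT, hν₂ T hT, ← hset]
    have := euclideanHausdorffMeasure_image_le (hγlip.mono (inter_subset_right (s := T))) m
    rw [smul_eq_mul, ENNReal.ofReal_pow (by positivity)]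
    exact this
  have hAfin : volume A < ⊤ := by
    refine Bornology.IsBounded.measure_lt_top ?_
    exact hπlip.isBounded_image (Metric.isBounded_ball.subset inter_subset_left)
  refine ⟨r, hr, fun x hx => ?_, ?_, fun f hf hfc hfB hf0 => ?_⟩
  · have hdx := hρ.isDefiningFunction hx.2
    have hGx : 0 < ‖gradient ρ x‖ := norm_pos_iff.2 hdx.gradient_ne_zero
    rw [hdx.outerNormal_eq, unitGradient, inner_smul_right, ← div_eq_inv_mul, le_div_iff₀ hGx]
    have h1 := hball x hx.1
    have h2 : inner ℝ n (gradient ρ x) = g + inner ℝ n (gradient ρ x - gradient ρ q) := by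
      rw [inner_sub_right, hGn, inner_smul_right, real_inner_self_eq_norm_sq, hn]; simp
    have h3 := (abs_le.1 (abs_real_inner_le_norm n (gradient ρ x - gradient ρ q))).1
    rw [hn, one_mul] at h3
    have h4 : ‖gradient ρ x‖ ≤ g + ε / 2 * g := by
      calc ‖gradient ρ x‖ = ‖gradient ρ q + (gradient ρ x - gradient ρ q)‖ := by congr 1; abel
        _ ≤ _ := (norm_add_le _ _).trans (by gcongr)
    rw [h2]
    calc (1 - ε) * ‖gradient ρ x‖ ≤ (1 - ε) * (g + ε / 2 * g) := by gcongr
      _ ≤ g - ε / 2 * g := by nlinarith [mul_pos hε hε, mul_pos (mul_pos hε hε) hG]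
      _ ≤ _ := by linarith
  · have h1 : surfaceMeasure E B = ν₂ univ := by
      rw [Measure.map_apply π.measurable MeasurableSet.univ, preimage_univ, Measure.restrict_apply_univ]
    rw [h1]
    refine (hle₂ univ).trans_lt ?_
    rw [Measure.smul_apply, smul_eq_mul, Measure.restrict_apply_univ]
    exact ENNReal.mul_lt_top ENNReal.ofReal_lt_top hAfin
  -- slicing in the normal direction
  set Θ : EuclideanSpace ℝ (Fin m) × ℝ → EuclideanSpace ℝ (Fin (m + 1)) :=
    fun w => ι w.1 + w.2 • n with hΘ
  have hfn : Continuous fun x => fderiv ℝ f x n := continuous_fderiv_apply hf continuous_const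
  have hfnc : HasCompactSupport fun x => fderiv ℝ f x n :=
    (hfc.fderiv ℝ).comp_left (g := fun A : EuclideanSpace ℝ (Fin (m + 1)) →L[ℝ] ℝ => A n) (by simp)
  have hfni : Integrable (E.indicator fun x => fderiv ℝ f x n) :=
    (hfn.integrable_of_hasCompactSupport hfnc).indicator hE.measurableSet
  have hemb : MeasurableEmbedding Θ := by
    refine Measurable.measurableEmbedding hmp.measurable fun w w' hw => ?_
    have h1 := congrArg π hw
    have h2 := congrArg (fun x => (inner ℝ n x : ℝ)) hw
    simp only [hΘ, hπ] at h1
    have h3 : ∀ y, inner ℝ n (ι y) = (0 : ℝ) := fun y => by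
      have := hdec (ι y)
      have h4 := hπ y 0
      rw [zero_smul, add_zero] at h4
      rw [h4, add_eq_left, smul_eq_zero] at this
      exact this.resolve_right fun h => by simp [h] at hn
    simp only [hΘ, inner_add_right, h3, inner_smul_right, real_inner_self_eq_norm_sq, hn] at h2
    exact Prod.ext h1 (by simpa using h2)
  set F : EuclideanSpace ℝ (Fin m) → ℝ :=
    fun y => ∫ t, E.indicator (fun x => fderiv ℝ f x n) (Θ (y, t)) with hF
  have hcomp : Integrable (fun w => E.indicator (fun x => fderiv ℝ f x n) (Θ w))
      (volume : Measure (EuclideanSpace ℝ (Fin m) × ℝ)) :=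
    (hmp.integrable_comp_emb hemb).2 hfni
  have hFint : ∫ x in E, fderiv ℝ f x n = ∫ y, F y := by
    rw [← integral_indicator hE.measurableSet, ← hmp.integral_comp hemb,
      Measure.volume_eq_prod, integral_prod _ (by rwa [← Measure.volume_eq_prod])]
  have hFi : Integrable F := by
    rw [Measure.volume_eq_prod] at hcomp
    exact hcomp.integral_prod_left
  have hFsm : StronglyMeasurable F := by
    refine StronglyMeasurable.integral_prod_right'
      (f := fun w => E.indicator (fun x => fderiv ℝ f x n) (Θ w)) ?_
    exact (hfn.stronglyMeasurable.indicator hE.measurableSet).comp_measurable hmp.measurable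
  -- the slices
  have hslice : ∀ y, (∀ t₀ : ℝ, Θ (y, t₀) ∈ S → F y = f (Θ (y, t₀))) ∧
      ((∀ t : ℝ, Θ (y, t) ∉ S) → F y = 0) := by
    intro y
    set a : ℝ → ℝ := fun t => f (Θ (y, t)) with ha
    set b : ℝ → ℝ := fun t => ρ (Θ (y, t)) with hb
    set I : Set ℝ := {t | Θ (y, t) ∈ B} with hI
    have hΘs : ContDiff ℝ ∞ fun t : ℝ => Θ (y, t) := by
      simp only [hΘ]; fun_prop
    have hΘd : ∀ t : ℝ, HasDerivAt (fun t : ℝ => Θ (y, t)) n t := fun t => by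
      have := ((hasDerivAt_id t).smul_const n).const_add (ι y)
      rwa [one_smul] at this
    have hΘemb : IsClosedEmbedding fun t : ℝ => Θ (y, t) := by
      refine Isometry.isClosedEmbedding (Isometry.of_dist_eq fun t t' => ?_)
      rw [dist_eq_norm]
      simp only [hΘ, add_sub_add_left_eq_sub, ← sub_smul, norm_smul, hn, mul_one]
      rfl
    have hac : HasCompactSupport a := hfc.comp_isClosedEmbedding hΘemb
    have has : ContDiff ℝ ∞ a := hf.comp hΘs
    have had : ∀ t, deriv a t = fderiv ℝ f (Θ (y, t)) n := fun t =>
      ((hf.differentiable (by simp) _).hasFDerivAt.comp_hasDerivAt t (hΘd t)).deriv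
    have hIc : Convex ℝ I := fun t ht t' ht' c c' hc hc' hcc' => by
      have := convex_ball q r ht ht' hc hc' hcc'
      simp only [hI, mem_ofPred_eq]
      convert this using 1
      simp only [hΘ, smul_add, smul_smul, add_smul]
      have : ι y = c • ι y + c' • ι y := by rw [← add_smul, hcc', one_smul]
      conv_lhs => rw [this]
      simp only [smul_eq_mul]
      abel
    have haI : tsupport a ⊆ I := fun t ht => by
      have : tsupport a ⊆ (fun t : ℝ => Θ (y, t)) ⁻¹' tsupport f :=
        closure_minimal (fun t ht => subset_closure ht)
          ((isClosed_tsupport f).preimage hΘs.continuous)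
      exact hfB (this ht)
    have hbd : ∀ t, HasDerivAt b (inner ℝ (gradient ρ (Θ (y, t))) n) t := fun t => by
      rw [inner_gradient]
      exact (hρd _).hasFDerivAt.comp_hasDerivAt t (hΘd t)
    have hbc : Continuous b := hρc.comp hΘs.continuous
    have hbm : StrictMonoOn b I := by
      refine strictMonoOn_of_deriv_pos hIc hbc.continuousOn fun t ht => ?_
      rw [(hbd t).deriv]
      exact hinc _ (show t ∈ I from interior_subset ht)
    have key := integral_indicator_deriv has hac hIc.ordConnected haI hbc hbm
    have hFy : F y = ∫ t, {t | b t < 0}.indicator (deriv a) t := by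
      refine integral_congr_ae (Eventually.of_forall fun t => ?_)
      simp only
      by_cases h : b t < 0
      · rw [indicator_of_mem (show t ∈ {t | b t < 0} from h),
          indicator_of_mem ((hρ.mem_iff _).2 h), had]
      · rw [indicator_of_notMem (show t ∉ {t | b t < 0} from h),
          indicator_of_notMem fun h' => h ((hρ.mem_iff _).1 h')]
    refine ⟨fun t₀ ht₀ => ?_, fun hne => ?_⟩
    · rw [hFy]; exact key.1 t₀ ht₀.1 ((hρ.frontier_iff _).1 ht₀.2)
    · rw [hFy]; exact key.2 fun t ht h0 => hne t ⟨ht, (hρ.frontier_iff _).2 h0⟩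
  have hFπ : ∀ x ∈ S, F (π x) = f x := fun x hx => by
    have e : Θ (π x, (inner ℝ n x : ℝ)) = x := hdec x
    have := (hslice (π x)).1 (inner ℝ n x) (by rw [e]; exact hx)
    rw [this, e]
  have hF0 : ∀ y, y ∉ A → F y = 0 := fun y hy => (hslice y).2 fun t ht => by
    refine hy ⟨_, ht, hπ y t⟩
  have hFnn : ∀ y, 0 ≤ F y := fun y => by
    by_cases hy : y ∈ A
    · obtain ⟨x, hx, rfl⟩ := hy
      rw [hFπ x hx]; exact hf0 x
    · rw [hF0 y hy]
  have hL1 : ENNReal.ofReal (∫ x in E, fderiv ℝ f x n) = ∫⁻ y, ENNReal.ofReal (F y) ∂ν₁ := by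
    rw [hFint, ofReal_integral_eq_lintegral_ofReal hFi (Eventually.of_forall hFnn),
      ← lintegral_indicator hAm]
    refine lintegral_congr fun y => ?_
    by_cases hy : y ∈ A
    · rw [indicator_of_mem hy]
    · rw [indicator_of_notMem hy, hF0 y hy, ENNReal.ofReal_zero]
  have hL2 : ∫⁻ x, ENNReal.ofReal (f x) ∂(surfaceMeasure E) =
      ∫⁻ y, ENNReal.ofReal (F y) ∂ν₂ := by
    rw [lintegral_map hFsm.measurable.ennreal_ofReal π.measurable, hσB]
    have h1 : ∫⁻ x in S, ENNReal.ofReal (F (π x)) ∂(Measure.euclideanHausdorffMeasure m) =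
        ∫⁻ x in S, ENNReal.ofReal (f x) ∂(Measure.euclideanHausdorffMeasure m) :=
      setLIntegral_congr_fun hSm fun x hx => by simp only [hFπ x hx]
    rw [h1, ← hσB, ← lintegral_indicator Metric.isOpen_ball.measurableSet]
    refine lintegral_congr fun x => ?_
    by_cases hx : x ∈ B
    · rw [indicator_of_mem hx]
    · rw [indicator_of_notMem hx,
        image_eq_zero_of_notMem_tsupport fun h => hx (hfB h), ENNReal.ofReal_zero]
  rw [hL1, hL2]
  refine ⟨lintegral_mono' hle₁ le_rfl, (lintegral_mono' hle₂ le_rfl).trans ?_⟩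
  rw [lintegral_smul_measure, smul_eq_mul]

/-! ### The divergence theorem -/

/-- A global defining function of `E` together with a smooth extension of the exterior normal. -/
structure BoundaryData (E : Set (EuclideanSpace ℝ (Fin N))) (ρ : EuclideanSpace ℝ (Fin N) → ℝ)
    (n : EuclideanSpace ℝ (Fin N) → EuclideanSpace ℝ (Fin N)) : Prop where
  one_le : 1 ≤ N
  isOpen : IsOpen E
  defining : IsGlobalDefiningFunction E ρ
  contDiff : ContDiff ℝ ∞ n
  eq_outerNormal : ∀ x ∈ frontier E, n x = outerNormal E x

lemma BoundaryData.norm_eq_one {E : Set 𝔼} {ρ : 𝔼 → ℝ} {n : 𝔼 → 𝔼} (H : BoundaryData E ρ n) {x : 𝔼}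
    (hx : x ∈ frontier E) : ‖n x‖ = 1 := by
  rw [H.eq_outerNormal x hx]; exact (H.defining.isDefiningFunction hx).norm_outerNormal

lemma surfaceMeasure_compl_frontier (E : Set 𝔼) : surfaceMeasure E (frontier E)ᶜ = 0 := by
  rw [surfaceMeasure, Measure.restrict_apply isClosed_frontier.isOpen_compl.measurableSet]
  simp

lemma ae_mem_frontier (E : Set 𝔼) : ∀ᵐ x ∂(surfaceMeasure E), x ∈ frontier E :=
  surfaceMeasure_compl_frontier E

lemma BoundaryData.isLocallyFiniteMeasure {E : Set 𝔼} {ρ : 𝔼 → ℝ} {n : 𝔼 → 𝔼}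
    (H : BoundaryData E ρ n) : IsLocallyFiniteMeasure (surfaceMeasure E) := by
  obtain ⟨m, rfl⟩ := Nat.exists_eq_add_of_le' H.one_le
  refine ⟨fun x => ?_⟩
  by_cases hx : x ∈ frontier E
  · obtain ⟨r, hr, -, h, -⟩ := H.defining.exists_ball_comparison H.isOpen hx (ε := 1 / 2)
      (by norm_num) (by norm_num)
    exact ⟨_, Metric.ball_mem_nhds x hr, h⟩
  · exact ⟨_, isClosed_frontier.isOpen_compl.mem_nhds hx, by
      rw [surfaceMeasure_compl_frontier]; exact ENNReal.zero_lt_top⟩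

lemma divergence_finset_sum {κ : Type*} (t : Finset κ) {Z : κ → 𝔼 → 𝔼} {x : 𝔼}
    (hZ : ∀ i ∈ t, DifferentiableAt ℝ (Z i) x) :
    divergence (fun y => ∑ i ∈ t, Z i y) x = ∑ i ∈ t, divergence (Z i) x := by
  rw [divergence, fderiv_fun_sum hZ, map_sum]
  rfl

lemma BoundaryData.setIntegral_divergence_smul_normal_of_local {m : ℕ}
    {E : Set (EuclideanSpace ℝ (Fin (m + 1)))} {ρ : EuclideanSpace ℝ (Fin (m + 1)) → ℝ}
    {n : EuclideanSpace ℝ (Fin (m + 1)) → EuclideanSpace ℝ (Fin (m + 1))}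
    (H : BoundaryData E ρ n) {f : EuclideanSpace ℝ (Fin (m + 1)) → ℝ} (hf : ContDiff ℝ ∞ f)
    (hfc : HasCompactSupport f) (hf0 : ∀ x, 0 ≤ f x) {ε : ℝ} (hε : 0 < ε) (hε1 : ε < 1) :
    (1 - ε) * (∫ x in E, divergence (fun y => f y • n y) x) ≤ ∫ x, f x ∂(surfaceMeasure E) ∧
    ∫ x, f x ∂(surfaceMeasure E) ≤ (1 + ε) ^ m * ∫ x in E, divergence (fun y => f y • n y) x := by
  haveI := H.isLocallyFiniteMeasure
  have hρ := H.defining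
  choose! r hr hr1 hr2 hr3 using fun q (hq : q ∈ frontier E) =>
    hρ.exists_ball_comparison H.isOpen hq hε hε1
  classical
  set U : EuclideanSpace ℝ (Fin (m + 1)) → Set (EuclideanSpace ℝ (Fin (m + 1))) := fun x =>
    if x ∈ frontier E then Metric.ball x (r x) else (frontier E)ᶜ with hU
  have hUo : ∀ x, IsOpen (U x) := fun x => by
    simp only [hU]; split_ifs
    · exact Metric.isOpen_ball
    · exact isClosed_frontier.isOpen_compl
  have hUx : ∀ x, x ∈ U x := fun x => by
    simp only [hU]; split_ifs with h
    · exact Metric.mem_ball_self (hr x h)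
    · exact h
  obtain ⟨t, -, htc⟩ := hfc.isCompact.elim_nhds_subcover U fun x _ => (hUo x).mem_nhds (hUx x)
  obtain ⟨P, hP⟩ := SmoothPartitionOfUnity.exists_isSubordinate
    (modelWithCornersSelf ℝ (EuclideanSpace ℝ (Fin (m + 1)))) (isClosed_tsupport f)
    (fun i : t => U i) (fun i => hUo i) (by
      intro x hx
      obtain ⟨i, hi, hxi⟩ := mem_iUnion₂.1 (htc hx)
      exact mem_iUnion.2 ⟨⟨i, hi⟩, hxi⟩)
  set φ : t → EuclideanSpace ℝ (Fin (m + 1)) → ℝ := fun i x => P i x * f x with hφ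
  have hφs : ∀ i, ContDiff ℝ ∞ (φ i) := fun i =>
    (contMDiff_iff_contDiff.1 (P i).contMDiff).mul hf
  have hφc : ∀ i, HasCompactSupport (φ i) := fun i => hfc.mul_left
  have hφU : ∀ i, tsupport (φ i) ⊆ U i := fun i => (tsupport_mul_subset_left).trans (hP i)
  have hφ0 : ∀ i x, 0 ≤ φ i x := fun i x => mul_nonneg (P.nonneg i x) (hf0 x)
  have hsum : ∀ x, f x = ∑ i, φ i x := fun x => by
    simp only [hφ]
    rw [← Finset.sum_mul]
    by_cases hx : x ∈ tsupport f
    · have := P.sum_eq_one hx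
      rw [finsum_eq_sum_of_fintype] at this
      rw [this, one_mul]
    · rw [image_eq_zero_of_notMem_tsupport hx, mul_zero]
  have hφn : ∀ i, ContDiff ℝ ∞ fun y => φ i y • n y := fun i => (hφs i).smul H.contDiff
  have hφnc : ∀ i, HasCompactSupport fun y => φ i y • n y := fun i => (hφc i).smul_right
  have hφi : ∀ i, Integrable (φ i) (surfaceMeasure E) := fun i =>
    (hφs i).continuous.integrable_of_hasCompactSupport (hφc i)
  have e1 : ∫ x in E, divergence (fun y => f y • n y) x =
      ∑ i, ∫ x in E, divergence (fun y => φ i y • n y) x := by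
    rw [← integral_finsetSum _ fun i _ => (integrable_divergence (hφn i) (hφnc i)).integrableOn]
    refine integral_congr_ae (Eventually.of_forall fun x => ?_)
    have : (fun y => f y • n y) = fun y => ∑ i, φ i y • n y := by
      ext1 y; rw [hsum y, Finset.sum_smul]
    simp only
    rw [this, divergence_finset_sum _ fun i _ => (hφn i).differentiable (by simp) x]
  have e2 : ∫ x, f x ∂(surfaceMeasure E) = ∑ i, ∫ x, φ i x ∂(surfaceMeasure E) := by
    rw [← integral_finsetSum _ fun i _ => hφi i]
    exact integral_congr_ae (Eventually.of_forall fun x => hsum x)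
  have key : ∀ i, (1 - ε) * (∫ x in E, divergence (fun y => φ i y • n y) x) ≤
      ∫ x, φ i x ∂(surfaceMeasure E) ∧ ∫ x, φ i x ∂(surfaceMeasure E) ≤
        (1 + ε) ^ m * ∫ x in E, divergence (fun y => φ i y • n y) x := by
    intro i
    by_cases hi : (i : EuclideanSpace ℝ (Fin (m + 1))) ∈ frontier E
    · have hUi : U i = Metric.ball (i : EuclideanSpace ℝ (Fin (m + 1))) (r i) := by simp only [hU, if_pos hi]
      set nq := outerNormal E (i : EuclideanSpace ℝ (Fin (m + 1)))
      have hnq : ‖nq‖ = 1 := (hρ.isDefiningFunction hi).norm_outerNormal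
      have hconst : ContDiff ℝ ∞ fun y => φ i y • nq := (hφs i).smul contDiff_const
      have hconstc : HasCompactSupport fun y => φ i y • nq := (hφc i).smul_right
      have hdiv : ∫ x in E, divergence (fun y => φ i y • nq) x = ∫ x in E, fderiv ℝ (φ i) x nq :=
        integral_congr_ae (Eventually.of_forall fun x =>
          divergence_smul_const ((hφs i).differentiable (by simp) x) _)
      have hcos : ∀ x ∈ frontier E, (1 - ε) * φ i x ≤ φ i x * inner ℝ nq (outerNormal E x) := by
        intro x hx
        by_cases hxs : x ∈ tsupport (φ i)
        · have := hr1 i hi x ⟨hUi ▸ hφU i hxs, hx⟩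
          rw [mul_comm]
          exact mul_le_mul_of_nonneg_left this (hφ0 i x)
        · rw [image_eq_zero_of_notMem_tsupport hxs]; simp
      have hnn : ∀ x ∈ frontier E, inner ℝ (n x) (outerNormal E x) = (1 : ℝ) := fun x hx => by
        rw [H.eq_outerNormal x hx, real_inner_self_eq_norm_sq,
          (hρ.isDefiningFunction hx).norm_outerNormal]; norm_num
      set a := ∫ x in E, fderiv ℝ (φ i) x nq
      have m1 : (1 - ε) * (∫ x in E, divergence (fun y => φ i y • n y) x) ≤ a := by
        have hs : ∀ x, divergence (fun y => (1 - ε) • (φ i y • n y)) x =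
            (1 - ε) * divergence (fun y => φ i y • n y) x := fun x => by
          rw [divergence, fderiv_fun_const_smul ((hφn i).differentiable (by simp) x), map_smul]
          rfl
        rw [← integral_const_mul]
        simp_rw [← hs]
        rw [← hdiv]
        refine hρ.setIntegral_divergence_mono H.isOpen ((hφn i).const_smul (1 - ε))
          ((hφnc i).smul_left (f := fun _ => (1 - ε))) hconst hconstc fun x hx => ?_
        simp only [inner_smul_left, hnn x hx, conj_trivial, mul_one]
        exact hcos x hx
      have m2 : a ≤ ∫ x in E, divergence (fun y => φ i y • n y) x := by
        rw [← hdiv]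
        refine hρ.setIntegral_divergence_mono H.isOpen hconst hconstc (hφn i) (hφnc i)
          fun x hx => ?_
        simp only [inner_smul_left, hnn x hx, conj_trivial]
        refine mul_le_mul_of_nonneg_left ?_ (hφ0 i x)
        have := (abs_le.1 (abs_real_inner_le_norm nq (outerNormal E x))).2
        rwa [hnq, (hρ.isDefiningFunction hx).norm_outerNormal, one_mul] at this
      have m0 : 0 ≤ a := by
        rw [← hdiv]
        have := hρ.setIntegral_divergence_mono H.isOpen (contDiff_const (c := 0))
          (HasCompactSupport.zero) hconst hconstc fun x hx => by
            simp only [inner_smul_left, inner_zero_left, conj_trivial]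
            refine le_trans ?_ (hcos x hx)
            exact mul_nonneg (by linarith) (hφ0 i x)
        simpa [divergence] using this
      obtain ⟨c1, c2⟩ := hr3 i hi (φ i) (hφs i) (hφc i) (hUi ▸ hφU i) (hφ0 i)
      rw [← ofReal_integral_eq_lintegral_ofReal (hφi i) (Eventually.of_forall (hφ0 i))] at c1 c2
      have hI0 : 0 ≤ ∫ x, φ i x ∂(surfaceMeasure E) := integral_nonneg (hφ0 i)
      rw [ENNReal.ofReal_le_ofReal_iff hI0] at c1
      rw [← ENNReal.ofReal_mul (by positivity),
        ENNReal.ofReal_le_ofReal_iff (mul_nonneg (by positivity) m0)] at c2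
      exact ⟨m1.trans c1, c2.trans (mul_le_mul_of_nonneg_left m2 (by positivity))⟩
    · have hUi : U i = (frontier E)ᶜ := by simp only [hU, if_neg hi]
      have hz : ∀ x ∈ frontier E, φ i x = 0 := fun x hx =>
        image_eq_zero_of_notMem_tsupport fun h => (hUi ▸ hφU i h) hx
      have z1 : ∫ x, φ i x ∂(surfaceMeasure E) = 0 := by
        rw [integral_eq_zero_of_ae]
        filter_upwards [ae_mem_frontier E] with x hx
        exact hz x hx
      have z2 : ∫ x in E, divergence (fun y => φ i y • n y) x = 0 := by
        have l1 := hρ.setIntegral_divergence_mono H.isOpen (contDiff_const (c := 0))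
          (HasCompactSupport.zero) (hφn i) (hφnc i) fun x hx => by simp [hz x hx]
        have l2 := hρ.setIntegral_divergence_mono H.isOpen (hφn i) (hφnc i)
          (contDiff_const (c := 0)) (HasCompactSupport.zero) fun x hx => by simp [hz x hx]
        simp only [divergence, fderiv_fun_const, Pi.zero_apply, map_zero, integral_zero] at l1 l2
        exact le_antisymm l2 l1
      rw [z1, z2]; simp
  rw [e1, e2, Finset.mul_sum, Finset.mul_sum]
  exact ⟨Finset.sum_le_sum fun i _ => (key i).1, Finset.sum_le_sum fun i _ => (key i).2⟩

lemma BoundaryData.setIntegral_divergence_smul_normal {E : Set 𝔼} {ρ : 𝔼 → ℝ} {n : 𝔼 → 𝔼}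
    (H : BoundaryData E ρ n) {f : 𝔼 → ℝ} (hf : ContDiff ℝ ∞ f)
    (hfc : HasCompactSupport f) (hf0 : ∀ x, 0 ≤ f x) :
    ∫ x in E, divergence (fun y => f y • n y) x = ∫ x, f x ∂(surfaceMeasure E) := by
  obtain ⟨m, rfl⟩ := Nat.exists_eq_add_of_le' H.one_le
  set a := ∫ x in E, divergence (fun y => f y • n y) x
  set b := ∫ x, f x ∂(surfaceMeasure E)
  have h1 : Tendsto (fun ε : ℝ => (1 - ε) * a) (𝓝[>] 0) (𝓝 a) := by
    have hc : Continuous fun ε : ℝ => (1 - ε) * a := by fun_prop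
    simpa using (hc.tendsto 0).mono_left nhdsWithin_le_nhds
  have h2 : Tendsto (fun ε : ℝ => (1 + ε) ^ m * a) (𝓝[>] 0) (𝓝 a) := by
    have hc : Continuous fun ε : ℝ => (1 + ε) ^ m * a := by fun_prop
    simpa using (hc.tendsto 0).mono_left nhdsWithin_le_nhds
  have h3 : ∀ᶠ ε in 𝓝[>] (0 : ℝ), (1 - ε) * a ≤ b ∧ b ≤ (1 + ε) ^ m * a := by
    filter_upwards [Ioo_mem_nhdsGT (zero_lt_one (α := ℝ))] with ε hε
    exact H.setIntegral_divergence_smul_normal_of_local hf hfc hf0 hε.1 hε.2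
  exact le_antisymm (le_of_tendsto h1 (h3.mono fun ε h => h.1))
    (ge_of_tendsto h2 (h3.mono fun ε h => h.2))

/-- **Divergence theorem** on an open set with smooth boundary, for smooth compactly supported
vector fields. -/
theorem BoundaryData.setIntegral_divergence {E : Set 𝔼} {ρ : 𝔼 → ℝ} {n : 𝔼 → 𝔼}
    (H : BoundaryData E ρ n) {Z : 𝔼 → 𝔼} (hZ : ContDiff ℝ ∞ Z) (hZc : HasCompactSupport Z) :
    ∫ x in E, divergence Z x = ∫ x, inner ℝ (Z x) (n x) ∂(surfaceMeasure E) := by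
  haveI := H.isLocallyFiniteMeasure
  set f : 𝔼 → ℝ := fun x => inner ℝ (Z x) (n x)
  have hf : ContDiff ℝ ∞ f := hZ.inner ℝ H.contDiff
  have hfc : HasCompactSupport f := hZc.mono fun x hx => by
    contrapose! hx
    simp only [Function.mem_support, not_not] at hx ⊢
    simp [f, hx]
  obtain ⟨M, hM⟩ := hfc.exists_bound_of_continuous hf.continuous
  have hM0 : 0 ≤ M := (norm_nonneg _).trans (hM 0)
  obtain ⟨R, hR⟩ := (hfc.isCompact.isBounded).subset_closedBall (0 : 𝔼)
  obtain ⟨η, hη, hηc, hη0, hη1, hηB⟩ := exists_smooth_cutoff (N := N) R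
  have hMη : ContDiff ℝ ∞ fun x => M * η x := contDiff_const.mul hη
  have hMηc : HasCompactSupport fun x => M * η x := hηc.mul_left
  have a1 := H.setIntegral_divergence_smul_normal hMη hMηc fun x => mul_nonneg hM0 (hη0 x)
  have a2 := H.setIntegral_divergence_smul_normal (hf.add hMη) (hfc.add hMηc) fun x => by
    change 0 ≤ f x + M * η x
    by_cases hx : x ∈ tsupport f
    · rw [hηB x (hR hx), mul_one]
      linarith [(abs_le.1 (hM x)).1]
    · rw [image_eq_zero_of_notMem_tsupport hx, zero_add]
      exact mul_nonneg hM0 (hη0 x)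
  have b : ∫ x in E, divergence Z x = ∫ x in E, divergence (fun y => f y • n y) x := by
    have hfn : ContDiff ℝ ∞ fun y => f y • n y := hf.smul H.contDiff
    have hfnc : HasCompactSupport fun y => f y • n y := hfc.smul_right
    have hinner : ∀ x ∈ frontier E, inner ℝ (f x • n x) (outerNormal E x) =
        (inner ℝ (Z x) (outerNormal E x) : ℝ) := fun x hx => by
      rw [← H.eq_outerNormal x hx, inner_smul_left, real_inner_self_eq_norm_sq, H.norm_eq_one hx]
      simp [f]
    refine le_antisymm ?_ ?_
    · exact H.defining.setIntegral_divergence_mono H.isOpen hZ hZc hfn hfnc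
        fun x hx => (hinner x hx).ge
    · exact H.defining.setIntegral_divergence_mono H.isOpen hfn hfnc hZ hZc
        fun x hx => (hinner x hx).le
  have hfi : Integrable f (surfaceMeasure E) := hf.continuous.integrable_of_hasCompactSupport hfc
  have hMi : Integrable (fun x => M * η x) (surfaceMeasure E) :=
    hMη.continuous.integrable_of_hasCompactSupport hMηc
  have c : ∀ x, divergence (fun y => (f y + M * η y) • n y) x =
      divergence (fun y => f y • n y) x + divergence (fun y => (M * η y) • n y) x := fun x => by
    simp_rw [add_smul]
    exact divergence_add ((hf.smul H.contDiff).differentiable (by simp) x)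
      ((hMη.smul H.contDiff).differentiable (by simp) x)
  change ∫ x in E, divergence (fun y => (f y + M * η y) • n y) x =
    ∫ x, (f x + M * η x) ∂(surfaceMeasure E) at a2
  simp_rw [c] at a2
  have i1 : Integrable (divergence fun y => f y • n y) :=
    integrable_divergence (hf.smul H.contDiff) hfc.smul_right
  have i2 : Integrable (divergence fun y => (M * η y) • n y) :=
    integrable_divergence (hMη.smul H.contDiff) hMηc.smul_right
  rw [integral_add i1.integrableOn i2.integrableOn, integral_add hfi hMi, a1] at a2
  rw [b]
  linarith

/-! ### Integrals of powers of the distance -/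

/-- A measure with `μ(B_ρ(p)) ≤ C ρ^d` integrates `|x - p|^{-a}` near `p` when `a < d`. -/
lemma lintegral_norm_sub_rpow_le {μ : Measure 𝔼} {p : 𝔼} {r C d a : ℝ} (hr : 0 < r) (hC : 0 ≤ C)
    (had : a < d) (ha : a ≠ 0)
    (hμ : ∀ t, 0 < t → t ≤ r → μ (Metric.closedBall p t) ≤ ENNReal.ofReal (C * t ^ d)) :
    ∫⁻ x in Metric.closedBall p r, ENNReal.ofReal (‖x - p‖ ^ (-a)) ∂μ ≤
      ENNReal.ofReal (2 ^ |a| * C * r ^ (d - a) * (1 - (1 / 2) ^ (d - a))⁻¹) := by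
  set w : ℕ → ℝ := fun k => r * (1 / 2) ^ k with hw
  have hw0 : ∀ k, 0 < w k := fun k => by positivity
  have hwr : ∀ k, w k ≤ r := fun k =>
    mul_le_of_le_one_right hr.le (pow_le_one₀ (by norm_num) (by norm_num))
  have hpt : ∀ x ∈ Metric.closedBall p r, ENNReal.ofReal (‖x - p‖ ^ (-a)) ≤
      ∑' k, ENNReal.ofReal (2 ^ |a| * w k ^ (-a)) *
        (Metric.closedBall p (w k)).indicator 1 x := by
    intro x hx
    rw [Metric.mem_closedBall, dist_eq_norm] at hx
    rcases (norm_nonneg (x - p)).eq_or_lt with h0 | h0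
    · rw [← h0, Real.zero_rpow (neg_ne_zero.2 ha), ENNReal.ofReal_zero]
      exact zero_le
    · obtain ⟨k, hk1, hk2⟩ := exists_nat_pow_near_of_lt_one (x := ‖x - p‖ / r) (y := 1 / 2)
        (by positivity) ((div_le_one hr).2 hx) (by norm_num) (by norm_num)
      rw [lt_div_iff₀ hr] at hk1
      rw [div_le_iff₀ hr] at hk2
      have h1 : ‖x - p‖ ≤ w k := by simp only [hw]; linarith
      have h2 : w k / 2 ≤ ‖x - p‖ := by simp only [hw]; rw [pow_succ] at hk1; linarith
      refine le_trans ?_ (ENNReal.le_tsum k)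
      rw [indicator_of_mem (by rwa [Metric.mem_closedBall, dist_eq_norm]), Pi.one_apply, mul_one]
      refine ENNReal.ofReal_le_ofReal ?_
      have hwk := hw0 k
      rcases le_or_gt 0 a with h | h
      · calc ‖x - p‖ ^ (-a) ≤ (w k / 2) ^ (-a) :=
              Real.rpow_le_rpow_of_nonpos (by positivity) h2 (by linarith)
          _ = 2 ^ |a| * w k ^ (-a) := by
              rw [Real.div_rpow hwk.le (by norm_num), abs_of_nonneg h, Real.rpow_neg (by norm_num : (0:ℝ) ≤ 2)]
              field_simp
      · calc ‖x - p‖ ^ (-a) ≤ w k ^ (-a) := Real.rpow_le_rpow (norm_nonneg _) h1 (by linarith)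
          _ ≤ _ := le_mul_of_one_le_left (by positivity)
              (Real.one_le_rpow (by norm_num) (abs_nonneg _))
  have hq0 : (0 : ℝ) < (1 / 2 : ℝ) ^ (d - a) := by positivity
  have hq1 : (1 / 2 : ℝ) ^ (d - a) < 1 :=
    Real.rpow_lt_one (by norm_num) (by norm_num) (by linarith)
  have hterm : ∀ k, 2 ^ |a| * w k ^ (-a) * (C * w k ^ d) =
      2 ^ |a| * C * r ^ (d - a) * ((1 / 2) ^ (d - a)) ^ k := fun k => by
    have e1 : w k ^ (-a) * w k ^ d = w k ^ (d - a) := by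
      rw [← Real.rpow_add (hw0 k)]; congr 1; ring
    have e2 : w k ^ (d - a) = r ^ (d - a) * ((1 / 2) ^ (d - a)) ^ k := by
      simp only [hw]
      rw [Real.mul_rpow hr.le (by positivity), ← Real.rpow_natCast, ← Real.rpow_natCast,
        ← Real.rpow_mul (by norm_num), ← Real.rpow_mul (by norm_num), mul_comm (k : ℝ)]
    calc _ = 2 ^ |a| * C * (w k ^ (-a) * w k ^ d) := by ring
      _ = _ := by rw [e1, e2]; ring
  calc ∫⁻ x in Metric.closedBall p r, ENNReal.ofReal (‖x - p‖ ^ (-a)) ∂μ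
      ≤ ∫⁻ x in Metric.closedBall p r, ∑' k, ENNReal.ofReal (2 ^ |a| * w k ^ (-a)) *
        (Metric.closedBall p (w k)).indicator 1 x ∂μ :=
        setLIntegral_mono' Metric.isClosed_closedBall.measurableSet hpt
    _ ≤ ∫⁻ x, ∑' k, ENNReal.ofReal (2 ^ |a| * w k ^ (-a)) *
        (Metric.closedBall p (w k)).indicator 1 x ∂μ := setLIntegral_le_lintegral _ _
    _ = ∑' k, ENNReal.ofReal (2 ^ |a| * w k ^ (-a)) * μ (Metric.closedBall p (w k)) := by
        rw [lintegral_tsum]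
        · congr 1
          ext1 k
          rw [lintegral_const_mul _ (measurable_one.indicator
            Metric.isClosed_closedBall.measurableSet),
            lintegral_indicator_one Metric.isClosed_closedBall.measurableSet]
        · intro k
          exact ((measurable_one.indicator
            Metric.isClosed_closedBall.measurableSet).const_mul _).aemeasurable
    _ ≤ ∑' k, ENNReal.ofReal (2 ^ |a| * C * r ^ (d - a) * ((1 / 2) ^ (d - a)) ^ k) := by
        refine ENNReal.tsum_le_tsum fun k => ?_
        rw [← hterm, ENNReal.ofReal_mul (p := 2 ^ |a| * w k ^ (-a)) (by have := hw0 k; positivity)]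
        exact mul_le_mul_right (hμ _ (hw0 k) (hwr k)) _
    _ = _ := by
        rw [← ENNReal.ofReal_tsum_of_nonneg (fun k => by positivity)
          ((summable_geometric_of_lt_one hq0.le hq1).mul_left _), tsum_mul_left,
          tsum_geometric_of_lt_one hq0.le hq1]

lemma exists_lipschitz_on_ball {F : Type*} [NormedAddCommGroup F] [NormedSpace ℝ F] {u : 𝔼 → F}
    (hu : ContDiff ℝ ∞ u) (R : ℝ) : ∃ L, 0 < L ∧ ∀ x ∈ Metric.closedBall (0 : 𝔼) R,
      ∀ y ∈ Metric.closedBall (0 : 𝔼) R, ‖u x - u y‖ ≤ L * ‖x - y‖ := by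
  obtain ⟨C, hC⟩ := (isCompact_closedBall (0 : 𝔼) R).exists_bound_of_continuousOn
    (hu.continuous_fderiv (by simp)).continuousOn
  refine ⟨max C 1, by positivity, fun x hx y hy => ?_⟩
  exact Convex.norm_image_sub_le_of_norm_fderiv_le
    (fun z _ => hu.differentiable (by simp) z) (fun z hz => (hC z hz).trans (le_max_left _ _))
    (convex_closedBall _ _) hy hx

/-- The surface measure of a ball of radius `t` centred on the boundary is `O(t^{N-1})`. -/
lemma BoundaryData.exists_surfaceMeasure_closedBall_le {E : Set 𝔼} {ρ : 𝔼 → ℝ} {n : 𝔼 → 𝔼}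
    (H : BoundaryData E ρ n) (R : ℝ) :
    ∃ C r, 0 ≤ C ∧ 0 < r ∧ r ≤ 1 ∧ ∀ p ∈ frontier E, ‖p‖ ≤ R → ∀ t, 0 < t → t ≤ r →
      surfaceMeasure E (Metric.closedBall p t) ≤ ENNReal.ofReal (C * t ^ ((N : ℝ) - 1)) := by
  haveI := H.isLocallyFiniteMeasure
  obtain ⟨L, hL0, hL⟩ := exists_lipschitz_on_ball H.contDiff (R + 2)
  let η : ContDiffBump (0 : 𝔼) := ⟨1, 2, by norm_num, by norm_num⟩
  obtain ⟨M, hM0, hM⟩ := exists_norm_fderiv_le (X := η) η.contDiff η.hasCompactSupport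
  set v := volume.real (Metric.closedBall (0 : 𝔼) 1)
  have hv0 : 0 ≤ v := measureReal_nonneg
  refine ⟨2 * (M * (2 ^ N * v)), min 1 (1 / (4 * L)), by positivity, by positivity,
    min_le_left _ _, fun p hp hpR t ht htr => ?_⟩
  have ht1 : t ≤ 1 := htr.trans (min_le_left _ _)
  have htL : t * (4 * L) ≤ 1 := (le_div_iff₀ (by positivity)).1 (htr.trans (min_le_right _ _))
  have hpn : ‖n p‖ = 1 := H.norm_eq_one hp
  have hcos : ∀ x, ‖x - p‖ ≤ 2 * t → 1 / 2 ≤ inner ℝ (n p) (n x) := fun x hx => by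
    have hp' : p ∈ Metric.closedBall (0 : 𝔼) (R + 2) := by simp; linarith
    have hx' : x ∈ Metric.closedBall (0 : 𝔼) (R + 2) := by
      rw [mem_closedBall_zero_iff]
      calc ‖x‖ = ‖p + (x - p)‖ := by congr 1; abel
        _ ≤ ‖p‖ + ‖x - p‖ := norm_add_le _ _
        _ ≤ _ := by linarith
    have h1 := hL x hx' p hp'
    have h2 : inner ℝ (n p) (n x) = 1 + inner ℝ (n p) (n x - n p) := by
      rw [inner_sub_right, real_inner_self_eq_norm_sq, hpn]; ring
    have h3 := (abs_le.1 (abs_real_inner_le_norm (n p) (n x - n p))).1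
    rw [hpn, one_mul] at h3
    rw [h2]
    nlinarith
  set θ : 𝔼 → ℝ := fun x => η (t⁻¹ • (x - p)) with hθ
  have hθs : ContDiff ℝ ∞ θ := η.contDiff.comp (by fun_prop)
  have hθ0 : ∀ x, 0 ≤ θ x := fun x => η.nonneg
  have hsupp : ∀ x, x ∉ Metric.closedBall p (2 * t) → θ x = 0 := fun x hx => by
    refine η.zero_of_le_dist ?_
    rw [Metric.mem_closedBall, dist_eq_norm, not_le] at hx
    rw [dist_zero_right, norm_smul, norm_inv, Real.norm_eq_abs, abs_of_pos ht, ← div_eq_inv_mul,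
      le_div_iff₀ ht]
    exact hx.le
  have hθt : tsupport θ ⊆ Metric.closedBall p (2 * t) :=
    closure_minimal (fun x hx => by
      by_contra h; exact hx (hsupp x h)) Metric.isClosed_closedBall
  have hθc : HasCompactSupport θ :=
    (isCompact_closedBall p (2 * t)).of_isClosed_subset (isClosed_tsupport θ) hθt
  have hθ1 : ∀ x ∈ Metric.closedBall p t, θ x = 1 := fun x hx => by
    refine η.one_of_mem_closedBall ?_
    rw [Metric.mem_closedBall, dist_eq_norm] at hx
    rw [mem_closedBall_zero_iff, norm_smul, norm_inv, Real.norm_eq_abs, abs_of_pos ht,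
      ← div_eq_inv_mul]
    exact (div_le_one ht).2 hx
  have hθd : ∀ x, ‖fderiv ℝ θ x (n p)‖ ≤ t⁻¹ * M := fun x => by
    have h1 : HasFDerivAt (fun x : 𝔼 => t⁻¹ • (x - p)) (t⁻¹ • (ContinuousLinearMap.id ℝ 𝔼)) x :=
      ((hasFDerivAt_id x).sub_const p).const_smul t⁻¹
    have h0 : ContDiff ℝ 1 η := η.contDiff
    have h2 := (h0.differentiable (by simp) (t⁻¹ • (x - p))).hasFDerivAt.comp x h1
    have h3 : fderiv ℝ θ x = _ := h2.fderiv
    rw [h3]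
    simp only [ContinuousLinearMap.comp_apply, _root_.smul_apply, ContinuousLinearMap.id_apply,
      map_smul, norm_smul, norm_inv, Real.norm_eq_abs, abs_of_pos ht]
    gcongr
    calc _ ≤ ‖fderiv ℝ η (t⁻¹ • (x - p))‖ * ‖n p‖ := ContinuousLinearMap.le_opNorm _ _
      _ ≤ M := by rw [hpn, mul_one]; exact hM _
  have hvol : volume.real (Metric.closedBall p (2 * t)) = (2 * t) ^ N * v := by
    rw [Measure.real, Measure.addHaar_closedBall' _ _ (by positivity), ENNReal.toReal_mul,
      ENNReal.toReal_ofReal (by positivity)]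
    simp [v, Measure.real]
  -- divergence theorem
  have hdiv := H.setIntegral_divergence (Z := fun x => θ x • n p) (hθs.smul contDiff_const)
    hθc.smul_right
  have e1 : ∀ x, divergence (fun x => θ x • n p) x = fderiv ℝ θ x (n p) := fun x =>
    divergence_smul_const (hθs.differentiable (by simp) x) _
  simp_rw [e1, inner_smul_left, conj_trivial] at hdiv
  have hup : ∫ x in E, fderiv ℝ θ x (n p) ≤ t⁻¹ * M * ((2 * t) ^ N * v) := by
    have hi : Integrable fun x => fderiv ℝ θ x (n p) :=
      (continuous_fderiv_apply hθs continuous_const).integrable_of_hasCompactSupport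
        ((hθc.fderiv ℝ).comp_left (g := fun A : 𝔼 →L[ℝ] ℝ => A (n p)) (by simp))
    calc ∫ x in E, fderiv ℝ θ x (n p) ≤ ‖∫ x in E, fderiv ℝ θ x (n p)‖ := le_abs_self _
      _ ≤ ∫ x in E, ‖fderiv ℝ θ x (n p)‖ := norm_integral_le_integral_norm _
      _ ≤ ∫ x, ‖fderiv ℝ θ x (n p)‖ :=
        setIntegral_le_integral hi.norm (Eventually.of_forall fun x => norm_nonneg _)
      _ = ∫ x in Metric.closedBall p (2 * t), ‖fderiv ℝ θ x (n p)‖ := by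
        refine (setIntegral_eq_integral_of_forall_compl_eq_zero fun x hx => ?_).symm
        have : fderiv ℝ θ x = 0 := image_eq_zero_of_notMem_tsupport fun h =>
          hx (hθt (tsupport_fderiv_subset ℝ h))
        simp [this]
      _ ≤ ∫ x in Metric.closedBall p (2 * t), t⁻¹ * M := by
        refine setIntegral_mono hi.norm.integrableOn (integrableOn_const
          (isCompact_closedBall _ _).measure_lt_top.ne) fun x => hθd x
      _ = _ := by
        rw [setIntegral_const, hvol, smul_eq_mul, mul_comm]
  have hcont : Continuous fun x => θ x * inner ℝ (n p) (n x) :=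
    hθs.continuous.mul (continuous_const.inner H.contDiff.continuous)
  have hfin : surfaceMeasure E (Metric.closedBall p t) ≠ ⊤ :=
    (isCompact_closedBall p t).measure_lt_top.ne
  have hlow : 1 / 2 * (surfaceMeasure E).real (Metric.closedBall p t) ≤
      ∫ x, θ x * inner ℝ (n p) (n x) ∂(surfaceMeasure E) := by
    have hi : Integrable (fun x => θ x * inner ℝ (n p) (n x)) (surfaceMeasure E) :=
      hcont.integrable_of_hasCompactSupport hθc.mul_right
    calc 1 / 2 * (surfaceMeasure E).real (Metric.closedBall p t)
        = ∫ x in Metric.closedBall p t, (1 / 2 : ℝ) ∂(surfaceMeasure E) := by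
          rw [setIntegral_const, smul_eq_mul, mul_comm]
      _ ≤ ∫ x in Metric.closedBall p t, θ x * inner ℝ (n p) (n x) ∂(surfaceMeasure E) := by
          refine setIntegral_mono_on (integrableOn_const hfin) hi.integrableOn
            Metric.isClosed_closedBall.measurableSet fun x hx => ?_
          rw [hθ1 x hx, one_mul]
          refine hcos x ?_
          rw [Metric.mem_closedBall, dist_eq_norm] at hx
          linarith
      _ ≤ _ := by
          refine setIntegral_le_integral hi (Eventually.of_forall fun x => ?_)
          simp only [Pi.zero_apply]
          by_cases hx : x ∈ Metric.closedBall p (2 * t)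
          · refine mul_nonneg (hθ0 x) (le_trans (by norm_num) (hcos x ?_))
            rwa [Metric.mem_closedBall, dist_eq_norm] at hx
          · rw [hsupp x hx, zero_mul]
  rw [← ENNReal.ofReal_toReal hfin]
  refine ENNReal.ofReal_le_ofReal ?_
  have h5 : (surfaceMeasure E (Metric.closedBall p t)).toReal ≤
      2 * (t⁻¹ * M * ((2 * t) ^ N * v)) := by
    have := hlow.trans (hdiv.symm.le.trans hup)
    rw [Measure.real] at this
    linarith
  refine h5.trans (le_of_eq ?_)
  rw [Real.rpow_sub ht, Real.rpow_natCast, Real.rpow_one, mul_pow]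
  field_simp

/-! ### The fractional kernel -/

/-- The kernel `|z|^{-(N+s)}`. -/
def fracKernel (s : ℝ) (z : EuclideanSpace ℝ (Fin N)) : ℝ := 1 / ‖z‖ ^ ((N : ℝ) + s)

lemma fracKernel_nonneg (s : ℝ) (z : 𝔼) : 0 ≤ fracKernel s z := by
  unfold fracKernel; positivity

lemma fracKernel_neg (s : ℝ) (z : 𝔼) : fracKernel s (-z) = fracKernel s z := by
  unfold fracKernel; rw [norm_neg]

lemma fracKernel_sub_comm (s : ℝ) (x y : 𝔼) : fracKernel s (x - y) = fracKernel s (y - x) := by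
  rw [← fracKernel_neg, neg_sub]

lemma fracKernel_eq_rpow (s : ℝ) (z : 𝔼) : fracKernel s z = ‖z‖ ^ (-((N : ℝ) + s)) := by
  rw [fracKernel, Real.rpow_neg (norm_nonneg _), one_div]

lemma fracKernel_zero {s : ℝ} (hs : 0 < s) : fracKernel s (0 : 𝔼) = 0 := by
  rw [fracKernel, norm_zero, Real.zero_rpow (by positivity), div_zero]

@[fun_prop]
lemma measurable_fracKernel (s : ℝ) : Measurable (fracKernel s : 𝔼 → ℝ) := by
  unfold fracKernel; fun_prop

lemma fracKernel_sub_le {s : ℝ} (hs : 0 < s) {R r : ℝ} (hR : 0 ≤ R) (hr : 0 < r) {p x : 𝔼}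
    (hp : ‖p‖ ≤ R) (hx : r ≤ ‖x - p‖) :
    fracKernel s (x - p) ≤
      ((1 + R) / r + 1) ^ ((N : ℝ) + s) * (1 / (1 + ‖x‖) ^ ((N : ℝ) + s)) := by
  have hpos : 0 < ‖x - p‖ := hr.trans_le hx
  have h1 : ‖x‖ ≤ ‖x - p‖ + ‖p‖ := by
    calc ‖x‖ = ‖(x - p) + p‖ := by congr 1; abel
      _ ≤ _ := norm_add_le _ _
  have h2 : 1 + ‖x‖ ≤ ((1 + R) / r + 1) * ‖x - p‖ := by
    have : 1 + R ≤ (1 + R) / r * ‖x - p‖ := by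
      rw [div_mul_eq_mul_div, le_div_iff₀ hr]
      gcongr
    linarith
  have h3 : (1 + ‖x‖) ^ ((N : ℝ) + s) ≤
      ((1 + R) / r + 1) ^ ((N : ℝ) + s) * ‖x - p‖ ^ ((N : ℝ) + s) := by
    rw [← Real.mul_rpow (by positivity) hpos.le]
    exact Real.rpow_le_rpow (by positivity) h2 (by positivity)
  rw [fracKernel, mul_one_div, div_le_div_iff₀ (by positivity) (by positivity), one_mul]
  exact h3

lemma exists_taylor_le {F : Type*} [NormedAddCommGroup F] [NormedSpace ℝ F] {u : 𝔼 → F}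
    (hu : ContDiff ℝ ∞ u) (R : ℝ) : ∃ L, 0 < L ∧ ∀ x ∈ Metric.closedBall (0 : 𝔼) R,
      ∀ y ∈ Metric.closedBall (0 : 𝔼) R,
        ‖u x - u y - fderiv ℝ u y (x - y)‖ ≤ L * ‖x - y‖ ^ 2 := by
  obtain ⟨L, hL0, hL⟩ := exists_lipschitz_on_ball (hu.fderiv_right (m := ∞) (by simp)) R
  refine ⟨L, hL0, fun x hx y hy => ?_⟩
  have := Convex.norm_image_sub_le_of_norm_fderiv_le' (𝕜 := ℝ) (f := u) (φ := fderiv ℝ u y)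
    (C := L * ‖x - y‖) (s := Metric.closedBall 0 R ∩ Metric.closedBall y ‖x - y‖)
    (fun z _ => hu.differentiable (by simp) z) (fun z hz => ?_)
    ((convex_closedBall _ _).inter (convex_closedBall _ _))
    (x := y) (y := x) ⟨hy, by simp⟩ ⟨hx, by simp [dist_eq_norm]⟩
  · rwa [mul_assoc, ← sq] at this
  · refine (hL z hz.1 y hy).trans ?_
    have := hz.2
    rw [Metric.mem_closedBall, dist_eq_norm] at this
    gcongr

/-! ### Uniform bounds for singular integrals -/

/-- Uniform integrability of `min(1, |x - p|²) |x - p|^{-(N+s)}` on the boundary. -/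
lemma BoundaryData.exists_lintegral_surface_le {E : Set 𝔼} {ρ : 𝔼 → ℝ} {n : 𝔼 → 𝔼}
    (H : BoundaryData E ρ n) {s : ℝ} (hs0 : 0 < s) (hs1 : s < 1)
    (harea : Integrable (fun x : 𝔼 => 1 / (1 + ‖x‖) ^ ((N : ℝ) + s)) (surfaceMeasure E))
    (R : ℝ) : ∃ C, 0 ≤ C ∧ ∀ p ∈ frontier E, ‖p‖ ≤ R →
      ∫⁻ x, ENNReal.ofReal (min 1 (‖x - p‖ ^ 2) * fracKernel s (x - p)) ∂(surfaceMeasure E) ≤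
        ENNReal.ofReal C := by
  obtain ⟨C₀, r, hC0, hr, hr1, hC⟩ := H.exists_surfaceMeasure_closedBall_le R
  have hN : (1 : ℝ) ≤ N := by exact_mod_cast H.one_le
  set a : ℝ := (N : ℝ) + s - 2 with ha
  have ha0 : a ≠ 0 := by
    intro h
    rcases H.one_le.eq_or_lt with h1 | h1
    · rw [← h1] at ha; push_cast at ha; linarith
    · have : (2 : ℝ) ≤ N := by exact_mod_cast h1
      linarith
  set A : ℝ := ∫ x, 1 / (1 + ‖x‖) ^ ((N : ℝ) + s) ∂(surfaceMeasure E) with hA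
  have hA0 : 0 ≤ A := integral_nonneg fun x => by positivity
  set M : ℝ := ((1 + max R 0) / r + 1) ^ ((N : ℝ) + s) with hM
  have hM0 : 0 ≤ M := by positivity
  set C₁ : ℝ := 2 ^ |a| * C₀ * r ^ ((N : ℝ) - 1 - a) * (1 - (1 / 2) ^ ((N : ℝ) - 1 - a))⁻¹ with hC₁
  have hC₁0 : 0 ≤ C₁ := by
    have : (1 / 2 : ℝ) ^ ((N : ℝ) - 1 - a) ≤ 1 :=
      Real.rpow_le_one (by norm_num) (by norm_num) (by linarith)
    have : 0 ≤ (1 - (1 / 2 : ℝ) ^ ((N : ℝ) - 1 - a))⁻¹ := inv_nonneg.2 (by linarith)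
    positivity
  refine ⟨C₁ + M * A, by positivity, fun p hp hpR => ?_⟩
  rw [← lintegral_add_compl _ (Metric.isClosed_closedBall (x := p) (ε := r)).measurableSet,
    ENNReal.ofReal_add hC₁0 (by positivity)]
  refine add_le_add ?_ ?_
  · refine le_trans (setLIntegral_mono' Metric.isClosed_closedBall.measurableSet fun x _ => ?_)
      (lintegral_norm_sub_rpow_le (a := a) hr hC0 (by linarith) ha0 (hC p hp hpR))
    refine ENNReal.ofReal_le_ofReal ?_
    rcases (norm_nonneg (x - p)).eq_or_lt with h0 | h0
    · rw [← h0, Real.zero_rpow (neg_ne_zero.2 ha0)]; simp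
    · calc min 1 (‖x - p‖ ^ 2) * fracKernel s (x - p) ≤ ‖x - p‖ ^ 2 * fracKernel s (x - p) := by
            gcongr
            · exact fracKernel_nonneg _ _
            · exact min_le_right _ _
        _ = ‖x - p‖ ^ (-a) := by
            rw [fracKernel_eq_rpow, ← Real.rpow_natCast, ← Real.rpow_add h0, ha]
            congr 1; push_cast; ring
        _ ≤ _ := le_rfl
  · have hi : Integrable (fun x : 𝔼 => M * (1 / (1 + ‖x‖) ^ ((N : ℝ) + s))) (surfaceMeasure E) :=
      harea.const_mul M
    calc _ ≤ ∫⁻ x in (Metric.closedBall p r)ᶜ,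
          ENNReal.ofReal (M * (1 / (1 + ‖x‖) ^ ((N : ℝ) + s))) ∂(surfaceMeasure E) := by
          refine setLIntegral_mono' Metric.isClosed_closedBall.measurableSet.compl fun x hx => ?_
          refine ENNReal.ofReal_le_ofReal ?_
          rw [mem_compl_iff, Metric.mem_closedBall, dist_eq_norm, not_le] at hx
          calc min 1 (‖x - p‖ ^ 2) * fracKernel s (x - p) ≤ 1 * fracKernel s (x - p) := by
                gcongr
                · exact fracKernel_nonneg _ _
                · exact min_le_left _ _
            _ ≤ _ := by
                rw [one_mul]
                exact fracKernel_sub_le hs0 (le_max_right _ _) hr (hpR.trans (le_max_left _ _)) hx.le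
      _ ≤ ∫⁻ x, ENNReal.ofReal (M * (1 / (1 + ‖x‖) ^ ((N : ℝ) + s))) ∂(surfaceMeasure E) :=
          setLIntegral_le_lintegral _ _
      _ = ENNReal.ofReal (∫ x, M * (1 / (1 + ‖x‖) ^ ((N : ℝ) + s)) ∂(surfaceMeasure E)) :=
          (ofReal_integral_eq_lintegral_ofReal hi (Eventually.of_forall fun x => by
            simp only [Pi.zero_apply]; positivity)).symm
      _ = _ := by rw [integral_const_mul]

/-- `χ_E - χ_{Eᶜ}`. -/
def sideSign (E : Set (EuclideanSpace ℝ (Fin N))) (x : EuclideanSpace ℝ (Fin N)) : ℝ :=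
  E.indicator 1 x - Eᶜ.indicator 1 x

lemma sideSign_of_mem {E : Set 𝔼} {x : 𝔼} (hx : x ∈ E) : sideSign E x = 1 := by
  simp [sideSign, hx]

lemma sideSign_of_notMem {E : Set 𝔼} {x : 𝔼} (hx : x ∉ E) : sideSign E x = -1 := by
  simp [sideSign, hx]

lemma abs_sideSign (E : Set 𝔼) (x : 𝔼) : |sideSign E x| = 1 := by
  by_cases hx : x ∈ E
  · rw [sideSign_of_mem hx, abs_one]
  · rw [sideSign_of_notMem hx, abs_neg, abs_one]

lemma measurable_sideSign {E : Set 𝔼} (hE : MeasurableSet E) : Measurable (sideSign E) :=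
  (measurable_one.indicator hE).sub (measurable_one.indicator hE.compl)

lemma exists_volume_slab_le (hN : 1 ≤ N) {c : ℝ} (hc : 0 ≤ c) :
    ∃ C, 0 ≤ C ∧ ∀ n : 𝔼, ‖n‖ = 1 → ∀ t, 0 < t →
      volume (Metric.closedBall (0 : 𝔼) t ∩ {z | |inner ℝ n z| ≤ c * ‖z‖ ^ 2}) ≤
        ENNReal.ofReal (C * t ^ ((N : ℝ) + 1)) := by
  obtain ⟨m, rfl⟩ := Nat.exists_eq_add_of_le' hN
  set v := volume.real (Metric.closedBall (0 : EuclideanSpace ℝ (Fin m)) 1)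
  have hv0 : 0 ≤ v := measureReal_nonneg
  refine ⟨v * (2 * c), by positivity, fun n hn t ht => ?_⟩
  obtain ⟨ι, π, hdec, hπ, hnorm, hmp⟩ := exists_orthogonal_coordinates hn
  set S := Metric.closedBall (0 : EuclideanSpace ℝ (Fin (m + 1))) t ∩
    {z | |inner ℝ n z| ≤ c * ‖z‖ ^ 2}
  have hS : MeasurableSet S := by
    refine Metric.isClosed_closedBall.measurableSet.inter (IsClosed.measurableSet ?_)
    exact isClosed_le (by fun_prop) (by fun_prop)
  rw [← hmp.measure_preimage hS.nullMeasurableSet]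
  have hin : ∀ y (τ : ℝ), inner ℝ n (ι y + τ • n) = τ := fun y τ => by
    have h1 := hdec (ι y + τ • n)
    rw [hπ, add_right_inj] at h1
    exact smul_left_injective ℝ (by rintro rfl; simp at hn) h1
  have hsub : (fun q : EuclideanSpace ℝ (Fin m) × ℝ => ι q.1 + q.2 • n) ⁻¹' S ⊆
      Metric.closedBall 0 t ×ˢ Icc (-(c * t ^ 2)) (c * t ^ 2) := by
    rintro ⟨y, τ⟩ ⟨h1, h2⟩
    simp only [mem_ofPred_eq, hin] at h2
    rw [mem_closedBall_zero_iff] at h1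
    have h3 := hnorm (ι y + τ • n)
    rw [hπ, hin] at h3
    simp only at h1 h2
    refine ⟨?_, abs_le.1 (h2.trans (by gcongr))⟩
    rw [mem_closedBall_zero_iff]
    refine le_trans (le_of_sq_le_sq ?_ (norm_nonneg _)) h1
    rw [h3]; nlinarith [sq_nonneg τ]
  refine (measure_mono hsub).trans (le_of_eq ?_)
  have hfin : volume (Metric.closedBall (0 : EuclideanSpace ℝ (Fin m)) 1) ≠ ⊤ :=
    (isCompact_closedBall _ _).measure_lt_top.ne
  rw [Measure.volume_eq_prod, Measure.prod_prod, Measure.addHaar_closedBall' _ _ ht.le,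
    Real.volume_Icc, ← ENNReal.ofReal_toReal hfin, ← ENNReal.ofReal_mul (by positivity),
    ← ENNReal.ofReal_mul (by positivity)]
  congr 1
  have : t ^ ((((m + 1 : ℕ) : ℝ)) + 1) = t ^ m * t ^ 2 := by
    rw [← pow_add, ← Real.rpow_natCast]; congr 1; push_cast; ring
  rw [this]
  simp only [v, Measure.real, finrank_euclideanSpace, Fintype.card_fin]
  ring

/-- Second order behaviour of a set with smooth boundary: the defect of symmetry of `E` about a
boundary point `p` is contained in a paraboloid slab about the tangent plane. -/
lemma BoundaryData.exists_slab {E : Set 𝔼} {ρ : 𝔼 → ℝ} {n : 𝔼 → 𝔼} (H : BoundaryData E ρ n)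
    (R : ℝ) : ∃ c, 0 ≤ c ∧ ∀ p ∈ frontier E, ‖p‖ ≤ R → ∀ z : 𝔼, ‖z‖ ≤ 1 →
      sideSign E (p + z) + sideSign E (p - z) ≠ 0 → |inner ℝ (n p) z| ≤ c * ‖z‖ ^ 2 := by
  obtain ⟨L, hL0, hL⟩ := exists_taylor_le H.defining.contDiff (R + 1)
  have hK : IsCompact (frontier E ∩ Metric.closedBall (0 : 𝔼) R) :=
    (isCompact_closedBall _ _).inter_left isClosed_frontier
  obtain ⟨g₀, hg0, hg⟩ := hK.exists_forall_le' (f := fun p => ‖gradient ρ p‖) (a := 0)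
    (contDiff_gradient H.defining.contDiff).continuous.norm.continuousOn
    (fun p hp => norm_pos_iff.2 (H.defining.gradient_ne_zero p hp.1))
  refine ⟨L / g₀, by positivity, fun p hp hpR z hz hne => ?_⟩
  have hpB : p ∈ Metric.closedBall (0 : 𝔼) (R + 1) := by simp; linarith
  have hB : ∀ w : 𝔼, ‖w‖ ≤ 1 → p + w ∈ Metric.closedBall (0 : 𝔼) (R + 1) := fun w hw => by
    rw [mem_closedBall_zero_iff]
    exact (norm_add_le _ _).trans (by linarith)
  have h0 : ρ p = 0 := (H.defining.frontier_iff p).1 hp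
  have hT : ∀ w : 𝔼, ‖w‖ ≤ 1 → |ρ (p + w) - inner ℝ (gradient ρ p) w| ≤ L * ‖w‖ ^ 2 :=
    fun w hw => by
      have := hL _ (hB w hw) p hpB
      rwa [h0, sub_zero, add_sub_cancel_left, ← inner_gradient] at this
  have h1 := abs_le.1 (hT z hz)
  have h2 := abs_le.1 (hT (-z) (by rwa [norm_neg]))
  rw [inner_neg_right, norm_neg, ← sub_eq_add_neg] at h2
  have hkey : |inner ℝ (gradient ρ p) z| ≤ L * ‖z‖ ^ 2 := by
    by_cases ha : p + z ∈ E <;> by_cases hb : p - z ∈ E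
    · have ha' := (H.defining.mem_iff _).1 ha
      have hb' := (H.defining.mem_iff _).1 hb
      rw [abs_le]; constructor <;> linarith
    · rw [sideSign_of_mem ha, sideSign_of_notMem hb] at hne; norm_num at hne
    · rw [sideSign_of_notMem ha, sideSign_of_mem hb] at hne; norm_num at hne
    · have ha' := not_lt.1 fun h => ha ((H.defining.mem_iff _).2 h)
      have hb' := not_lt.1 fun h => hb ((H.defining.mem_iff _).2 h)
      rw [abs_le]; constructor <;> linarith
  rw [gradient_eq_smul_outerNormal (H.defining.isDefiningFunction hp), inner_smul_left,
    conj_trivial, ← H.eq_outerNormal p hp, abs_mul, abs_norm] at hkey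
  have := hg p ⟨hp, by simpa using hpR⟩
  rw [div_mul_eq_mul_div, le_div_iff₀ hg0, mul_comm]
  exact (mul_le_mul_of_nonneg_right this (abs_nonneg _)).trans hkey

lemma integrable_one_div_one_add_norm {s : ℝ} (hs : 0 < s) :
    Integrable (fun x : 𝔼 => 1 / (1 + ‖x‖) ^ ((N : ℝ) + s)) := by
  have := integrable_one_add_norm (E := 𝔼) (μ := volume) (r := (N : ℝ) + s) (by simp [hs])
  refine this.congr (Eventually.of_forall fun x => ?_)
  simp only
  rw [Real.rpow_neg (by positivity), one_div]

/-- Uniform integrability of the symmetrized integrand of the nonlocal mean curvature. -/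
lemma BoundaryData.exists_lintegral_symm_le {E : Set 𝔼} {ρ : 𝔼 → ℝ} {n : 𝔼 → 𝔼}
    (H : BoundaryData E ρ n) {s : ℝ} (hs0 : 0 < s) (hs1 : s < 1) (R : ℝ) :
    ∃ C, 0 ≤ C ∧ ∀ p ∈ frontier E, ‖p‖ ≤ R →
      ∫⁻ z, ENNReal.ofReal (|sideSign E (p + z) + sideSign E (p - z)| * fracKernel s z) ≤
        ENNReal.ofReal C := by
  obtain ⟨c, hc0, hc⟩ := H.exists_slab R
  obtain ⟨C₀, hC0, hC⟩ := exists_volume_slab_le H.one_le hc0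
  have hN : (1 : ℝ) ≤ N := by exact_mod_cast H.one_le
  set A : ℝ := ∫ x : 𝔼, 1 / (1 + ‖x‖) ^ ((N : ℝ) + s) with hA
  have hA0 : 0 ≤ A := integral_nonneg fun x => by positivity
  set M : ℝ := 2 * ((1 + 0) / 1 + 1) ^ ((N : ℝ) + s) with hM
  have hM0 : 0 ≤ M := by positivity
  set a : ℝ := (N : ℝ) + s with ha
  set C₁ : ℝ := 2 ^ |a| * C₀ * 1 ^ ((N : ℝ) + 1 - a) * (1 - (1 / 2) ^ ((N : ℝ) + 1 - a))⁻¹ with hC₁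
  have hC₁0 : 0 ≤ C₁ := by
    have : (1 / 2 : ℝ) ^ ((N : ℝ) + 1 - a) ≤ 1 :=
      Real.rpow_le_one (by norm_num) (by norm_num) (by linarith)
    have : 0 ≤ (1 - (1 / 2 : ℝ) ^ ((N : ℝ) + 1 - a))⁻¹ := inv_nonneg.2 (by linarith)
    positivity
  have hle2 : ∀ p z, |sideSign E (p + z) + sideSign E (p - z)| ≤ 2 := fun p z => by
    refine (abs_add_le _ _).trans ?_
    rw [abs_sideSign, abs_sideSign]; norm_num
  refine ⟨2 * C₁ + M * A, by positivity, fun p hp hpR => ?_⟩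
  rw [← lintegral_add_compl _ (Metric.isClosed_closedBall (x := (0 : 𝔼)) (ε := 1)).measurableSet,
    ENNReal.ofReal_add (by positivity) (by positivity)]
  refine add_le_add ?_ ?_
  · set S : Set 𝔼 := {z | |inner ℝ (n p) z| ≤ c * ‖z‖ ^ 2}
    have hS : MeasurableSet S :=
      (isClosed_le (by fun_prop) (by fun_prop)).measurableSet
    have hpow := lintegral_norm_sub_rpow_le (μ := volume.restrict S) (p := (0 : 𝔼)) (r := 1)
      (C := C₀) (d := (N : ℝ) + 1) (a := a) one_pos hC0 (by linarith) (by positivity)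
      (fun t ht _ => by
        rw [Measure.restrict_apply Metric.isClosed_closedBall.measurableSet]
        exact hC (n p) (H.norm_eq_one hp) t ht)
    calc _ ≤ ∫⁻ z in Metric.closedBall (0 : 𝔼) 1,
          S.indicator (fun z => ENNReal.ofReal 2 * ENNReal.ofReal (‖z - 0‖ ^ (-a))) z := by
          refine setLIntegral_mono' Metric.isClosed_closedBall.measurableSet fun z hz => ?_
          rw [mem_closedBall_zero_iff] at hz
          by_cases hne : sideSign E (p + z) + sideSign E (p - z) = 0
          · rw [hne, abs_zero, zero_mul, ENNReal.ofReal_zero]; exact zero_le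
          · rw [indicator_of_mem (show z ∈ S from hc p hp hpR z hz hne),
              ← ENNReal.ofReal_mul (by norm_num), sub_zero, fracKernel_eq_rpow]
            exact ENNReal.ofReal_le_ofReal (by gcongr; exact hle2 p z)
      _ = ENNReal.ofReal 2 * ∫⁻ z in Metric.closedBall (0 : 𝔼) 1,
            ENNReal.ofReal (‖z - 0‖ ^ (-a)) ∂(volume.restrict S) := by
          rw [← lintegral_const_mul _ (by fun_prop), lintegral_indicator hS,
            Measure.restrict_restrict hS,
            Measure.restrict_restrict Metric.isClosed_closedBall.measurableSet, inter_comm]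
      _ ≤ _ := by
          rw [ENNReal.ofReal_mul (by norm_num)]
          exact mul_le_mul_right hpow _
  · have hi : Integrable (fun x : 𝔼 => M * (1 / (1 + ‖x‖) ^ ((N : ℝ) + s))) :=
      (integrable_one_div_one_add_norm hs0).const_mul M
    calc _ ≤ ∫⁻ x in (Metric.closedBall (0 : 𝔼) 1)ᶜ,
          ENNReal.ofReal (M * (1 / (1 + ‖x‖) ^ ((N : ℝ) + s))) := by
          refine setLIntegral_mono' Metric.isClosed_closedBall.measurableSet.compl fun x hx => ?_
          refine ENNReal.ofReal_le_ofReal ?_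
          rw [mem_compl_iff, Metric.mem_closedBall, dist_eq_norm, not_le] at hx
          have := fracKernel_sub_le hs0 le_rfl one_pos (p := (0 : 𝔼)) (by simp) hx.le
          rw [sub_zero] at this
          calc _ ≤ 2 * fracKernel s x := by
                gcongr
                · exact fracKernel_nonneg _ _
                · exact hle2 p x
            _ ≤ _ := by rw [hM, mul_assoc]; gcongr
      _ ≤ ∫⁻ x : 𝔼, ENNReal.ofReal (M * (1 / (1 + ‖x‖) ^ ((N : ℝ) + s))) :=
          setLIntegral_le_lintegral _ _
      _ = ENNReal.ofReal (∫ x : 𝔼, M * (1 / (1 + ‖x‖) ^ ((N : ℝ) + s))) :=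
          (ofReal_integral_eq_lintegral_ofReal hi (Eventually.of_forall fun x => by
            simp only [Pi.zero_apply]; positivity)).symm
      _ = _ := by rw [integral_const_mul]

/-! ### Convergence of the nonlocal mean curvature -/

lemma integrableOn_fracKernel_compl_ball {μ : Measure 𝔼} {s : ℝ} (hs : 0 < s)
    (hμ : Integrable (fun x : 𝔼 => 1 / (1 + ‖x‖) ^ ((N : ℝ) + s)) μ) (p : 𝔼) {ε : ℝ} (hε : 0 < ε) :
    IntegrableOn (fun x => fracKernel s (x - p)) (Metric.ball p ε)ᶜ μ := by
  refine Integrable.mono' (hμ.integrableOn.const_mul (((1 + ‖p‖) / ε + 1) ^ ((N : ℝ) + s)))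
    ((measurable_fracKernel s).comp (measurable_id.sub_const p)).aestronglyMeasurable ?_
  refine (ae_restrict_iff' Metric.isOpen_ball.measurableSet.compl).2 (Eventually.of_forall fun x hx => ?_)
  rw [mem_compl_iff, Metric.mem_ball, dist_eq_norm, not_lt] at hx
  rw [Real.norm_of_nonneg (fracKernel_nonneg _ _)]
  exact fracKernel_sub_le hs (norm_nonneg p) hε le_rfl hx

lemma tendsto_setIntegral_compl_ball {μ : Measure 𝔼} {φ : 𝔼 → ℝ} (hφ : Integrable φ μ) {p : 𝔼}
    (hp : φ p = 0) :
    Tendsto (fun ε => ∫ x in (Metric.ball p ε)ᶜ, φ x ∂μ) (𝓝[>] (0 : ℝ)) (𝓝 (∫ x, φ x ∂μ)) := by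
  simp_rw [← integral_indicator (Metric.isOpen_ball (x := p)).measurableSet.compl]
  refine tendsto_integral_filter_of_dominated_convergence (fun x => ‖φ x‖) ?_ ?_ hφ.norm ?_
  · exact Eventually.of_forall fun ε =>
      hφ.aestronglyMeasurable.indicator Metric.isOpen_ball.measurableSet.compl
  · exact Eventually.of_forall fun ε => Eventually.of_forall fun x => norm_indicator_le_norm_self _ _
  · refine Eventually.of_forall fun x => ?_
    by_cases hx : x = p
    · subst hx
      refine tendsto_const_nhds.congr fun ε => ?_
      by_cases h : x ∈ (Metric.ball x ε)ᶜ
      · rw [indicator_of_mem h]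
      · rw [indicator_of_notMem h, hp]
    · refine tendsto_const_nhds.congr' ?_
      have : 0 < dist x p := dist_pos.2 hx
      filter_upwards [Ioo_mem_nhdsGT this] with ε hε
      rw [indicator_of_mem]
      simp only [mem_compl_iff, Metric.mem_ball, not_lt]
      exact hε.2.le

lemma curvatureIntegrand_eq (s : ℝ) (E : Set 𝔼) (p x : 𝔼) :
    curvatureIntegrand s E p x = sideSign E x * fracKernel s (x - p) := by
  rw [curvatureIntegrand, fracKernel, mul_one_div, sideSign]

lemma BoundaryData.integrable_symm {E : Set 𝔼} {ρ : 𝔼 → ℝ} {n : 𝔼 → 𝔼}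
    (H : BoundaryData E ρ n) {s : ℝ} (hs0 : 0 < s) (hs1 : s < 1) {p : 𝔼} (hp : p ∈ frontier E) :
    Integrable fun z => (sideSign E (p + z) + sideSign E (p - z)) * fracKernel s z := by
  obtain ⟨C, -, hC⟩ := H.exists_lintegral_symm_le hs0 hs1 ‖p‖
  have hm := measurable_sideSign H.isOpen.measurableSet
  refine ⟨(((hm.comp (measurable_const_add p)).add (hm.comp (measurable_const_sub p))).mul
    (measurable_fracKernel s)).aestronglyMeasurable, ?_⟩
  rw [hasFiniteIntegral_iff_norm]
  refine lt_of_le_of_lt (le_of_eq ?_) ((hC p hp le_rfl).trans_lt ENNReal.ofReal_lt_top)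
  refine lintegral_congr fun z => ?_
  rw [norm_mul, Real.norm_eq_abs, Real.norm_of_nonneg (fracKernel_nonneg _ _)]

lemma integral_sideSign_mul_eq {E : Set 𝔼} (hE : MeasurableSet E) {κ : 𝔼 → ℝ}
    (hκ : Integrable κ) (hκe : ∀ z, κ (-z) = κ z) (p : 𝔼) :
    ∫ x, sideSign E x * κ (x - p) =
      1 / 2 * ∫ z, (sideSign E (p + z) + sideSign E (p - z)) * κ z := by
  have hb : ∀ q : 𝔼 → 𝔼, Measurable q → Integrable fun z => sideSign E (q z) * κ z := fun q hq =>
    hκ.bdd_mul ((measurable_sideSign hE).comp hq).aestronglyMeasurable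
      (c := 1) (Eventually.of_forall fun z => by
        rw [Real.norm_eq_abs, abs_sideSign])
  have h1 : ∫ x, sideSign E x * κ (x - p) = ∫ z, sideSign E (p + z) * κ z := by
    rw [← integral_add_left_eq_self _ p]
    simp
  have h2 : ∫ x, sideSign E x * κ (x - p) = ∫ z, sideSign E (p - z) * κ z := by
    rw [← integral_sub_left_eq_self _ _ p]
    simp [hκe]
  have h3 : ∫ z, (sideSign E (p + z) + sideSign E (p - z)) * κ z =
      (∫ z, sideSign E (p + z) * κ z) + ∫ z, sideSign E (p - z) * κ z := by
    rw [← integral_add (hb _ (measurable_const_add p)) (hb _ (measurable_const_sub p))]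
    simp_rw [add_mul]
  rw [h3, ← h1, ← h2]; ring

lemma BoundaryData.tendsto_curvature {E : Set 𝔼} {ρ : 𝔼 → ℝ} {n : 𝔼 → 𝔼}
    (H : BoundaryData E ρ n) {s : ℝ} (hs0 : 0 < s) (hs1 : s < 1) {p : 𝔼} (hp : p ∈ frontier E) :
    Tendsto (fun ε => ∫ x in (Metric.ball p ε)ᶜ, curvatureIntegrand s E p x) (𝓝[>] (0 : ℝ))
      (𝓝 (1 / 2 * ∫ z, (sideSign E (p + z) + sideSign E (p - z)) * fracKernel s z)) := by
  have h1 := (tendsto_setIntegral_compl_ball (H.integrable_symm hs0 hs1 hp) (p := 0)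
    (by rw [fracKernel_zero hs0, mul_zero])).const_mul (1 / 2)
  refine h1.congr' ?_
  filter_upwards [self_mem_nhdsWithin] with ε (hε : 0 < ε)
  set κ : 𝔼 → ℝ := (Metric.ball (0 : 𝔼) ε)ᶜ.indicator (fracKernel s) with hκ
  have hκi : Integrable κ := by
    have := integrableOn_fracKernel_compl_ball hs0 (integrable_one_div_one_add_norm hs0)
      (0 : 𝔼) hε
    simp_rw [sub_zero] at this
    exact this.integrable_indicator Metric.isOpen_ball.measurableSet.compl
  have hκe : ∀ z, κ (-z) = κ z := fun z => by
    classical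
    simp only [hκ, indicator_apply, fracKernel_neg, mem_compl_iff, Metric.mem_ball, dist_zero_right,
      norm_neg]
  have h2 := integral_sideSign_mul_eq H.isOpen.measurableSet hκi hκe p
  rw [← integral_indicator Metric.isOpen_ball.measurableSet.compl,
    ← integral_indicator Metric.isOpen_ball.measurableSet.compl]
  have e1 : ∀ z, (Metric.ball (0 : 𝔼) ε)ᶜ.indicator
      (fun z => (sideSign E (p + z) + sideSign E (p - z)) * fracKernel s z) z =
      (sideSign E (p + z) + sideSign E (p - z)) * κ z := fun z => by
    classical
    simp only [hκ, indicator_apply, mul_ite, mul_zero]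
  have e2 : ∀ x, (Metric.ball p ε)ᶜ.indicator (curvatureIntegrand s E p) x =
      sideSign E x * κ (x - p) := fun x => by
    classical
    simp only [hκ, indicator_apply, mul_ite, mul_zero, curvatureIntegrand_eq, mem_compl_iff,
      Metric.mem_ball, dist_eq_norm, sub_zero]
  simp_rw [e1, e2, h2]

lemma BoundaryData.pvConverges_curvature {E : Set 𝔼} {ρ : 𝔼 → ℝ} {n : 𝔼 → 𝔼}
    (H : BoundaryData E ρ n) {s : ℝ} (hs0 : 0 < s) (hs1 : s < 1) {p : 𝔼} (hp : p ∈ frontier E) :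
    PVConverges volume (curvatureIntegrand s E p) p := by
  refine ⟨fun ε hε => ?_, _, H.tendsto_curvature hs0 hs1 hp⟩
  have := integrableOn_fracKernel_compl_ball hs0 (integrable_one_div_one_add_norm hs0) p hε
  simp_rw [IntegrableOn, funext (curvatureIntegrand_eq s E p)]
  exact Integrable.bdd_mul this (measurable_sideSign H.isOpen.measurableSet).aestronglyMeasurable
      (c := 1) (Eventually.of_forall fun z => by
        rw [Real.norm_eq_abs, abs_sideSign])

lemma BoundaryData.nonlocalMeanCurvature_eq {E : Set 𝔼} {ρ : 𝔼 → ℝ} {n : 𝔼 → 𝔼}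
    (H : BoundaryData E ρ n) {s : ℝ} (hs0 : 0 < s) (hs1 : s < 1) {p : 𝔼} (hp : p ∈ frontier E) :
    nonlocalMeanCurvature s E p =
      1 / 2 * ∫ z, (sideSign E (p + z) + sideSign E (p - z)) * fracKernel s z :=
  (H.tendsto_curvature hs0 hs1 hp).limUnder_eq

/-- For an even kernel dominated by the fractional kernel, the curvature integrals are uniformly
bounded at boundary points. -/
lemma BoundaryData.exists_abs_symm_le {E : Set 𝔼} {ρ : 𝔼 → ℝ} {n : 𝔼 → 𝔼}
    (H : BoundaryData E ρ n) {s : ℝ} (hs0 : 0 < s) (hs1 : s < 1) (R : ℝ) :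
    ∃ C, 0 ≤ C ∧ ∀ κ : 𝔼 → ℝ, (∀ z, |κ z| ≤ fracKernel s z) → ∀ p ∈ frontier E, ‖p‖ ≤ R →
      |1 / 2 * ∫ z, (sideSign E (p + z) + sideSign E (p - z)) * κ z| ≤ C := by
  obtain ⟨C, hC0, hC⟩ := H.exists_lintegral_symm_le hs0 hs1 R
  refine ⟨C, hC0, fun κ hκ p hp hpR => ?_⟩
  have h1 : ‖∫ z, (sideSign E (p + z) + sideSign E (p - z)) * κ z‖ ≤
      ∫ z, |sideSign E (p + z) + sideSign E (p - z)| * fracKernel s z := by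
    refine norm_integral_le_of_norm_le ?_ (Eventually.of_forall fun z => ?_)
    · refine (H.integrable_symm hs0 hs1 hp).norm.congr (Eventually.of_forall fun z => ?_)
      simp only [norm_mul, Real.norm_eq_abs, abs_of_nonneg (fracKernel_nonneg s z)]
    · rw [norm_mul, Real.norm_eq_abs, Real.norm_eq_abs]
      gcongr
      exact hκ z
  have h2 : ∫ z, |sideSign E (p + z) + sideSign E (p - z)| * fracKernel s z ≤ C := by
    have hi : Integrable fun z => |sideSign E (p + z) + sideSign E (p - z)| * fracKernel s z := by
      refine (H.integrable_symm hs0 hs1 hp).norm.congr (Eventually.of_forall fun z => ?_)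
      simp only [norm_mul, Real.norm_eq_abs, abs_of_nonneg (fracKernel_nonneg s z)]
    rw [← ENNReal.ofReal_le_ofReal_iff hC0, ofReal_integral_eq_lintegral_ofReal hi
      (Eventually.of_forall fun z => mul_nonneg (abs_nonneg _) (fracKernel_nonneg _ _))]
    exact hC p hp hpR
  rw [Real.norm_eq_abs] at h1
  rw [abs_mul, abs_of_pos (by norm_num : (0 : ℝ) < 1 / 2)]
  linarith [abs_nonneg (∫ z, (sideSign E (p + z) + sideSign E (p - z)) * κ z)]

lemma measurable_integral_symm {E : Set 𝔼} (hE : MeasurableSet E) {κ : 𝔼 → ℝ} (hκ : Measurable κ) :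
    StronglyMeasurable fun p => 1 / 2 * ∫ z, (sideSign E (p + z) + sideSign E (p - z)) * κ z := by
  have hm := measurable_sideSign hE
  refine StronglyMeasurable.const_mul (StronglyMeasurable.integral_prod_right'
    (f := fun q : 𝔼 × 𝔼 => (sideSign E (q.1 + q.2) + sideSign E (q.1 - q.2)) * κ q.2) ?_) _
  exact (((hm.comp (measurable_fst.add measurable_snd)).add
    (hm.comp (measurable_fst.sub measurable_snd))).mul (hκ.comp measurable_snd)).stronglyMeasurable

/-! ### Weights on product spaces -/

lemma BoundaryData.integrable_surface_weight {E : Set 𝔼} {ρ : 𝔼 → ℝ} {n : 𝔼 → 𝔼}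
    (H : BoundaryData E ρ n) {s : ℝ} (hs0 : 0 < s) (hs1 : s < 1)
    (harea : Integrable (fun x : 𝔼 => 1 / (1 + ‖x‖) ^ ((N : ℝ) + s)) (surfaceMeasure E)) (R : ℝ) :
    Integrable (fun q : 𝔼 × 𝔼 => (Metric.closedBall (0 : 𝔼) R).indicator 1 q.1 *
      (min 1 (‖q.1 - q.2‖ ^ 2) * fracKernel s (q.1 - q.2)))
      ((surfaceMeasure E).prod (surfaceMeasure E)) := by
  haveI := H.isLocallyFiniteMeasure
  obtain ⟨C, hC0, hC⟩ := H.exists_lintegral_surface_le hs0 hs1 harea R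
  set B := Metric.closedBall (0 : 𝔼) R
  have hB : MeasurableSet B := Metric.isClosed_closedBall.measurableSet
  have hm : Measurable fun q : 𝔼 × 𝔼 => B.indicator (1 : 𝔼 → ℝ) q.1 *
      (min 1 (‖q.1 - q.2‖ ^ 2) * fracKernel s (q.1 - q.2)) := by
    have : Measurable (B.indicator (1 : 𝔼 → ℝ)) := measurable_one.indicator hB
    fun_prop
  refine ⟨hm.aestronglyMeasurable, ?_⟩
  have hnn : ∀ q : 𝔼 × 𝔼, 0 ≤ B.indicator (1 : 𝔼 → ℝ) q.1 *
      (min 1 (‖q.1 - q.2‖ ^ 2) * fracKernel s (q.1 - q.2)) := fun q =>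
    mul_nonneg (indicator_nonneg (fun _ _ => zero_le_one) _)
      (mul_nonneg (le_min zero_le_one (sq_nonneg _)) (fracKernel_nonneg _ _))
  rw [hasFiniteIntegral_iff_ofReal (Eventually.of_forall hnn), lintegral_prod _
    hm.ennreal_ofReal.aemeasurable]
  calc _ ≤ ∫⁻ x, B.indicator (fun _ => ENNReal.ofReal C) x ∂(surfaceMeasure E) := by
        refine lintegral_mono_ae ?_
        filter_upwards [ae_mem_frontier E] with x hx
        by_cases hxB : x ∈ B
        · simp only [indicator_of_mem hxB, Pi.one_apply, one_mul]
          refine le_trans (le_of_eq ?_) (hC x hx (by simpa [B] using hxB))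
          refine lintegral_congr fun y => ?_
          rw [norm_sub_rev, fracKernel_sub_comm]
        · simp [indicator_of_notMem hxB]
    _ < ⊤ := by
        rw [lintegral_indicator hB, setLIntegral_const]
        exact ENNReal.mul_lt_top ENNReal.ofReal_lt_top (isCompact_closedBall _ _).measure_lt_top

lemma IsGlobalDefiningFunction.integrable_weight {E : Set 𝔼} {ρ : 𝔼 → ℝ} (hN : 1 ≤ N)
    (hE : IsOpen E) (hρ : IsGlobalDefiningFunction E ρ) {s : ℝ} (hs0 : 0 < s) (hs1 : s < 1) (R : ℝ) :
    Integrable (fun q : 𝔼 × 𝔼 => {q : 𝔼 × 𝔼 | ‖q.1‖ ≤ R ∧ ¬ (q.1 ∈ E ↔ q.2 ∈ E)}.indicator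
      (fun q => fracKernel s (q.1 - q.2)) q) (volume.prod volume) := by
  obtain ⟨C, hC0, hC⟩ := hρ.exists_volume_layer_le R
  obtain ⟨L, hL0, hL⟩ := exists_lipschitz_on_ball hρ.contDiff (R + 1)
  have hN' : (1 : ℝ) ≤ N := by exact_mod_cast hN
  set D : Set (𝔼 × 𝔼) := {q : 𝔼 × 𝔼 | ‖q.1‖ ≤ R ∧ ¬ (q.1 ∈ E ↔ q.2 ∈ E)} with hD
  have hDm : MeasurableSet D := by
    have h1 : MeasurableSet {q : 𝔼 × 𝔼 | q.1 ∈ E} := measurable_fst hE.measurableSet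
    have h2 : MeasurableSet {q : 𝔼 × 𝔼 | q.2 ∈ E} := measurable_snd hE.measurableSet
    have h3 : MeasurableSet {q : 𝔼 × 𝔼 | ‖q.1‖ ≤ R} :=
      (isClosed_le (by fun_prop) (by fun_prop)).measurableSet
    exact h3.inter (h1.iff h2).compl
  have hm : Measurable (D.indicator fun q : 𝔼 × 𝔼 => fracKernel s (q.1 - q.2)) :=
    Measurable.indicator (by fun_prop) hDm
  refine ⟨hm.aestronglyMeasurable, ?_⟩
  rw [hasFiniteIntegral_iff_ofReal (Eventually.of_forall fun q =>
    indicator_nonneg (fun _ _ => fracKernel_nonneg _ _) q)]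
  rw [lintegral_prod _ hm.ennreal_ofReal.aemeasurable]
  -- substitute `y = x + z` and integrate in `x` first
  have e1 : ∀ x : 𝔼, ∫⁻ y, ENNReal.ofReal (D.indicator (fun q : 𝔼 × 𝔼 => fracKernel s (q.1 - q.2)) (x, y))
      = ∫⁻ z, {x | (x, x + z) ∈ D}.indicator (fun _ => ENNReal.ofReal (fracKernel s z)) x := fun x => by
    rw [← lintegral_add_left_eq_self _ x]
    refine lintegral_congr fun z => ?_
    by_cases h : (x, x + z) ∈ D
    · rw [indicator_of_mem h, indicator_of_mem (show x ∈ {x | (x, x + z) ∈ D} from h)]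
      simp only [sub_add_cancel_left, fracKernel_neg]
    · rw [indicator_of_notMem h, indicator_of_notMem (show x ∉ {x | (x, x + z) ∈ D} from h),
        ENNReal.ofReal_zero]
  have hDz : ∀ z, MeasurableSet {x : 𝔼 | (x, x + z) ∈ D} := fun z =>
    (measurable_id.prodMk (measurable_add_const z)) hDm
  simp_rw [e1]
  rw [lintegral_lintegral_swap]
  swap
  · have : MeasurableSet {q : 𝔼 × 𝔼 | (q.1, q.1 + q.2) ∈ D} :=
      (measurable_fst.prodMk (measurable_fst.add measurable_snd)) hDm
    exact (Measurable.indicator (f := fun q : 𝔼 × 𝔼 => ENNReal.ofReal (fracKernel s q.2))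
      (by fun_prop) this).aemeasurable
  simp_rw [fun z => lintegral_indicator_const (μ := (volume : Measure 𝔼)) (hDz z)
    (ENNReal.ofReal (fracKernel s z))]
  set r : ℝ := min 1 (1 / L) with hr
  have hr0 : 0 < r := by positivity
  rw [← lintegral_add_compl _ (Metric.isClosed_closedBall (x := (0 : 𝔼)) (ε := r)).measurableSet]
  refine ENNReal.add_lt_top.2 ⟨?_, ?_⟩
  · have hpow := lintegral_norm_sub_rpow_le (μ := volume) (p := (0 : 𝔼)) (r := r)
      (C := volume.real (Metric.closedBall (0 : 𝔼) 1)) (d := (N : ℝ)) (a := (N : ℝ) + s - 1) hr0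
      measureReal_nonneg (by linarith) (by linarith) (fun t ht _ => by
        rw [Measure.addHaar_closedBall' _ _ ht.le, Real.rpow_natCast, mul_comm,
          ENNReal.ofReal_mul measureReal_nonneg]
        simp [Measure.real, (isCompact_closedBall (0 : 𝔼) 1).measure_lt_top.ne])
    calc _ ≤ ∫⁻ z in Metric.closedBall (0 : 𝔼) r,
          ENNReal.ofReal (C * L) * ENNReal.ofReal (‖z - 0‖ ^ (-((N : ℝ) + s - 1))) := by
          refine setLIntegral_mono' Metric.isClosed_closedBall.measurableSet fun z hz => ?_
          rw [mem_closedBall_zero_iff] at hz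
          rcases (norm_nonneg z).eq_or_lt with h0 | h0
          · rw [norm_eq_zero.1 h0.symm, fracKernel_zero hs0]; simp
          have hz1 : ‖z‖ ≤ 1 := hz.trans (min_le_left _ _)
          have hzL : L * ‖z‖ ≤ 1 := by
            have := (le_div_iff₀ hL0).1 (hz.trans (min_le_right _ _))
            linarith
          have hsub : {x : 𝔼 | (x, x + z) ∈ D} ⊆
              Metric.closedBall 0 R ∩ {x | |ρ x| ≤ L * ‖z‖} := by
            rintro x ⟨hxR, hx⟩
            simp only at hxR hx
            refine ⟨by simpa using hxR, ?_⟩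
            have h1 := hL (x + z) (by
              rw [mem_closedBall_zero_iff]; exact (norm_add_le _ _).trans (by linarith)) x
              (by rw [mem_closedBall_zero_iff]; linarith)
            rw [add_sub_cancel_left, Real.norm_eq_abs] at h1
            have h1' := abs_le.1 h1
            rw [hρ.mem_iff, hρ.mem_iff] at hx
            simp only [mem_ofPred_eq]
            rw [abs_le]
            by_cases h2 : ρ x < 0 <;> by_cases h3 : ρ (x + z) < 0
            · exact absurd (iff_of_true h2 h3) hx
            · constructor <;> linarith
            · constructor <;> linarith
            · exact absurd (iff_of_false h2 h3) hx
          calc _ ≤ ENNReal.ofReal (fracKernel s z) * ENNReal.ofReal (C * (L * ‖z‖)) :=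
                mul_le_mul_right ((measure_mono hsub).trans (hC _ (by positivity) hzL)) _
            _ = _ := by
                rw [← ENNReal.ofReal_mul (fracKernel_nonneg _ _), ← ENNReal.ofReal_mul (by positivity)]
                congr 1
                rw [sub_zero, fracKernel_eq_rpow, show -((N : ℝ) + s - 1) = -((N : ℝ) + s) + 1 by ring,
                  Real.rpow_add h0, Real.rpow_one]
                ring
      _ < ⊤ := by
          rw [lintegral_const_mul _ (by fun_prop)]
          exact ENNReal.mul_lt_top ENNReal.ofReal_lt_top (hpow.trans_lt ENNReal.ofReal_lt_top)
  · have hi := integrableOn_fracKernel_compl_ball hs0 (integrable_one_div_one_add_norm hs0)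
      (0 : 𝔼) hr0
    simp_rw [sub_zero] at hi
    calc _ ≤ ∫⁻ z in (Metric.closedBall (0 : 𝔼) r)ᶜ,
          ENNReal.ofReal (fracKernel s z) * volume (Metric.closedBall (0 : 𝔼) R) := by
          refine lintegral_mono fun z => mul_le_mul_right (measure_mono fun x hx => ?_) _
          simpa using hx.1
      _ = (∫⁻ z in (Metric.closedBall (0 : 𝔼) r)ᶜ, ENNReal.ofReal (fracKernel s z)) *
          volume (Metric.closedBall (0 : 𝔼) R) := lintegral_mul_const _ (by fun_prop)
      _ ≤ (∫⁻ z in (Metric.ball (0 : 𝔼) r)ᶜ, ENNReal.ofReal (fracKernel s z)) *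
          volume (Metric.closedBall (0 : 𝔼) R) := by
          gcongr
          exact Metric.ball_subset_closedBall
      _ < ⊤ := by
          refine ENNReal.mul_lt_top ?_ (isCompact_closedBall _ _).measure_lt_top
          rw [← ofReal_integral_eq_lintegral_ofReal hi
            (Eventually.of_forall fun z => fracKernel_nonneg _ _)]
          exact ENNReal.ofReal_lt_top

/-! ### Rotation fields and the principal value on the boundary -/

lemma hasFDerivAt_radial {w : ℝ → ℝ} {w' : ℝ} {p x : 𝔼} (hw : HasDerivAt w w' (‖x - p‖ ^ 2)) :
    HasFDerivAt (fun x : 𝔼 => w (‖x - p‖ ^ 2)) ((2 * w') • innerSL ℝ (x - p)) x := by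
  have h1 : HasFDerivAt (fun x : 𝔼 => ‖x - p‖ ^ 2) (2 • innerSL ℝ (x - p)) x := by
    have := ((hasFDerivAt_id x).sub_const p).norm_sq
    exact this
  have h2 := hw.comp_hasFDerivAt x h1
  have e : (2 * w') • innerSL ℝ (x - p) = w' • 2 • innerSL ℝ (x - p) := by
    rw [mul_comm, mul_smul, ofNat_smul_eq_nsmul]
  rw [e]
  exact h2

/-- The component along `m` of the infinitesimal rotation at `v` in the plane of `a` and `τ`. -/
def rotation (a τ v m : EuclideanSpace ℝ (Fin N)) : ℝ :=
  inner ℝ v τ * inner ℝ a m - inner ℝ v a * inner ℝ τ m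

lemma abs_rotation_le (a τ v m : 𝔼) : |rotation a τ v m| ≤ 2 * ‖v‖ * ‖τ‖ * ‖a‖ * ‖m‖ := by
  have h1 := abs_real_inner_le_norm v τ
  have h2 := abs_real_inner_le_norm a m
  have h3 := abs_real_inner_le_norm v a
  have h4 := abs_real_inner_le_norm τ m
  calc |rotation a τ v m| ≤ |inner ℝ v τ * inner ℝ a m| + |inner ℝ v a * inner ℝ τ m| :=
        abs_sub _ _
    _ ≤ ‖v‖ * ‖τ‖ * (‖a‖ * ‖m‖) + ‖v‖ * ‖a‖ * (‖τ‖ * ‖m‖) := by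
        rw [abs_mul, abs_mul]; gcongr
    _ = _ := by ring

lemma BoundaryData.integral_rotation_eq_zero {E : Set 𝔼} {ρ : 𝔼 → ℝ} {n : 𝔼 → 𝔼}
    (H : BoundaryData E ρ n) {w : ℝ → ℝ} (hw : ContDiff ℝ ∞ w) (hw0 : ∀ u, 2 ≤ u → w u = 0)
    (p a τ : 𝔼) :
    ∫ x, w (‖x - p‖ ^ 2) * rotation a τ (x - p) (n x) ∂(surfaceMeasure E) = 0 := by
  set V : 𝔼 → 𝔼 := fun x => inner ℝ (x - p) τ • a - inner ℝ (x - p) a • τ with hV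
  have hVs : ContDiff ℝ ∞ V := 
    (((contDiff_id.sub contDiff_const).inner ℝ contDiff_const).smul contDiff_const).sub
      (((contDiff_id.sub contDiff_const).inner ℝ contDiff_const).smul contDiff_const)
  set f : 𝔼 → ℝ := fun x => w (‖x - p‖ ^ 2) with hf
  have hfs : ContDiff ℝ ∞ f := hw.comp ((contDiff_id.sub contDiff_const).norm_sq ℝ)
  have hfc : HasCompactSupport f := by
    refine HasCompactSupport.intro (isCompact_closedBall p 2) fun x hx => hw0 _ ?_
    rw [Metric.mem_closedBall, dist_eq_norm, not_le] at hx
    nlinarith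
  have hdiv := H.setIntegral_divergence (Z := fun x => f x • V x) (hfs.smul hVs) hfc.smul_right
  have h0 : ∀ x, divergence (fun x => f x • V x) x = 0 := fun x => by
    rw [divergence_smul (hfs.differentiable (by simp) x) (hVs.differentiable (by simp) x)]
    have h1 : HasFDerivAt V ((innerSL ℝ τ).smulRight a - (innerSL ℝ a).smulRight τ) x := by
      have hl : ∀ b : 𝔼, HasFDerivAt (fun x : 𝔼 => inner ℝ (x - p) b) (innerSL ℝ b) x := fun b => by
        have := (innerSL ℝ b).hasFDerivAt.comp x ((hasFDerivAt_id x).sub_const p)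
        refine (this.congr_of_eventuallyEq (Eventually.of_forall fun y => ?_))
        simp [real_inner_comm]
      exact ((hl τ).smul_const a).sub ((hl a).smul_const τ)
    have h2 : fderiv ℝ f x = _ := (hasFDerivAt_radial
      ((hw.differentiable (by simp) (‖x - p‖ ^ 2)).hasDerivAt)).fderiv
    rw [divergence, h1.fderiv, map_sub (traceL N), traceL_smulRight, traceL_smulRight, h2]
    simp only [hV, _root_.smul_apply, innerSL_apply_apply, inner_sub_right, inner_smul_right,
      smul_eq_mul, real_inner_comm a τ]
    ring
  simp_rw [h0, integral_zero] at hdiv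
  rw [hdiv]
  refine integral_congr_ae (Eventually.of_forall fun x => ?_)
  simp only [hf, hV, rotation, inner_smul_left, inner_sub_left, conj_trivial]

/-- A smooth cutoff on the line: `1` on `(-∞, 1]`, `0` on `[2, ∞)`. -/
def cutoff (u : ℝ) : ℝ := Real.smoothTransition (2 - u)

lemma cutoff_of_le {u : ℝ} (hu : u ≤ 1) : cutoff u = 1 :=
  Real.smoothTransition.one_of_one_le (by linarith)

lemma cutoff_of_ge {u : ℝ} (hu : 2 ≤ u) : cutoff u = 0 :=
  Real.smoothTransition.zero_of_nonpos (by linarith)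

lemma cutoff_nonneg (u : ℝ) : 0 ≤ cutoff u := Real.smoothTransition.nonneg _

lemma cutoff_le_one (u : ℝ) : cutoff u ≤ 1 := Real.smoothTransition.le_one _

lemma contDiff_cutoff : ContDiff ℝ ∞ cutoff :=
  Real.smoothTransition.contDiff.comp (contDiff_const.sub contDiff_id)

lemma BoundaryData.setIntegral_rotation_eq_zero {E : Set 𝔼} {ρ : 𝔼 → ℝ} {n : 𝔼 → 𝔼}
    (H : BoundaryData E ρ n) {s : ℝ} (hs0 : 0 < s) (p a τ : 𝔼) {ε : ℝ} (hε : 0 < ε) :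
    ∫ x in (Metric.ball p ε)ᶜ, cutoff (‖x - p‖ ^ 2) * rotation a τ (x - p) (n x) *
      fracKernel s (x - p) ∂(surfaceMeasure E) = 0 := by
  haveI := H.isLocallyFiniteMeasure
  set c : ℝ := ((N : ℝ) + s) / 2 with hc
  have hc0 : 0 < c := by positivity
  set δ : ℕ → ℝ := fun j => ε ^ 2 / (j + 2) with hδ
  have hδ0 : ∀ j, 0 < δ j := fun j => by simp only [hδ]; positivity
  have hδh : ∀ j, δ j ≤ ε ^ 2 / 2 := fun j => by
    simp only [hδ]
    gcongr
    have : (0 : ℝ) ≤ j := Nat.cast_nonneg j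
    linarith
  have hδt : Tendsto δ atTop (𝓝 0) := by
    have h1 : Tendsto (fun j : ℕ => (j : ℝ) + 2) atTop atTop :=
      tendsto_atTop_add_const_right _ _ tendsto_natCast_atTop_atTop
    exact h1.const_div_atTop _
  set ψ : ℕ → ℝ → ℝ := fun j u => Real.smoothTransition ((u - ε ^ 2) / δ j + 1) with hψ
  have hψs : ∀ j, ContDiff ℝ ∞ (ψ j) := fun j =>
    Real.smoothTransition.contDiff.comp (by fun_prop)
  have hψ1 : ∀ j u, ε ^ 2 ≤ u → ψ j u = 1 := fun j u hu =>
    Real.smoothTransition.one_of_one_le (by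
      have : 0 ≤ (u - ε ^ 2) / δ j := div_nonneg (by linarith) (hδ0 j).le
      linarith)
  have hψ0 : ∀ j u, u ≤ ε ^ 2 - δ j → ψ j u = 0 := fun j u hu =>
    Real.smoothTransition.zero_of_nonpos (by
      have : (u - ε ^ 2) / δ j ≤ -1 := by rw [div_le_iff₀ (hδ0 j)]; linarith
      linarith)
  set w : ℕ → ℝ → ℝ := fun j u => ψ j u * cutoff u * u ^ (-c) with hw
  have hws : ∀ j, ContDiff ℝ ∞ (w j) := fun j => by
    rw [contDiff_iff_contDiffAt]
    intro u
    rcases lt_or_ge 0 u with hu | hu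
    · exact ((hψs j).contDiffAt.mul contDiff_cutoff.contDiffAt).mul
        (Real.contDiffAt_rpow_const_of_ne hu.ne')
    · refine (contDiffAt_const (c := (0 : ℝ))).congr_of_eventuallyEq ?_
      have : u < ε ^ 2 / 2 := hu.trans_lt (by positivity)
      filter_upwards [gt_mem_nhds this] with y hy
      simp only [hw]
      rw [hψ0 j y (by linarith [hδh j]), zero_mul, zero_mul]
  have hw2 : ∀ j u, 2 ≤ u → w j u = 0 := fun j u hu => by
    simp only [hw, cutoff_of_ge hu, mul_zero, zero_mul]
  have hz : ∀ j, ∫ x, w j (‖x - p‖ ^ 2) * rotation a τ (x - p) (n x) ∂(surfaceMeasure E) = 0 :=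
    fun j => H.integral_rotation_eq_zero (hws j) (hw2 j) p a τ
  have hrc : Continuous fun x => rotation a τ (x - p) (n x) := by
    have := H.contDiff.continuous
    unfold rotation
    fun_prop
  obtain ⟨M, hM⟩ := (isCompact_closedBall p 2).exists_bound_of_continuousOn hrc.continuousOn
  have hlim : Tendsto (fun j => ∫ x, w j (‖x - p‖ ^ 2) * rotation a τ (x - p) (n x)
      ∂(surfaceMeasure E)) atTop (𝓝 (∫ x, (Metric.ball p ε)ᶜ.indicator (fun x =>
        cutoff (‖x - p‖ ^ 2) * rotation a τ (x - p) (n x) * fracKernel s (x - p)) x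
        ∂(surfaceMeasure E))) := by
    refine tendsto_integral_of_dominated_convergence
      ((Metric.closedBall p 2).indicator fun _ => (ε ^ 2 / 2) ^ (-c) * M) ?_ ?_ ?_ ?_
    · intro j
      have := (hws j).continuous
      exact (Continuous.mul (by fun_prop) hrc).aestronglyMeasurable
    · exact (integrable_indicator_iff Metric.isClosed_closedBall.measurableSet).2
        (integrableOn_const (isCompact_closedBall _ _).measure_lt_top.ne)
    · intro j
      refine Eventually.of_forall fun x => ?_
      by_cases hx : x ∈ Metric.closedBall p 2
      · rw [indicator_of_mem hx, norm_mul]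
        have hM0 := hM x hx
        refine mul_le_mul ?_ hM0 (norm_nonneg _) (by positivity)
        simp only [hw]
        rcases le_or_gt (‖x - p‖ ^ 2) (ε ^ 2 / 2) with h | h
        · rw [hψ0 j _ (by linarith [hδh j])]
          simp only [zero_mul, norm_zero]
          positivity
        · rw [norm_mul, norm_mul, Real.norm_of_nonneg (Real.smoothTransition.nonneg _),
            Real.norm_of_nonneg (cutoff_nonneg _), Real.norm_of_nonneg (by positivity)]
          calc _ ≤ 1 * 1 * (‖x - p‖ ^ 2) ^ (-c) := by
                gcongr
                · exact cutoff_nonneg _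
                · exact Real.smoothTransition.le_one _
                · exact cutoff_le_one _
            _ ≤ _ := by
                rw [one_mul, one_mul]
                exact Real.rpow_le_rpow_of_nonpos (by positivity) h.le (by linarith)
      · rw [indicator_of_notMem hx, hw2 j, zero_mul, norm_zero]
        rw [Metric.mem_closedBall, dist_eq_norm, not_le] at hx
        nlinarith
    · refine Eventually.of_forall fun x => ?_
      by_cases hx : ε ≤ ‖x - p‖
      · refine tendsto_const_nhds.congr fun j => ?_
        rw [indicator_of_mem (by simpa [dist_eq_norm] using hx)]
        simp only [hw]
        have h0 : 0 < ‖x - p‖ := hε.trans_le hx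
        rw [hψ1 j _ (by gcongr), one_mul, fracKernel_eq_rpow, ← Real.rpow_natCast,
          ← Real.rpow_mul h0.le, hc,
          show ((2 : ℕ) : ℝ) * -(((N : ℝ) + s) / 2) = -((N : ℝ) + s) by push_cast; ring]
        ring
      · refine tendsto_const_nhds.congr' ?_
        have h1 : 0 < ε ^ 2 - ‖x - p‖ ^ 2 := by nlinarith [norm_nonneg (x - p)]
        filter_upwards [hδt.eventually (gt_mem_nhds h1)] with j hj
        rw [indicator_of_notMem (by simpa [dist_eq_norm] using hx)]
        simp only [hw]
        rw [hψ0 j _ (by linarith)]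
        simp
  simp_rw [hz] at hlim
  rw [← integral_indicator Metric.isOpen_ball.measurableSet.compl]
  exact (tendsto_nhds_unique tendsto_const_nhds hlim).symm

lemma BoundaryData.exists_inner_normal_le {E : Set 𝔼} {ρ : 𝔼 → ℝ} {n : 𝔼 → 𝔼}
    (H : BoundaryData E ρ n) (R : ℝ) : ∃ c, 0 ≤ c ∧ ∀ p ∈ frontier E, ‖p‖ ≤ R →
      ∀ x ∈ frontier E, ‖x‖ ≤ R → |inner ℝ (x - p) (n p)| ≤ c * ‖x - p‖ ^ 2 := by
  obtain ⟨L, hL0, hL⟩ := exists_taylor_le H.defining.contDiff R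
  have hK : IsCompact (frontier E ∩ Metric.closedBall (0 : 𝔼) R) :=
    (isCompact_closedBall _ _).inter_left isClosed_frontier
  obtain ⟨g₀, hg0, hg⟩ := hK.exists_forall_le' (f := fun p => ‖gradient ρ p‖) (a := 0)
    (contDiff_gradient H.defining.contDiff).continuous.norm.continuousOn
    (fun p hp => norm_pos_iff.2 (H.defining.gradient_ne_zero p hp.1))
  refine ⟨L / g₀, by positivity, fun p hp hpR x hx hxR => ?_⟩
  have hkey := hL x (by simpa using hxR) p (by simpa using hpR)
  rw [(H.defining.frontier_iff p).1 hp, (H.defining.frontier_iff x).1 hx, sub_zero, zero_sub,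
    norm_neg, ← inner_gradient, gradient_eq_smul_outerNormal (H.defining.isDefiningFunction hp),
    inner_smul_left, conj_trivial, ← H.eq_outerNormal p hp, Real.norm_eq_abs, abs_mul, abs_norm,
    real_inner_comm] at hkey
  have := hg p ⟨hp, by simpa using hpR⟩
  rw [div_mul_eq_mul_div, le_div_iff₀ hg0, mul_comm]
  exact (mul_le_mul_of_nonneg_right this (abs_nonneg _)).trans hkey

/-- The tangential part at `p` of the gradient of `g`. -/
def tangentialGradient (n : EuclideanSpace ℝ (Fin N) → EuclideanSpace ℝ (Fin N))
    (g : EuclideanSpace ℝ (Fin N) → ℝ) (p : EuclideanSpace ℝ (Fin N)) :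
    EuclideanSpace ℝ (Fin N) :=
  gradient g p - (inner ℝ (gradient g p) (n p) : ℝ) • n p

/-- The increment of `g` minus its odd part, as it appears in the principal value. -/
def secondDifference (n : EuclideanSpace ℝ (Fin N) → EuclideanSpace ℝ (Fin N))
    (g : EuclideanSpace ℝ (Fin N) → ℝ) (p x : EuclideanSpace ℝ (Fin N)) : ℝ :=
  g x - g p - cutoff (‖x - p‖ ^ 2) * rotation (n p) (tangentialGradient n g p) (x - p) (n x)

lemma BoundaryData.exists_secondDifference_le {E : Set 𝔼} {ρ : 𝔼 → ℝ} {n : 𝔼 → 𝔼}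
    (H : BoundaryData E ρ n) {g : 𝔼 → ℝ} (hg : ContDiff ℝ ∞ g) (hgc : HasCompactSupport g) (R : ℝ) :
    ∃ C, 0 ≤ C ∧ ∀ p ∈ frontier E, ‖p‖ ≤ R → ∀ x ∈ frontier E,
      |secondDifference n g p x| ≤ C * min 1 (‖x - p‖ ^ 2) := by
  obtain ⟨L₁, hL₁0, hL₁⟩ := exists_taylor_le hg (R + 1)
  obtain ⟨L₂, hL₂0, hL₂⟩ := exists_lipschitz_on_ball H.contDiff (R + 1)
  obtain ⟨c, hc0, hc⟩ := H.exists_inner_normal_le (R + 1)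
  obtain ⟨M, hM⟩ := hgc.exists_bound_of_continuous hg.continuous
  have hM0 : 0 ≤ M := (norm_nonneg _).trans (hM 0)
  obtain ⟨G, hG0, hG⟩ := exists_norm_fderiv_le hg hgc
  have hGn : ∀ p, ‖gradient g p‖ ≤ G := fun p => by
    rw [gradient, LinearIsometryEquiv.norm_map]; exact hG p
  have hτ : ∀ p ∈ frontier E, ‖tangentialGradient n g p‖ ≤ 2 * G := fun p hp => by
    have h1 := H.norm_eq_one hp
    have h2 := abs_real_inner_le_norm (gradient g p) (n p)
    rw [h1, mul_one] at h2
    calc _ ≤ ‖gradient g p‖ + ‖(inner ℝ (gradient g p) (n p) : ℝ) • n p‖ := norm_sub_le _ _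
      _ ≤ G + G := by
          rw [norm_smul, h1, mul_one, Real.norm_eq_abs]
          exact add_le_add (hGn p) (h2.trans (hGn p))
      _ = _ := by ring
  set C₁ := L₁ + G * c + 2 * G * L₂ + c * (2 * G) with hC₁
  set C₂ := 2 * M + 2 * 2 * (2 * G) with hC₂
  refine ⟨C₁ + C₂, by positivity, fun p hp hpR x hx => ?_⟩
  have hnp := H.norm_eq_one hp
  have hnx := H.norm_eq_one hx
  have hτp := hτ p hp
  set τ := tangentialGradient n g p with hτdef
  rcases le_total ‖x - p‖ 1 with h1 | h1
  · have h2 : ‖x - p‖ ^ 2 ≤ 1 := pow_le_one₀ (norm_nonneg _) h1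
    rw [min_eq_right h2]
    have hxn : ‖x‖ ≤ R + 1 := by
      calc ‖x‖ = ‖p + (x - p)‖ := by congr 1; abel
        _ ≤ ‖p‖ + ‖x - p‖ := norm_add_le _ _
        _ ≤ _ := by linarith
    have hpn : ‖p‖ ≤ R + 1 := by linarith
    have hxB : x ∈ Metric.closedBall (0 : 𝔼) (R + 1) := by simpa using hxn
    have hpB : p ∈ Metric.closedBall (0 : 𝔼) (R + 1) := by simpa using hpn
    have t1 := hL₁ x hxB p hpB
    rw [← inner_gradient, Real.norm_eq_abs] at t1
    have t2 := hc p hp hpn x hx hxn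
    have t3 := hL₂ x hxB p hpB
    have e : secondDifference n g p x = (g x - g p - inner ℝ (gradient g p) (x - p)) +
        inner ℝ (gradient g p) (n p) * inner ℝ (x - p) (n p) -
        inner ℝ (x - p) τ * inner ℝ (n p) (n x - n p) +
        inner ℝ (x - p) (n p) * inner ℝ τ (n x) := by
      rw [secondDifference, cutoff_of_le h2, one_mul, rotation, ← hτdef]
      have h3 : inner ℝ (gradient g p) (x - p) = inner ℝ (x - p) τ +
          inner ℝ (gradient g p) (n p) * inner ℝ (x - p) (n p) := by
        rw [hτdef, tangentialGradient, inner_sub_right (x - p), inner_smul_right,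
          real_inner_comm (gradient g p) (x - p)]
        ring
      rw [inner_sub_right (n p) (n x), real_inner_self_eq_norm_sq, hnp, h3]
      ring
    have b1 : |inner ℝ (gradient g p) (n p) * inner ℝ (x - p) (n p)| ≤ G * (c * ‖x - p‖ ^ 2) := by
      rw [abs_mul]
      have := abs_real_inner_le_norm (gradient g p) (n p)
      rw [hnp, mul_one] at this
      exact mul_le_mul (this.trans (hGn p)) t2 (abs_nonneg _) hG0.le
    have b2 : |inner ℝ (x - p) τ * inner ℝ (n p) (n x - n p)| ≤
        ‖x - p‖ * (2 * G) * (L₂ * ‖x - p‖) := by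
      rw [abs_mul]
      have h3 := abs_real_inner_le_norm (x - p) τ
      have h4 := abs_real_inner_le_norm (n p) (n x - n p)
      rw [hnp, one_mul] at h4
      exact mul_le_mul (h3.trans (by gcongr)) (h4.trans t3) (abs_nonneg _) (by positivity)
    have b3 : |inner ℝ (x - p) (n p) * inner ℝ τ (n x)| ≤ c * ‖x - p‖ ^ 2 * (2 * G) := by
      rw [abs_mul]
      have h4 := abs_real_inner_le_norm τ (n x)
      rw [hnx, mul_one] at h4
      exact mul_le_mul t2 (h4.trans hτp) (abs_nonneg _) (by positivity)
    rw [e]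
    calc _ ≤ |g x - g p - inner ℝ (gradient g p) (x - p)| +
          |inner ℝ (gradient g p) (n p) * inner ℝ (x - p) (n p)| +
          |inner ℝ (x - p) τ * inner ℝ (n p) (n x - n p)| +
          |inner ℝ (x - p) (n p) * inner ℝ τ (n x)| := by
          refine (abs_add_le _ _).trans (add_le_add ((abs_sub _ _).trans
            (add_le_add (abs_add_le _ _) le_rfl)) le_rfl)
      _ ≤ C₁ * ‖x - p‖ ^ 2 := by rw [hC₁]; linarith
      _ ≤ _ := by
          gcongr
          have : 0 ≤ C₂ := by positivity
          linarith
  · rw [min_eq_left (by nlinarith), mul_one]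
    have b1 : |g x - g p| ≤ 2 * M := by
      refine (abs_sub _ _).trans ?_
      have := hM x
      have := hM p
      rw [Real.norm_eq_abs] at *
      linarith
    have b2 : |cutoff (‖x - p‖ ^ 2) * rotation (n p) τ (x - p) (n x)| ≤ 2 * 2 * (2 * G) := by
      rcases le_total ‖x - p‖ 2 with h3 | h3
      · rw [abs_mul, abs_of_nonneg (cutoff_nonneg _)]
        have := abs_rotation_le (n p) τ (x - p) (n x)
        rw [hnp, hnx, mul_one, mul_one] at this
        calc _ ≤ 1 * (2 * 2 * (2 * G)) := by
              refine mul_le_mul (cutoff_le_one _) (this.trans ?_) (abs_nonneg _) zero_le_one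
              gcongr
          _ = _ := one_mul _
      · rw [cutoff_of_ge (by nlinarith), zero_mul, abs_zero]; positivity
    calc |secondDifference n g p x| ≤ |g x - g p| + |cutoff (‖x - p‖ ^ 2) *
          rotation (n p) τ (x - p) (n x)| := abs_sub _ _
      _ ≤ C₂ := by rw [hC₂]; linarith
      _ ≤ _ := by
          have : 0 ≤ C₁ := by positivity
          linarith

/-- The truncated integral defining the principal value on the boundary. -/
def truncatedDifference (s : ℝ) (E : Set (EuclideanSpace ℝ (Fin N)))
    (g : EuclideanSpace ℝ (Fin N) → ℝ) (ε : ℝ) (p : EuclideanSpace ℝ (Fin N)) : ℝ :=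
  ∫ x in (Metric.ball p ε)ᶜ, (g x - g p) * fracKernel s (x - p) ∂(surfaceMeasure E)

lemma BoundaryData.exists_truncatedDifference {E : Set 𝔼} {ρ : 𝔼 → ℝ} {n : 𝔼 → 𝔼}
    (H : BoundaryData E ρ n) {s : ℝ} (hs0 : 0 < s) (hs1 : s < 1)
    (harea : Integrable (fun x : 𝔼 => 1 / (1 + ‖x‖) ^ ((N : ℝ) + s)) (surfaceMeasure E))
    {g : 𝔼 → ℝ} (hg : ContDiff ℝ ∞ g) (hgc : HasCompactSupport g) (R : ℝ) :
    ∃ C, 0 ≤ C ∧ ∀ p ∈ frontier E, ‖p‖ ≤ R →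
      (∀ ε, 0 < ε → |truncatedDifference s E g ε p| ≤ C) ∧
      ∃ v, Tendsto (fun ε => truncatedDifference s E g ε p) (𝓝[>] (0 : ℝ)) (𝓝 v) := by
  haveI := H.isLocallyFiniteMeasure
  obtain ⟨C₁, hC₁0, hC₁⟩ := H.exists_lintegral_surface_le hs0 hs1 harea R
  obtain ⟨C₂, hC₂0, hC₂⟩ := H.exists_secondDifference_le hg hgc R
  refine ⟨C₂ * C₁, by positivity, fun p hp hpR => ?_⟩
  have hnc := H.contDiff.continuous
  have hcc : Continuous cutoff := contDiff_cutoff.continuous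
  have hrc : Continuous fun x => cutoff (‖x - p‖ ^ 2) *
      rotation (n p) (tangentialGradient n g p) (x - p) (n x) := by
    unfold rotation; fun_prop
  have hsc : Continuous (secondDifference n g p) := by
    unfold secondDifference
    exact (hg.continuous.sub continuous_const).sub hrc
  have hKm : Measurable fun x : 𝔼 => fracKernel s (x - p) := by fun_prop
  have hwi : Integrable (fun x => min 1 (‖x - p‖ ^ 2) * fracKernel s (x - p))
      (surfaceMeasure E) := by
    refine ⟨(Measurable.mul (by fun_prop) hKm).aestronglyMeasurable, ?_⟩
    rw [hasFiniteIntegral_iff_ofReal (Eventually.of_forall fun x =>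
      mul_nonneg (le_min zero_le_one (sq_nonneg _)) (fracKernel_nonneg _ _))]
    exact (hC₁ p hp hpR).trans_lt ENNReal.ofReal_lt_top
  have hwle : ∫ x, min 1 (‖x - p‖ ^ 2) * fracKernel s (x - p) ∂(surfaceMeasure E) ≤ C₁ := by
    rw [← ENNReal.ofReal_le_ofReal_iff hC₁0, ofReal_integral_eq_lintegral_ofReal hwi
      (Eventually.of_forall fun x => mul_nonneg (le_min zero_le_one (sq_nonneg _))
        (fracKernel_nonneg _ _))]
    exact hC₁ p hp hpR
  have hbd : ∀ᵐ x ∂(surfaceMeasure E), ‖secondDifference n g p x * fracKernel s (x - p)‖ ≤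
      C₂ * (min 1 (‖x - p‖ ^ 2) * fracKernel s (x - p)) := by
    filter_upwards [ae_mem_frontier E] with x hx
    rw [norm_mul, Real.norm_eq_abs, Real.norm_of_nonneg (fracKernel_nonneg _ _), ← mul_assoc]
    exact mul_le_mul_of_nonneg_right (hC₂ p hp hpR x hx) (fracKernel_nonneg _ _)
  have hsi : Integrable (fun x => secondDifference n g p x * fracKernel s (x - p))
      (surfaceMeasure E) :=
    (hwi.const_mul C₂).mono' (hsc.measurable.mul hKm).aestronglyMeasurable hbd
  have heq : ∀ ε, 0 < ε → truncatedDifference s E g ε p =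
      ∫ x in (Metric.ball p ε)ᶜ, secondDifference n g p x * fracKernel s (x - p)
        ∂(surfaceMeasure E) := fun ε hε => by
    have h0 := H.setIntegral_rotation_eq_zero hs0 p (n p) (tangentialGradient n g p) hε
    have hK := integrableOn_fracKernel_compl_ball hs0 harea p hε
    obtain ⟨M, hM⟩ := (HasCompactSupport.intro (isCompact_closedBall p 2)
      (f := fun x => cutoff (‖x - p‖ ^ 2) * rotation (n p) (tangentialGradient n g p) (x - p) (n x))
      (fun x hx => by
        rw [Metric.mem_closedBall, dist_eq_norm, not_le] at hx
        rw [cutoff_of_ge (by nlinarith), zero_mul])).exists_bound_of_continuous hrc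
    have hi2 : IntegrableOn (fun x => cutoff (‖x - p‖ ^ 2) *
        rotation (n p) (tangentialGradient n g p) (x - p) (n x) * fracKernel s (x - p))
        (Metric.ball p ε)ᶜ (surfaceMeasure E) :=
      Integrable.bdd_mul hK hrc.aestronglyMeasurable (c := M) (Eventually.of_forall hM)
    have : ∫ x in (Metric.ball p ε)ᶜ, (secondDifference n g p x * fracKernel s (x - p) +
        cutoff (‖x - p‖ ^ 2) * rotation (n p) (tangentialGradient n g p) (x - p) (n x) *
          fracKernel s (x - p)) ∂(surfaceMeasure E) = _ :=
      integral_add hsi.integrableOn hi2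
    rw [h0, add_zero] at this
    rw [← this, truncatedDifference]
    refine integral_congr_ae (Eventually.of_forall fun x => ?_)
    simp only [secondDifference]
    ring
  refine ⟨fun ε hε => ?_, ⟨∫ x, secondDifference n g p x * fracKernel s (x - p)
    ∂(surfaceMeasure E), ?_⟩⟩
  · rw [heq ε hε, ← Real.norm_eq_abs]
    calc _ ≤ ∫ x in (Metric.ball p ε)ᶜ, C₂ * (min 1 (‖x - p‖ ^ 2) * fracKernel s (x - p))
          ∂(surfaceMeasure E) :=
          norm_integral_le_of_norm_le (hwi.const_mul C₂).integrableOn (ae_restrict_of_ae hbd)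
      _ ≤ ∫ x, C₂ * (min 1 (‖x - p‖ ^ 2) * fracKernel s (x - p)) ∂(surfaceMeasure E) :=
          setIntegral_le_integral (hwi.const_mul C₂) (Eventually.of_forall fun x =>
            mul_nonneg hC₂0 (mul_nonneg (le_min zero_le_one (sq_nonneg _)) (fracKernel_nonneg _ _)))
      _ ≤ _ := by rw [integral_const_mul]; gcongr
  · refine (tendsto_setIntegral_compl_ball hsi (p := p) (by
      rw [sub_self, fracKernel_zero hs0, mul_zero])).congr' ?_
    filter_upwards [self_mem_nhdsWithin] with ε hε
    exact (heq ε hε).symm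

lemma BoundaryData.integrable_of_le_surface_weight {E : Set 𝔼} {ρ : 𝔼 → ℝ} {n : 𝔼 → 𝔼}
    (H : BoundaryData E ρ n) {s : ℝ} (hs0 : 0 < s) (hs1 : s < 1)
    (harea : Integrable (fun x : 𝔼 => 1 / (1 + ‖x‖) ^ ((N : ℝ) + s)) (surfaceMeasure E))
    {F : 𝔼 × 𝔼 → ℝ} (hF : AEStronglyMeasurable F ((surfaceMeasure E).prod (surfaceMeasure E)))
    {C R : ℝ} (hFC : ∀ x ∈ frontier E, ∀ y ∈ frontier E, |F (x, y)| ≤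
      C * ((Metric.closedBall (0 : 𝔼) R).indicator 1 x *
        (min 1 (‖x - y‖ ^ 2) * fracKernel s (x - y)))) :
    Integrable F ((surfaceMeasure E).prod (surfaceMeasure E)) := by
  haveI := H.isLocallyFiniteMeasure
  refine ((H.integrable_surface_weight hs0 hs1 harea R).const_mul C).mono' hF ?_
  have h1 : ∀ᵐ q ∂((surfaceMeasure E).prod (surfaceMeasure E)), q.1 ∈ frontier E :=
    Measure.quasiMeasurePreserving_fst.ae (ae_mem_frontier E)
  have h2 : ∀ᵐ q ∂((surfaceMeasure E).prod (surfaceMeasure E)), q.2 ∈ frontier E :=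
    Measure.quasiMeasurePreserving_snd.ae (ae_mem_frontier E)
  filter_upwards [h1, h2] with q hq1 hq2
  exact hFC q.1 hq1 q.2 hq2

/-- `(g(x) - g(y))² ≤ C min(1, |x - y|²)`. -/
lemma exists_sq_sub_le {g : 𝔼 → ℝ} (hg : ContDiff ℝ ∞ g) (hgc : HasCompactSupport g) :
    ∃ C, 0 ≤ C ∧ ∀ x y, (g x - g y) ^ 2 ≤ C * min 1 (‖x - y‖ ^ 2) := by
  obtain ⟨M, hM⟩ := hgc.exists_bound_of_continuous hg.continuous
  have hM0 : 0 ≤ M := (norm_nonneg _).trans (hM 0)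
  obtain ⟨G, hG0, hG⟩ := exists_norm_fderiv_le hg hgc
  refine ⟨(2 * M + G) ^ 2, by positivity, fun x y => ?_⟩
  have h1 : |g x - g y| ≤ G * ‖x - y‖ := norm_sub_le_of_norm_fderiv_le hg hG x y
  have h2 : |g x - g y| ≤ 2 * M := by
    refine (abs_sub _ _).trans ?_
    have := hM x
    have := hM y
    rw [Real.norm_eq_abs] at *
    linarith
  rw [← sq_abs]
  rcases le_total ((1 : ℝ)) (‖x - y‖ ^ 2) with h | h
  · rw [min_eq_left h, mul_one]
    gcongr
    linarith
  · rw [min_eq_right h, ← mul_pow]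
    gcongr
    refine h1.trans ?_
    gcongr
    linarith

lemma BoundaryData.abs_one_sub_inner_normal_le {E : Set 𝔼} {ρ : 𝔼 → ℝ} {n : 𝔼 → 𝔼}
    (H : BoundaryData E ρ n) (R : ℝ) :
    ∃ C, 0 ≤ C ∧ ∀ p ∈ frontier E, ‖p‖ ≤ R → ∀ x ∈ frontier E,
      |1 - inner ℝ (n p) (n x)| ≤ C * min 1 (‖p - x‖ ^ 2) := by
  obtain ⟨L, hL0, hL⟩ := exists_lipschitz_on_ball H.contDiff (R + 1)
  refine ⟨L ^ 2 + 2, by positivity, fun p hp hpR x hx => ?_⟩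
  have hnp := H.norm_eq_one hp
  have hnx := H.norm_eq_one hx
  have e : 1 - inner ℝ (n p) (n x) = 1 / 2 * ‖n p - n x‖ ^ 2 := by
    rw [norm_sub_sq_real, hnp, hnx]; ring
  rw [e, abs_of_nonneg (by positivity)]
  rcases le_total 1 ‖p - x‖ with h | h
  · rw [min_eq_left (by nlinarith), mul_one]
    have h1 : ‖n p - n x‖ ≤ 2 := (norm_sub_le _ _).trans (by rw [hnp, hnx]; norm_num)
    nlinarith [norm_nonneg (n p - n x), sq_nonneg L]
  · rw [min_eq_right (by nlinarith [norm_nonneg (p - x)])]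
    have hxn : ‖x‖ ≤ R + 1 := by
      calc ‖x‖ = ‖p - (p - x)‖ := by congr 1; abel
        _ ≤ ‖p‖ + ‖p - x‖ := norm_sub_le _ _
        _ ≤ _ := by linarith
    have h1 := hL p (by simp; linarith) x (by simpa using hxn)
    calc 1 / 2 * ‖n p - n x‖ ^ 2 ≤ 1 * (L * ‖p - x‖) ^ 2 := by gcongr; norm_num
      _ = L ^ 2 * ‖p - x‖ ^ 2 := by ring
      _ ≤ _ := by gcongr; linarith

lemma BoundaryData.integrable_sq_sub {E : Set 𝔼} {ρ : 𝔼 → ℝ} {n : 𝔼 → 𝔼}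
    (H : BoundaryData E ρ n) {s : ℝ} (hs0 : 0 < s) (hs1 : s < 1)
    (harea : Integrable (fun x : 𝔼 => 1 / (1 + ‖x‖) ^ ((N : ℝ) + s)) (surfaceMeasure E))
    {g : 𝔼 → ℝ} (hg : ContDiff ℝ ∞ g) (hgc : HasCompactSupport g) :
    Integrable (fun q : 𝔼 × 𝔼 => (g q.1 - g q.2) ^ 2 * fracKernel s (q.1 - q.2))
      ((surfaceMeasure E).prod (surfaceMeasure E)) := by
  haveI := H.isLocallyFiniteMeasure
  obtain ⟨C, hC0, hC⟩ := exists_sq_sub_le hg hgc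
  obtain ⟨R, hR⟩ := hgc.isCompact.isBounded.subset_closedBall (0 : 𝔼)
  have hgm : Measurable g := hg.continuous.measurable
  set B := Metric.closedBall (0 : 𝔼) R
  have hBm : MeasurableSet B := Metric.isClosed_closedBall.measurableSet
  have hW := H.integrable_surface_weight hs0 hs1 harea R
  have hW' := hW.swap
  refine ((hW.add hW').const_mul C).mono' (Measurable.aestronglyMeasurable (by fun_prop))
    (Eventually.of_forall fun q => ?_)
  simp only [Pi.add_apply, Function.comp, Prod.fst_swap, Prod.snd_swap]
  rw [norm_sub_rev q.2 q.1, fracKernel_sub_comm s q.2 q.1, ← add_mul, norm_mul, norm_pow,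
    Real.norm_eq_abs, sq_abs, Real.norm_of_nonneg (fracKernel_nonneg _ _)]
  have h0 : ∀ x, x ∉ B → g x = 0 := fun x hx => image_eq_zero_of_notMem_tsupport fun h => hx (hR h)
  have hK := fracKernel_nonneg s (q.1 - q.2)
  have hm : 0 ≤ min 1 (‖q.1 - q.2‖ ^ 2) := le_min zero_le_one (sq_nonneg _)
  have hnn : ∀ x, 0 ≤ B.indicator (1 : 𝔼 → ℝ) x := fun x => indicator_nonneg (fun _ _ => zero_le_one) x
  by_cases hq : q.1 ∈ B ∨ q.2 ∈ B
  · have h1 : 1 ≤ B.indicator (1 : 𝔼 → ℝ) q.1 + B.indicator (1 : 𝔼 → ℝ) q.2 := by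
      rcases hq with h | h
      · rw [indicator_of_mem h, Pi.one_apply]; linarith [hnn q.2]
      · rw [indicator_of_mem h, Pi.one_apply]; linarith [hnn q.1]
    calc _ ≤ C * min 1 (‖q.1 - q.2‖ ^ 2) * fracKernel s (q.1 - q.2) :=
          mul_le_mul_of_nonneg_right (hC _ _) hK
      _ = C * (1 * (min 1 (‖q.1 - q.2‖ ^ 2) * fracKernel s (q.1 - q.2))) := by ring
      _ ≤ _ := by gcongr
  · push Not at hq
    rw [h0 _ hq.1, h0 _ hq.2, indicator_of_notMem hq.1, indicator_of_notMem hq.2]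
    simp

lemma BoundaryData.integrable_normal_defect {E : Set 𝔼} {ρ : 𝔼 → ℝ} {n : 𝔼 → 𝔼}
    (H : BoundaryData E ρ n) {s : ℝ} (hs0 : 0 < s) (hs1 : s < 1)
    (harea : Integrable (fun x : 𝔼 => 1 / (1 + ‖x‖) ^ ((N : ℝ) + s)) (surfaceMeasure E))
    {g : 𝔼 → ℝ} (hg : ContDiff ℝ ∞ g) (hgc : HasCompactSupport g) :
    Integrable (fun q : 𝔼 × 𝔼 => g q.1 ^ 2 * (1 - inner ℝ (n q.1) (n q.2)) *
      fracKernel s (q.1 - q.2)) ((surfaceMeasure E).prod (surfaceMeasure E)) := by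
  obtain ⟨M, hM⟩ := hgc.exists_bound_of_continuous hg.continuous
  have hM0 : 0 ≤ M := (norm_nonneg _).trans (hM 0)
  obtain ⟨R, hR⟩ := hgc.isCompact.isBounded.subset_closedBall (0 : 𝔼)
  obtain ⟨C, hC0, hC⟩ := H.abs_one_sub_inner_normal_le R
  have hgm : Measurable g := hg.continuous.measurable
  have hnm : Measurable n := H.contDiff.continuous.measurable
  refine H.integrable_of_le_surface_weight hs0 hs1 harea (C := M ^ 2 * C) (R := R)
    (Measurable.aestronglyMeasurable (by fun_prop)) fun x hx y hy => ?_
  simp only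
  by_cases hxB : x ∈ Metric.closedBall (0 : 𝔼) R
  · rw [indicator_of_mem hxB, Pi.one_apply, one_mul, abs_mul, abs_mul, abs_pow,
      abs_of_nonneg (fracKernel_nonneg _ _), ← mul_assoc, mul_assoc (M ^ 2)]
    refine mul_le_mul_of_nonneg_right (mul_le_mul ?_ (hC x hx (by simpa using hxB) y hy)
      (abs_nonneg _) (by positivity)) (fracKernel_nonneg _ _)
    exact pow_le_pow_left₀ (abs_nonneg _) (hM x) 2
  · rw [indicator_of_notMem hxB, image_eq_zero_of_notMem_tsupport fun h => hxB (hR h)]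
    simp

/-! ### The nonlocal Jacobi operator -/

lemma BoundaryData.integrable_min_mul_fracKernel {E : Set 𝔼} {ρ : 𝔼 → ℝ} {n : 𝔼 → 𝔼}
    (H : BoundaryData E ρ n) {s : ℝ} (hs0 : 0 < s) (hs1 : s < 1)
    (harea : Integrable (fun x : 𝔼 => 1 / (1 + ‖x‖) ^ ((N : ℝ) + s)) (surfaceMeasure E))
    {p : 𝔼} (hp : p ∈ frontier E) :
    Integrable (fun x => min 1 (‖x - p‖ ^ 2) * fracKernel s (x - p)) (surfaceMeasure E) := by
  obtain ⟨C₁, hC₁0, hC₁⟩ := H.exists_lintegral_surface_le hs0 hs1 harea ‖p‖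
  refine ⟨Measurable.aestronglyMeasurable (by fun_prop), ?_⟩
  rw [hasFiniteIntegral_iff_ofReal (Eventually.of_forall fun x =>
    mul_nonneg (le_min zero_le_one (sq_nonneg _)) (fracKernel_nonneg _ _))]
  exact (hC₁ p hp le_rfl).trans_lt ENNReal.ofReal_lt_top

lemma ae_jacobiIntegrand_eq (s : ℝ) {E : Set 𝔼} {g h : 𝔼 → ℝ} (hgh : ∀ x ∈ frontier E, g x = h x)
    {p : 𝔼} (hp : p ∈ frontier E) :
    (fun x => (g x - g p) * fracKernel s (x - p)) =ᵐ[surfaceMeasure E] jacobiIntegrand s h p := by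
  filter_upwards [ae_mem_frontier E] with x hx
  rw [jacobiIntegrand, hgh x hx, hgh p hp, fracKernel_sub_comm, fracKernel, mul_one_div]

lemma truncatedDifference_eq (s : ℝ) {E : Set 𝔼} {g h : 𝔼 → ℝ}
    (hgh : ∀ x ∈ frontier E, g x = h x) {p : 𝔼} (hp : p ∈ frontier E) (ε : ℝ) :
    truncatedDifference s E g ε p =
      ∫ x in (Metric.ball p ε)ᶜ, jacobiIntegrand s h p x ∂(surfaceMeasure E) :=
  integral_congr_ae (ae_restrict_of_ae (ae_jacobiIntegrand_eq s hgh hp))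

lemma BoundaryData.pvConverges_jacobi {E : Set 𝔼} {ρ : 𝔼 → ℝ} {n : 𝔼 → 𝔼}
    (H : BoundaryData E ρ n) {s : ℝ} (hs0 : 0 < s) (hs1 : s < 1)
    (harea : Integrable (fun x : 𝔼 => 1 / (1 + ‖x‖) ^ ((N : ℝ) + s)) (surfaceMeasure E))
    {g h : 𝔼 → ℝ} (hg : ContDiff ℝ ∞ g) (hgc : HasCompactSupport g)
    (hgh : ∀ x ∈ frontier E, g x = h x) {p : 𝔼} (hp : p ∈ frontier E) :
    PVConverges (surfaceMeasure E) (jacobiIntegrand s h p) p := by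
  obtain ⟨C, -, hC⟩ := H.exists_truncatedDifference hs0 hs1 harea hg hgc ‖p‖
  obtain ⟨M, hM⟩ := hgc.exists_bound_of_continuous hg.continuous
  obtain ⟨v, hv⟩ := (hC p hp le_rfl).2
  refine ⟨fun ε hε => ?_, v, ?_⟩
  · have hK := integrableOn_fracKernel_compl_ball hs0 harea p hε
    have : IntegrableOn (fun x => (g x - g p) * fracKernel s (x - p)) (Metric.ball p ε)ᶜ
        (surfaceMeasure E) :=
      Integrable.bdd_mul hK (hg.continuous.sub continuous_const).aestronglyMeasurable
        (c := M + M) (Eventually.of_forall fun x =>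
          (norm_sub_le _ _).trans (add_le_add (hM x) (hM p)))
    exact this.congr (ae_restrict_of_ae (ae_jacobiIntegrand_eq s hgh hp))
  · simp_rw [truncatedDifference_eq s hgh hp] at hv
    exact hv

lemma BoundaryData.tendsto_truncatedDifference {E : Set 𝔼} {ρ : 𝔼 → ℝ} {n : 𝔼 → 𝔼}
    (H : BoundaryData E ρ n) {s : ℝ} (hs0 : 0 < s) (hs1 : s < 1)
    (harea : Integrable (fun x : 𝔼 => 1 / (1 + ‖x‖) ^ ((N : ℝ) + s)) (surfaceMeasure E))
    {g h : 𝔼 → ℝ} (hg : ContDiff ℝ ∞ g) (hgc : HasCompactSupport g)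
    (hgh : ∀ x ∈ frontier E, g x = h x) {p : 𝔼} (hp : p ∈ frontier E) :
    Tendsto (fun ε => truncatedDifference s E g ε p) (𝓝[>] (0 : ℝ))
      (𝓝 (pvIntegral (surfaceMeasure E) (jacobiIntegrand s h p) p)) := by
  simp_rw [truncatedDifference_eq s hgh hp]
  obtain ⟨v, hv⟩ := (H.pvConverges_jacobi hs0 hs1 harea hg hgc hgh hp).2
  rw [pvIntegral, hv.limUnder_eq]
  exact hv

lemma BoundaryData.ae_potential_eq {E : Set 𝔼} {ρ : 𝔼 → ℝ} {n : 𝔼 → 𝔼}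
    (H : BoundaryData E ρ n) (s : ℝ) {p : 𝔼} (hp : p ∈ frontier E) :
    (fun x => (1 - inner ℝ (n p) (n x)) * fracKernel s (p - x)) =ᵐ[surfaceMeasure E]
      jacobiPotentialIntegrand s E p := by
  filter_upwards [ae_mem_frontier E] with x hx
  rw [jacobiPotentialIntegrand, ← H.eq_outerNormal x hx, ← H.eq_outerNormal p hp, inner_sub_left,
    real_inner_self_eq_norm_sq, H.norm_eq_one hp, fracKernel, mul_one_div, one_pow,
    real_inner_comm]

lemma BoundaryData.integrable_potential {E : Set 𝔼} {ρ : 𝔼 → ℝ} {n : 𝔼 → 𝔼}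
    (H : BoundaryData E ρ n) {s : ℝ} (hs0 : 0 < s) (hs1 : s < 1)
    (harea : Integrable (fun x : 𝔼 => 1 / (1 + ‖x‖) ^ ((N : ℝ) + s)) (surfaceMeasure E))
    {p : 𝔼} (hp : p ∈ frontier E) :
    Integrable (jacobiPotentialIntegrand s E p) (surfaceMeasure E) := by
  obtain ⟨C, hC0, hC⟩ := H.abs_one_sub_inner_normal_le ‖p‖
  have hnm : Measurable n := H.contDiff.continuous.measurable
  refine Integrable.congr ?_ (H.ae_potential_eq s hp)
  refine ((H.integrable_min_mul_fracKernel hs0 hs1 harea hp).const_mul C).mono'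
    (Measurable.aestronglyMeasurable (by fun_prop)) ?_
  filter_upwards [ae_mem_frontier E] with x hx
  rw [norm_mul, Real.norm_eq_abs, Real.norm_of_nonneg (fracKernel_nonneg _ _), ← mul_assoc,
    fracKernel_sub_comm s p x, norm_sub_rev x p]
  exact mul_le_mul_of_nonneg_right (hC p hp le_rfl x hx) (fracKernel_nonneg _ _)

lemma BoundaryData.stronglyMeasurable_truncatedDifference {E : Set 𝔼} {ρ : 𝔼 → ℝ} {n : 𝔼 → 𝔼}
    (H : BoundaryData E ρ n) (s : ℝ) {g : 𝔼 → ℝ} (hg : Measurable g) (ε : ℝ) :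
    StronglyMeasurable (truncatedDifference s E g ε) := by
  haveI := H.isLocallyFiniteMeasure
  have hA : MeasurableSet {q : 𝔼 × 𝔼 | q.2 ∈ (Metric.ball q.1 ε)ᶜ} := by
    have : {q : 𝔼 × 𝔼 | q.2 ∈ (Metric.ball q.1 ε)ᶜ} = {q : 𝔼 × 𝔼 | ε ≤ dist q.2 q.1} := by
      ext q; simp
    rw [this]
    exact (isClosed_le (by fun_prop) (by fun_prop)).measurableSet
  have h1 := (Measurable.stronglyMeasurable (Measurable.indicator
    (f := fun q : 𝔼 × 𝔼 => (g q.2 - g q.1) * fracKernel s (q.2 - q.1)) (by fun_prop)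
      hA)).integral_prod_right' (ν := surfaceMeasure E)
  convert h1 using 2 with p
  rw [truncatedDifference, ← integral_indicator Metric.isOpen_ball.measurableSet.compl]
  refine integral_congr_ae (Eventually.of_forall fun x => ?_)
  rfl

lemma BoundaryData.integral_mul_truncatedDifference {E : Set 𝔼} {ρ : 𝔼 → ℝ} {n : 𝔼 → 𝔼}
    (H : BoundaryData E ρ n) {s : ℝ} (hs0 : 0 < s) (hs1 : s < 1)
    (harea : Integrable (fun x : 𝔼 => 1 / (1 + ‖x‖) ^ ((N : ℝ) + s)) (surfaceMeasure E))
    {g : 𝔼 → ℝ} (hg : ContDiff ℝ ∞ g) (hgc : HasCompactSupport g) {ε : ℝ} (hε : 0 < ε) :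
    ∫ p, g p * truncatedDifference s E g ε p ∂(surfaceMeasure E) =
      -(1 / 2) * ∫ q, {q : 𝔼 × 𝔼 | ε ≤ ‖q.1 - q.2‖}.indicator (fun q : 𝔼 × 𝔼 =>
        (g q.1 - g q.2) ^ 2 * fracKernel s (q.1 - q.2)) q
        ∂((surfaceMeasure E).prod (surfaceMeasure E)) := by
  haveI := H.isLocallyFiniteMeasure
  obtain ⟨M, hM⟩ := hgc.exists_bound_of_continuous hg.continuous
  have hM0 : 0 ≤ M := (norm_nonneg _).trans (hM 0)
  obtain ⟨R, hR⟩ := hgc.isCompact.isBounded.subset_closedBall (0 : 𝔼)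
  have hgm : Measurable g := hg.continuous.measurable
  set A := {q : 𝔼 × 𝔼 | ε ≤ ‖q.1 - q.2‖} with hA
  have hAm : MeasurableSet A := (isClosed_le (by fun_prop) (by fun_prop)).measurableSet
  set F : 𝔼 × 𝔼 → ℝ := A.indicator fun q => g q.1 * ((g q.2 - g q.1) * fracKernel s (q.1 - q.2))
    with hF
  have hFi : Integrable F ((surfaceMeasure E).prod (surfaceMeasure E)) := by
    refine H.integrable_of_le_surface_weight hs0 hs1 harea
      (C := M * (M + M) * (1 + (ε ^ 2)⁻¹)) (R := R)
      (Measurable.aestronglyMeasurable (Measurable.indicator (by fun_prop) hAm)) fun x _ y _ => ?_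
    have hK := fracKernel_nonneg s (x - y)
    by_cases hxB : x ∈ Metric.closedBall (0 : 𝔼) R
    · rw [indicator_of_mem hxB, Pi.one_apply, one_mul]
      by_cases hq : (x, y) ∈ A
      · rw [hF, indicator_of_mem hq, abs_mul, abs_mul, abs_of_nonneg hK]
        have h1 : ε ≤ ‖x - y‖ := hq
        have h2 : 1 ≤ (1 + (ε ^ 2)⁻¹) * min 1 (‖x - y‖ ^ 2) := by
          rw [mul_min_of_nonneg _ _ (by positivity)]
          refine le_min ?_ ?_
          · have : 0 < (ε ^ 2)⁻¹ := by positivity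
            linarith
          · calc 1 = (ε ^ 2)⁻¹ * ε ^ 2 := by field_simp
              _ ≤ (1 + (ε ^ 2)⁻¹) * ‖x - y‖ ^ 2 := by gcongr; linarith
        have h3 : |g y - g x| ≤ M + M := (abs_sub _ _).trans (add_le_add (hM y) (hM x))
        calc |g x| * (|g y - g x| * fracKernel s (x - y))
            ≤ M * ((M + M) * fracKernel s (x - y)) := by
              refine mul_le_mul (hM x) (mul_le_mul_of_nonneg_right h3 hK) (by positivity) hM0
          _ = M * (M + M) * (1 * fracKernel s (x - y)) := by ring
          _ ≤ M * (M + M) * (((1 + (ε ^ 2)⁻¹) * min 1 (‖x - y‖ ^ 2)) * fracKernel s (x - y)) := by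
              gcongr
          _ = _ := by ring
      · rw [hF, indicator_of_notMem hq, abs_zero]
        have : 0 ≤ min 1 (‖x - y‖ ^ 2) := le_min zero_le_one (sq_nonneg _)
        positivity
    · rw [indicator_of_notMem hxB, hF]
      have h0 : g x = 0 := image_eq_zero_of_notMem_tsupport fun h => hxB (hR h)
      by_cases hq : (x, y) ∈ A
      · rw [indicator_of_mem hq]; simp [h0]
      · rw [indicator_of_notMem hq]; simp
  have h1 : ∫ p, g p * truncatedDifference s E g ε p ∂(surfaceMeasure E) =
      ∫ q, F q ∂((surfaceMeasure E).prod (surfaceMeasure E)) := by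
    rw [integral_prod _ hFi]
    refine integral_congr_ae (Eventually.of_forall fun p => ?_)
    simp only
    rw [truncatedDifference, ← integral_indicator Metric.isOpen_ball.measurableSet.compl,
      ← integral_const_mul]
    refine integral_congr_ae (Eventually.of_forall fun x => ?_)
    simp only
    by_cases hq : (p, x) ∈ A
    · rw [hF, indicator_of_mem hq, indicator_of_mem, fracKernel_sub_comm]
      have : ε ≤ ‖p - x‖ := hq
      simpa [dist_eq_norm, norm_sub_rev x p] using this
    · rw [hF, indicator_of_notMem hq, indicator_of_notMem, mul_zero]
      have : ¬ ε ≤ ‖p - x‖ := hq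
      simpa [dist_eq_norm, norm_sub_rev x p] using this
  have h2 : ∫ q, F q.swap ∂((surfaceMeasure E).prod (surfaceMeasure E)) =
      ∫ q, F q ∂((surfaceMeasure E).prod (surfaceMeasure E)) := integral_prod_swap F
  have h3 : ∫ q, (F q + F q.swap) ∂((surfaceMeasure E).prod (surfaceMeasure E)) =
      - ∫ q, A.indicator (fun q : 𝔼 × 𝔼 => (g q.1 - g q.2) ^ 2 * fracKernel s (q.1 - q.2)) q
        ∂((surfaceMeasure E).prod (surfaceMeasure E)) := by
    rw [← integral_neg]
    refine integral_congr_ae (Eventually.of_forall fun q => ?_)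
    simp only
    have hsw : q.swap ∈ A ↔ q ∈ A := by
      simp only [hA, mem_ofPred_eq, Prod.fst_swap, Prod.snd_swap, norm_sub_rev]
    by_cases hq : q ∈ A
    · rw [hF, indicator_of_mem hq, indicator_of_mem (hsw.2 hq), indicator_of_mem hq]
      simp only [Prod.fst_swap, Prod.snd_swap, fracKernel_sub_comm s q.2 q.1]
      ring
    · rw [hF, indicator_of_notMem hq, indicator_of_notMem (fun h => hq (hsw.1 h)),
        indicator_of_notMem hq]
      simp
  have hFs : Integrable (fun q : 𝔼 × 𝔼 => F q.swap)
      ((surfaceMeasure E).prod (surfaceMeasure E)) := hFi.swap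
  rw [integral_add hFi hFs, h2] at h3
  rw [h1]
  linarith

theorem BoundaryData.integral_jacobi {E : Set 𝔼} {ρ : 𝔼 → ℝ} {n : 𝔼 → 𝔼}
    (H : BoundaryData E ρ n) {s : ℝ} (hs0 : 0 < s) (hs1 : s < 1)
    (harea : Integrable (fun x : 𝔼 => 1 / (1 + ‖x‖) ^ ((N : ℝ) + s)) (surfaceMeasure E))
    {g h : 𝔼 → ℝ} (hg : ContDiff ℝ ∞ g) (hgc : HasCompactSupport g)
    (hgh : ∀ x ∈ frontier E, g x = h x) :
    Integrable (fun p => nonlocalJacobi s E h p * h p) (surfaceMeasure E) ∧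
    -2 * ∫ p, nonlocalJacobi s E h p * h p ∂(surfaceMeasure E) =
      ∫ q, ((g q.1 - g q.2) ^ 2 - 2 * (g q.1 ^ 2 * (1 - inner ℝ (n q.1) (n q.2)))) *
        fracKernel s (q.1 - q.2) ∂((surfaceMeasure E).prod (surfaceMeasure E)) := by
  haveI := H.isLocallyFiniteMeasure
  obtain ⟨R, hR⟩ := hgc.isCompact.isBounded.subset_closedBall (0 : 𝔼)
  obtain ⟨C, hC0, hC⟩ := H.exists_truncatedDifference hs0 hs1 harea hg hgc R
  have hg0 : ∀ x, ¬ ‖x‖ ≤ R → g x = 0 := fun x hx =>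
    image_eq_zero_of_notMem_tsupport fun h => hx (by simpa using hR h)
  have hgm : Measurable g := hg.continuous.measurable
  set σ := surfaceMeasure E with hσ
  set PV : 𝔼 → ℝ := fun p => pvIntegral σ (jacobiIntegrand s h p) p with hPV
  set Pot : 𝔼 → ℝ := fun p => ∫ x, jacobiPotentialIntegrand s E p x ∂σ with hPot
  set ε : ℕ → ℝ := fun j => 1 / ((j : ℝ) + 1) with hε
  have hε0 : ∀ j, 0 < ε j := fun j => by simp only [hε]; positivity
  have hεt : Tendsto ε atTop (𝓝[>] 0) :=
    tendsto_nhdsWithin_iff.2 ⟨tendsto_one_div_add_atTop_nhds_zero_nat, Eventually.of_forall hε0⟩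
  have hT : ∀ p ∈ frontier E, Tendsto (fun j => truncatedDifference s E g (ε j) p) atTop
      (𝓝 (PV p)) := fun p hp =>
    (H.tendsto_truncatedDifference hs0 hs1 harea hg hgc hgh hp).comp hεt
  have hTae : ∀ᵐ p ∂σ, Tendsto (fun j => g p * truncatedDifference s E g (ε j) p) atTop
      (𝓝 (g p * PV p)) := by
    filter_upwards [ae_mem_frontier E] with p hp
    exact (hT p hp).const_mul _
  have hTm : ∀ j, AEStronglyMeasurable (fun p => g p * truncatedDifference s E g (ε j) p) σ :=
    fun j => (hgm.stronglyMeasurable.mul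
      (H.stronglyMeasurable_truncatedDifference s hgm (ε j))).aestronglyMeasurable
  have hCg : Integrable (fun p => C * ‖g p‖) σ :=
    (hg.continuous.integrable_of_hasCompactSupport hgc).norm.const_mul C
  have hTb : ∀ j, ∀ᵐ p ∂σ, ‖g p * truncatedDifference s E g (ε j) p‖ ≤ C * ‖g p‖ := fun j => by
    filter_upwards [ae_mem_frontier E] with p hp
    by_cases hpR : ‖p‖ ≤ R
    · rw [norm_mul, mul_comm]
      exact mul_le_mul_of_nonneg_right ((hC p hp hpR).1 (ε j) (hε0 j)) (norm_nonneg _)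
    · simp [hg0 p hpR]
  have hPVi : Integrable (fun p => g p * PV p) σ := by
    refine hCg.mono' (aestronglyMeasurable_of_tendsto_ae atTop hTm hTae) ?_
    filter_upwards [hTae, ae_all_iff.2 hTb] with p h1 h2
    exact le_of_tendsto h1.norm (Eventually.of_forall h2)
  have hlim1 := tendsto_integral_of_dominated_convergence _ hTm hCg hTb hTae
  have hsq := H.integrable_sq_sub hs0 hs1 harea hg hgc
  have hlim2 : Tendsto (fun j => -(1 / 2) * ∫ q, {q : 𝔼 × 𝔼 | ε j ≤ ‖q.1 - q.2‖}.indicator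
      (fun q : 𝔼 × 𝔼 => (g q.1 - g q.2) ^ 2 * fracKernel s (q.1 - q.2)) q ∂(σ.prod σ)) atTop
      (𝓝 (-(1 / 2) * ∫ q : 𝔼 × 𝔼, (g q.1 - g q.2) ^ 2 * fracKernel s (q.1 - q.2)
        ∂(σ.prod σ))) := by
    refine Tendsto.const_mul _ (tendsto_integral_of_dominated_convergence _ (fun j => ?_) hsq.norm
      (fun j => Eventually.of_forall fun q => norm_indicator_le_norm_self _ _)
      (Eventually.of_forall fun q => ?_))
    · exact hsq.aestronglyMeasurable.indicator
        (isClosed_le (by fun_prop) (by fun_prop)).measurableSet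
    · refine tendsto_const_nhds.congr' ?_
      by_cases hq : q.1 = q.2
      · refine Eventually.of_forall fun j => ?_
        simp only
        by_cases hqA : q ∈ {q : 𝔼 × 𝔼 | ε j ≤ ‖q.1 - q.2‖}
        · rw [indicator_of_mem hqA]
        · rw [indicator_of_notMem hqA, hq]; simp
      · have : 0 < ‖q.1 - q.2‖ := norm_pos_iff.2 (sub_ne_zero.2 hq)
        filter_upwards [hεt.eventually (Ioo_mem_nhdsGT this)] with j hj
        rw [indicator_of_mem]
        exact hj.2.le
  have hPVeq : ∫ p, g p * PV p ∂σ = -(1 / 2) * ∫ q : 𝔼 × 𝔼, (g q.1 - g q.2) ^ 2 *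
      fracKernel s (q.1 - q.2) ∂(σ.prod σ) := by
    refine tendsto_nhds_unique hlim1 (hlim2.congr fun j => ?_)
    exact (H.integral_mul_truncatedDifference hs0 hs1 harea hg hgc (hε0 j)).symm
  have hnd := H.integrable_normal_defect hs0 hs1 harea hg hgc
  have hPotae : ∀ᵐ p ∂σ, g p ^ 2 * Pot p = ∫ x, g p ^ 2 * (1 - inner ℝ (n p) (n x)) *
      fracKernel s (p - x) ∂σ := by
    filter_upwards [ae_mem_frontier E] with p hp
    simp only [hPot]
    rw [← integral_congr_ae (H.ae_potential_eq s hp), ← integral_const_mul]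
    simp_rw [mul_assoc]
    rfl
  have hPoti : Integrable (fun p => g p ^ 2 * Pot p) σ :=
    hnd.integral_prod_left.congr (hPotae.mono fun p hp => hp.symm)
  have hPoteq : ∫ p, g p ^ 2 * Pot p ∂σ = ∫ q, g q.1 ^ 2 * (1 - inner ℝ (n q.1) (n q.2)) *
      fracKernel s (q.1 - q.2) ∂(σ.prod σ) := by
    rw [integral_prod _ hnd]
    exact integral_congr_ae hPotae
  have hJ : (fun p => g p * PV p + g p ^ 2 * Pot p) =ᵐ[σ] fun p => nonlocalJacobi s E h p * h p := by
    filter_upwards [ae_mem_frontier E] with p hp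
    rw [nonlocalJacobi, hgh p hp]
    ring
  refine ⟨(hPVi.add hPoti).congr hJ, ?_⟩
  rw [← integral_congr_ae hJ, integral_add hPVi hPoti, hPVeq, hPoteq]
  have e : ∀ q : 𝔼 × 𝔼, ((g q.1 - g q.2) ^ 2 - 2 * (g q.1 ^ 2 * (1 - inner ℝ (n q.1) (n q.2)))) *
      fracKernel s (q.1 - q.2) = (g q.1 - g q.2) ^ 2 * fracKernel s (q.1 - q.2) -
        2 * (g q.1 ^ 2 * (1 - inner ℝ (n q.1) (n q.2)) * fracKernel s (q.1 - q.2)) := fun q => by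
    ring
  simp_rw [e]
  rw [integral_sub hsq (hnd.const_mul 2), integral_const_mul]
  ring

/-! ### The second variation integrand as a divergence -/

/-- The second derivative at `t = 0` of the Jacobian determinant of `x + t X(x)`. -/
def jacobianSecond (X : EuclideanSpace ℝ (Fin N) → EuclideanSpace ℝ (Fin N))
    (x : EuclideanSpace ℝ (Fin N)) : ℝ :=
  divergence X x ^ 2 - traceL N ((fderiv ℝ X x).comp (fderiv ℝ X x))

/-- The second derivative at `t = 0` of `k(|Φ_t x - Φ_t y|²) J_t(x) J_t(y)`, where
`Φ_t(x) = x + t X(x)`, and `k₁`, `k₂` are the derivatives of `k = k₀`. -/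
def secondVariationIntegrand (k₀ k₁ k₂ : ℝ → ℝ)
    (X : EuclideanSpace ℝ (Fin N) → EuclideanSpace ℝ (Fin N))
    (x y : EuclideanSpace ℝ (Fin N)) : ℝ :=
  4 * k₂ (‖x - y‖ ^ 2) * inner ℝ (x - y) (X x - X y) ^ 2 + 2 * k₁ (‖x - y‖ ^ 2) * ‖X x - X y‖ ^ 2 +
    4 * k₁ (‖x - y‖ ^ 2) * inner ℝ (x - y) (X x - X y) * (divergence X x + divergence X y) +
    k₀ (‖x - y‖ ^ 2) * (2 * (divergence X x * divergence X y) + jacobianSecond X x +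
      jacobianSecond X y)

/-- The part of the second variation in which only the first variable moves. -/
def firstVariableIntegrand (k₀ k₁ k₂ : ℝ → ℝ)
    (X : EuclideanSpace ℝ (Fin N) → EuclideanSpace ℝ (Fin N))
    (x y : EuclideanSpace ℝ (Fin N)) : ℝ :=
  4 * k₂ (‖x - y‖ ^ 2) * inner ℝ (x - y) (X x) ^ 2 + 2 * k₁ (‖x - y‖ ^ 2) * ‖X x‖ ^ 2 +
    4 * k₁ (‖x - y‖ ^ 2) * inner ℝ (x - y) (X x) * divergence X x +
    k₀ (‖x - y‖ ^ 2) * jacobianSecond X x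

/-- The mixed part of the second variation. -/
def mixedIntegrand (k₀ k₁ k₂ : ℝ → ℝ)
    (X : EuclideanSpace ℝ (Fin N) → EuclideanSpace ℝ (Fin N))
    (x y : EuclideanSpace ℝ (Fin N)) : ℝ :=
  -4 * k₂ (‖x - y‖ ^ 2) * inner ℝ (x - y) (X x) * inner ℝ (x - y) (X y) -
    2 * k₁ (‖x - y‖ ^ 2) * inner ℝ (X x) (X y) +
    2 * k₁ (‖x - y‖ ^ 2) * inner ℝ (x - y) (X x) * divergence X y -
    2 * k₁ (‖x - y‖ ^ 2) * inner ℝ (x - y) (X y) * divergence X x +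
    k₀ (‖x - y‖ ^ 2) * (divergence X x * divergence X y)

lemma secondVariationIntegrand_eq (k₀ k₁ k₂ : ℝ → ℝ) (X : 𝔼 → 𝔼) (x y : 𝔼) :
    secondVariationIntegrand k₀ k₁ k₂ X x y = firstVariableIntegrand k₀ k₁ k₂ X x y +
      firstVariableIntegrand k₀ k₁ k₂ X y x + 2 * mixedIntegrand k₀ k₁ k₂ X x y := by
  have h1 : inner ℝ (y - x) (X y) = -inner ℝ (x - y) (X y) := by
    rw [← inner_neg_left, neg_sub]
  simp only [secondVariationIntegrand, firstVariableIntegrand, mixedIntegrand, norm_sub_rev y x, h1,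
    norm_sub_sq_real (X x), inner_sub_right (x - y) (X x)]
  ring

lemma divergence_fderiv_apply {X : 𝔼 → 𝔼} (hX : ContDiff ℝ ∞ X) (x : 𝔼) :
    divergence (fun x => fderiv ℝ X x (X x)) x =
      fderiv ℝ (divergence X) x (X x) + traceL N ((fderiv ℝ X x).comp (fderiv ℝ X x)) := by
  have hX1 : DifferentiableAt ℝ X x := hX.differentiable (by simp) x
  have hX2 : DifferentiableAt ℝ (fderiv ℝ X) x :=
    (hX.fderiv_right (m := ∞) (by simp)).differentiable (by simp) x
  have h1 := hX2.hasFDerivAt.clm_apply hX1.hasFDerivAt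
  have h2 : HasFDerivAt (divergence X) ((traceL N).comp (fderiv ℝ (fderiv ℝ X) x)) x :=
    (traceL N).hasFDerivAt.comp x hX2.hasFDerivAt
  have hsymm : (fderiv ℝ (fderiv ℝ X) x).flip (X x) = fderiv ℝ (fderiv ℝ X) x (X x) := by
    ext1 v
    exact ((hX.contDiffAt (x := x)).isSymmSndFDerivAt
      (by rw [minSmoothness_of_isRCLikeNormedField]; exact WithTop.coe_le_coe.2 le_top)) v (X x)
  rw [divergence, h1.fderiv, map_add, hsymm, h2.fderiv, add_comm]
  rfl

section kernel

variable {k : ℝ → ℝ}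

lemma contDiff_deriv_real (hk : ContDiff ℝ ∞ k) : ContDiff ℝ ∞ (deriv k) :=
  (contDiff_infty_iff_deriv.1 hk).2

lemma hasFDerivAt_kernel (hk : ContDiff ℝ ∞ k) (x y : 𝔼) :
    HasFDerivAt (fun x : 𝔼 => k (‖x - y‖ ^ 2))
      ((2 * deriv k (‖x - y‖ ^ 2)) • innerSL ℝ (x - y)) x :=
  hasFDerivAt_radial (hk.differentiable (by simp) _).hasDerivAt

lemma contDiff_kernel (hk : ContDiff ℝ ∞ k) (y : 𝔼) :
    ContDiff ℝ ∞ fun x : 𝔼 => k (‖x - y‖ ^ 2) :=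
  hk.comp ((contDiff_id.sub contDiff_const).norm_sq ℝ)

/-- The field whose divergence is `firstVariableIntegrand`. -/
def firstVariableField (k : ℝ → ℝ) (X : EuclideanSpace ℝ (Fin N) → EuclideanSpace ℝ (Fin N))
    (y x : EuclideanSpace ℝ (Fin N)) : EuclideanSpace ℝ (Fin N) :=
  (2 * deriv k (‖x - y‖ ^ 2) * inner ℝ (x - y) (X x) + k (‖x - y‖ ^ 2) * divergence X x) • X x -
    k (‖x - y‖ ^ 2) • fderiv ℝ X x (X x)

lemma contDiff_inner_sub {X : 𝔼 → 𝔼} (hX : ContDiff ℝ ∞ X) (y : 𝔼) :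
    ContDiff ℝ ∞ fun x : 𝔼 => (inner ℝ (x - y) (X x) : ℝ) :=
  (contDiff_id.sub contDiff_const).inner ℝ hX

lemma contDiff_firstVariableField (hk : ContDiff ℝ ∞ k) {X : 𝔼 → 𝔼} (hX : ContDiff ℝ ∞ X) (y : 𝔼) :
    ContDiff ℝ ∞ (firstVariableField k X y) := by
  have h1 := contDiff_kernel hk y
  have h2 := contDiff_kernel (contDiff_deriv_real hk) y
  have h3 := contDiff_divergence hX
  have h4 : ContDiff ℝ ∞ fun x => fderiv ℝ X x (X x) :=
    (hX.fderiv_right (m := ∞) (by simp)).clm_apply hX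
  exact ((((contDiff_const.mul h2).mul (contDiff_inner_sub hX y)).add (h1.mul h3)).smul hX).sub
    (h1.smul h4)

lemma hasCompactSupport_firstVariableField (k : ℝ → ℝ) {X : 𝔼 → 𝔼} (hXc : HasCompactSupport X)
    (y : 𝔼) : HasCompactSupport (firstVariableField k X y) :=
  hXc.mono fun x hx => by
    contrapose! hx
    simp only [Function.mem_support, not_not] at hx ⊢
    simp [firstVariableField, hx]

lemma divergence_firstVariableField (hk : ContDiff ℝ ∞ k) {X : 𝔼 → 𝔼} (hX : ContDiff ℝ ∞ X)
    (x y : 𝔼) : divergence (firstVariableField k X y) x =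
      firstVariableIntegrand k (deriv k) (deriv (deriv k)) X x y := by
  have hk1 := contDiff_deriv_real hk
  have d0 := hasFDerivAt_kernel hk x y
  have d1 := hasFDerivAt_kernel hk1 x y
  have dX : HasFDerivAt X (fderiv ℝ X x) x := (hX.differentiable (by simp) x).hasFDerivAt
  have dd : HasFDerivAt (divergence X) (fderiv ℝ (divergence X) x) x :=
    ((contDiff_divergence hX).differentiable (by simp) x).hasFDerivAt
  have h4 : ContDiff ℝ ∞ fun x => fderiv ℝ X x (X x) :=
    (hX.fderiv_right (m := ∞) (by simp)).clm_apply hX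
  have di : HasFDerivAt (fun x : 𝔼 => (inner ℝ (x - y) (X x) : ℝ)) _ x :=
    ((hasFDerivAt_id x).sub_const y).inner ℝ dX
  have dφ : HasFDerivAt (fun x => 2 * deriv k (‖x - y‖ ^ 2) * inner ℝ (x - y) (X x) +
      k (‖x - y‖ ^ 2) * divergence X x) _ x := ((d1.const_mul 2).mul di).add (d0.mul dd)
  have e1 : divergence (firstVariableField k X y) x =
      divergence (fun x => (2 * deriv k (‖x - y‖ ^ 2) * inner ℝ (x - y) (X x) +
        k (‖x - y‖ ^ 2) * divergence X x) • X x) x -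
      divergence (fun x => k (‖x - y‖ ^ 2) • fderiv ℝ X x (X x)) x :=
    divergence_sub (dφ.differentiableAt.smul dX.differentiableAt)
      (d0.differentiableAt.smul (h4.differentiable (by simp) x))
  have e2 := divergence_smul dφ.differentiableAt dX.differentiableAt
  have e3 := divergence_smul d0.differentiableAt (h4.differentiable (by simp) x)
  rw [e1]
  refine (congrArg₂ (· - ·) e2 e3).trans ?_
  rw [divergence_fderiv_apply hX, d0.fderiv, dφ.fderiv]
  simp only [firstVariableIntegrand, jacobianSecond, _root_.add_apply, _root_.smul_apply,
    innerSL_apply_apply, smul_eq_mul, fderivInnerCLM_apply, ContinuousLinearMap.comp_apply,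
    ContinuousLinearMap.prod_apply, ContinuousLinearMap.id_apply,
    real_inner_self_eq_norm_sq, id_eq]
  ring

/-- The field whose divergence is `mixedIntegrand`. -/
def mixedCoefficient (k : ℝ → ℝ) (X : EuclideanSpace ℝ (Fin N) → EuclideanSpace ℝ (Fin N))
    (x y : EuclideanSpace ℝ (Fin N)) : ℝ :=
  -2 * deriv k (‖x - y‖ ^ 2) * inner ℝ (x - y) (X y) + k (‖x - y‖ ^ 2) * divergence X y

lemma contDiff_mixedCoefficient (hk : ContDiff ℝ ∞ k) (X : 𝔼 → 𝔼) (y : 𝔼) :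
    ContDiff ℝ ∞ fun x => mixedCoefficient k X x y := by
  have h1 := contDiff_kernel hk y
  have h2 := contDiff_kernel (contDiff_deriv_real hk) y
  exact ((contDiff_const.mul h2).mul ((contDiff_id.sub contDiff_const).inner ℝ
    contDiff_const)).add (h1.mul contDiff_const)

lemma divergence_mixed (hk : ContDiff ℝ ∞ k) {X : 𝔼 → 𝔼} (hX : ContDiff ℝ ∞ X) (x y : 𝔼) :
    divergence (fun x => mixedCoefficient k X x y • X x) x =
      mixedIntegrand k (deriv k) (deriv (deriv k)) X x y := by
  have hk1 := contDiff_deriv_real hk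
  have d0 := hasFDerivAt_kernel hk x y
  have d1 := hasFDerivAt_kernel hk1 x y
  have di : HasFDerivAt (fun x : 𝔼 => (inner ℝ (x - y) (X y) : ℝ)) _ x :=
    ((hasFDerivAt_id x).sub_const y).inner ℝ (hasFDerivAt_const (X y) x)
  have dφ : HasFDerivAt (fun x => mixedCoefficient k X x y) _ x :=
    ((d1.const_mul (-2)).mul di).add (d0.mul_const (divergence X y))
  rw [divergence_smul dφ.differentiableAt (hX.differentiable (by simp) x), dφ.fderiv]
  simp only [mixedIntegrand, mixedCoefficient, _root_.add_apply, _root_.smul_apply,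
    innerSL_apply_apply, smul_eq_mul, fderivInnerCLM_apply, ContinuousLinearMap.comp_apply,
    ContinuousLinearMap.prod_apply, ContinuousLinearMap.id_apply, _root_.zero_apply,
    inner_zero_right, id_eq]
  ring

lemma divergence_kernel_smul (hk : ContDiff ℝ ∞ k) {X : 𝔼 → 𝔼} (hX : ContDiff ℝ ∞ X) (x y : 𝔼) :
    divergence (fun y => k (‖x - y‖ ^ 2) • X y) y = mixedCoefficient k X x y := by
  have h1 : (fun y => k (‖x - y‖ ^ 2) • X y) = fun y => k (‖y - x‖ ^ 2) • X y := by
    ext1 y; rw [norm_sub_rev]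
  have d0 := hasFDerivAt_kernel hk y x
  rw [h1, divergence_smul d0.differentiableAt (hX.differentiable (by simp) y), d0.fderiv,
    mixedCoefficient, norm_sub_rev y x, ← neg_sub x y]
  simp only [_root_.smul_apply, innerSL_apply_apply, smul_eq_mul, inner_neg_left]
  ring

end kernel

/-! ### The second variation for smooth compactly supported kernels -/

lemma deriv_eq_zero_of_ge {k : ℝ → ℝ} {U : ℝ} (hU : ∀ u, U ≤ u → k u = 0) {u : ℝ} (hu : U + 1 ≤ u) :
    deriv k u = 0 := by
  have : k =ᶠ[𝓝 u] fun _ => 0 := by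
    filter_upwards [lt_mem_nhds (show U < u by linarith)] with v hv
    exact hU v hv.le
  rw [this.deriv_eq, deriv_const]

lemma hasCompactSupport_of_radial {F : 𝔼 × 𝔼 → ℝ} {S : Set 𝔼} (hS : IsCompact S) {U : ℝ}
    (h1 : ∀ x y, x ∉ S → F (x, y) = 0) (h2 : ∀ x y, U ≤ ‖x - y‖ ^ 2 → F (x, y) = 0) :
    HasCompactSupport F := by
  obtain ⟨R, hR⟩ := hS.isBounded.subset_closedBall (0 : 𝔼)
  refine HasCompactSupport.intro (hS.prod (isCompact_closedBall (0 : 𝔼) (R + |U| + 1))) ?_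
  rintro ⟨x, y⟩ hxy
  by_cases hx : x ∈ S
  · refine h2 x y ?_
    have hy : y ∉ Metric.closedBall (0 : 𝔼) (R + |U| + 1) := fun h => hxy ⟨hx, h⟩
    rw [mem_closedBall_zero_iff, not_le] at hy
    have hxR := hR hx
    rw [mem_closedBall_zero_iff] at hxR
    have h3 : ‖y‖ ≤ ‖x‖ + ‖x - y‖ := by
      calc ‖y‖ = ‖x - (x - y)‖ := by congr 1; abel
        _ ≤ _ := norm_sub_le _ _
    nlinarith [le_abs_self U, abs_nonneg U]
  · exact h1 x y hx

lemma continuous_jacobianSecond {X : 𝔼 → 𝔼} (hX : ContDiff ℝ ∞ X) :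
    Continuous (jacobianSecond X) := by
  have h1 : Continuous (fderiv ℝ X) := hX.continuous_fderiv (by simp)
  exact ((contDiff_divergence hX).continuous.pow 2).sub
    ((traceL N).continuous.comp (h1.clm_comp h1))

lemma fderiv_eq_zero_of_notMem {X : 𝔼 → 𝔼} {x : 𝔼} (hx : x ∉ tsupport X) : fderiv ℝ X x = 0 :=
  image_eq_zero_of_notMem_tsupport fun h => hx (tsupport_fderiv_subset ℝ h)

lemma divergence_eq_zero_of_notMem {X : 𝔼 → 𝔼} {x : 𝔼} (hx : x ∉ tsupport X) :
    divergence X x = 0 := by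
  rw [divergence, fderiv_eq_zero_of_notMem hx, map_zero]

lemma jacobianSecond_eq_zero_of_notMem {X : 𝔼 → 𝔼} {x : 𝔼} (hx : x ∉ tsupport X) :
    jacobianSecond X x = 0 := by
  simp [jacobianSecond, divergence_eq_zero_of_notMem hx, fderiv_eq_zero_of_notMem hx]

lemma BoundaryData.setIntegral_compl_divergence {E : Set 𝔼} {ρ : 𝔼 → ℝ} {n : 𝔼 → 𝔼}
    (H : BoundaryData E ρ n) {Z : 𝔼 → 𝔼} (hZ : ContDiff ℝ ∞ Z) (hZc : HasCompactSupport Z) :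
    ∫ x in Eᶜ, divergence Z x = -1 * ∫ x, inner ℝ (Z x) (n x) ∂(surfaceMeasure E) := by
  have h1 := integral_add_compl H.isOpen.measurableSet (integrable_divergence hZ hZc)
  rw [integral_divergence_eq_zero hZ hZc, H.setIntegral_divergence hZ hZc] at h1
  linarith

/-- `g (div X - ⟨DX n, n⟩)`, which on the boundary is `g²` times the mean curvature. -/
def curvatureWeight (g : EuclideanSpace ℝ (Fin N) → ℝ)
    (n X : EuclideanSpace ℝ (Fin N) → EuclideanSpace ℝ (Fin N)) (x : EuclideanSpace ℝ (Fin N)) : ℝ :=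
  g x * (divergence X x - inner ℝ (fderiv ℝ X x (n x)) (n x))

section identity

variable {E : Set (EuclideanSpace ℝ (Fin N))} {ρ : EuclideanSpace ℝ (Fin N) → ℝ}
  {n X : EuclideanSpace ℝ (Fin N) → EuclideanSpace ℝ (Fin N)} {g : EuclideanSpace ℝ (Fin N) → ℝ}
  {k : ℝ → ℝ} {U : ℝ}

lemma continuous_firstVariableField (hk : ContDiff ℝ ∞ k) (hX : ContDiff ℝ ∞ X) :
    Continuous fun q : 𝔼 × 𝔼 => firstVariableField k X q.1 q.2 := by
  have h0 := hk.continuous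
  have h1 := (contDiff_deriv_real hk).continuous
  have h2 := hX.continuous
  have h3 := (contDiff_divergence hX).continuous
  have h4 : Continuous (fderiv ℝ X) := hX.continuous_fderiv (by simp)
  unfold firstVariableField
  fun_prop

lemma BoundaryData.integral_firstVariable (H : BoundaryData E ρ n) (hk : ContDiff ℝ ∞ k)
    (hkU : ∀ u, U ≤ u → k u = 0) (hX : ContDiff ℝ ∞ X) (hXc : HasCompactSupport X)
    (hXn : ∀ x ∈ frontier E, X x = g x • n x) {A A' : Set 𝔼} {e e' : ℝ}
    (hA : ∀ Z : 𝔼 → 𝔼, ContDiff ℝ ∞ Z → HasCompactSupport Z → ∫ x in A, divergence Z x =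
      e * ∫ x, inner ℝ (Z x) (n x) ∂(surfaceMeasure E))
    (hA' : ∀ Z : 𝔼 → 𝔼, ContDiff ℝ ∞ Z → HasCompactSupport Z → ∫ x in A', divergence Z x =
      e' * ∫ x, inner ℝ (Z x) (n x) ∂(surfaceMeasure E)) :
    ∫ y in A', ∫ x in A, firstVariableIntegrand k (deriv k) (deriv (deriv k)) X x y =
      e * ∫ x, (-e' * (g x ^ 2 * ∫ y, k (‖x - y‖ ^ 2) * inner ℝ (n x) (n y) ∂(surfaceMeasure E)) +
        curvatureWeight g n X x * ∫ y in A', k (‖x - y‖ ^ 2)) ∂(surfaceMeasure E) := by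
  haveI := H.isLocallyFiniteMeasure
  have hkc := hk.continuous
  have hk1c := (contDiff_deriv_real hk).continuous
  simp_rw [← divergence_firstVariableField hk hX, fun y => hA _ (contDiff_firstVariableField hk hX y)
    (hasCompactSupport_firstVariableField k hXc y)]
  rw [integral_const_mul]
  congr 1
  have hcont : Continuous (Function.uncurry fun y x => inner ℝ (firstVariableField k X y x) (n x)) :=
    (continuous_firstVariableField hk hX).inner (H.contDiff.continuous.comp continuous_snd)
  have hsupp : HasCompactSupport (Function.uncurry fun y x =>
      (inner ℝ (firstVariableField k X y x) (n x) : ℝ)) := by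
    have : HasCompactSupport fun q : 𝔼 × 𝔼 =>
        (inner ℝ (firstVariableField k X q.2 q.1) (n q.1) : ℝ) := by
      refine hasCompactSupport_of_radial hXc.isCompact (U := U + 1) (fun x y hx => ?_)
        (fun x y hxy => ?_)
      · simp [firstVariableField, image_eq_zero_of_notMem_tsupport hx]
      · simp [firstVariableField, hkU _ (by linarith : U ≤ ‖x - y‖ ^ 2),
          deriv_eq_zero_of_ge hkU hxy]
    exact this.comp_homeomorph (Homeomorph.prodComm 𝔼 𝔼)
  rw [integral_integral_swap_of_hasCompactSupport hcont hsupp]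
  refine integral_congr_ae ?_
  filter_upwards [ae_mem_frontier E] with x hx
  have hnx := H.norm_eq_one hx
  have hpt : ∀ y, inner ℝ (firstVariableField k X y x) (n x) =
      -(g x ^ 2 * mixedCoefficient k (fun _ => n x) x y) +
        curvatureWeight g n X x * k (‖x - y‖ ^ 2) := fun y => by
    simp only [firstVariableField, curvatureWeight, mixedCoefficient, hXn x hx, inner_sub_left,
      inner_smul_left, inner_smul_right, map_smul, conj_trivial, real_inner_self_eq_norm_sq, hnx,
      divergence, fderiv_const_apply, map_zero]
    ring
  simp_rw [hpt]
  have hkx : HasCompactSupport fun y : 𝔼 => k (‖x - y‖ ^ 2) :=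
    HasCompactSupport.intro (isCompact_closedBall x (|U| + 1)) fun y hy => hkU _ (by
      rw [Metric.mem_closedBall, dist_comm, dist_eq_norm, not_le] at hy
      nlinarith [le_abs_self U, abs_nonneg U])
  have hkxs : ContDiff ℝ ∞ fun y : 𝔼 => k (‖x - y‖ ^ 2) :=
    hk.comp ((contDiff_const.sub contDiff_id).norm_sq ℝ)
  have hZs : ContDiff ℝ ∞ fun y : 𝔼 => k (‖x - y‖ ^ 2) • n x := hkxs.smul contDiff_const
  have hZc : HasCompactSupport fun y : 𝔼 => k (‖x - y‖ ^ 2) • n x := hkx.smul_right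
  have hmx : ∀ y, mixedCoefficient k (fun _ => n x) x y =
      divergence (fun y => k (‖x - y‖ ^ 2) • n x) y := fun y =>
    (divergence_kernel_smul hk (contDiff_const (c := n x)) x y).symm
  simp_rw [hmx]
  have i1 : IntegrableOn (fun y => -(g x ^ 2 * divergence (fun y => k (‖x - y‖ ^ 2) • n x) y)) A' :=
    ((integrable_divergence hZs hZc).integrableOn.const_mul _).neg
  rw [integral_add i1
    ((hkxs.continuous.integrable_of_hasCompactSupport hkx).integrableOn.const_mul _),
    integral_neg, integral_const_mul, integral_const_mul, hA' _ hZs hZc]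
  simp_rw [inner_smul_left, conj_trivial]
  ring

lemma BoundaryData.integral_mixed (H : BoundaryData E ρ n) (hk : ContDiff ℝ ∞ k)
    (hkU : ∀ u, U ≤ u → k u = 0) (hX : ContDiff ℝ ∞ X) (hXc : HasCompactSupport X)
    (hXn : ∀ x ∈ frontier E, X x = g x • n x) {A A' : Set 𝔼} {e e' : ℝ}
    (hA : ∀ Z : 𝔼 → 𝔼, ContDiff ℝ ∞ Z → HasCompactSupport Z → ∫ x in A, divergence Z x =
      e * ∫ x, inner ℝ (Z x) (n x) ∂(surfaceMeasure E))
    (hA' : ∀ Z : 𝔼 → 𝔼, ContDiff ℝ ∞ Z → HasCompactSupport Z → ∫ x in A', divergence Z x =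
      e' * ∫ x, inner ℝ (Z x) (n x) ∂(surfaceMeasure E)) :
    ∫ y in A', ∫ x in A, mixedIntegrand k (deriv k) (deriv (deriv k)) X x y =
      e * ∫ x, (e' * ∫ y, g x * g y * k (‖x - y‖ ^ 2) ∂(surfaceMeasure E)) ∂(surfaceMeasure E) := by
  haveI := H.isLocallyFiniteMeasure
  have hkc := hk.continuous
  have hk1c := (contDiff_deriv_real hk).continuous
  have hXcont := hX.continuous
  have hdc := (contDiff_divergence hX).continuous
  have hnc := H.contDiff.continuous
  have hsm : ∀ f : 𝔼 → ℝ, HasCompactSupport fun x => f x • X x := fun f =>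
    HasCompactSupport.smul_left (f := f) hXc
  have hAm : ∀ y, ∫ x in A, divergence (fun x => mixedCoefficient k X x y • X x) x =
      e * ∫ x, inner ℝ (mixedCoefficient k X x y • X x) (n x) ∂(surfaceMeasure E) := fun y =>
    hA _ ((contDiff_mixedCoefficient hk X y).smul hX) (hsm fun x => mixedCoefficient k X x y)
  simp_rw [← divergence_mixed hk hX, hAm]
  rw [integral_const_mul]
  congr 1
  have hcont : Continuous (Function.uncurry fun y x =>
      (inner ℝ (mixedCoefficient k X x y • X x) (n x) : ℝ)) := by
    unfold mixedCoefficient Function.uncurry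
    fun_prop
  have hsupp : HasCompactSupport (Function.uncurry fun y x =>
      (inner ℝ (mixedCoefficient k X x y • X x) (n x) : ℝ)) := by
    have : HasCompactSupport fun q : 𝔼 × 𝔼 =>
        (inner ℝ (mixedCoefficient k X q.1 q.2 • X q.1) (n q.1) : ℝ) := by
      refine hasCompactSupport_of_radial hXc.isCompact (U := U + 1) (fun x y hx => ?_)
        (fun x y hxy => ?_)
      · simp [image_eq_zero_of_notMem_tsupport hx]
      · simp [mixedCoefficient, hkU _ (by linarith : U ≤ ‖x - y‖ ^ 2),
          deriv_eq_zero_of_ge hkU hxy]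
    exact this.comp_homeomorph (Homeomorph.prodComm 𝔼 𝔼)
  rw [integral_integral_swap_of_hasCompactSupport hcont hsupp]
  refine integral_congr_ae ?_
  filter_upwards [ae_mem_frontier E] with x hx
  have hnx := H.norm_eq_one hx
  have hkxs : ContDiff ℝ ∞ fun y : 𝔼 => k (‖x - y‖ ^ 2) :=
    hk.comp ((contDiff_const.sub contDiff_id).norm_sq ℝ)
  have hpt : ∀ y, inner ℝ (mixedCoefficient k X x y • X x) (n x) =
      g x * divergence (fun y => k (‖x - y‖ ^ 2) • X y) y := fun y => by
    rw [divergence_kernel_smul hk hX, hXn x hx, inner_smul_left, inner_smul_left,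
      real_inner_self_eq_norm_sq, hnx]
    simp only [conj_trivial]
    ring
  simp_rw [hpt]
  rw [integral_const_mul, hA' (fun y => k (‖x - y‖ ^ 2) • X y) (hkxs.smul hX)
    (hsm fun y => k (‖x - y‖ ^ 2)), mul_left_comm, ← integral_const_mul]
  congr 1
  refine integral_congr_ae ?_
  filter_upwards [ae_mem_frontier E] with y hy
  rw [hXn y hy, inner_smul_left, inner_smul_left, real_inner_self_eq_norm_sq, H.norm_eq_one hy]
  simp only [conj_trivial]
  ring

/-- The second variation for a smooth compactly supported radial kernel. -/
theorem BoundaryData.integral_secondVariation (H : BoundaryData E ρ n) (hk : ContDiff ℝ ∞ k)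
    (hkU : ∀ u, U ≤ u → k u = 0) (hX : ContDiff ℝ ∞ X) (hXc : HasCompactSupport X)
    (hg : ContDiff ℝ ∞ g) (hgc : HasCompactSupport g)
    (hXn : ∀ x ∈ frontier E, X x = g x • n x) :
    ∫ q in E ×ˢ Eᶜ, secondVariationIntegrand k (deriv k) (deriv (deriv k)) X q.1 q.2
        ∂(volume.prod volume) =
      ∫ q, ((g q.1 - g q.2) ^ 2 - 2 * (g q.1 ^ 2 * (1 - inner ℝ (n q.1) (n q.2)))) *
        k (‖q.1 - q.2‖ ^ 2) ∂((surfaceMeasure E).prod (surfaceMeasure E)) -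
      ∫ x, curvatureWeight g n X x * (∫ y, sideSign E y * k (‖y - x‖ ^ 2))
        ∂(surfaceMeasure E) := by
  haveI := H.isLocallyFiniteMeasure
  have hEm := H.isOpen.measurableSet
  have hkc := hk.continuous
  have hk1c := (contDiff_deriv_real hk).continuous
  have hk2c := (contDiff_deriv_real (contDiff_deriv_real hk)).continuous
  have hXcont := hX.continuous
  have hdc := (contDiff_divergence hX).continuous
  have hjc := continuous_jacobianSecond hX
  have hnc := H.contDiff.continuous
  have hgcont := hg.continuous
  have hDc : Continuous (fderiv ℝ X) := hX.continuous_fderiv (by simp)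
  set σ := surfaceMeasure E with hσ
  have hk1U : ∀ u, U + 1 ≤ u → deriv k u = 0 := fun u hu => deriv_eq_zero_of_ge hkU hu
  have hk2U : ∀ u, U + 1 + 1 ≤ u → deriv (deriv k) u = 0 := fun u hu => deriv_eq_zero_of_ge hk1U hu
  set G : 𝔼 × 𝔼 → ℝ := fun q =>
    firstVariableIntegrand k (deriv k) (deriv (deriv k)) X q.1 q.2 with hG
  set Mx : 𝔼 × 𝔼 → ℝ := fun q => mixedIntegrand k (deriv k) (deriv (deriv k)) X q.1 q.2 with hMx
  have hGc : Continuous G := by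
    simp only [hG]; unfold firstVariableIntegrand; fun_prop
  have hMc : Continuous Mx := by
    simp only [hMx]; unfold mixedIntegrand; fun_prop
  have hGs : HasCompactSupport G := by
    refine hasCompactSupport_of_radial hXc.isCompact (U := U + 1 + 1) (fun x y hx => ?_)
      (fun x y hxy => ?_)
    · simp [hG, firstVariableIntegrand, image_eq_zero_of_notMem_tsupport hx,
        divergence_eq_zero_of_notMem hx, jacobianSecond_eq_zero_of_notMem hx]
    · simp [hG, firstVariableIntegrand, hk2U _ hxy, hk1U _ (by linarith : U + 1 ≤ ‖x - y‖ ^ 2),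
        hkU _ (by linarith : U ≤ ‖x - y‖ ^ 2)]
  have hMs : HasCompactSupport Mx := by
    refine hasCompactSupport_of_radial hXc.isCompact (U := U + 1 + 1) (fun x y hx => ?_)
      (fun x y hxy => ?_)
    · simp [hMx, mixedIntegrand, image_eq_zero_of_notMem_tsupport hx,
        divergence_eq_zero_of_notMem hx]
    · simp [hMx, mixedIntegrand, hk2U _ hxy, hk1U _ (by linarith : U + 1 ≤ ‖x - y‖ ^ 2),
        hkU _ (by linarith : U ≤ ‖x - y‖ ^ 2)]
  rw [← Measure.prod_restrict]
  set μ₁ := (volume : Measure 𝔼).restrict E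
  set μ₂ := (volume : Measure 𝔼).restrict Eᶜ
  have iG : Integrable G (μ₁.prod μ₂) := hGc.integrable_of_hasCompactSupport hGs
  have iG' : Integrable (fun q : 𝔼 × 𝔼 => G q.swap) (μ₁.prod μ₂) :=
    (hGc.integrable_of_hasCompactSupport hGs : Integrable G (μ₂.prod μ₁)).swap
  have iM : Integrable Mx (μ₁.prod μ₂) := hMc.integrable_of_hasCompactSupport hMs
  have hQ : ∀ q : 𝔼 × 𝔼, secondVariationIntegrand k (deriv k) (deriv (deriv k)) X q.1 q.2 =
      G q + G q.swap + 2 * Mx q := fun q => secondVariationIntegrand_eq _ _ _ _ _ _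
  simp_rw [hQ]
  have iGG : Integrable (fun q => G q + G q.swap) (μ₁.prod μ₂) := iG.add iG'
  rw [integral_add iGG (iM.const_mul 2), integral_add iG iG', integral_const_mul]
  have hdE : ∀ Z : 𝔼 → 𝔼, ContDiff ℝ ∞ Z → HasCompactSupport Z → ∫ x in E, divergence Z x =
      1 * ∫ x, inner ℝ (Z x) (n x) ∂σ := fun Z h1 h2 => by
    rw [one_mul]; exact H.setIntegral_divergence h1 h2
  have hdE' : ∀ Z : 𝔼 → 𝔼, ContDiff ℝ ∞ Z → HasCompactSupport Z → ∫ x in Eᶜ, divergence Z x =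
      -1 * ∫ x, inner ℝ (Z x) (n x) ∂σ := fun Z h1 h2 => H.setIntegral_compl_divergence h1 h2
  have e1 : ∫ q, G q ∂(μ₁.prod μ₂) = _ :=
    (integral_prod_symm _ iG).trans (H.integral_firstVariable hk hkU hX hXc hXn hdE hdE')
  have e2 : ∫ q, G q.swap ∂(μ₁.prod μ₂) = _ :=
    (integral_prod _ iG').trans (H.integral_firstVariable hk hkU hX hXc hXn hdE' hdE)
  have e3 : ∫ q, Mx q ∂(μ₁.prod μ₂) = _ :=
    (integral_prod_symm _ iM).trans (H.integral_mixed hk hkU hX hXc hXn hdE hdE')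
  rw [e1, e2, e3]
  -- integrability on the boundary
  have hcs : ∀ F : 𝔼 × 𝔼 → ℝ, Continuous F → (∀ x y, g x = 0 → F (x, y) = 0) →
      (∀ x y, U ≤ ‖x - y‖ ^ 2 → F (x, y) = 0) → HasCompactSupport F := fun F _ h1 h2 =>
    hasCompactSupport_of_radial hgc.isCompact
      (fun x y hx => h1 x y (image_eq_zero_of_notMem_tsupport hx)) h2
  have iA : Integrable (fun q : 𝔼 × 𝔼 => g q.1 ^ 2 * (k (‖q.1 - q.2‖ ^ 2) *
      inner ℝ (n q.1) (n q.2))) (σ.prod σ) := by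
    have hc : Continuous fun q : 𝔼 × 𝔼 => g q.1 ^ 2 * (k (‖q.1 - q.2‖ ^ 2) *
      inner ℝ (n q.1) (n q.2)) := by fun_prop
    exact hc.integrable_of_hasCompactSupport (hcs _ hc (fun x y h => by simp [h])
      (fun x y h => by simp [hkU _ h]))
  have iB : Integrable (fun q : 𝔼 × 𝔼 => g q.1 * g q.2 * k (‖q.1 - q.2‖ ^ 2)) (σ.prod σ) := by
    have hc : Continuous fun q : 𝔼 × 𝔼 => g q.1 * g q.2 * k (‖q.1 - q.2‖ ^ 2) := by fun_prop
    exact hc.integrable_of_hasCompactSupport (hcs _ hc (fun x y h => by simp [h])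
      (fun x y h => by simp [hkU _ h]))
  have iD : Integrable (fun q : 𝔼 × 𝔼 => g q.1 ^ 2 * k (‖q.1 - q.2‖ ^ 2)) (σ.prod σ) := by
    have hc : Continuous fun q : 𝔼 × 𝔼 => g q.1 ^ 2 * k (‖q.1 - q.2‖ ^ 2) := by fun_prop
    exact hc.integrable_of_hasCompactSupport (hcs _ hc (fun x y h => by simp [h])
      (fun x y h => by simp [hkU _ h]))
  have iC : ∀ A : Set 𝔼, Integrable (fun q : 𝔼 × 𝔼 => curvatureWeight g n X q.1 *
      k (‖q.1 - q.2‖ ^ 2)) (σ.prod (volume.restrict A)) := fun A => by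
    have hc : Continuous fun q : 𝔼 × 𝔼 => curvatureWeight g n X q.1 * k (‖q.1 - q.2‖ ^ 2) := by
      unfold curvatureWeight
      fun_prop
    exact hc.integrable_of_hasCompactSupport (hcs _ hc (fun x y h => by simp [curvatureWeight, h])
      (fun x y h => by simp [hkU _ h]))
  have iA' : Integrable (fun x => g x ^ 2 * ∫ y, k (‖x - y‖ ^ 2) * inner ℝ (n x) (n y) ∂σ) σ := by
    have := iA.integral_prod_left
    simp_rw [integral_const_mul] at this
    exact this
  have iC' : ∀ A : Set 𝔼, Integrable (fun x => curvatureWeight g n X x *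
      ∫ y in A, k (‖x - y‖ ^ 2)) σ := fun A => by
    have := (iC A).integral_prod_left
    simp_rw [integral_const_mul] at this
    exact this
  have f1 : ∫ x, g x ^ 2 * ∫ y, k (‖x - y‖ ^ 2) * inner ℝ (n x) (n y) ∂σ ∂σ =
      ∫ q : 𝔼 × 𝔼, g q.1 ^ 2 * (k (‖q.1 - q.2‖ ^ 2) * inner ℝ (n q.1) (n q.2)) ∂(σ.prod σ) := by
    rw [integral_prod _ iA]
    simp_rw [integral_const_mul]
  have f2 : ∫ x, ∫ y, g x * g y * k (‖x - y‖ ^ 2) ∂σ ∂σ =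
      ∫ q : 𝔼 × 𝔼, g q.1 * g q.2 * k (‖q.1 - q.2‖ ^ 2) ∂(σ.prod σ) :=
    (integral_prod _ iB).symm
  have iD' : Integrable (fun q : 𝔼 × 𝔼 => g q.2 ^ 2 * k (‖q.1 - q.2‖ ^ 2)) (σ.prod σ) := by
    refine iD.swap.congr (Eventually.of_forall fun q => ?_)
    simp only [Function.comp, Prod.fst_swap, Prod.snd_swap, norm_sub_rev]
  have f3 : ∫ q : 𝔼 × 𝔼, g q.2 ^ 2 * k (‖q.1 - q.2‖ ^ 2) ∂(σ.prod σ) =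
      ∫ q : 𝔼 × 𝔼, g q.1 ^ 2 * k (‖q.1 - q.2‖ ^ 2) ∂(σ.prod σ) := by
    rw [← integral_prod_swap]
    refine integral_congr_ae (Eventually.of_forall fun q => ?_)
    simp only [Prod.fst_swap, Prod.snd_swap, norm_sub_rev]
  have f4 : ∫ q, ((g q.1 - g q.2) ^ 2 - 2 * (g q.1 ^ 2 * (1 - inner ℝ (n q.1) (n q.2)))) *
        k (‖q.1 - q.2‖ ^ 2) ∂(σ.prod σ) =
      2 * (∫ q : 𝔼 × 𝔼, g q.1 ^ 2 * (k (‖q.1 - q.2‖ ^ 2) * inner ℝ (n q.1) (n q.2)) ∂(σ.prod σ)) -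
      2 * ∫ q : 𝔼 × 𝔼, g q.1 * g q.2 * k (‖q.1 - q.2‖ ^ 2) ∂(σ.prod σ) := by
    have h1 : ∀ q : 𝔼 × 𝔼, ((g q.1 - g q.2) ^ 2 - 2 * (g q.1 ^ 2 *
        (1 - inner ℝ (n q.1) (n q.2)))) * k (‖q.1 - q.2‖ ^ 2) =
        (2 * (g q.1 ^ 2 * (k (‖q.1 - q.2‖ ^ 2) * inner ℝ (n q.1) (n q.2))) -
        2 * (g q.1 * g q.2 * k (‖q.1 - q.2‖ ^ 2))) + (g q.2 ^ 2 * k (‖q.1 - q.2‖ ^ 2) -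
          g q.1 ^ 2 * k (‖q.1 - q.2‖ ^ 2)) := fun q => by ring
    simp_rw [h1]
    have i1 : Integrable (fun q : 𝔼 × 𝔼 => 2 * (g q.1 ^ 2 * (k (‖q.1 - q.2‖ ^ 2) *
        inner ℝ (n q.1) (n q.2))) - 2 * (g q.1 * g q.2 * k (‖q.1 - q.2‖ ^ 2))) (σ.prod σ) :=
      (iA.const_mul 2).sub (iB.const_mul 2)
    have i2 : Integrable (fun q : 𝔼 × 𝔼 => g q.2 ^ 2 * k (‖q.1 - q.2‖ ^ 2) -
        g q.1 ^ 2 * k (‖q.1 - q.2‖ ^ 2)) (σ.prod σ) := iD'.sub iD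
    rw [integral_add i1 i2,
      integral_sub (iA.const_mul 2) (iB.const_mul 2), integral_sub iD' iD, f3, sub_self, add_zero,
      integral_const_mul, integral_const_mul]
  have f5 : ∀ x, ∫ y, sideSign E y * k (‖y - x‖ ^ 2) =
      (∫ y in E, k (‖x - y‖ ^ 2)) - ∫ y in Eᶜ, k (‖x - y‖ ^ 2) := fun x => by
    have hkx : HasCompactSupport fun y : 𝔼 => k (‖x - y‖ ^ 2) :=
      HasCompactSupport.intro (isCompact_closedBall x (|U| + 1)) fun y hy => hkU _ (by
        rw [Metric.mem_closedBall, dist_comm, dist_eq_norm, not_le] at hy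
        nlinarith [le_abs_self U, abs_nonneg U])
    have hi : Integrable fun y : 𝔼 => k (‖x - y‖ ^ 2) :=
      Continuous.integrable_of_hasCompactSupport (by fun_prop) hkx
    rw [← integral_indicator hEm, ← integral_indicator hEm.compl, ← integral_sub
      (hi.indicator hEm) (hi.indicator hEm.compl)]
    refine integral_congr_ae (Eventually.of_forall fun y => ?_)
    simp only
    by_cases hy : y ∈ E
    · rw [sideSign_of_mem hy, indicator_of_mem hy, indicator_of_notMem (by simpa using hy),
        norm_sub_rev]; ring
    · rw [sideSign_of_notMem hy, indicator_of_notMem hy, indicator_of_mem (by simpa using hy),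
        norm_sub_rev]; ring
  have f6 : ∀ x, curvatureWeight g n X x * ∫ y, sideSign E y * k (‖y - x‖ ^ 2) =
      curvatureWeight g n X x * (∫ y in E, k (‖x - y‖ ^ 2)) -
        curvatureWeight g n X x * ∫ y in Eᶜ, k (‖x - y‖ ^ 2) := fun x => by
    rw [f5, mul_sub]
  simp_rw [f6]
  rw [← hσ, integral_sub (iC' E) (iC' Eᶜ), f4, integral_add (iA'.const_mul _) (iC' Eᶜ),
    integral_add (iA'.const_mul _) (iC' E), integral_const_mul, integral_const_mul,
    integral_const_mul, f1, f2]
  ring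

end identity

/-! ### Approximation of the fractional kernel -/

/-- `u^{-c}` cut off smoothly near `0` and `∞`, on the logarithmic scale `J`. -/
def logCutoffKernel (c J u : ℝ) : ℝ :=
  if u ≤ 0 then 0 else
    u ^ (-c) * (⟨1, 2, by norm_num, by norm_num⟩ : ContDiffBump (0 : ℝ)) (Real.log u / J)

lemma hasDerivAt_rpow_mul_log {f : ℝ → ℝ} {f' a J u : ℝ} (hu : 0 < u)
    (hf : HasDerivAt f f' (Real.log u / J)) :
    HasDerivAt (fun u => u ^ (-a) * f (Real.log u / J))
      (u ^ (-(a + 1)) * (f' / J - a * f (Real.log u / J))) u := by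
  have h1 : HasDerivAt (fun u : ℝ => u ^ (-a)) (-a * u ^ (-a - 1)) u :=
    Real.hasDerivAt_rpow_const (Or.inl hu.ne')
  have h2 : HasDerivAt (fun u => f (Real.log u / J)) (f' * (u⁻¹ / J)) u :=
    hf.comp u ((Real.hasDerivAt_log hu.ne').div_const J)
  have h3 : u ^ (-a) * u⁻¹ = u ^ (-(a + 1)) := by
    rw [← Real.rpow_neg_one, ← Real.rpow_add hu]; congr 1; ring
  refine (h1.mul h2).congr_deriv ?_
  rw [show -a - 1 = -(a + 1) by ring, ← h3]
  ring

lemma logCutoffKernel_bounds {c : ℝ} (hc : 0 ≤ c) : ∃ B, 1 ≤ B ∧ ∀ J, 1 ≤ J →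
    ContDiff ℝ ∞ (logCutoffKernel c J) ∧ (∀ u, Real.exp (2 * J) ≤ u → logCutoffKernel c J u = 0) ∧
    logCutoffKernel c J 0 = 0 ∧
    ∀ u, 0 < u → |logCutoffKernel c J u| ≤ u ^ (-c) ∧
      |deriv (logCutoffKernel c J) u| ≤ B * u ^ (-(c + 1)) ∧
      |deriv (deriv (logCutoffKernel c J)) u| ≤ B * u ^ (-(c + 2)) ∧
      (|Real.log u| < J → logCutoffKernel c J u = u ^ (-c) ∧
        deriv (logCutoffKernel c J) u = -c * u ^ (-(c + 1)) ∧
        deriv (deriv (logCutoffKernel c J)) u = c * (c + 1) * u ^ (-(c + 2))) := by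
  set η : ContDiffBump (0 : ℝ) := ⟨1, 2, by norm_num, by norm_num⟩ with hη
  have hηs : ContDiff ℝ ∞ η := η.contDiff
  have hη1s : ContDiff ℝ ∞ (deriv η) := contDiff_deriv_real hηs
  have hη2s : ContDiff ℝ ∞ (deriv (deriv η)) := contDiff_deriv_real hη1s
  obtain ⟨M₁, hM₁⟩ := η.hasCompactSupport.deriv.exists_bound_of_continuous hη1s.continuous
  obtain ⟨M₂, hM₂⟩ := η.hasCompactSupport.deriv.deriv.exists_bound_of_continuous hη2s.continuous
  have hM₁0 : 0 ≤ M₁ := (norm_nonneg _).trans (hM₁ 0)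
  have hM₂0 : 0 ≤ M₂ := (norm_nonneg _).trans (hM₂ 0)
  have hη1 : ∀ v, |η v| ≤ 1 := fun v => by rw [abs_of_nonneg η.nonneg]; exact η.le_one
  refine ⟨1 + (M₁ + c) + (M₂ + c * M₁ + (c + 1) * (M₁ + c)), by
    have : 0 ≤ (M₁ + c) + (M₂ + c * M₁ + (c + 1) * (M₁ + c)) := by positivity
    linarith, fun J hJ => ?_⟩
  have hJ0 : 0 < J := by linarith
  set κ := logCutoffKernel c J with hκ
  have hκpos : ∀ u, 0 < u → κ u = u ^ (-c) * η (Real.log u / J) := fun u hu => by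
    rw [hκ, logCutoffKernel, if_neg (not_le.2 hu)]
  set f₁ : ℝ → ℝ := fun v => deriv η v / J - c * η v with hf₁
  have hd1 : ∀ u, 0 < u → HasDerivAt κ (u ^ (-(c + 1)) * f₁ (Real.log u / J)) u := fun u hu => by
    refine (hasDerivAt_rpow_mul_log hu
      (hηs.differentiable (by simp) _).hasDerivAt).congr_of_eventuallyEq ?_
    filter_upwards [lt_mem_nhds hu] with v hv
    exact hκpos v hv
  have hd2 : ∀ u, 0 < u → HasDerivAt (deriv κ) (u ^ (-(c + 2)) *
      ((deriv (deriv η) (Real.log u / J) / J - c * deriv η (Real.log u / J)) / J -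
        (c + 1) * f₁ (Real.log u / J))) u := fun u hu => by
    have hf : HasDerivAt f₁ (deriv (deriv η) (Real.log u / J) / J - c * deriv η (Real.log u / J))
        (Real.log u / J) :=
      ((hη1s.differentiable (by simp) _).hasDerivAt.div_const J).sub
        ((hηs.differentiable (by simp) _).hasDerivAt.const_mul c)
    have := hasDerivAt_rpow_mul_log (a := c + 1) hu hf
    rw [show c + 1 + 1 = c + 2 by ring] at this
    refine this.congr_of_eventuallyEq ?_
    filter_upwards [lt_mem_nhds hu] with v hv
    exact (hd1 v hv).deriv
  have hbdiv : ∀ a, |a / J| ≤ |a| := fun a => by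
    rw [abs_div, abs_of_pos hJ0]; exact div_le_self (abs_nonneg _) hJ
  have hf₁b : ∀ v, |f₁ v| ≤ M₁ + c := fun v => by
    refine (abs_sub _ _).trans (add_le_add ((hbdiv _).trans (hM₁ v)) ?_)
    rw [abs_mul, abs_of_nonneg hc]
    exact mul_le_of_le_one_right hc (hη1 v)
  refine ⟨?_, ?_, ?_, fun u hu => ⟨?_, ?_, ?_, ?_⟩⟩
  · rw [contDiff_iff_contDiffAt]
    intro u
    rcases lt_or_ge 0 u with hu | hu
    · have : ContDiffAt ℝ ∞ (fun u => u ^ (-c) * η (Real.log u / J)) u :=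
        (Real.contDiffAt_rpow_const_of_ne hu.ne').mul
          (hηs.contDiffAt.comp u ((Real.contDiffAt_log.2 hu.ne').div_const J))
      refine this.congr_of_eventuallyEq ?_
      filter_upwards [lt_mem_nhds hu] with v hv
      exact hκpos v hv
    · refine (contDiffAt_const (c := (0 : ℝ))).congr_of_eventuallyEq ?_
      filter_upwards [gt_mem_nhds (hu.trans_lt (Real.exp_pos (-(2 * J))))] with v hv
      rcases le_or_gt v 0 with h | h
      · rw [hκ, logCutoffKernel, if_pos h]
      · rw [hκpos v h, η.zero_of_le_dist, mul_zero]
        have h1 : Real.log v ≤ -(2 * J) := by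
          rw [Real.log_le_iff_le_exp h]; exact hv.le
        have h2 : Real.log v / J ≤ -2 := by rw [div_le_iff₀ hJ0]; linarith
        rw [Real.dist_eq, sub_zero, abs_of_neg (by linarith)]
        show (2 : ℝ) ≤ _
        linarith
  · intro u hu
    have hu0 : 0 < u := (Real.exp_pos _).trans_le hu
    rw [hκpos u hu0, η.zero_of_le_dist, mul_zero]
    have h1 : 2 * J ≤ Real.log u := (Real.le_log_iff_exp_le hu0).2 hu
    have h2 : 2 ≤ Real.log u / J := by rw [le_div_iff₀ hJ0]; exact h1
    rw [Real.dist_eq, sub_zero, abs_of_pos (by linarith)]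
    exact h2
  · rw [hκ, logCutoffKernel, if_pos le_rfl]
  · rw [hκpos u hu, abs_mul, abs_of_nonneg (by positivity)]
    exact mul_le_of_le_one_right (by positivity) (hη1 _)
  · rw [(hd1 u hu).deriv, abs_mul, abs_of_nonneg (by positivity), mul_comm]
    gcongr
    refine (hf₁b _).trans ?_
    have : 0 ≤ (M₂ + c * M₁ + (c + 1) * (M₁ + c)) := by positivity
    linarith
  · rw [(hd2 u hu).deriv, abs_mul, abs_of_nonneg (by positivity), mul_comm]
    gcongr
    have h1 : |(deriv (deriv η) (Real.log u / J) / J - c * deriv η (Real.log u / J)) / J| ≤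
        M₂ + c * M₁ := by
      refine (hbdiv _).trans ((abs_sub _ _).trans (add_le_add ((hbdiv _).trans (hM₂ _)) ?_))
      rw [abs_mul, abs_of_nonneg hc]
      exact mul_le_mul_of_nonneg_left (hM₁ _) hc
    have h2 : |(c + 1) * f₁ (Real.log u / J)| ≤ (c + 1) * (M₁ + c) := by
      rw [abs_mul, abs_of_nonneg (by linarith)]
      exact mul_le_mul_of_nonneg_left (hf₁b _) (by linarith)
    refine (abs_sub _ _).trans ?_
    have : 0 ≤ M₁ + c := by positivity
    linarith
  · intro hlog
    have hℓ : |Real.log u / J| < 1 := by rw [abs_div, abs_of_pos hJ0, div_lt_one hJ0]; exact hlog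
    have hev : η =ᶠ[𝓝 (Real.log u / J)] fun _ => 1 := by
      refine η.eventuallyEq_one_of_mem_ball ?_
      rw [Metric.mem_ball, Real.dist_eq, sub_zero]
      exact hℓ
    have g0 : η (Real.log u / J) = 1 := hev.self_of_nhds
    have g1 : deriv η (Real.log u / J) = 0 := by rw [hev.deriv_eq, deriv_const]
    have g2 : deriv (deriv η) (Real.log u / J) = 0 := by
      rw [hev.deriv.deriv_eq]; simp
    refine ⟨by rw [hκpos u hu, g0, mul_one], ?_, ?_⟩
    · rw [(hd1 u hu).deriv, hf₁]
      simp only [g0, g1]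
      ring
    · rw [(hd2 u hu).deriv, hf₁]
      simp only [g0, g1, g2]
      ring

lemma fracKernel_eq_sq_rpow (s : ℝ) (z : 𝔼) :
    fracKernel s z = (‖z‖ ^ 2) ^ (-(((N : ℝ) + s) / 2)) := by
  rw [fracKernel_eq_rpow, ← Real.rpow_natCast, ← Real.rpow_mul (norm_nonneg _)]
  congr 1
  push_cast
  ring

lemma exists_secondVariationIntegrand_le {X : 𝔼 → 𝔼} (hX : ContDiff ℝ ∞ X)
    (hXc : HasCompactSupport X) (s : ℝ) : ∃ C R, 0 ≤ C ∧ ∀ k₀ k₁ k₂ : ℝ → ℝ, ∀ B x y, x ≠ y →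
      |k₀ (‖x - y‖ ^ 2)| ≤ B * (‖x - y‖ ^ 2) ^ (-(((N : ℝ) + s) / 2)) →
      |k₁ (‖x - y‖ ^ 2)| ≤ B * (‖x - y‖ ^ 2) ^ (-(((N : ℝ) + s) / 2 + 1)) →
      |k₂ (‖x - y‖ ^ 2)| ≤ B * (‖x - y‖ ^ 2) ^ (-(((N : ℝ) + s) / 2 + 2)) →
      |secondVariationIntegrand k₀ k₁ k₂ X x y| ≤ C * B * fracKernel s (x - y) ∧
      (¬ ‖x‖ ≤ R → ¬ ‖y‖ ≤ R → secondVariationIntegrand k₀ k₁ k₂ X x y = 0) := by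
  obtain ⟨L, hL0, hL⟩ := exists_norm_fderiv_le hX hXc
  obtain ⟨D, hD⟩ := (HasCompactSupport.divergence hXc).exists_bound_of_continuous
    (contDiff_divergence hX).continuous
  obtain ⟨M, hM⟩ := (HasCompactSupport.intro hXc.isCompact fun x hx =>
    jacobianSecond_eq_zero_of_notMem hx).exists_bound_of_continuous (continuous_jacobianSecond hX)
  obtain ⟨R, hR⟩ := hXc.isCompact.isBounded.subset_closedBall (0 : 𝔼)
  have hD0 : 0 ≤ D := (norm_nonneg _).trans (hD 0)
  have hM0 : 0 ≤ M := (norm_nonneg _).trans (hM 0)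
  refine ⟨6 * L ^ 2 + 8 * (L * D) + 2 * D ^ 2 + 2 * M, R, by positivity,
    fun k₀ k₁ k₂ B x y hxy h0 h1 h2 => ⟨?_, fun hx hy => ?_⟩⟩
  · set u := ‖x - y‖ ^ 2 with hu
    set c := ((N : ℝ) + s) / 2
    have hz : 0 < ‖x - y‖ := norm_pos_iff.2 (sub_ne_zero.2 hxy)
    have hu0 : 0 < u := by positivity
    rw [fracKernel_eq_sq_rpow, ← hu]
    set P := u ^ (-c) with hP
    have hP0 : 0 < P := by positivity
    have e1 : u ^ (-(c + 1)) * u = P := by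
      rw [hP, ← Real.rpow_add_one hu0.ne']; congr 1; ring
    have e2 : u ^ (-(c + 2)) * u ^ 2 = P := by
      rw [hP, ← Real.rpow_natCast, ← Real.rpow_add hu0]; congr 1; push_cast; ring
    have hB : 0 ≤ B := by
      by_contra hB
      push Not at hB
      have := mul_neg_of_neg_of_pos hB hP0
      linarith [abs_nonneg (k₀ u)]
    have hw : ‖X x - X y‖ ≤ L * ‖x - y‖ := norm_sub_le_of_norm_fderiv_le hX hL x y
    have hw2 : ‖X x - X y‖ ^ 2 ≤ L ^ 2 * u := by
      rw [hu, ← mul_pow]; gcongr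
    have hi : |inner ℝ (x - y) (X x - X y)| ≤ L * u := by
      refine (abs_real_inner_le_norm _ _).trans ?_
      calc ‖x - y‖ * ‖X x - X y‖ ≤ ‖x - y‖ * (L * ‖x - y‖) := by gcongr
        _ = L * u := by rw [hu]; ring
    have b1 : |4 * k₂ u * inner ℝ (x - y) (X x - X y) ^ 2| ≤ 4 * L ^ 2 * B * P := by
      rw [abs_mul, abs_mul, abs_pow, abs_of_pos (by norm_num : (0 : ℝ) < 4)]
      calc 4 * |k₂ u| * |inner ℝ (x - y) (X x - X y)| ^ 2
          ≤ 4 * (B * u ^ (-(c + 2))) * (L * u) ^ 2 := by gcongr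
        _ = 4 * L ^ 2 * B * (u ^ (-(c + 2)) * u ^ 2) := by ring
        _ = _ := by rw [e2]
    have b2 : |2 * k₁ u * ‖X x - X y‖ ^ 2| ≤ 2 * L ^ 2 * B * P := by
      rw [abs_mul, abs_mul, abs_of_nonneg (sq_nonneg ‖X x - X y‖),
        abs_of_pos (by norm_num : (0 : ℝ) < 2)]
      calc 2 * |k₁ u| * ‖X x - X y‖ ^ 2 ≤ 2 * (B * u ^ (-(c + 1))) * (L ^ 2 * u) := by gcongr
        _ = 2 * L ^ 2 * B * (u ^ (-(c + 1)) * u) := by ring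
        _ = _ := by rw [e1]
    have b3 : |4 * k₁ u * inner ℝ (x - y) (X x - X y) * (divergence X x + divergence X y)| ≤
        8 * (L * D) * B * P := by
      have hdd : |divergence X x + divergence X y| ≤ 2 * D := by
        refine (abs_add_le _ _).trans ?_
        have := hD x
        have := hD y
        rw [Real.norm_eq_abs] at *
        linarith
      rw [abs_mul, abs_mul, abs_mul, abs_of_pos (by norm_num : (0 : ℝ) < 4)]
      calc 4 * |k₁ u| * |inner ℝ (x - y) (X x - X y)| * |divergence X x + divergence X y|
          ≤ 4 * (B * u ^ (-(c + 1))) * (L * u) * (2 * D) := by gcongr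
        _ = 8 * (L * D) * B * (u ^ (-(c + 1)) * u) := by ring
        _ = _ := by rw [e1]
    have b4 : |k₀ u * (2 * (divergence X x * divergence X y) + jacobianSecond X x +
        jacobianSecond X y)| ≤ (2 * D ^ 2 + 2 * M) * B * P := by
      have h3 : |2 * (divergence X x * divergence X y) + jacobianSecond X x +
          jacobianSecond X y| ≤ 2 * D ^ 2 + 2 * M := by
        have h4 : |2 * (divergence X x * divergence X y)| ≤ 2 * D ^ 2 := by
          rw [abs_mul, abs_mul, abs_of_pos (by norm_num : (0 : ℝ) < 2), sq]
          have := hD x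
          have := hD y
          rw [Real.norm_eq_abs] at *
          gcongr
        have := hM x
        have := hM y
        rw [Real.norm_eq_abs] at *
        calc _ ≤ |2 * (divergence X x * divergence X y)| + |jacobianSecond X x| +
              |jacobianSecond X y| := (abs_add_le _ _).trans (add_le_add (abs_add_le _ _) le_rfl)
          _ ≤ _ := by linarith
      rw [abs_mul]
      calc _ ≤ (B * P) * (2 * D ^ 2 + 2 * M) := by gcongr
        _ = _ := by ring
    rw [secondVariationIntegrand, ← hu]
    calc _ ≤ |4 * k₂ u * inner ℝ (x - y) (X x - X y) ^ 2| + |2 * k₁ u * ‖X x - X y‖ ^ 2| +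
          |4 * k₁ u * inner ℝ (x - y) (X x - X y) * (divergence X x + divergence X y)| +
          |k₀ u * (2 * (divergence X x * divergence X y) + jacobianSecond X x +
            jacobianSecond X y)| := (abs_add_le _ _).trans (add_le_add ((abs_add_le _ _).trans
            (add_le_add (abs_add_le _ _) le_rfl)) le_rfl)
      _ ≤ _ := by linarith
  · have hx' : x ∉ tsupport X := fun h => hx (by simpa using hR h)
    have hy' : y ∉ tsupport X := fun h => hy (by simpa using hR h)
    simp [secondVariationIntegrand, image_eq_zero_of_notMem_tsupport hx',
      image_eq_zero_of_notMem_tsupport hy', divergence_eq_zero_of_notMem hx',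
      divergence_eq_zero_of_notMem hy', jacobianSecond_eq_zero_of_notMem hx',
      jacobianSecond_eq_zero_of_notMem hy']

lemma IsGlobalDefiningFunction.integrable_weight_symm {E : Set 𝔼} {ρ : 𝔼 → ℝ} (hN : 1 ≤ N)
    (hE : IsOpen E) (hρ : IsGlobalDefiningFunction E ρ) {s : ℝ} (hs0 : 0 < s) (hs1 : s < 1) (R : ℝ) :
    Integrable ({q : 𝔼 × 𝔼 | ‖q.1‖ ≤ R ∨ ‖q.2‖ ≤ R}.indicator fun q => fracKernel s (q.1 - q.2))
      ((volume.prod volume).restrict (E ×ˢ Eᶜ)) := by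
  have h1 := hρ.integrable_weight hN hE hs0 hs1 R
  have hS : MeasurableSet {q : 𝔼 × 𝔼 | ‖q.1‖ ≤ R ∨ ‖q.2‖ ≤ R} :=
    ((isClosed_le (by fun_prop) (by fun_prop) : IsClosed {q : 𝔼 × 𝔼 | ‖q.1‖ ≤ R}).union
      (isClosed_le (by fun_prop) (by fun_prop) : IsClosed {q : 𝔼 × 𝔼 | ‖q.2‖ ≤ R})).measurableSet
  refine Integrable.mono' (h1.add h1.swap).integrableOn
    (Measurable.aestronglyMeasurable (Measurable.indicator (by fun_prop) hS)) ?_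
  refine (ae_restrict_iff' (hE.measurableSet.prod hE.measurableSet.compl)).2
    (Eventually.of_forall fun q hq => ?_)
  have hK := fracKernel_nonneg s (q.1 - q.2)
  have hnn : ∀ q, 0 ≤ {q : 𝔼 × 𝔼 | ‖q.1‖ ≤ R ∧ ¬ (q.1 ∈ E ↔ q.2 ∈ E)}.indicator
      (fun q => fracKernel s (q.1 - q.2)) q := fun q =>
    indicator_nonneg (fun _ _ => fracKernel_nonneg _ _) q
  have hne : ¬ (q.1 ∈ E ↔ q.2 ∈ E) := fun h => hq.2 (h.1 hq.1)
  have hne' : ¬ (q.2 ∈ E ↔ q.1 ∈ E) := fun h => hq.2 (h.2 hq.1)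
  simp only [Pi.add_apply, Function.comp]
  by_cases hqS : q ∈ {q : 𝔼 × 𝔼 | ‖q.1‖ ≤ R ∨ ‖q.2‖ ≤ R}
  · rw [indicator_of_mem hqS, Real.norm_of_nonneg hK]
    rcases hqS with h | h
    · rw [indicator_of_mem (show q ∈ {q : 𝔼 × 𝔼 | ‖q.1‖ ≤ R ∧ ¬ (q.1 ∈ E ↔ q.2 ∈ E)} from ⟨h, hne⟩)]
      linarith [hnn q.swap]
    · have : q.swap ∈ {q : 𝔼 × 𝔼 | ‖q.1‖ ≤ R ∧ ¬ (q.1 ∈ E ↔ q.2 ∈ E)} := ⟨h, hne'⟩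
      have e : {q : 𝔼 × 𝔼 | ‖q.1‖ ≤ R ∧ ¬ (q.1 ∈ E ↔ q.2 ∈ E)}.indicator
          (fun q => fracKernel s (q.1 - q.2)) q.swap = fracKernel s (q.1 - q.2) := by
        rw [indicator_of_mem this, fracKernel_sub_comm]; rfl
      rw [e]
      linarith [hnn q]
  · rw [indicator_of_notMem hqS, norm_zero]
    exact add_nonneg (hnn _) (hnn _)

section identity

variable {E : Set (EuclideanSpace ℝ (Fin N))} {ρ : EuclideanSpace ℝ (Fin N) → ℝ}
  {n X : EuclideanSpace ℝ (Fin N) → EuclideanSpace ℝ (Fin N)} {g : EuclideanSpace ℝ (Fin N) → ℝ}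

lemma continuous_curvatureWeight (hg : Continuous g) (hn : Continuous n) (hX : ContDiff ℝ ∞ X) :
    Continuous (curvatureWeight g n X) := by
  have h1 : Continuous (fderiv ℝ X) := hX.continuous_fderiv (by simp)
  have h2 := (contDiff_divergence hX).continuous
  unfold curvatureWeight
  fun_prop

lemma BoundaryData.integrable_curvatureWeight_mul (H : BoundaryData E ρ n) {s : ℝ} (hs0 : 0 < s)
    (hs1 : s < 1) (hX : ContDiff ℝ ∞ X) (hg : ContDiff ℝ ∞ g) (hgc : HasCompactSupport g) :
    Integrable (fun x => curvatureWeight g n X x * nonlocalMeanCurvature s E x)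
      (surfaceMeasure E) := by
  haveI := H.isLocallyFiniteMeasure
  have hcc := continuous_curvatureWeight hg.continuous H.contDiff.continuous hX
  have hcs : HasCompactSupport (curvatureWeight g n X) := hgc.mul_right
  obtain ⟨R, hR⟩ := hgc.isCompact.isBounded.subset_closedBall (0 : 𝔼)
  obtain ⟨C, hC0, hC⟩ := H.exists_abs_symm_le hs0 hs1 R
  have hci : Integrable (curvatureWeight g n X) (surfaceMeasure E) :=
    hcc.integrable_of_hasCompactSupport hcs
  refine Integrable.congr (f := fun x => curvatureWeight g n X x *
    (1 / 2 * ∫ z, (sideSign E (x + z) + sideSign E (x - z)) * fracKernel s z)) ?_ ?_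
  · refine (hci.norm.const_mul C).mono' (hcc.aestronglyMeasurable.mul (measurable_integral_symm
      H.isOpen.measurableSet (measurable_fracKernel s)).aestronglyMeasurable) ?_
    filter_upwards [ae_mem_frontier E] with x hx
    rw [norm_mul, mul_comm]
    by_cases hxR : ‖x‖ ≤ R
    · gcongr
      exact hC _ (fun z => (abs_of_nonneg (fracKernel_nonneg s z)).le) x hx hxR
    · have : curvatureWeight g n X x = 0 := by
        have hg0 : g x = 0 := image_eq_zero_of_notMem_tsupport fun h => hxR (by simpa using hR h)
        rw [curvatureWeight, hg0, zero_mul]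
      simp [this]
  · filter_upwards [ae_mem_frontier E] with x hx
    rw [H.nonlocalMeanCurvature_eq hs0 hs1 hx]

/-- The second variation of the fractional perimeter as an integral over the boundary. -/
theorem BoundaryData.integral_secondVariation_frac (H : BoundaryData E ρ n) {s : ℝ} (hs0 : 0 < s)
    (hs1 : s < 1)
    (harea : Integrable (fun x : 𝔼 => 1 / (1 + ‖x‖) ^ ((N : ℝ) + s)) (surfaceMeasure E))
    (hX : ContDiff ℝ ∞ X) (hXc : HasCompactSupport X)
    (hg : ContDiff ℝ ∞ g) (hgc : HasCompactSupport g)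
    (hXn : ∀ x ∈ frontier E, X x = g x • n x) {c : ℝ} (hc : c = ((N : ℝ) + s) / 2) :
    ∫ q in E ×ˢ Eᶜ, secondVariationIntegrand (fun u => u ^ (-c)) (fun u => -c * u ^ (-(c + 1)))
        (fun u => c * (c + 1) * u ^ (-(c + 2))) X q.1 q.2 ∂(volume.prod volume) =
      ∫ q, ((g q.1 - g q.2) ^ 2 - 2 * (g q.1 ^ 2 * (1 - inner ℝ (n q.1) (n q.2)))) *
        fracKernel s (q.1 - q.2) ∂((surfaceMeasure E).prod (surfaceMeasure E)) -
      ∫ x, curvatureWeight g n X x * nonlocalMeanCurvature s E x ∂(surfaceMeasure E) := by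
  haveI := H.isLocallyFiniteMeasure
  have hEm := H.isOpen.measurableSet
  have hc0 : 0 < c := by rw [hc]; positivity
  obtain ⟨B, hB1, hB⟩ := logCutoffKernel_bounds hc0.le
  set J : ℕ → ℝ := fun j => (j : ℝ) + 1 with hJ
  have hJ1 : ∀ j, 1 ≤ J j := fun j => by simp [hJ]
  have hJt : Tendsto J atTop atTop :=
    tendsto_atTop_add_const_right _ _ tendsto_natCast_atTop_atTop
  set k : ℕ → ℝ → ℝ := fun j => logCutoffKernel c (J j) with hk
  have hks : ∀ j, ContDiff ℝ ∞ (k j) := fun j => (hB _ (hJ1 j)).1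
  have hk0 : ∀ j, k j 0 = 0 := fun j => (hB _ (hJ1 j)).2.2.1
  have hkK : ∀ j (z : 𝔼), |k j (‖z‖ ^ 2)| ≤ fracKernel s z := fun j z => by
    rcases (norm_nonneg z).eq_or_lt with h0 | h0
    · rw [← h0, zero_pow two_ne_zero, hk0, abs_zero]; exact fracKernel_nonneg _ _
    · rw [fracKernel_eq_sq_rpow, ← hc]
      exact ((hB _ (hJ1 j)).2.2.2 _ (by positivity)).1
  have hklim : ∀ z : 𝔼, ∀ᶠ j in atTop, k j (‖z‖ ^ 2) = fracKernel s z := fun z => by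
    rcases (norm_nonneg z).eq_or_lt with h0 | h0
    · refine Eventually.of_forall fun j => ?_
      rw [← h0, zero_pow two_ne_zero, hk0, norm_eq_zero.1 h0.symm, fracKernel_zero hs0]
    · filter_upwards [hJt.eventually_gt_atTop |Real.log (‖z‖ ^ 2)|] with j hj
      rw [fracKernel_eq_sq_rpow, ← hc]
      exact (((hB _ (hJ1 j)).2.2.2 _ (by positivity)).2.2.2 hj).1
  have hkc : ∀ j, Continuous (k j) := fun j => (hks j).continuous
  have hid := fun j => H.integral_secondVariation (hks j) (hB _ (hJ1 j)).2.1 hX hXc hg hgc hXn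
  -- the volume integral
  obtain ⟨C, R, hC0, hC⟩ := exists_secondVariationIntegrand_le hX hXc s
  have hlim1 : Tendsto (fun j => ∫ q in E ×ˢ Eᶜ, secondVariationIntegrand (k j) (deriv (k j))
      (deriv (deriv (k j))) X q.1 q.2 ∂(volume.prod volume)) atTop
      (𝓝 (∫ q in E ×ˢ Eᶜ, secondVariationIntegrand (fun u => u ^ (-c))
        (fun u => -c * u ^ (-(c + 1))) (fun u => c * (c + 1) * u ^ (-(c + 2))) X q.1 q.2
        ∂(volume.prod volume))) := by
    refine tendsto_integral_of_dominated_convergence _ (fun j => ?_)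
      ((H.defining.integrable_weight_symm H.one_le H.isOpen hs0 hs1 R).const_mul (C * B))
      (fun j => ?_) ?_
    · have h0 := hkc j
      have h1 := (contDiff_deriv_real (hks j)).continuous
      have h2 := (contDiff_deriv_real (contDiff_deriv_real (hks j))).continuous
      have h3 := hX.continuous
      have h4 := (contDiff_divergence hX).continuous
      have h5 := continuous_jacobianSecond hX
      refine Continuous.aestronglyMeasurable ?_
      unfold secondVariationIntegrand
      fun_prop
    · refine (ae_restrict_iff' (hEm.prod hEm.compl)).2 (Eventually.of_forall fun q hq => ?_)
      have hne : q.1 ≠ q.2 := fun h => hq.2 (h ▸ hq.1)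
      have hu : 0 < ‖q.1 - q.2‖ ^ 2 := by
        have := norm_pos_iff.2 (sub_ne_zero.2 hne)
        positivity
      obtain ⟨b0, b1, b2, -⟩ := (hB _ (hJ1 j)).2.2.2 _ hu
      rw [hc] at b0 b1 b2
      obtain ⟨h1, h2⟩ := hC (k j) (deriv (k j)) (deriv (deriv (k j))) B q.1 q.2 hne
        (by
          refine le_trans ?_ (le_mul_of_one_le_left (by positivity) hB1)
          simp only [hk, hc]; exact b0)
        (by simp only [hk, hc]; exact b1) (by simp only [hk, hc]; exact b2)
      by_cases hqS : q ∈ {q : 𝔼 × 𝔼 | ‖q.1‖ ≤ R ∨ ‖q.2‖ ≤ R}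
      · rw [indicator_of_mem hqS]; exact h1
      · rw [indicator_of_notMem hqS]
        have hqS' : ¬ (‖q.1‖ ≤ R ∨ ‖q.2‖ ≤ R) := hqS
        rw [not_or] at hqS'
        rw [h2 hqS'.1 hqS'.2]
        simp
    · refine (ae_restrict_iff' (hEm.prod hEm.compl)).2 (Eventually.of_forall fun q hq => ?_)
      have hne : q.1 ≠ q.2 := fun h => hq.2 (h ▸ hq.1)
      have hu : 0 < ‖q.1 - q.2‖ ^ 2 := by
        have := norm_pos_iff.2 (sub_ne_zero.2 hne)
        positivity
      refine tendsto_const_nhds.congr' ?_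
      filter_upwards [hJt.eventually_gt_atTop |Real.log (‖q.1 - q.2‖ ^ 2)|] with j hj
      obtain ⟨b0, b1, b2⟩ := ((hB _ (hJ1 j)).2.2.2 _ hu).2.2.2 hj
      simp only [secondVariationIntegrand, hk, b0, b1, b2]
  -- the double boundary integral
  have hsq := H.integrable_sq_sub hs0 hs1 harea hg hgc
  have hnd := H.integrable_normal_defect hs0 hs1 harea hg hgc
  have hbr : Integrable (fun q : 𝔼 × 𝔼 => ((g q.1 - g q.2) ^ 2 - 2 * (g q.1 ^ 2 *
      (1 - inner ℝ (n q.1) (n q.2)))) * fracKernel s (q.1 - q.2))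
      ((surfaceMeasure E).prod (surfaceMeasure E)) := by
    refine (hsq.sub (hnd.const_mul 2)).congr (Eventually.of_forall fun q => ?_)
    simp only [Pi.sub_apply]
    ring
  have hlim2 : Tendsto (fun j => ∫ q, ((g q.1 - g q.2) ^ 2 - 2 * (g q.1 ^ 2 *
        (1 - inner ℝ (n q.1) (n q.2)))) * k j (‖q.1 - q.2‖ ^ 2)
        ∂((surfaceMeasure E).prod (surfaceMeasure E))) atTop
      (𝓝 (∫ q, ((g q.1 - g q.2) ^ 2 - 2 * (g q.1 ^ 2 * (1 - inner ℝ (n q.1) (n q.2)))) *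
        fracKernel s (q.1 - q.2) ∂((surfaceMeasure E).prod (surfaceMeasure E)))) := by
    refine tendsto_integral_of_dominated_convergence _ (fun j => ?_) hbr.norm (fun j => ?_) ?_
    · have h0 := hkc j
      have h1 := hg.continuous
      have h2 := H.contDiff.continuous
      exact Continuous.aestronglyMeasurable (by fun_prop)
    · refine Eventually.of_forall fun q => ?_
      rw [norm_mul, norm_mul, Real.norm_eq_abs (k j _), Real.norm_of_nonneg (fracKernel_nonneg _ _)]
      gcongr
      exact hkK j _
    · refine Eventually.of_forall fun q => tendsto_const_nhds.congr' ?_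
      filter_upwards [hklim (q.1 - q.2)] with j hj
      rw [hj]
  -- the curvature term
  have hcc := continuous_curvatureWeight hg.continuous H.contDiff.continuous hX
  have hcs : HasCompactSupport (curvatureWeight g n X) := hgc.mul_right
  obtain ⟨R', hR'⟩ := hgc.isCompact.isBounded.subset_closedBall (0 : 𝔼)
  obtain ⟨C', hC'0, hC'⟩ := H.exists_abs_symm_le hs0 hs1 R'
  have hci : Integrable (curvatureWeight g n X) (surfaceMeasure E) :=
    hcc.integrable_of_hasCompactSupport hcs
  have hκm : ∀ j, Continuous fun z : 𝔼 => k j (‖z‖ ^ 2) := fun j => by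
    have := hkc j
    fun_prop
  have hκi : ∀ j, Integrable fun z : 𝔼 => k j (‖z‖ ^ 2) := fun j => by
    refine (hκm j).integrable_of_hasCompactSupport (HasCompactSupport.intro
      (isCompact_closedBall (0 : 𝔼) (Real.exp (2 * J j))) fun z hz => (hB _ (hJ1 j)).2.1 _ ?_)
    rw [mem_closedBall_zero_iff, not_le] at hz
    have : 1 ≤ Real.exp (2 * J j) := Real.one_le_exp (by linarith [hJ1 j])
    nlinarith
  have hsymm : ∀ j x, ∫ y, sideSign E y * k j (‖y - x‖ ^ 2) =
      1 / 2 * ∫ z, (sideSign E (x + z) + sideSign E (x - z)) * k j (‖z‖ ^ 2) := fun j x =>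
    integral_sideSign_mul_eq hEm (hκi j) (fun z => by rw [norm_neg]) x
  have hlim3 : Tendsto (fun j => ∫ x, curvatureWeight g n X x *
      (∫ y, sideSign E y * k j (‖y - x‖ ^ 2)) ∂(surfaceMeasure E)) atTop
      (𝓝 (∫ x, curvatureWeight g n X x * nonlocalMeanCurvature s E x ∂(surfaceMeasure E))) := by
    simp_rw [hsymm]
    refine tendsto_integral_of_dominated_convergence _ (fun j => ?_) (hci.norm.const_mul C')
      (fun j => ?_) ?_
    · exact hcc.aestronglyMeasurable.mul (measurable_integral_symm hEm
        (hκm j).measurable).aestronglyMeasurable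
    · filter_upwards [ae_mem_frontier E] with x hx
      rw [norm_mul, mul_comm]
      by_cases hxR : ‖x‖ ≤ R'
      · gcongr
        exact hC' _ (hkK j) x hx hxR
      · have : curvatureWeight g n X x = 0 := by
          have hg0 : g x = 0 := image_eq_zero_of_notMem_tsupport fun h => hxR (by simpa using hR' h)
          rw [curvatureWeight, hg0, zero_mul]
        simp [this]
    · filter_upwards [ae_mem_frontier E] with x hx
      rw [H.nonlocalMeanCurvature_eq hs0 hs1 hx]
      have hi := H.integrable_symm hs0 hs1 hx
      have hsm := measurable_sideSign hEm
      refine Tendsto.const_mul _ (Tendsto.const_mul _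
        (tendsto_integral_of_dominated_convergence _ (fun j => ?_) hi.norm (fun j => ?_) ?_))
      · exact (((hsm.comp (measurable_const_add x)).add
          (hsm.comp (measurable_const_sub x))).mul (hκm j).measurable).aestronglyMeasurable
      · refine Eventually.of_forall fun z => ?_
        rw [norm_mul, norm_mul, Real.norm_eq_abs (k j _),
          Real.norm_of_nonneg (fracKernel_nonneg _ _)]
        gcongr
        exact hkK j _
      · refine Eventually.of_forall fun z => tendsto_const_nhds.congr' ?_
        filter_upwards [hklim z] with j hj
        rw [hj]
  refine tendsto_nhds_unique hlim1 ?_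
  simp_rw [hid]
  exact hlim2.sub hlim3

end identity

/-- A vector field that vanishes on the boundary has a derivative of rank one there. -/
lemma IsDefiningFunction.fderiv_eq_smulRight {E : Set 𝔼} {p : 𝔼} {φ : 𝔼 → ℝ}
    (hφ : IsDefiningFunction E p φ) {m : 𝔼 → 𝔼} (hm : ContDiffAt ℝ ∞ m p)
    (hm0 : ∀ᶠ x in 𝓝 p, x ∈ frontier E → m x = 0) :
    fderiv ℝ m p = (innerSL ℝ (outerNormal E p)).smulRight (fderiv ℝ m p (outerNormal E p)) := by
  set ν := outerNormal E p with hν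
  have hν1 : ‖ν‖ = 1 := hφ.norm_outerNormal
  have hmd : HasStrictFDerivAt m (fderiv ℝ m p) p := hm.hasStrictFDerivAt (by simp)
  have hφd : HasStrictFDerivAt φ (fderiv ℝ φ p) p :=
    hφ.contDiff.contDiffAt.hasStrictFDerivAt (by simp)
  have htan : ∀ τ, fderiv ℝ φ p τ = 0 → fderiv ℝ m p τ = 0 := fun τ hτ => by
    refine ext_inner_left ℝ fun v => ?_
    have hvd : HasStrictFDerivAt (fun x => inner ℝ v (m x)) ((innerSL ℝ v).comp (fderiv ℝ m p)) p :=
      (innerSL ℝ v).hasStrictFDerivAt.comp p hmd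
    have hp0 : m p = 0 := hm0.self_of_nhds hφ.mem_frontier
    have hext : IsLocalExtrOn (fun x => inner ℝ v (m x)) {x | φ x = φ p} p := by
      left
      filter_upwards [self_mem_nhdsWithin, nhdsWithin_le_nhds hm0,
        nhdsWithin_le_nhds hφ.eventually_frontier_iff] with x hx hx0 hxf
      rw [hx0 (hxf.2 (Eq.trans hx hφ.apply_eq_zero)), hp0]
    obtain ⟨a, b, hab, h⟩ := hext.exists_multipliers_of_hasStrictFDerivAt_1d hφd hvd
    have hb : b ≠ 0 := by
      rintro rfl
      rw [zero_smul, add_zero, smul_eq_zero] at h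
      rcases h with h | h
      · exact hab (by rw [h]; rfl)
      · exact hφ.gradient_ne_zero (by rw [gradient, h, map_zero])
    have h2 : a * fderiv ℝ φ p τ + b * inner ℝ v (fderiv ℝ m p τ) = 0 := congrArg (fun A => A τ) h
    rw [hτ, mul_zero, zero_add, mul_eq_zero] at h2
    rw [inner_zero_right]
    exact h2.resolve_left hb
  refine ContinuousLinearMap.ext fun w => ?_
  have hG : gradient φ p = ‖gradient φ p‖ • ν := by
    rw [hν, hφ.outerNormal_eq, unitGradient, smul_smul,
      mul_inv_cancel₀ (norm_ne_zero_iff.2 hφ.gradient_ne_zero), one_smul]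
  have h0 := htan (w - inner ℝ ν w • ν) (by
    rw [← inner_gradient, hG, real_inner_smul_left, inner_sub_right, real_inner_smul_right,
      real_inner_self_eq_norm_sq, hν1]
    ring)
  rw [map_sub, map_smul, sub_eq_zero] at h0
  rw [h0]
  simp

lemma IsDefiningFunction.inner_fderiv_unitGradient {E : Set 𝔼} {p : 𝔼} {φ : 𝔼 → ℝ}
    (hφ : IsDefiningFunction E p φ) (v : 𝔼) :
    inner ℝ (fderiv ℝ (unitGradient φ) p v) (unitGradient φ p) = 0 := by
  have hd : DifferentiableAt ℝ (unitGradient φ) p :=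
    (contDiffAt_unitGradient hφ.contDiff hφ.gradient_ne_zero).differentiableAt (by simp)
  have h1 : (fun x => inner ℝ (unitGradient φ x) (unitGradient φ x)) =ᶠ[𝓝 p] fun _ => (1 : ℝ) := by
    filter_upwards [hφ.continuous_gradient.continuousAt.eventually_ne hφ.gradient_ne_zero] with x hx
    rw [real_inner_self_eq_norm_sq, norm_unitGradient hx, one_pow]
  have h2 := congrArg (fun A : 𝔼 →L[ℝ] ℝ => A v) (h1.fderiv_eq (𝕜 := ℝ))
  simp only [fderiv_inner_apply ℝ hd hd, fderiv_const_apply, _root_.zero_apply] at h2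
  rw [real_inner_comm] at h2
  linarith

/-- The mean curvature in terms of an arbitrary smooth extension of the normal. -/
lemma meanCurvature_eq {E : Set 𝔼} {p : 𝔼} (hEp : ∃ φ, IsDefiningFunction E p φ) {n : 𝔼 → 𝔼}
    (hn : ContDiff ℝ ∞ n) (hnE : ∀ x ∈ frontier E, n x = outerNormal E x) :
    meanCurvature E p = divergence n p - inner ℝ (fderiv ℝ n p (n p)) (n p) := by
  set φ := hEp.choose with hφdef
  have hφ : IsDefiningFunction E p φ := hEp.choose_spec
  have hp := hφ.mem_frontier
  have hu := contDiffAt_unitGradient hφ.contDiff hφ.gradient_ne_zero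
  have hud : DifferentiableAt ℝ (unitGradient φ) p := hu.differentiableAt (by simp)
  have hnd : DifferentiableAt ℝ n p := hn.differentiable (by simp) p
  have hm : fderiv ℝ (fun x => n x - unitGradient φ x) p =
      fderiv ℝ n p - fderiv ℝ (unitGradient φ) p := fderiv_fun_sub hnd hud
  have h1 := hφ.fderiv_eq_smulRight (m := fun x => n x - unitGradient φ x)
    (hn.contDiffAt.sub hu) (by
      filter_upwards [hφ.eventually_frontier_iff, hφ.eventually_isDefiningFunction] with x hx hx' hxE
      rw [hnE x hxE, (hx' (hx.1 hxE)).outerNormal_eq, sub_self])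
  have h2 := congrArg (traceL N) h1
  rw [traceL_smulRight, hm, map_sub, _root_.sub_apply, innerSL_apply_apply, inner_sub_right,
    hφ.outerNormal_eq, real_inner_comm, real_inner_comm _ (unitGradient φ p),
    hφ.inner_fderiv_unitGradient, sub_zero] at h2
  have h3 : meanCurvature E p = traceL N (fderiv ℝ (unitGradient φ) p) := by
    rw [meanCurvature, dif_pos hEp, traceL_apply]
  rw [h3, divergence, hnE p hp, hφ.outerNormal_eq]
  rw [real_inner_comm] at h2
  linarith [real_inner_comm (fderiv ℝ n p (unitGradient φ p)) (unitGradient φ p)]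

lemma BoundaryData.curvatureWeight_eq {E : Set 𝔼} {ρ : 𝔼 → ℝ} {n : 𝔼 → 𝔼} (H : BoundaryData E ρ n)
    {g : 𝔼 → ℝ} (hg : ContDiff ℝ ∞ g) {x : 𝔼} (hx : x ∈ frontier E) :
    curvatureWeight g n (fun y => g y • n y) x = g x ^ 2 * meanCurvature E x := by
  have hgd : DifferentiableAt ℝ g x := hg.differentiable (by simp) x
  have hnd : DifferentiableAt ℝ n x := H.contDiff.differentiable (by simp) x
  rw [meanCurvature_eq ⟨ρ, H.defining.isDefiningFunction hx⟩ H.contDiff H.eq_outerNormal,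
    curvatureWeight, divergence_smul hgd hnd, fderiv_fun_smul hgd hnd]
  simp only [_root_.add_apply, _root_.smul_apply, ContinuousLinearMap.smulRight_apply,
    inner_add_left, real_inner_smul_left, real_inner_self_eq_norm_sq, H.norm_eq_one hx]
  ring

lemma det_eq_det_coordinates (A : 𝔼 →L[ℝ] 𝔼) :
    A.det = Matrix.det (Matrix.of fun i j => A (EuclideanSpace.basisFun (Fin N) ℝ j) i) := by
  rw [ContinuousLinearMap.det, ← LinearMap.det_toMatrix (EuclideanSpace.basisFun (Fin N) ℝ).toBasis]
  congr 1
  ext i j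
  simp [LinearMap.toMatrix_apply]

lemma contDiff_det : ContDiff ℝ ∞ (fun A : 𝔼 →L[ℝ] 𝔼 => A.det) := by
  simp_rw [det_eq_det_coordinates, Matrix.det_apply, Matrix.of_apply]
  refine ContDiff.sum fun σ _ => ContDiff.const_smul _ (contDiff_prod fun i _ => ?_)
  exact ((EuclideanSpace.proj (σ i)).comp (ContinuousLinearMap.apply ℝ 𝔼
    (EuclideanSpace.basisFun (Fin N) ℝ i))).contDiff

lemma hasDerivAt_det_one_add_smul_zero (A : 𝔼 →L[ℝ] 𝔼) :
    HasDerivAt (fun t : ℝ => (1 + t • A).det) (traceL N A) 0 := by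
  set M : Matrix (Fin N) (Fin N) ℝ := LinearMap.toMatrix (EuclideanSpace.basisFun (Fin N) ℝ).toBasis
    (EuclideanSpace.basisFun (Fin N) ℝ).toBasis (A : 𝔼 →ₗ[ℝ] 𝔼) with hM
  have h1 : ∀ t : ℝ, (1 + t • A).det = (1 + t • M).det := fun t => by
    rw [ContinuousLinearMap.det, ← LinearMap.det_toMatrix (EuclideanSpace.basisFun (Fin N) ℝ).toBasis]
    congr 1
    rw [hM, ← map_smul, ← LinearMap.toMatrix_one (EuclideanSpace.basisFun (Fin N) ℝ).toBasis,
      ← map_add]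
    rfl
  have h2 : traceL N A = M.trace := by
    rw [traceL_apply, LinearMap.trace_eq_matrix_trace ℝ (EuclideanSpace.basisFun (Fin N) ℝ).toBasis]
  rw [h2, funext fun t => (h1 t).trans (Matrix.det_one_add_smul t M)]
  have h3 := (Polynomial.differentiableAt (𝕜 := ℝ) (x := (0 : ℝ)) (Polynomial.divX (Polynomial.divX
    (Matrix.det ((1 : Matrix (Fin N) (Fin N) (Polynomial ℝ)) +
      (Polynomial.X : Polynomial ℝ) • M.map Polynomial.C))))).hasDerivAt
  have h4 := (((hasDerivAt_id (0 : ℝ)).const_mul M.trace).const_add 1).add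
    (h3.mul ((hasDerivAt_id (0 : ℝ)).pow 2))
  exact h4.congr_deriv (by simp)

/-- The first two derivatives of the Jacobian determinant `det (1 + t A)` with respect to `t`. -/
lemma exists_hasDerivAt_det_one_add_smul :
    ∃ D₁ D₂ : ℝ × (EuclideanSpace ℝ (Fin N) →L[ℝ] EuclideanSpace ℝ (Fin N)) → ℝ,
      Continuous D₁ ∧ Continuous D₂ ∧
      (∀ t A, HasDerivAt (fun t : ℝ => (1 + t • A).det) (D₁ (t, A)) t) ∧
      (∀ t A, HasDerivAt (fun t : ℝ => D₁ (t, A)) (D₂ (t, A)) t) ∧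
      ∀ A, D₁ (0, A) = traceL N A ∧ D₂ (0, A) = traceL N A ^ 2 - traceL N (A.comp A) := by
  set D : ℝ × (𝔼 →L[ℝ] 𝔼) → ℝ := fun q => (1 + q.1 • q.2).det with hD
  have hDs : ContDiff ℝ ∞ D :=
    contDiff_det.comp (contDiff_const.add (contDiff_fst.smul contDiff_snd))
  set D₁ : ℝ × (𝔼 →L[ℝ] 𝔼) → ℝ := fun q => fderiv ℝ D q (1, 0) with hD₁
  have hD₁s : ContDiff ℝ ∞ D₁ := (hDs.fderiv_right (by simp)).clm_apply contDiff_const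
  set D₂ : ℝ × (𝔼 →L[ℝ] 𝔼) → ℝ := fun q => fderiv ℝ D₁ q (1, 0) with hD₂
  have hD₂s : ContDiff ℝ ∞ D₂ := (hD₁s.fderiv_right (by simp)).clm_apply contDiff_const
  have hline : ∀ (t : ℝ) (A : 𝔼 →L[ℝ] 𝔼), HasDerivAt (fun t : ℝ => (t, A)) (1, 0) t := fun t A =>
    (hasDerivAt_id t).prodMk (hasDerivAt_const t A)
  have h1 : ∀ t A, HasDerivAt (fun t : ℝ => (1 + t • A).det) (D₁ (t, A)) t := fun t A => by
    have h : HasFDerivAt D (fderiv ℝ D (t, A)) (t, A) :=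
      (hDs.differentiable (by simp) (t, A)).hasFDerivAt
    exact h.comp_hasDerivAt t (hline t A)
  have h2 : ∀ t A, HasDerivAt (fun t : ℝ => D₁ (t, A)) (D₂ (t, A)) t := fun t A => by
    have h : HasFDerivAt D₁ (fderiv ℝ D₁ (t, A)) (t, A) :=
      (hD₁s.differentiable (by simp) (t, A)).hasFDerivAt
    exact h.comp_hasDerivAt t (hline t A)
  have h3 : ∀ A, D₁ (0, A) = traceL N A := fun A =>
    (h1 0 A).unique (hasDerivAt_det_one_add_smul_zero A)
  refine ⟨D₁, D₂, hD₁s.continuous, hD₂s.continuous, h1, h2, fun A => ⟨h3 A, ?_⟩⟩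
  have hone : D (0, A) = 1 := by simp [hD, ContinuousLinearMap.det]
  have hmul : ∀ t : ℝ, D (t, A) * D (-t, A) = D (-t ^ 2, A.comp A) := fun t => by
    simp only [hD]
    rw [ContinuousLinearMap.det, ContinuousLinearMap.det, ContinuousLinearMap.det, ← LinearMap.det_comp]
    congr 1
    ext1 v
    simp only [LinearMap.comp_apply, ContinuousLinearMap.coe_coe, _root_.add_apply,
      _root_.smul_apply, one_apply_eq_self, ContinuousLinearMap.comp_apply, map_add,
      map_smul]
    module
  have hneg : ∀ t : ℝ, HasDerivAt (fun t : ℝ => D (-t, A)) (-D₁ (-t, A)) t := fun t => by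
    exact ((h1 (-t) A).scomp t (hasDerivAt_neg t)).congr_deriv (by simp)
  have hneg₁ : ∀ t : ℝ, HasDerivAt (fun t : ℝ => D₁ (-t, A)) (-D₂ (-t, A)) t := fun t => by
    exact ((h2 (-t) A).scomp t (hasDerivAt_neg t)).congr_deriv (by simp)
  have hl : ∀ t : ℝ, D₁ (t, A) * D (-t, A) + D (t, A) * (-D₁ (-t, A)) =
      -(2 * t) * D₁ (-t ^ 2, A.comp A) := fun t => by
    refine ((h1 t A).mul (hneg t)).unique ?_
    have h4 : HasDerivAt (fun t : ℝ => -t ^ 2) (-(2 * t)) t := by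
      simpa using (hasDerivAt_pow 2 t).fun_neg
    have h5 := (h1 (-t ^ 2) (A.comp A)).scomp t h4
    refine h5.congr_of_eventuallyEq (Eventually.of_forall fun τ => ?_)
    exact hmul τ
  have hl₁ := ((h2 0 A).mul (hneg 0)).add ((h1 0 A).mul (hneg₁ 0).fun_neg)
  have hr₁ : HasDerivAt (fun t : ℝ => -(2 * t) * D₁ (-t ^ 2, A.comp A))
      (-2 * traceL N (A.comp A)) 0 := by
    have h4 : HasDerivAt (fun t : ℝ => -(2 * t)) (-2) 0 := by
      simpa using ((hasDerivAt_id (0 : ℝ)).const_mul 2).fun_neg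
    have h5 : HasDerivAt (fun t : ℝ => -t ^ 2) (-(2 * 0)) 0 := by
      simpa using (hasDerivAt_pow 2 (0 : ℝ)).fun_neg
    have h6 := (h2 (-0 ^ 2) (A.comp A)).scomp 0 h5
    have h7 := h4.mul h6
    exact h7.congr_deriv (by simp [h3])
  have h8 := hl₁.unique (hr₁.congr_of_eventuallyEq (Eventually.of_forall fun t => hl t))
  have hdet1 : (1 + (0 : ℝ) • A).det = 1 := hone
  simp only [neg_zero, hone, h3, hdet1] at h8
  linarith

/-- Twice differentiation under the integral sign. -/
lemma hasDerivAt_integral_of_dominated_twice {α : Type*} [MeasurableSpace α] {μ : Measure α}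
    {f f₁ f₂ : ℝ → α → ℝ} {G : α → ℝ} {t₀ : ℝ} (hG : Integrable G μ)
    (hf : ∀ t, |t| < t₀ → AEStronglyMeasurable (f t) μ)
    (hf₁ : ∀ t, |t| < t₀ → AEStronglyMeasurable (f₁ t) μ)
    (hf₂ : ∀ t, |t| < t₀ → AEStronglyMeasurable (f₂ t) μ)
    (hd : ∀ᵐ q ∂μ, ∀ t, |t| < t₀ → (|f t q| ≤ G q ∧ |f₁ t q| ≤ G q ∧ |f₂ t q| ≤ G q) ∧
      HasDerivAt (fun t => f t q) (f₁ t q) t ∧ HasDerivAt (fun t => f₁ t q) (f₂ t q) t) {t : ℝ}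
    (ht : |t| < t₀) :
    HasDerivAt (fun t => ∫ q, f t q ∂μ) (∫ q, f₁ t q ∂μ) t ∧
      HasDerivAt (fun t => ∫ q, f₁ t q ∂μ) (∫ q, f₂ t q ∂μ) t := by
  have hnhds : {τ : ℝ | |τ| < t₀} ∈ 𝓝 t := (isOpen_lt continuous_abs continuous_const).mem_nhds ht
  refine ⟨(hasDerivAt_integral_of_dominated_loc_of_deriv_le (bound := G) hnhds
      (by filter_upwards [hnhds] with τ hτ using hf τ hτ)
      (hG.mono' (hf t ht) (hd.mono fun q hq => (hq t ht).1.1)) (hf₁ t ht)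
      (hd.mono fun q hq τ hτ => (hq τ hτ).1.2.1) hG
      (hd.mono fun q hq τ hτ => (hq τ hτ).2.1)).2,
    (hasDerivAt_integral_of_dominated_loc_of_deriv_le (bound := G) hnhds
      (by filter_upwards [hnhds] with τ hτ using hf₁ τ hτ)
      (hG.mono' (hf₁ t ht) (hd.mono fun q hq => (hq t ht).1.2.1)) (hf₂ t ht)
      (hd.mono fun q hq τ hτ => (hq τ hτ).1.2.2) hG
      (hd.mono fun q hq τ hτ => (hq τ hτ).2.2)).2⟩

lemma hasDerivAt_norm_add_smul_sq (z w : 𝔼) (t : ℝ) :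
    HasDerivAt (fun t : ℝ => ‖z + t • w‖ ^ 2) (2 * inner ℝ (z + t • w) w) t := by
  have h : HasDerivAt (fun t : ℝ => z + t • w) w t := by
    simpa using ((hasDerivAt_id t).smul_const w).const_add z
  exact h.norm_sq

lemma hasDerivAt_inner_add_smul (z w : 𝔼) (t : ℝ) :
    HasDerivAt (fun t : ℝ => 2 * inner ℝ (z + t • w) w) (2 * ‖w‖ ^ 2) t := by
  have h : HasDerivAt (fun t : ℝ => z + t • w) w t := by
    simpa using ((hasDerivAt_id t).smul_const w).const_add z
  have h2 := (h.inner ℝ (hasDerivAt_const t w)).const_mul 2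
  exact h2.congr_deriv (by simp [real_inner_self_eq_norm_sq])

lemma hasDerivAt_rpow_comp {a : ℝ → ℝ} {a' t : ℝ} (ha : HasDerivAt a a' t) (h : 0 < a t) (c : ℝ) :
    HasDerivAt (fun t => a t ^ (-c)) (-c * a t ^ (-(c + 1)) * a') t := by
  refine (ha.rpow_const (p := -c) (Or.inl h.ne')).congr_deriv ?_
  rw [show -(c + 1) = -c - 1 by ring]
  ring

/-- The kernel `|z + t w|^{-2c}` along a moving pair of points, with its first two derivatives. -/
lemma exists_norm_add_smul_rpow_le {c L : ℝ} (hc : 0 ≤ c) (hL : 0 ≤ L) :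
    ∃ C, 0 ≤ C ∧ ∀ (z w : 𝔼) (t : ℝ), z ≠ 0 → ‖w‖ ≤ L * ‖z‖ → |t| * L ≤ 1 / 4 →
      0 < ‖z + t • w‖ ^ 2 ∧
      |(‖z + t • w‖ ^ 2) ^ (-c)| ≤ C * (‖z‖ ^ 2) ^ (-c) ∧
      |-c * (‖z + t • w‖ ^ 2) ^ (-(c + 1)) * (2 * inner ℝ (z + t • w) w)| ≤
        C * (‖z‖ ^ 2) ^ (-c) ∧
      |c * (c + 1) * (‖z + t • w‖ ^ 2) ^ (-(c + 2)) * (2 * inner ℝ (z + t • w) w) ^ 2 +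
        -c * (‖z + t • w‖ ^ 2) ^ (-(c + 1)) * (2 * ‖w‖ ^ 2)| ≤ C * (‖z‖ ^ 2) ^ (-c) := by
  refine ⟨2 ^ c * (1 + 4 * c * L + 16 * c * (c + 1) * L ^ 2 + 8 * c * L ^ 2), by positivity,
    fun z w t hz hw ht => ?_⟩
  have hz0 : 0 < ‖z‖ := norm_pos_iff.2 hz
  set r := ‖z + t • w‖ with hr
  have htw : ‖t • w‖ ≤ 1 / 4 * ‖z‖ := by
    rw [norm_smul, Real.norm_eq_abs]
    calc |t| * ‖w‖ ≤ |t| * (L * ‖z‖) := by gcongr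
      _ = |t| * L * ‖z‖ := by ring
      _ ≤ 1 / 4 * ‖z‖ := by gcongr
  have hrz : 3 / 4 * ‖z‖ ≤ r := by
    have := norm_sub_le (z + t • w) (t • w)
    rw [add_sub_cancel_right] at this
    linarith
  have hr0 : 0 < r := by linarith
  have hwr : ‖w‖ ≤ 2 * L * r := by nlinarith
  set a := r ^ 2 with ha
  have ha0 : 0 < a := by positivity
  have haz : ‖z‖ ^ 2 / 2 ≤ a := by nlinarith
  have hin : |2 * inner ℝ (z + t • w) w| ≤ 4 * L * a := by
    rw [abs_mul, abs_two]
    have := abs_real_inner_le_norm (z + t • w) w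
    rw [← hr] at this
    nlinarith
  have hw2 : 2 * ‖w‖ ^ 2 ≤ 8 * L ^ 2 * a := by
    have := mul_self_le_mul_self (norm_nonneg w) hwr
    nlinarith
  set P := a ^ (-c) with hP
  have hP0 : 0 < P := by positivity
  have e1 : a ^ (-(c + 1)) * a = P := by
    rw [hP, ← Real.rpow_add_one ha0.ne']; congr 1; ring
  have e2 : a ^ (-(c + 2)) * a ^ 2 = P := by
    rw [hP, ← Real.rpow_natCast, ← Real.rpow_add ha0]; congr 1; push_cast; ring
  have hPz : P ≤ 2 ^ c * (‖z‖ ^ 2) ^ (-c) := by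
    calc P ≤ (‖z‖ ^ 2 / 2) ^ (-c) :=
          Real.rpow_le_rpow_of_nonpos (by positivity) haz (by linarith)
      _ = 2 ^ c * (‖z‖ ^ 2) ^ (-c) := by
          rw [Real.div_rpow (by positivity) (by norm_num), Real.rpow_neg (by norm_num : (0 : ℝ) ≤ 2),
            div_inv_eq_mul, mul_comm]
  have b1 : |-c * a ^ (-(c + 1)) * (2 * inner ℝ (z + t • w) w)| ≤ 4 * c * L * P := by
    rw [abs_mul, abs_mul, abs_neg, abs_of_nonneg hc, abs_of_pos (by positivity : 0 < a ^ (-(c + 1)))]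
    calc c * a ^ (-(c + 1)) * |2 * inner ℝ (z + t • w) w| ≤ c * a ^ (-(c + 1)) * (4 * L * a) := by
          gcongr
      _ = 4 * c * L * P := by rw [← e1]; ring
  have b2 : |c * (c + 1) * a ^ (-(c + 2)) * (2 * inner ℝ (z + t • w) w) ^ 2| ≤
      16 * c * (c + 1) * L ^ 2 * P := by
    rw [abs_mul, abs_of_nonneg (by positivity : 0 ≤ c * (c + 1) * a ^ (-(c + 2))), abs_pow]
    calc c * (c + 1) * a ^ (-(c + 2)) * |2 * inner ℝ (z + t • w) w| ^ 2
        ≤ c * (c + 1) * a ^ (-(c + 2)) * (4 * L * a) ^ 2 := by gcongr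
      _ = 16 * c * (c + 1) * L ^ 2 * P := by rw [← e2]; ring
  have b3 : |-c * a ^ (-(c + 1)) * (2 * ‖w‖ ^ 2)| ≤ 8 * c * L ^ 2 * P := by
    rw [abs_mul, abs_mul, abs_neg, abs_of_nonneg hc, abs_of_pos (by positivity : 0 < a ^ (-(c + 1))),
      abs_of_nonneg (by positivity : 0 ≤ 2 * ‖w‖ ^ 2)]
    calc c * a ^ (-(c + 1)) * (2 * ‖w‖ ^ 2) ≤ c * a ^ (-(c + 1)) * (8 * L ^ 2 * a) := by gcongr
      _ = 8 * c * L ^ 2 * P := by rw [← e1]; ring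
  have key : ∀ b v : ℝ, v ≤ b * P → b ≤ 1 + 4 * c * L + 16 * c * (c + 1) * L ^ 2 + 8 * c * L ^ 2 →
      v ≤ 2 ^ c * (1 + 4 * c * L + 16 * c * (c + 1) * L ^ 2 + 8 * c * L ^ 2) *
        (‖z‖ ^ 2) ^ (-c) := fun b v h1 h2 => by
    calc v ≤ b * P := h1
      _ ≤ (1 + 4 * c * L + 16 * c * (c + 1) * L ^ 2 + 8 * c * L ^ 2) *
          (2 ^ c * (‖z‖ ^ 2) ^ (-c)) := by gcongr
      _ = _ := by ring
  have p1 : 0 ≤ 4 * c * L := by positivity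
  have p2 : 0 ≤ 16 * c * (c + 1) * L ^ 2 := by positivity
  have p3 : 0 ≤ 8 * c * L ^ 2 := by positivity
  refine ⟨ha0, key 1 _ (by rw [abs_of_pos hP0, one_mul]) (by linarith),
    key _ _ b1 (by linarith), key (16 * c * (c + 1) * L ^ 2 + 8 * c * L ^ 2) _ ?_ (by linarith)⟩
  refine (abs_add_le _ _).trans ?_
  rw [add_mul]
  exact add_le_add b2 b3

lemma exists_det_one_add_smul_le (L : ℝ) {D₁ D₂ : ℝ × (𝔼 →L[ℝ] 𝔼) → ℝ}
    (hD₁ : Continuous D₁) (hD₂ : Continuous D₂)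
    (hd : ∀ t A, HasDerivAt (fun t : ℝ => (1 + t • A).det) (D₁ (t, A)) t) :
    ∃ M t₀, 1 ≤ M ∧ 0 < t₀ ∧ t₀ ≤ 1 ∧ ∀ t A, |t| ≤ t₀ → ‖A‖ ≤ L →
      0 < (1 + t • A).det ∧ (1 + t • A).det ≤ M ∧ |D₁ (t, A)| ≤ M ∧ |D₂ (t, A)| ≤ M := by
  haveI : ProperSpace (𝔼 →L[ℝ] 𝔼) := FiniteDimensional.proper ℝ _
  have hK : IsCompact (Metric.closedBall (0 : ℝ) 1 ×ˢ Metric.closedBall (0 : 𝔼 →L[ℝ] 𝔼) L) :=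
    (isCompact_closedBall _ _).prod (isCompact_closedBall _ _)
  obtain ⟨M₁, hM₁⟩ := hK.exists_bound_of_continuousOn hD₁.continuousOn
  obtain ⟨M₂, hM₂⟩ := hK.exists_bound_of_continuousOn hD₂.continuousOn
  set M := max 2 (max M₁ M₂) with hM
  have hM2 : 2 ≤ M := le_max_left _ _
  have hb : ∀ t A, |t| ≤ 1 → ‖A‖ ≤ L → |D₁ (t, A)| ≤ M ∧ |D₂ (t, A)| ≤ M := fun t A ht hA => by
    have hmem : (t, A) ∈ Metric.closedBall (0 : ℝ) 1 ×ˢ Metric.closedBall (0 : 𝔼 →L[ℝ] 𝔼) L := by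
      simp [ht, hA]
    exact ⟨(hM₁ _ hmem).trans ((le_max_left _ _).trans (le_max_right _ _)),
      (hM₂ _ hmem).trans ((le_max_right _ _).trans (le_max_right _ _))⟩
  have hMinv : 1 / (2 * M) ≤ 1 := by
    rw [div_le_one (by positivity)]; linarith
  refine ⟨M, 1 / (2 * M), by linarith, by positivity, hMinv, fun t A ht hA => ?_⟩
  have hmvt := Convex.norm_image_sub_le_of_norm_hasDerivWithin_le (s := Metric.closedBall (0 : ℝ) 1)
    (f := fun t : ℝ => (1 + t • A).det) (f' := fun t => D₁ (t, A)) (C := M) (x := 0) (y := t)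
    (fun τ _ => (hd τ A).hasDerivWithinAt)
    (fun τ hτ => (hb τ A (by simpa using hτ) hA).1) (convex_closedBall _ _) (by simp)
    (by simpa using ht.trans hMinv)
  have h0 : (1 + (0 : ℝ) • A).det = 1 := by simp [ContinuousLinearMap.det]
  simp only [h0, sub_zero, Real.norm_eq_abs] at hmvt
  have h1 : M * |t| ≤ 1 / 2 := by
    calc M * |t| ≤ M * (1 / (2 * M)) := by gcongr
      _ = 1 / 2 := by field_simp
  have h2 := abs_le.1 (hmvt.trans h1)
  exact ⟨by linarith [h2.1], by linarith [h2.2], hb t A (ht.trans hMinv) hA⟩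

/-- The integrand of the fractional perimeter of `(1 + t X)(E)`, pulled back to `E × Eᶜ`. -/
def movedIntegrand (s : ℝ) (X : EuclideanSpace ℝ (Fin N) → EuclideanSpace ℝ (Fin N)) (t : ℝ)
    (q : EuclideanSpace ℝ (Fin N) × EuclideanSpace ℝ (Fin N)) : ℝ :=
  (‖q.1 - q.2 + t • (X q.1 - X q.2)‖ ^ 2) ^ (-(((N : ℝ) + s) / 2)) *
    ((1 + t • fderiv ℝ X q.1).det * (1 + t • fderiv ℝ X q.2).det)

lemma continuous_det_one_add_smul {X : 𝔼 → 𝔼} (hX : ContDiff ℝ ∞ X) (t : ℝ) :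
    Continuous fun x => (1 + t • fderiv ℝ X x).det :=
  contDiff_det.continuous.comp
    (continuous_const.add ((hX.continuous_fderiv (by simp)).const_smul t))

lemma measurable_movedIntegrand {X : 𝔼 → 𝔼} (hX : ContDiff ℝ ∞ X) (s t : ℝ) :
    Measurable (movedIntegrand s X t) := by
  have hXc := hX.continuous
  have h1 : Continuous fun q : 𝔼 × 𝔼 => ‖q.1 - q.2 + t • (X q.1 - X q.2)‖ ^ 2 := by fun_prop
  have h2 := continuous_det_one_add_smul hX t
  exact (h1.measurable.pow_const _).mul
    ((h2.comp continuous_fst).mul (h2.comp continuous_snd)).measurable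

lemma exists_hasDerivAt_movedIntegrand {X : 𝔼 → 𝔼} (hX : ContDiff ℝ ∞ X) {L : ℝ} (hL0 : 0 < L)
    (hL : ∀ x, ‖fderiv ℝ X x‖ ≤ L) {s c : ℝ} (hs : 0 < s) (hc : c = ((N : ℝ) + s) / 2) :
    ∃ t₀ C, 0 < t₀ ∧ 0 ≤ C ∧ ∃ f₁ f₂ : ℝ → 𝔼 × 𝔼 → ℝ,
      (∀ t, Measurable (f₁ t)) ∧ (∀ t, Measurable (f₂ t)) ∧
      (∀ t, |t| < t₀ → |t| * L ≤ 1 / 4 ∧ ∀ x, 0 < (1 + t • fderiv ℝ X x).det) ∧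
      (∀ q : 𝔼 × 𝔼, q.1 ≠ q.2 → ∀ t, |t| < t₀ →
        (|movedIntegrand s X t q| ≤ C * fracKernel s (q.1 - q.2) ∧
          |f₁ t q| ≤ C * fracKernel s (q.1 - q.2) ∧ |f₂ t q| ≤ C * fracKernel s (q.1 - q.2)) ∧
        HasDerivAt (fun t => movedIntegrand s X t q) (f₁ t q) t ∧
        HasDerivAt (fun t => f₁ t q) (f₂ t q) t) ∧
      ∀ q : 𝔼 × 𝔼, f₂ 0 q = secondVariationIntegrand (fun u => u ^ (-c))
        (fun u => -c * u ^ (-(c + 1))) (fun u => c * (c + 1) * u ^ (-(c + 2))) X q.1 q.2 := by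
  have hc0 : 0 ≤ c := by rw [hc]; positivity
  obtain ⟨D₁, D₂, hD₁, hD₂, hd₁, hd₂, hD0⟩ := exists_hasDerivAt_det_one_add_smul (N := N)
  obtain ⟨M, t₁, hM1, ht₁, ht₁1, hM⟩ := exists_det_one_add_smul_le L hD₁ hD₂ hd₁
  obtain ⟨C, hC0, hC⟩ := exists_norm_add_smul_rpow_le (N := N) hc0 hL0.le
  set A : 𝔼 → 𝔼 →L[ℝ] 𝔼 := fderiv ℝ X with hA
  have hAc : Continuous A := hX.continuous_fderiv (by simp)
  have hXc := hX.continuous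
  set a : ℝ → 𝔼 × 𝔼 → ℝ := fun t q => ‖q.1 - q.2 + t • (X q.1 - X q.2)‖ ^ 2 with ha
  set a₁ : ℝ → 𝔼 × 𝔼 → ℝ := fun t q =>
    2 * inner ℝ (q.1 - q.2 + t • (X q.1 - X q.2)) (X q.1 - X q.2) with ha₁
  set a₂ : 𝔼 × 𝔼 → ℝ := fun q => 2 * ‖X q.1 - X q.2‖ ^ 2 with ha₂
  set k₀ : ℝ → 𝔼 × 𝔼 → ℝ := fun t q => a t q ^ (-c) with hk₀
  set k₁ : ℝ → 𝔼 × 𝔼 → ℝ := fun t q => -c * a t q ^ (-(c + 1)) * a₁ t q with hk₁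
  set k₂ : ℝ → 𝔼 × 𝔼 → ℝ := fun t q => c * (c + 1) * a t q ^ (-(c + 2)) * a₁ t q ^ 2 +
    -c * a t q ^ (-(c + 1)) * a₂ q with hk₂
  set d₀ : ℝ → 𝔼 → ℝ := fun t x => (1 + t • A x).det with hd₀
  set b₀ : ℝ → 𝔼 × 𝔼 → ℝ := fun t q => d₀ t q.1 * d₀ t q.2 with hb₀
  set b₁ : ℝ → 𝔼 × 𝔼 → ℝ := fun t q =>
    D₁ (t, A q.1) * d₀ t q.2 + d₀ t q.1 * D₁ (t, A q.2) with hb₁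
  set b₂ : ℝ → 𝔼 × 𝔼 → ℝ := fun t q => D₂ (t, A q.1) * d₀ t q.2 +
    2 * (D₁ (t, A q.1) * D₁ (t, A q.2)) + d₀ t q.1 * D₂ (t, A q.2) with hb₂
  have hac : ∀ t, Continuous (a t) := fun t => by simp only [ha]; fun_prop
  have ha₁c : ∀ t, Continuous (a₁ t) := fun t => by simp only [ha₁]; fun_prop
  have ha₂c : Continuous a₂ := by simp only [ha₂]; fun_prop
  have hd₀c : ∀ t, Continuous (d₀ t) := fun t => continuous_det_one_add_smul hX t
  have hD₁c : ∀ t, Continuous fun x => D₁ (t, A x) := fun t =>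
    hD₁.comp (continuous_const.prodMk hAc)
  have hD₂c : ∀ t, Continuous fun x => D₂ (t, A x) := fun t =>
    hD₂.comp (continuous_const.prodMk hAc)
  have hk₀m : ∀ t, Measurable (k₀ t) := fun t => (hac t).measurable.pow_const _
  have hk₁m : ∀ t, Measurable (k₁ t) := fun t =>
    (((hac t).measurable.pow_const _).const_mul _).mul (ha₁c t).measurable
  have hk₂m : ∀ t, Measurable (k₂ t) := fun t =>
    ((((hac t).measurable.pow_const _).const_mul _).mul ((ha₁c t).measurable.pow_const _)).add
      ((((hac t).measurable.pow_const _).const_mul _).mul ha₂c.measurable)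
  have hb₀m : ∀ t, Measurable (b₀ t) := fun t =>
    (((hd₀c t).comp continuous_fst).mul ((hd₀c t).comp continuous_snd)).measurable
  have hb₁m : ∀ t, Measurable (b₁ t) := fun t =>
    ((((hD₁c t).comp continuous_fst).mul ((hd₀c t).comp continuous_snd)).add
      (((hd₀c t).comp continuous_fst).mul ((hD₁c t).comp continuous_snd))).measurable
  have hb₂m : ∀ t, Measurable (b₂ t) := fun t =>
    (((((hD₂c t).comp continuous_fst).mul ((hd₀c t).comp continuous_snd)).add
      (continuous_const.mul (((hD₁c t).comp continuous_fst).mul ((hD₁c t).comp continuous_snd)))).add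
      (((hd₀c t).comp continuous_fst).mul ((hD₂c t).comp continuous_snd))).measurable
  refine ⟨min t₁ (1 / (4 * L)), 9 * C * M ^ 2, by positivity, by positivity,
    fun t q => k₁ t q * b₀ t q + k₀ t q * b₁ t q,
    fun t q => k₂ t q * b₀ t q + 2 * (k₁ t q * b₁ t q) + k₀ t q * b₂ t q,
    fun t => ((hk₁m t).mul (hb₀m t)).add ((hk₀m t).mul (hb₁m t)),
    fun t => (((hk₂m t).mul (hb₀m t)).add (((hk₁m t).mul (hb₁m t)).const_mul 2)).add
      ((hk₀m t).mul (hb₂m t)), ?_, ?_, ?_⟩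
  · intro t ht
    refine ⟨?_, fun x => (hM t (A x) (ht.le.trans (min_le_left _ _)) (hL x)).1⟩
    calc |t| * L ≤ 1 / (4 * L) * L := by
          gcongr; exact ht.le.trans (min_le_right _ _)
      _ = 1 / 4 := by field_simp
  · intro q hq t ht
    have htL : |t| * L ≤ 1 / 4 := by
      calc |t| * L ≤ 1 / (4 * L) * L := by
            gcongr; exact ht.le.trans (min_le_right _ _)
        _ = 1 / 4 := by field_simp
    have ht1 := ht.le.trans (min_le_left _ _)
    obtain ⟨hapos, hk0, hk1, hk2⟩ := hC (q.1 - q.2) (X q.1 - X q.2) t (sub_ne_zero.2 hq)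
      (norm_sub_le_of_norm_fderiv_le hX hL _ _) htL
    obtain ⟨x0, x1, x2, x3⟩ := hM t (A q.1) ht1 (hL _)
    obtain ⟨y0, y1, y2, y3⟩ := hM t (A q.2) ht1 (hL _)
    have x1' : |d₀ t q.1| ≤ M := by rw [abs_of_pos x0]; exact x1
    have y1' : |d₀ t q.2| ≤ M := by rw [abs_of_pos y0]; exact y1
    rw [fracKernel_eq_sq_rpow, ← hc]
    set P := (‖q.1 - q.2‖ ^ 2) ^ (-c) with hP
    have hP0 : 0 ≤ P := by positivity
    have hM0 : 0 ≤ M := by linarith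
    have mulb : ∀ {u v U V : ℝ}, |u| ≤ U → |v| ≤ V → |u * v| ≤ U * V := fun {u v U V} hu hv => by
      rw [abs_mul]; exact mul_le_mul hu hv (abs_nonneg _) ((abs_nonneg _).trans hu)
    have B0 : |b₀ t q| ≤ M * M := mulb x1' y1'
    have B1 : |b₁ t q| ≤ M * M + M * M :=
      (abs_add_le _ _).trans (add_le_add (mulb x2 y1') (mulb x1' y2))
    have B2 : |b₂ t q| ≤ M * M + 2 * (M * M) + M * M := by
      refine (abs_add_le _ _).trans (add_le_add ((abs_add_le _ _).trans
        (add_le_add (mulb x3 y1') ?_)) (mulb x1' y3))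
      exact mulb abs_two.le (mulb x2 y2)
    have hCP : 0 ≤ C * P * (M * M) := by positivity
    have hmv : ∀ t, movedIntegrand s X t q = k₀ t q * b₀ t q := fun t => by
      rw [movedIntegrand, ← hc]
    refine ⟨⟨?_, ?_, ?_⟩, ?_, ?_⟩
    · rw [hmv]
      refine (mulb hk0 B0).trans ?_
      nlinarith
    · refine (abs_add_le _ _).trans ((add_le_add (mulb hk1 B0) (mulb hk0 B1)).trans ?_)
      nlinarith
    · refine (abs_add_le _ _).trans ((add_le_add ((abs_add_le _ _).trans (add_le_add (mulb hk2 B0)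
        (mulb abs_two.le (mulb hk1 B1)))) (mulb hk0 B2)).trans (le_of_eq ?_))
      ring
    all_goals
      have e0 : HasDerivAt (fun t => k₀ t q) (k₁ t q) t :=
        hasDerivAt_rpow_comp (hasDerivAt_norm_add_smul_sq _ _ t) hapos c
      have g0 : ∀ x, HasDerivAt (fun t => d₀ t x) (D₁ (t, A x)) t := fun x => hd₁ t (A x)
      have g1 : ∀ x, HasDerivAt (fun t => D₁ (t, A x)) (D₂ (t, A x)) t := fun x => hd₂ t (A x)
      have f0 : HasDerivAt (fun t => b₀ t q) (b₁ t q) t := (g0 q.1).mul (g0 q.2)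
    · rw [funext hmv]
      exact e0.mul f0
    · have e1 : HasDerivAt (fun t => k₁ t q) (k₂ t q) t := by
        have h1 := hasDerivAt_rpow_comp (hasDerivAt_norm_add_smul_sq (q.1 - q.2) (X q.1 - X q.2) t)
          hapos (c + 1)
        have h2 := (h1.const_mul (-c)).mul (hasDerivAt_inner_add_smul (q.1 - q.2) (X q.1 - X q.2) t)
        refine h2.congr_deriv ?_
        simp only [hk₂, ha, ha₁, ha₂]
        rw [show c + 1 + 1 = c + 2 by ring]
        ring
      have f1 : HasDerivAt (fun t => b₁ t q) (b₂ t q) t := by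
        refine (((g1 q.1).mul (g0 q.2)).add ((g0 q.1).mul (g1 q.2))).congr_deriv ?_
        simp only [hb₂]
        ring
      refine ((e1.mul f0).add (e0.mul f1)).congr_deriv ?_
      ring
  · intro q
    have h1 : ∀ x, d₀ 0 x = 1 := fun x => by simp [hd₀, ContinuousLinearMap.det]
    simp only [hk₀, hk₁, hk₂, hb₀, hb₁, hb₂, ha, ha₁, ha₂, h1, (hD0 _).1, (hD0 _).2, zero_smul,
      add_zero, secondVariationIntegrand, jacobianSecond, divergence, hA]
    ring

/-- The pairs of points that interact in the localized fractional perimeter. -/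
def interactionSet (E Ω : Set (EuclideanSpace ℝ (Fin N))) :
    Set (EuclideanSpace ℝ (Fin N) × EuclideanSpace ℝ (Fin N)) :=
  (E ∩ Ω) ×ˢ Eᶜ ∪ (E \ Ω) ×ˢ (Ω \ E)

lemma measurableSet_interactionSet {E Ω : Set 𝔼} (hE : MeasurableSet E) (hΩ : MeasurableSet Ω) :
    MeasurableSet (interactionSet E Ω) :=
  ((hE.inter hΩ).prod hE.compl).union ((hE.diff hΩ).prod (hΩ.diff hE))

lemma lintegral_image_prod {X : 𝔼 → 𝔼} (hX : ContDiff ℝ ∞ X) (s : ℝ) {t : ℝ} {Φ : 𝔼 ≃ₜ 𝔼}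
    (hΦ : ∀ x, Φ x = x + t • X x) (hpos : ∀ x, 0 < (1 + t • fderiv ℝ X x).det) {S T : Set 𝔼}
    (hS : MeasurableSet S) (hT : MeasurableSet T) :
    ∫⁻ x in Φ '' S, ∫⁻ y in Φ '' T, ENNReal.ofReal (1 / ‖x - y‖ ^ ((N : ℝ) + s)) =
      ∫⁻ q in S ×ˢ T, ENNReal.ofReal (movedIntegrand s X t q) ∂(volume.prod volume) := by
  have hd : ∀ (U : Set 𝔼), ∀ x ∈ U, HasFDerivWithinAt Φ (1 + t • fderiv ℝ X x) U x :=
    fun U x _ => by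
      have := (hasFDerivAt_add_smul hX t x).hasFDerivWithinAt (s := U)
      rwa [← funext hΦ] at this
  rw [setLIntegral_prod _ (measurable_movedIntegrand hX s t).ennreal_ofReal.aemeasurable,
    lintegral_image_eq_lintegral_abs_det_fderiv_mul volume hS (hd S) Φ.injective.injOn]
  refine lintegral_congr fun x => ?_
  rw [lintegral_image_eq_lintegral_abs_det_fderiv_mul volume hT (hd T) Φ.injective.injOn,
    ← lintegral_const_mul' _ _ ENNReal.ofReal_ne_top]
  refine lintegral_congr fun y => ?_
  rw [abs_of_pos (hpos x), abs_of_pos (hpos y), ← ENNReal.ofReal_mul (hpos y).le,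
    ← ENNReal.ofReal_mul (hpos x).le]
  congr 1
  have h1 : Φ x - Φ y = x - y + t • (X x - X y) := by rw [hΦ, hΦ]; module
  have h2 := fracKernel_eq_sq_rpow s (Φ x - Φ y)
  rw [fracKernel, h1] at h2
  rw [h1, h2, movedIntegrand]
  ring

lemma image_eq_self_of_tsupport_subset {X : 𝔼 → 𝔼} {Ω : Set 𝔼} (hXΩ : tsupport X ⊆ Ω) {t : ℝ}
    {Φ : 𝔼 ≃ₜ 𝔼} (hΦ : ∀ x, Φ x = x + t • X x) : Φ '' Ω = Ω := by
  have hfix : ∀ x, x ∉ Ω → Φ x = x := fun x hx => by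
    rw [hΦ, image_eq_zero_of_notMem_tsupport fun h => hx (hXΩ h), smul_zero, add_zero]
  have h1 : Φ '' Ωᶜ = Ωᶜ := (image_congr hfix).trans (image_id' _)
  rw [← compl_inj_iff, ← image_compl_eq Φ.bijective, h1]

/-- The fractional perimeter of the perturbed set as an integral over a fixed domain. -/
lemma sPerimeter_image {X : 𝔼 → 𝔼} (hX : ContDiff ℝ ∞ X) (s : ℝ) {t : ℝ} {Φ : 𝔼 ≃ₜ 𝔼}
    (hΦ : ∀ x, Φ x = x + t • X x) (hpos : ∀ x, 0 < (1 + t • fderiv ℝ X x).det) {E Ω : Set 𝔼}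
    (hE : MeasurableSet E) (hΩ : MeasurableSet Ω) (hXΩ : tsupport X ⊆ Ω) :
    sPerimeter s (Φ '' E) Ω =
      ∫⁻ q in interactionSet E Ω, ENNReal.ofReal (movedIntegrand s X t q) ∂(volume.prod volume) := by
  have hΩΦ := image_eq_self_of_tsupport_subset hXΩ hΦ
  have e1 : Φ '' E ∩ Ω = Φ '' (E ∩ Ω) := by rw [image_inter Φ.injective, hΩΦ]
  have e2 : (Φ '' E)ᶜ = Φ '' Eᶜ := (image_compl_eq Φ.bijective).symm
  have e3 : Φ '' E \ Ω = Φ '' (E \ Ω) := by rw [image_sdiff Φ.injective, hΩΦ]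
  have e4 : Ω \ Φ '' E = Φ '' (Ω \ E) := by rw [image_sdiff Φ.injective, hΩΦ]
  rw [sPerimeter, e1, e2, e3, e4, lintegral_image_prod hX s hΦ hpos (hE.inter hΩ) hE.compl,
    lintegral_image_prod hX s hΦ hpos (hE.diff hΩ) (hΩ.diff hE), interactionSet,
    lintegral_union ((hE.diff hΩ).prod (hΩ.diff hE))]
  exact Set.disjoint_prod.2 (Or.inl (disjoint_sdiff_right.mono_left inter_subset_right))

variable {E Ω : Set (EuclideanSpace ℝ (Fin N))} {ρ : EuclideanSpace ℝ (Fin N) → ℝ}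
  {X : EuclideanSpace ℝ (Fin N) → EuclideanSpace ℝ (Fin N)}

lemma interactionSet_subset : interactionSet E Ω ⊆ E ×ˢ Eᶜ := by
  rintro ⟨x, y⟩ (⟨hx, hy⟩ | ⟨hx, hy⟩)
  · exact ⟨hx.1, hy⟩
  · exact ⟨hx.1, hy.2⟩

lemma IsGlobalDefiningFunction.integrableOn_interactionSet (hN : 1 ≤ N) (hE : IsOpen E)
    (hρ : IsGlobalDefiningFunction E ρ) (hΩ : IsOpen Ω) (hΩb : Bornology.IsBounded Ω) {s : ℝ}
    (hs0 : 0 < s) (hs1 : s < 1) :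
    IntegrableOn (fun q : 𝔼 × 𝔼 => fracKernel s (q.1 - q.2)) (interactionSet E Ω)
      (volume.prod volume) := by
  obtain ⟨R, hR⟩ := hΩb.subset_closedBall (0 : 𝔼)
  have h1 : IntegrableOn _ (interactionSet E Ω) (volume.prod volume) :=
    IntegrableOn.mono_set (hρ.integrable_weight_symm hN hE hs0 hs1 R) interactionSet_subset
  refine h1.congr_fun (fun q hq => ?_)
    (measurableSet_interactionSet hE.measurableSet hΩ.measurableSet)
  refine indicator_of_mem ?_ _
  have hnorm : ∀ x ∈ Ω, ‖x‖ ≤ R := fun x hx => by simpa using hR hx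
  rcases hq with ⟨hx, hy⟩ | ⟨hx, hy⟩
  · exact Or.inl (hnorm _ hx.2)
  · exact Or.inr (hnorm _ hy.1)

/-- The fractional perimeter is twice differentiable along the flow `1 + t X`. -/
theorem IsGlobalDefiningFunction.exists_hasDerivAt_sPerimeter (hN : 1 ≤ N) (hE : IsOpen E)
    (hρ : IsGlobalDefiningFunction E ρ) (hΩ : IsOpen Ω) (hΩb : Bornology.IsBounded Ω) {s c : ℝ}
    (hs0 : 0 < s) (hs1 : s < 1) (hc : c = ((N : ℝ) + s) / 2) (hX : ContDiff ℝ ∞ X) {L : ℝ}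
    (hL0 : 0 < L) (hL : ∀ x, ‖fderiv ℝ X x‖ ≤ L) (hXΩ : tsupport X ⊆ Ω) :
    ∃ t₀ > 0, ∃ p p₁ : ℝ → ℝ,
      (∀ t, |t| < t₀ → |t| * L ≤ 1 / 4 ∧ HasDerivAt p (p₁ t) t ∧
        ∀ Φ : 𝔼 ≃ₜ 𝔼, (∀ x, Φ x = x + t • X x) → sPerimeter s (Φ '' E) Ω = ENNReal.ofReal (p t) ∧
          0 ≤ p t) ∧
      HasDerivAt p₁ (∫ q in E ×ˢ Eᶜ, secondVariationIntegrand (fun u => u ^ (-c))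
        (fun u => -c * u ^ (-(c + 1))) (fun u => c * (c + 1) * u ^ (-(c + 2))) X q.1 q.2
        ∂(volume.prod volume)) 0 := by
  have hEm := hE.measurableSet
  have hDm := measurableSet_interactionSet hEm hΩ.measurableSet
  obtain ⟨t₀, C, ht₀, hC0, f₁, f₂, hf₁, hf₂, hpos, hf, h0⟩ :=
    exists_hasDerivAt_movedIntegrand hX hL0 hL hs0 hc
  have hK := (hρ.integrableOn_interactionSet hN hE hΩ hΩb hs0 hs1).const_mul C
  have hae : ∀ᵐ q ∂((volume.prod volume).restrict (interactionSet E Ω)), q.1 ≠ q.2 :=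
    (ae_restrict_iff' hDm).2 (Eventually.of_forall fun q hq he =>
      (interactionSet_subset hq).2 (he ▸ (interactionSet_subset hq).1))
  have hd := fun {t : ℝ} => hasDerivAt_integral_of_dominated_twice (t := t) hK
    (fun t _ => (measurable_movedIntegrand hX s t).aestronglyMeasurable)
    (fun t _ => (hf₁ t).aestronglyMeasurable) (fun t _ => (hf₂ t).aestronglyMeasurable)
    (hae.mono fun q hq => hf q hq)
  refine ⟨t₀, ht₀, _, _, fun t ht => ⟨(hpos t ht).1, (hd ht).1, fun Φ hΦ => ?_⟩, ?_⟩
  · have hnn : ∀ q, 0 ≤ movedIntegrand s X t q := fun q => by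
      have h1 := ((hpos t ht).2 q.1).le
      have h2 := ((hpos t ht).2 q.2).le
      rw [movedIntegrand]
      positivity
    rw [sPerimeter_image hX s hΦ (hpos t ht).2 hEm hΩ.measurableSet hXΩ,
      ofReal_integral_eq_lintegral_ofReal _ (Eventually.of_forall hnn)]
    · exact ⟨rfl, integral_nonneg hnn⟩
    · exact hK.mono' (measurable_movedIntegrand hX s t).aestronglyMeasurable
        (hae.mono fun q hq => (hf q hq t ht).1.1)
  · have h1 := (hd (t := 0) (by simpa using ht₀)).2
    simp_rw [h0] at h1
    refine h1.congr_deriv (Eq.symm <| setIntegral_eq_of_subset_of_forall_sdiff_eq_zero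
      (hEm.prod hEm.compl) interactionSet_subset fun q hq => ?_)
    have hx : q.1 ∉ Ω := fun h => hq.2 (Or.inl ⟨⟨hq.1.1, h⟩, hq.1.2⟩)
    have hy : q.2 ∉ Ω := fun h => hq.2 (Or.inr ⟨⟨hq.1.1, hx⟩, h, hq.1.2⟩)
    have hx' : q.1 ∉ tsupport X := fun h => hx (hXΩ h)
    have hy' : q.2 ∉ tsupport X := fun h => hy (hXΩ h)
    simp [secondVariationIntegrand, divergence_eq_zero_of_notMem hx',
      divergence_eq_zero_of_notMem hy', jacobianSecond_eq_zero_of_notMem hx',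
      jacobianSecond_eq_zero_of_notMem hy', image_eq_zero_of_notMem_tsupport hx',
      image_eq_zero_of_notMem_tsupport hy']

end NonlocalPerimeter

end

theorem mainTheorem4 (N : ℕ) (hN : 1 ≤ N) (s : ℝ) (hs0 : 0 < s) (hs1 : s < 1)
    (E Ω : Set (EuclideanSpace ℝ (Fin N)))
    (hE : IsOpen E) (hEs : NonlocalPerimeter.HasSmoothBoundary E)
    (hΩ : IsOpen Ω) (hΩb : Bornology.IsBounded Ω)
    -- the area of `∂E` near infinity is such that the integrals over `∂E` converge there
    (harea : Integrable (fun x : EuclideanSpace ℝ (Fin N) => 1 / (1 + ‖x‖) ^ ((N : ℝ) + s))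
      (NonlocalPerimeter.surfaceMeasure E))
    (h : EuclideanSpace ℝ (Fin N) → ℝ) (hh : NonlocalPerimeter.IsTestFunction E Ω h) :
    -- the nonlocal mean curvature and the nonlocal Jacobi operator are well defined on `∂E`
    (∀ p ∈ frontier E, NonlocalPerimeter.PVConverges volume
      (NonlocalPerimeter.curvatureIntegrand s E p) p) ∧
    (∀ p ∈ frontier E, NonlocalPerimeter.PVConverges (NonlocalPerimeter.surfaceMeasure E)
      (NonlocalPerimeter.jacobiIntegrand s h p) p) ∧
    (∀ p ∈ frontier E, Integrable (NonlocalPerimeter.jacobiPotentialIntegrand s E p)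
      (NonlocalPerimeter.surfaceMeasure E)) ∧
    -- the two integrals of the formula converge
    Integrable (fun p => NonlocalPerimeter.nonlocalJacobi s E h p * h p)
      (NonlocalPerimeter.surfaceMeasure E) ∧
    Integrable (fun p => h p ^ 2 * NonlocalPerimeter.meanCurvature E p *
      NonlocalPerimeter.nonlocalMeanCurvature s E p) (NonlocalPerimeter.surfaceMeasure E) ∧
    -- the normal perturbations exist for small `t`
    (∀ᶠ t in 𝓝 (0 : ℝ), ∃ F, NonlocalPerimeter.IsNormalPerturbation E h t F) ∧
    -- the second variation
    ∀ F : ℝ → Set (EuclideanSpace ℝ (Fin N)),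
      (∀ᶠ t in 𝓝 (0 : ℝ), NonlocalPerimeter.IsNormalPerturbation E h t (F t)) →
      (∀ᶠ t in 𝓝 (0 : ℝ), NonlocalPerimeter.sPerimeter s (F t) Ω ≠ ⊤) ∧
      (∀ᶠ t in 𝓝 (0 : ℝ),
        DifferentiableAt ℝ (fun τ => (NonlocalPerimeter.sPerimeter s (F τ) Ω).toReal) t) ∧
      HasDerivAt (deriv fun τ => (NonlocalPerimeter.sPerimeter s (F τ) Ω).toReal)
        (-2 * (∫ p, NonlocalPerimeter.nonlocalJacobi s E h p * h p
            ∂(NonlocalPerimeter.surfaceMeasure E)) -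
          ∫ p, h p ^ 2 * NonlocalPerimeter.meanCurvature E p *
            NonlocalPerimeter.nonlocalMeanCurvature s E p
            ∂(NonlocalPerimeter.surfaceMeasure E)) 0 ∧
      (NonlocalPerimeter.IsNonlocalMinimal s E Ω →
        HasDerivAt (deriv fun τ => (NonlocalPerimeter.sPerimeter s (F τ) Ω).toReal)
          (-2 * ∫ p, NonlocalPerimeter.nonlocalJacobi s E h p * h p
            ∂(NonlocalPerimeter.surfaceMeasure E)) 0) := by
  classical
  obtain ⟨n, hn, hnE⟩ := NonlocalPerimeter.exists_contDiff_eq_outerNormal hEs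
  obtain ⟨g, hg, hgc, hgΩ, hgh⟩ := hh.exists_extension hΩ
  obtain ⟨ρ, hρ⟩ := hEs.exists_globalDefiningFunction hE
  have H : NonlocalPerimeter.BoundaryData E ρ n := ⟨hN, hE, hρ, hn, hnE⟩
  set X : EuclideanSpace ℝ (Fin N) → EuclideanSpace ℝ (Fin N) := fun x => g x • n x with hXdef
  have hX : ContDiff ℝ ∞ X := hg.smul hn
  have hXc : HasCompactSupport X := hgc.smul_right
  have hXΩ : tsupport X ⊆ Ω := (tsupport_smul_subset_left g n).trans hgΩ
  have hXh : ∀ x ∈ frontier E, X x = h x • NonlocalPerimeter.outerNormal E x := fun x hx => by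
    rw [hXdef, ← hgh x hx, ← hnE x hx]
  obtain ⟨L, hL0, hL⟩ := NonlocalPerimeter.exists_norm_fderiv_le hX hXc
  obtain ⟨t₀, ht₀, p, p₁, hp, hp₁⟩ := hρ.exists_hasDerivAt_sPerimeter hN hE hΩ hΩb hs0 hs1 rfl hX
    hL0 hL hXΩ
  obtain ⟨hJi, hJ⟩ := H.integral_jacobi hs0 hs1 harea hg hgc hgh
  have hw : ∀ x ∈ frontier E, NonlocalPerimeter.curvatureWeight g n X x *
      NonlocalPerimeter.nonlocalMeanCurvature s E x = h x ^ 2 * NonlocalPerimeter.meanCurvature E x *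
        NonlocalPerimeter.nonlocalMeanCurvature s E x := fun x hx => by
    rw [H.curvatureWeight_eq hg hx, hgh x hx]
  have hwae := (NonlocalPerimeter.ae_mem_frontier E).mono hw
  have hci := (integrable_congr hwae).1 (H.integrable_curvatureWeight_mul hs0 hs1 hX hg hgc)
  rw [H.integral_secondVariation_frac hs0 hs1 harea hX hXc hg hgc (fun x _ => rfl) rfl, ← hJ,
    integral_congr_ae hwae] at hp₁
  have hsmall : ∀ᶠ t in 𝓝 (0 : ℝ), |t| < t₀ :=
    (isOpen_lt continuous_abs continuous_const).mem_nhds (by simpa using ht₀)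
  have hpert : ∀ t, |t| < t₀ → ∃ F, NonlocalPerimeter.IsNormalPerturbation E h t F ∧
      NonlocalPerimeter.sPerimeter s F Ω = ENNReal.ofReal (p t) ∧ 0 ≤ p t := fun t ht => by
    obtain ⟨htL, -, hper⟩ := hp t ht
    obtain ⟨Φ, hΦ, hΦs⟩ := NonlocalPerimeter.exists_homeomorph_add_smul hX hL0 hL htL
    exact ⟨Φ '' E, NonlocalPerimeter.isNormalPerturbation_image hE hρ hX hXh hL htL hΦ hΦs,
      hper Φ hΦ⟩
  refine ⟨fun q hq => H.pvConverges_curvature hs0 hs1 hq,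
    fun q hq => H.pvConverges_jacobi hs0 hs1 harea hg hgc hgh hq,
    fun q hq => H.integrable_potential hs0 hs1 harea hq, hJi, hci,
    hsmall.mono fun t ht => (hpert t ht).imp fun F hF => hF.1, fun F hF => ?_⟩
  have hPF : ∀ᶠ t in 𝓝 (0 : ℝ), NonlocalPerimeter.sPerimeter s (F t) Ω = ENNReal.ofReal (p t) ∧
      0 ≤ p t := by
    filter_upwards [hF, hsmall] with t hFt ht
    obtain ⟨F', hF', hper, hpt⟩ := hpert t ht
    exact ⟨(hFt.sPerimeter_eq hF' s Ω).trans hper, hpt⟩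
  have hreal : (fun τ => (NonlocalPerimeter.sPerimeter s (F τ) Ω).toReal) =ᶠ[𝓝 0] p :=
    hPF.mono fun t ht => by simp only [ht.1, ENNReal.toReal_ofReal ht.2]
  have hder : ∀ᶠ t in 𝓝 (0 : ℝ),
      HasDerivAt (fun τ => (NonlocalPerimeter.sPerimeter s (F τ) Ω).toReal) (p₁ t) t := by
    filter_upwards [hreal.eventually_nhds, hsmall] with t ht ht'
    exact (hp t ht').2.1.congr_of_eventuallyEq ht
  have hsecond := hp₁.congr_of_eventuallyEq
    (show (deriv fun τ => (NonlocalPerimeter.sPerimeter s (F τ) Ω).toReal) =ᶠ[𝓝 0] p₁ from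
      hder.mono fun t ht => ht.deriv)
  refine ⟨hPF.mono fun t ht => by rw [ht.1]; exact ENNReal.ofReal_ne_top,
    hder.mono fun t ht => ht.differentiableAt, hsecond, fun hmin => ?_⟩
  have hzero : ∫ p, h p ^ 2 * NonlocalPerimeter.meanCurvature E p *
      NonlocalPerimeter.nonlocalMeanCurvature s E p ∂(NonlocalPerimeter.surfaceMeasure E) = 0 := by
    refine integral_eq_zero_of_ae ((NonlocalPerimeter.ae_mem_frontier E).mono fun x hx => ?_)
    simp only [Pi.zero_apply]
    by_cases hxΩ : x ∈ Ω
    · rw [hmin x ⟨hx, hxΩ⟩, mul_zero]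
    · rw [← hgh x hx, image_eq_zero_of_notMem_tsupport fun h' => hxΩ (hgΩ h')]
      simp
  rwa [hzero, sub_zero] at hsecond
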